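/- **Conventions.** For a C*-algebra $A$, $\mathrm{Ped}(A)$ denotes the Pedersen ideal (the smallest dense two-sided ideal), $\mathrm{Ped}(A)_+$ its positive part, $\mathrm T(A)$ the set of tracial states, and $\overline{\mathrm T(A)}^{\mathrm w}$ the weak* closure of $\mathrm T(A)$ in $A^*$. $A$ is stably projectionless if no matrix algebra $\mathrm M_n(A)$ contains a nonzero projection. A simple C*-algebra is nonzero. For $a,b\in A_+$ write $a\lesssim b$ if $x_n^*bx_n\to a$ for some sequence $(x_n)$ in $A$. Let $f_\varepsilon(t)=0$ for $t\le\varepsilon/2$, $f_\varepsilon(t)=1$ for $t\ge\varepsilon$, and let $f_\varepsilon$ be linear in between. Let $\mathcal C_0$ be the class of C*-algebras $$C=\{(f,g)\in C([0,1],F_2)\oplus F_1:\ f(0)=\phi_0(g),\ f(1)=\phi_1(g)\},$$ where $F_1,F_2$ are finite dimensional C*-algebras and $\phi_0,\phi_1:F_1\to F_2$ are (not necessarily unital) $*$-homomorphisms, such that $\mathrm K_1(C)=\{0\}$, $\mathrm K_0(C)_+=\{0\}$ and $0\notin\overline{\mathrm T(C)}^{\mathrm w}$. Let $\mathcal C_0'$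 be the class of C*-algebras isomorphic to a full hereditary sub-C*-algebra of some algebra in $\mathcal C_0$. A C*-algebra $A$ is in the class $\mathcal D$ if it is simple and has a strictly positive element $a$ with $\|a\|=1$ for which there is $\mathfrak f_a\in(0,1)$ such that: for every $\varepsilon>0$, every finite $\mathcal F\subset A$ and every $b\in A_+\setminus\{0\}$ there are a nonzero sub-C*-algebra $D\subset A$ with $D\in\mathcal C_0'$ and completely positive contractive maps $\phi:A\to A$, $\psi:A\to D$ which are $\mathcal F$-$\varepsilon$-multiplicative (i.e. $\|\phi(xy)-\phi(x)\phi(y)\|<\varepsilon$ for $x,y\in\mathcal F$, and likewise for $\psi$), with $\phi(A)D=\{0\}$, $\|x-(\phi(x)+\psi(x))\|<\varepsilon$ for all $x\in\mathcal F\cup\{a\}$, $\phi(a)\lesssim b$, and $t(f_{1/4}(\psi(a)))\ge\mathfrak f_a$ for all $t\in\mathrm T(D)$. A simple stably projectionless C*-algebra $A$ has generalized tracial rank at most one, written $\mathrm{gTR}(A)\le1$, if $\overline{aAa}\in\mathcal D$ for every $a\in\mathrm{Ped}(A)_+\setminus\{0\}$. **Proposition.** Let $A$ be a separable stably projectionless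 simple C*-algebra. Then $\mathrm{gTR}(A)\le1$ if and only if $\overline{aAa}\in\mathcal D$ for some $a\in\mathrm{Ped}(A)_+\setminus\{0\}$. -/

import Mathlib

open Matrix Filter Topology

noncomputable section

namespace GTR

/-! ### K-theory of C⋆-algebras -/

section KTheory

variable {R : Type*} [Ring R]

/-- The block-diagonal sum `diag(p, q)` of two (possibly rectangular) matrices. -/
def diagSum {m n m' n' : ℕ} (p : Matrix (Fin m) (Fin m') R) (q : Matrix (Fin n) (Fin n') R) :
    Matrix (Fin (m + n)) (Fin (m' + n')) R :=
  (fromBlocks p 0 0 q).submatrix finSumFinEquiv.symm finSumFinEquiv.symm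

lemma diagSum_mul {m n m' n' m'' n'' : ℕ} (p : Matrix (Fin m) (Fin m') R)
    (q : Matrix (Fin n) (Fin n') R) (p' : Matrix (Fin m') (Fin m'') R)
    (q' : Matrix (Fin n') (Fin n'') R) :
    diagSum p q * diagSum p' q' = diagSum (p * p') (q * q') := by
  simp [diagSum, submatrix_mul_equiv, fromBlocks_multiply]

lemma diagSum_conjTranspose [StarRing R] {m n m' n' : ℕ} (p : Matrix (Fin m) (Fin m') R)
    (q : Matrix (Fin n) (Fin n') R) : (diagSum p q)ᴴ = diagSum pᴴ qᴴ := by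
  simp [diagSum, conjTranspose_submatrix, fromBlocks_conjTranspose]

lemma diagSum_apply {m n m' n' : ℕ} (p : Matrix (Fin m) (Fin m') R)
    (q : Matrix (Fin n) (Fin n') R) (i : Fin (m + n)) (j : Fin (m' + n')) :
    diagSum p q i j =
      if hi : (i : ℕ) < m then (if hj : (j : ℕ) < m' then p ⟨i, hi⟩ ⟨j, hj⟩ else 0)
      else (if hj : (j : ℕ) < m' then 0 else q ⟨i - m, by omega⟩ ⟨j - m', by omega⟩) := by
  refine Fin.addCases (fun i => ?_) (fun i => ?_) i <;>
    refine Fin.addCases (fun j => ?_) (fun j => ?_) j <;> simp [diagSum]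

lemma diagSum_map {S : Type*} [Ring S] (φ : R →+* S) {m n m' n' : ℕ}
    (p : Matrix (Fin m) (Fin m') R) (q : Matrix (Fin n) (Fin n') R) :
    (diagSum p q).map φ = diagSum (p.map φ) (q.map φ) := by
  ext i j
  simp only [map_apply, diagSum_apply]
  split_ifs <;> simp

lemma diagSum_one {n r : ℕ} :
    diagSum (1 : Matrix (Fin n) (Fin n) R) (1 : Matrix (Fin r) (Fin r) R) = 1 := by
  simp [diagSum]

lemma diagSum_assoc {a b c : ℕ} (p : Matrix (Fin a) (Fin a) R) (q : Matrix (Fin b) (Fin b) R)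
    (r : Matrix (Fin c) (Fin c) R) (i j : Fin (a + b + c)) :
    diagSum p (diagSum q r) (finCongr (Nat.add_assoc a b c) i) (finCongr (Nat.add_assoc a b c) j) =
      diagSum (diagSum p q) r i j := by
  obtain ⟨i, hi⟩ := i
  obtain ⟨j, hj⟩ := j
  simp only [finCongr_apply, Fin.cast_mk, diagSum_apply]
  grind

lemma diagSum_comm {a b : ℕ} (p : Matrix (Fin a) (Fin a) R) (q : Matrix (Fin b) (Fin b) R)
    (i j : Fin (a + b)) : diagSum q p (finAddFlip i) (finAddFlip j) = diagSum p q i j := by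
  refine Fin.addCases (fun i => ?_) (fun i => ?_) i <;>
    refine Fin.addCases (fun j => ?_) (fun j => ?_) j <;> simp [diagSum]

/-- The matrix `diag(u, 1)` of size `k`, for a matrix `u` of size `n ≤ k` (for `k < n` this is a
truncation of `u`, which is never used). -/
def stab {n : ℕ} (k : ℕ) (u : Matrix (Fin n) (Fin n) R) : Matrix (Fin k) (Fin k) R :=
  fun i j => if h : (i : ℕ) < n ∧ (j : ℕ) < n then u ⟨i, h.1⟩ ⟨j, h.2⟩ else if i = j then 1 else 0

lemma stab_self {n : ℕ} (u : Matrix (Fin n) (Fin n) R) : stab n u = u := by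
  ext i j; simp [stab]

lemma stab_stab {n k l : ℕ} (h : n ≤ k) (u : Matrix (Fin n) (Fin n) R) :
    stab l (stab k u) = stab l u := by
  ext i j
  simp only [stab, Fin.ext_iff]
  grind

lemma stab_eq_diagSum {n r : ℕ} (u : Matrix (Fin n) (Fin n) R) :
    stab (n + r) u = diagSum u (1 : Matrix (Fin r) (Fin r) R) := by
  ext i j
  rw [diagSum_apply]
  simp only [stab, Fin.ext_iff, Matrix.one_apply]
  grind

lemma continuous_stab [TopologicalSpace R] {n k : ℕ} :
    Continuous (stab k : Matrix (Fin n) (Fin n) R → Matrix (Fin k) (Fin k) R) := by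
  refine continuous_matrix fun i j => ?_
  unfold stab
  split_ifs
  · exact continuous_id.matrix_elem _ _
  · exact continuous_const
  · exact continuous_const

variable [StarRing R]

variable (R) in
/-- Projections in square matrices of arbitrary finite size over `R`. -/
structure MatProj where
  /-- the size of the matrix -/
  size : ℕ
  /-- the projection -/
  mat : Matrix (Fin size) (Fin size) R
  isProj : IsStarProjection mat

namespace MatProj

lemma mul_self (p : MatProj R) : p.mat * p.mat = p.mat := p.isProj.isIdempotentElem

lemma conjTranspose_eq (p : MatProj R) : p.matᴴ = p.mat := p.isProj.isSelfAdjoint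

/-- Murray–von Neumann equivalence of projections in matrices over `R`, possibly of different
sizes. -/
def MvN (p q : MatProj R) : Prop :=
  ∃ v : Matrix (Fin q.size) (Fin p.size) R, vᴴ * v = p.mat ∧ v * vᴴ = q.mat

instance setoid : Setoid (MatProj R) where
  r := MvN
  iseqv :=
    { refl := fun p => ⟨p.mat, by rw [p.conjTranspose_eq, p.mul_self],
        by rw [p.conjTranspose_eq, p.mul_self]⟩
      symm := fun ⟨v, h1, h2⟩ => ⟨vᴴ, by simpa using h2, by simpa using h1⟩
      trans := by
        rintro p q r ⟨v, h1, h2⟩ ⟨w, h3, h4⟩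
        refine ⟨w * v, ?_, ?_⟩
        · calc (w * v)ᴴ * (w * v) = vᴴ * (wᴴ * w) * v := by
                simp only [conjTranspose_mul, Matrix.mul_assoc]
            _ = (vᴴ * v) * (vᴴ * v) := by rw [h3, ← h2]; simp only [Matrix.mul_assoc]
            _ = p.mat := by rw [h1, p.mul_self]
        · calc (w * v) * (w * v)ᴴ = w * (v * vᴴ) * wᴴ := by
                simp only [conjTranspose_mul, Matrix.mul_assoc]
            _ = (w * wᴴ) * (w * wᴴ) := by rw [h2, ← h3]; simp only [Matrix.mul_assoc]
            _ = r.mat := by rw [h4, r.mul_self] }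

/-- The orthogonal sum `diag(p, q)` of two projections. -/
def add (p q : MatProj R) : MatProj R where
  size := p.size + q.size
  mat := diagSum p.mat q.mat
  isProj :=
    ⟨by rw [IsIdempotentElem, diagSum_mul, p.mul_self, q.mul_self],
     by rw [IsSelfAdjoint, star_eq_conjTranspose, diagSum_conjTranspose, p.conjTranspose_eq,
          q.conjTranspose_eq]⟩

/-- The projection `0`, as an empty matrix. -/
def zero : MatProj R := ⟨0, 0, .zero _⟩

lemma equiv_mk {m n : ℕ} {p : Matrix (Fin m) (Fin m) R} {q : Matrix (Fin n) (Fin n) R}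
    {hp : IsStarProjection p} {hq : IsStarProjection q} (v : Matrix (Fin n) (Fin m) R)
    (h1 : vᴴ * v = p) (h2 : v * vᴴ = q) : (⟨m, p, hp⟩ : MatProj R) ≈ ⟨n, q, hq⟩ := ⟨v, h1, h2⟩

/-- Relabelling the index set does not change the class of a projection. -/
lemma equiv_mk_of_reindex {m n : ℕ} {p : Matrix (Fin m) (Fin m) R} {q : Matrix (Fin n) (Fin n) R}
    {hp : IsStarProjection p} {hq : IsStarProjection q} (e : Fin m ≃ Fin n)
    (h : ∀ i j, q (e i) (e j) = p i j) : (⟨m, p, hp⟩ : MatProj R) ≈ ⟨n, q, hq⟩ := by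
  have h : q.submatrix e e = p := by ext i j; exact h i j
  have h1 : qᴴ = q := hq.isSelfAdjoint
  have h2 : q * q = q := hq.isIdempotentElem
  refine equiv_mk (q.submatrix id e) ?_ ?_
  · rw [conjTranspose_submatrix, h1, ← h]
    conv_rhs => rw [← h2]
    rw [submatrix_mul _ _ _ id _ Function.bijective_id]
  · rw [conjTranspose_submatrix, h1, submatrix_mul_equiv, h2, submatrix_id_id]

lemma add_congr {p p' q q' : MatProj R} (h : p ≈ p') (h' : q ≈ q') : p.add q ≈ p'.add q' := by
  obtain ⟨v, h1, h2⟩ := h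
  obtain ⟨w, h3, h4⟩ := h'
  exact equiv_mk (diagSum v w) (by rw [diagSum_conjTranspose, diagSum_mul, h1, h3])
    (by rw [diagSum_conjTranspose, diagSum_mul, h2, h4])

/-- The image of a projection under a ⋆-homomorphism, applied entrywise. -/
def map {S : Type*} [Ring S] [StarRing S] (φ : R →+* S) (hφ : ∀ x, φ (star x) = star (φ x))
    (p : MatProj R) : MatProj S where
  size := p.size
  mat := p.mat.map φ
  isProj :=
    ⟨by rw [IsIdempotentElem, ← Matrix.map_mul, p.mul_self],
     by rw [IsSelfAdjoint, star_eq_conjTranspose, ← conjTranspose_map _ hφ, p.conjTranspose_eq]⟩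

lemma map_congr {S : Type*} [Ring S] [StarRing S] (φ : R →+* S)
    (hφ : ∀ x, φ (star x) = star (φ x)) {p q : MatProj R} (h : p ≈ q) :
    p.map φ hφ ≈ q.map φ hφ := by
  obtain ⟨v, h1, h2⟩ := h
  refine equiv_mk (v.map φ) ?_ ?_
  · rw [← conjTranspose_map _ hφ, ← Matrix.map_mul, h1]
  · rw [← conjTranspose_map _ hφ, ← Matrix.map_mul, h2]

end MatProj

variable (R) in
/-- The Murray–von Neumann semigroup `V(R)`. -/
def VMonoid : Type _ := Quotient (MatProj.setoid (R := R))

namespace VMonoid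

/-- The class of a projection in `V(R)`. -/
def mk (p : MatProj R) : VMonoid R := Quotient.mk _ p

lemma mk_eq_mk {p q : MatProj R} : mk p = mk q ↔ MatProj.MvN p q := Quotient.eq

instance : Add (VMonoid R) := ⟨Quotient.map₂ MatProj.add fun _ _ h _ _ h' => MatProj.add_congr h h'⟩

instance : Zero (VMonoid R) := ⟨mk MatProj.zero⟩

instance : AddCommMonoid (VMonoid R) where
  nsmul := nsmulRec
  add_assoc := by
    rintro ⟨p⟩ ⟨q⟩ ⟨r⟩
    exact Quotient.sound (MatProj.equiv_mk_of_reindex (finCongr (Nat.add_assoc _ _ _))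
      (diagSum_assoc p.mat q.mat r.mat))
  zero_add := by
    rintro ⟨⟨n, p, hp⟩⟩
    refine Quotient.sound (MatProj.equiv_mk_of_reindex (finCongr (Nat.zero_add n)) ?_)
    rintro ⟨i, hi⟩ ⟨j, hj⟩
    rw [diagSum_apply]
    rfl
  add_zero := by
    rintro ⟨⟨n, p, hp⟩⟩
    refine Quotient.sound (MatProj.equiv_mk_of_reindex (finCongr (Nat.add_zero n)) ?_)
    rintro ⟨i, hi⟩ ⟨j, hj⟩
    rw [diagSum_apply, dif_pos (show i < n from hi), dif_pos (show j < n from hj)]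
    rfl
  add_comm := by
    rintro ⟨p⟩ ⟨q⟩
    exact Quotient.sound (MatProj.equiv_mk_of_reindex finAddFlip (diagSum_comm p.mat q.mat))

/-- Functoriality of `V` for ⋆-homomorphisms. -/
def map {S : Type*} [Ring S] [StarRing S] (φ : R →+* S) (hφ : ∀ x, φ (star x) = star (φ x)) :
    VMonoid R →+ VMonoid S where
  toFun := Quotient.map (MatProj.map φ hφ) fun _ _ h => MatProj.map_congr φ hφ h
  map_zero' := Quotient.sound
    (MatProj.equiv_mk_of_reindex (Equiv.refl (Fin 0)) fun i => i.elim0)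
  map_add' := by
    rintro ⟨p⟩ ⟨q⟩
    refine Quotient.sound (MatProj.equiv_mk_of_reindex (Equiv.refl _) fun i j => ?_)
    exact (congrFun (congrFun (diagSum_map φ p.mat q.mat) i) j).symm

end VMonoid

variable (R) in
/-- The Grothendieck group `K₀₀(R)` of `V(R)`; it is `K₀(R)` when `R` is a unital C⋆-algebra. -/
abbrev K00 : Type _ := Algebra.GrothendieckAddGroup (VMonoid R)

/-- The class in `K₀₀(R)` of a projection in a matrix algebra over `R`. -/
def K00.cls (p : MatProj R) : K00 R := Algebra.GrothendieckAddGroup.of (VMonoid.mk p)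

/-- Functoriality of `K₀₀`. -/
def K00.map {S : Type*} [Ring S] [StarRing S] (φ : R →+* S) (hφ : ∀ x, φ (star x) = star (φ x)) :
    K00 R →+ K00 S :=
  Algebra.GrothendieckAddGroup.lift (Algebra.GrothendieckAddGroup.of.comp (VMonoid.map φ hφ))

lemma stab_mem_unitary {n k : ℕ} (h : n ≤ k) {u : Matrix (Fin n) (Fin n) R}
    (hu : u ∈ unitary (Matrix (Fin n) (Fin n) R)) :
    stab k u ∈ unitary (Matrix (Fin k) (Fin k) R) := by
  obtain ⟨r, rfl⟩ := Nat.exists_eq_add_of_le h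
  rw [Unitary.mem_iff, star_eq_conjTranspose] at hu ⊢
  rw [stab_eq_diagSum, diagSum_conjTranspose, diagSum_mul, diagSum_mul, hu.1, hu.2]
  simp [diagSum_one]

variable (R) in
/-- Unitaries in square matrices of arbitrary finite size over `R`. -/
structure MatUnitary where
  /-- the size of the matrix -/
  size : ℕ
  /-- the unitary matrix -/
  mat : Matrix (Fin size) (Fin size) R
  isUnitary : mat ∈ unitary (Matrix (Fin size) (Fin size) R)

/-- Stable homotopy of unitary matrices: `diag(u, 1)` and `diag(v, 1)` are joined by a path of
unitaries in some matrix algebra that contains both. -/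
def MatUnitary.StablyHomotopic [TopologicalSpace R] (u v : MatUnitary R) : Prop :=
  ∃ k, u.size ≤ k ∧ v.size ≤ k ∧
    JoinedIn (unitary (Matrix (Fin k) (Fin k) R) : Set (Matrix (Fin k) (Fin k) R))
      (stab k u.mat) (stab k v.mat)

lemma joinedIn_stab [TopologicalSpace R] {k l : ℕ} (h : k ≤ l) {u v : Matrix (Fin k) (Fin k) R}
    (huv : JoinedIn (unitary (Matrix (Fin k) (Fin k) R) : Set (Matrix (Fin k) (Fin k) R)) u v) :
    JoinedIn (unitary (Matrix (Fin l) (Fin l) R) : Set (Matrix (Fin l) (Fin l) R))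
      (stab l u) (stab l v) :=
  (huv.map_continuousOn (f := stab l) continuous_stab.continuousOn).mono
    (by rintro _ ⟨w, hw, rfl⟩; exact stab_mem_unitary h hw)

instance MatUnitary.setoid [TopologicalSpace R] : Setoid (MatUnitary R) where
  r := MatUnitary.StablyHomotopic
  iseqv :=
    { refl := fun u => ⟨u.size, le_rfl, le_rfl,
        JoinedIn.refl (stab_mem_unitary le_rfl u.isUnitary)⟩
      symm := fun ⟨k, h1, h2, h⟩ => ⟨k, h2, h1, h.symm⟩
      trans := by
        rintro u v w ⟨k, h1, h2, h⟩ ⟨l, h3, h4, h'⟩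
        refine ⟨max k l, h1.trans (le_max_left _ _), h4.trans (le_max_right _ _), ?_⟩
        have a := joinedIn_stab (le_max_left k l) h
        have b := joinedIn_stab (le_max_right k l) h'
        rw [stab_stab h1, stab_stab h2] at a
        rw [stab_stab h3, stab_stab h4] at b
        exact a.trans b }

section NonUnital

variable (A : Type*) [NonUnitalCStarAlgebra A]

/-- The canonical ⋆-homomorphism from the (forced) unitization of `A` onto `ℂ`, as a ring
homomorphism. -/
def augmentation : Unitization ℂ A →+* ℂ := (Unitization.fstHom ℂ A).toRingHom

lemma augmentation_star (x : Unitization ℂ A) :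
    augmentation A (star x) = star (augmentation A x) := rfl

/-- The group `K₀(A)` of a (possibly non-unital) C⋆-algebra: the kernel of the map
`K₀(Ã) → K₀(ℂ)` induced by the augmentation, `Ã` being the unitization of `A`. -/
def K0 : AddSubgroup (K00 (Unitization ℂ A)) :=
  (K00.map (augmentation A) (augmentation_star A)).ker

variable {A} in
/-- A projection in `Mₙ(A)`, viewed as a projection in `Mₙ(Ã)`. -/
def MatProj.ofNonUnital {n : ℕ} (p : Matrix (Fin n) (Fin n) A) (hp : IsStarProjection p) :
    MatProj (Unitization ℂ A) where
  size := n
  mat := p.map (Unitization.inrNonUnitalStarAlgHom ℂ A)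
  isProj :=
    ⟨by rw [IsIdempotentElem, ← Matrix.map_mul, hp.isIdempotentElem.eq],
     by
      rw [IsSelfAdjoint, star_eq_conjTranspose, ← conjTranspose_map _ (map_star _),
        ← star_eq_conjTranspose, hp.isSelfAdjoint.star_eq]⟩

/-- The positive cone `K₀(A)₊`: the classes of the projections in the matrix algebras `Mₙ(A)`. -/
def K0Pos : Set (K0 A) :=
  {x | ∃ (n : ℕ) (p : Matrix (Fin n) (Fin n) A) (hp : IsStarProjection p),
    (x : K00 (Unitization ℂ A)) = K00.cls (MatProj.ofNonUnital p hp)}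

/-- The (underlying set of the) group `K₁(A)`: unitary matrices over the unitization of `A`, up to
stable homotopy. -/
def K1 : Type _ := Quotient (MatUnitary.setoid (R := Unitization ℂ A))

end NonUnital

end KTheory

/-! ### Basic notions for C⋆-algebras -/

section Basic

/- Every C⋆-algebra below carries its usual order: `a ≤ b` iff `b - a` is selfadjoint with nonnegative
spectrum, equivalently `b - a = star x * x` for some `x`. -/
attribute [local instance] CStarAlgebra.spectralOrder CStarAlgebra.spectralOrderedRing

variable {A : Type*} [NonUnitalCStarAlgebra A]

/-- `I` is a two-sided ideal of the algebra `A` (not necessarily closed). -/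
def IsIdeal (I : Submodule ℂ A) : Prop :=
  ∀ x ∈ I, ∀ a : A, a * x ∈ I ∧ x * a ∈ I

variable (A) in
/-- `A` is a simple C⋆-algebra: it is nonzero and its only closed two-sided ideals are `0` and
`A`. -/
def IsSimpleCStar : Prop :=
  Nontrivial A ∧ ∀ I : Submodule ℂ A, IsIdeal I → IsClosed (I : Set A) → I = ⊥ ∨ I = ⊤

variable (A) in
/-- `A` is stably projectionless: no matrix algebra over `A` contains a nonzero projection. -/
def IsStablyProjectionless : Prop :=
  ∀ (n : ℕ) (p : Matrix (Fin n) (Fin n) A), IsStarProjection p → p = 0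

variable (A) in
/-- The Pedersen ideal `Ped(A)`: the smallest dense two-sided ideal of `A`. -/
def pedersenIdeal : Submodule ℂ A :=
  sInf {I : Submodule ℂ A | IsIdeal I ∧ Dense (I : Set A)}

variable (A) in
/-- The positive part `Ped(A)₊` of the Pedersen ideal. -/
def pedersenPos : Set A := {a | a ∈ pedersenIdeal A ∧ 0 ≤ a}

/-- The hereditary C⋆-subalgebra of `A` generated by `a ≥ 0`, i.e. the closure of `aAa`. -/
def her (a : A) : NonUnitalStarSubalgebra ℂ A :=
  NonUnitalStarSubalgebra.topologicalClosure
    { carrier := Set.range fun x : A => a * x * star a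
      add_mem' := by
        rintro _ _ ⟨x, rfl⟩ ⟨y, rfl⟩
        exact ⟨x + y, by simp [mul_add, add_mul]⟩
      zero_mem' := ⟨0, by simp⟩
      mul_mem' := by
        rintro _ _ ⟨x, rfl⟩ ⟨y, rfl⟩
        exact ⟨x * star a * a * y, by simp [mul_assoc]⟩
      smul_mem' := by
        rintro c _ ⟨x, rfl⟩
        exact ⟨c • x, by simp only [mul_smul_comm, smul_mul_assoc]⟩
      star_mem' := by
        rintro _ ⟨x, rfl⟩
        exact ⟨star x, by simp [mul_assoc]⟩ }

instance (a : A) : IsClosed (her a : Set A) :=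
  NonUnitalStarSubalgebra.isClosed_topologicalClosure _

lemma coe_her {a : A} (ha : 0 ≤ a) : (her a : Set A) = closure (Set.range fun x => a * x * a) := by
  have h : star a = a := (IsSelfAdjoint.of_nonneg ha).star_eq
  change closure (Set.range fun x : A => a * x * star a) = _
  rw [h]

/-- `a` is a strictly positive element of `A`: it is positive and `aAa` is dense in `A`. -/
def IsStrictlyPos (a : A) : Prop :=
  0 ≤ a ∧ Dense (Set.range fun x => a * x * a)

/-- Cuntz subequivalence `a ≲ b` of positive elements of `A`. -/
def CuntzLE (a b : A) : Prop :=
  ∃ x : ℕ → A, Tendsto (fun n => star (x n) * b * x n) atTop (𝓝 a)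

variable (A) in
/-- The set `T(A)` of tracial states of `A`, as a subset of the dual of `A` with the weak-⋆
topology. -/
def tracialStates : Set (WeakDual ℂ A) :=
  {τ | (∀ a : A, 0 ≤ a → 0 ≤ (τ a).re ∧ (τ a).im = 0) ∧ ‖WeakDual.toStrongDual τ‖ = 1 ∧
    ∀ a b : A, τ (a * b) = τ (b * a)}

/-- `B` is a hereditary sub-C⋆-algebra of `A`. -/
def IsHereditary (B : NonUnitalStarSubalgebra ℂ A) : Prop :=
  IsClosed (B : Set A) ∧ ∀ x y : A, 0 ≤ x → x ≤ y → y ∈ B → x ∈ B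

/-- The subalgebra `B` is full in `A`: it is not contained in a proper closed two-sided ideal. -/
def IsFull (B : NonUnitalStarSubalgebra ℂ A) : Prop :=
  ∀ I : Submodule ℂ A, IsIdeal I → IsClosed (I : Set A) → (B : Set A) ⊆ I → I = ⊤

open scoped CStarAlgebra in
/-- The linear map `φ` is completely positive and contractive. -/
def IsCPC {B : Type*} [NonUnitalCStarAlgebra B] (φ : A →ₗ[ℂ] B) : Prop :=
  (∃ Φ : A →CP B, Φ.toLinearMap = φ) ∧ ∀ x, ‖φ x‖ ≤ ‖x‖

/-- `φ` is `F`-`ε`-multiplicative. -/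
def IsAlmostMul {B : Type*} [NonUnitalCStarAlgebra B] (F : Finset A) (ε : ℝ) (φ : A →ₗ[ℂ] B) :
    Prop :=
  ∀ x ∈ F, ∀ y ∈ F, ‖φ (x * y) - φ x * φ y‖ < ε

/-- The function `f_ε`, equal to `0` up to `ε/2`, to `1` from `ε` on, and linear in between. -/
def cutoff (ε t : ℝ) : ℝ :=
  if t ≤ ε / 2 then 0 else if t ≤ ε then (t - ε / 2) / (ε / 2) else 1

end Basic

/-! ### One-dimensional noncommutative CW complexes -/

section Complexes

/-- The C⋆-algebra `A(F₁, F₂, φ₀, φ₁)` of the pairs `(f, g)` in `C([0,1], F₂) ⊕ F₁` with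
`f(0) = φ₀(g)` and `f(1) = φ₁(g)`. -/
def mappingTorus {F₁ F₂ : Type*} [NonUnitalCStarAlgebra F₁] [NonUnitalCStarAlgebra F₂]
    (φ₀ φ₁ : F₁ →⋆ₙₐ[ℂ] F₂) : NonUnitalStarSubalgebra ℂ (C(unitInterval, F₂) × F₁) where
  carrier := {x | x.1 0 = φ₀ x.2 ∧ x.1 1 = φ₁ x.2}
  add_mem' := fun ⟨h1, h2⟩ ⟨h3, h4⟩ => by simp [h1, h2, h3, h4]
  zero_mem' := by simp
  mul_mem' := fun ⟨h1, h2⟩ ⟨h3, h4⟩ => by simp [h1, h2, h3, h4]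
  smul_mem' := fun c x ⟨h1, h2⟩ => by simp [h1, h2]
  star_mem' := fun ⟨h1, h2⟩ => by simp [h1, h2, map_star]

instance {F₁ F₂ : Type*} [NonUnitalCStarAlgebra F₁] [NonUnitalCStarAlgebra F₂]
    (φ₀ φ₁ : F₁ →⋆ₙₐ[ℂ] F₂) :
    IsClosed (mappingTorus φ₀ φ₁ : Set (C(unitInterval, F₂) × F₁)) := by
  have h0 : Continuous φ₀ := AddMonoidHomClass.continuous_of_bound φ₀ 1 fun x => by
    simpa using NonUnitalStarAlgHom.norm_apply_le φ₀ x
  have h1 : Continuous φ₁ := AddMonoidHomClass.continuous_of_bound φ₁ 1 fun x => by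
    simpa using NonUnitalStarAlgHom.norm_apply_le φ₁ x
  have e : ∀ t : unitInterval, Continuous fun x : C(unitInterval, F₂) × F₁ => x.1 t :=
    fun t => (continuous_eval_const t).comp continuous_fst
  exact (isClosed_eq (e 0) (h0.comp continuous_snd)).inter
    (isClosed_eq (e 1) (h1.comp continuous_snd))

/-- The conditions defining the class `𝒞₀` among the algebras `A(F₁, F₂, φ₀, φ₁)`: `K₁ = 0`,
`(K₀)₊ = 0`, and `0` is not in the weak-⋆ closure of the tracial state space. -/
def SatisfiesC0 (C : Type*) [NonUnitalCStarAlgebra C] : Prop :=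
  Subsingleton (K1 C) ∧ K0Pos C = {0} ∧ 0 ∉ closure (tracialStates C)

/-- `D` is in the class `𝒞₀'`: it is isomorphic to a full hereditary sub-C⋆-algebra of an algebra in
`𝒞₀`. -/
def InC0' (D : Type*) [NonUnitalCStarAlgebra D] : Prop :=
  ∃ (F₁ F₂ : Type) (_ : NonUnitalCStarAlgebra F₁) (_ : NonUnitalCStarAlgebra F₂)
    (φ₀ φ₁ : F₁ →⋆ₙₐ[ℂ] F₂) (B : NonUnitalStarSubalgebra ℂ (mappingTorus φ₀ φ₁)),
    FiniteDimensional ℂ F₁ ∧ FiniteDimensional ℂ F₂ ∧ SatisfiesC0 (mappingTorus φ₀ φ₁) ∧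
      IsHereditary B ∧ IsFull B ∧ Nonempty (D ≃⋆ₐ[ℂ] B)

end Complexes

/-! ### The class `𝒟` and generalized tracial rank at most one -/

section ClassD

attribute [local instance] CStarAlgebra.spectralOrder CStarAlgebra.spectralOrderedRing

/-- The class `𝒟` of simple C⋆-algebras that are tracially approximated by algebras in `𝒞₀'`. -/
def InD (A : Type*) [NonUnitalCStarAlgebra A] : Prop :=
  IsSimpleCStar A ∧ ∃ a : A, IsStrictlyPos a ∧ ‖a‖ = 1 ∧ ∃ f : ℝ, 0 < f ∧ f < 1 ∧
    ∀ (ε : ℝ) (F : Finset A) (b : A), 0 < ε → 0 ≤ b → b ≠ 0 →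
      ∃ (D : NonUnitalStarSubalgebra ℂ A) (_ : IsClosed (D : Set A))
        (φ : A →ₗ[ℂ] A) (ψ : A →ₗ[ℂ] D),
        D ≠ ⊥ ∧ IsCPC φ ∧ IsCPC ψ ∧ IsAlmostMul F ε φ ∧ IsAlmostMul F ε ψ ∧
        (∀ (x : A) (d : D), φ x * d = 0) ∧
        (∀ x ∈ F, ‖x - (φ x + ψ x)‖ < ε) ∧ ‖a - (φ a + ψ a)‖ < ε ∧
        InC0' D ∧
        CuntzLE (φ a) b ∧
        ∀ t ∈ tracialStates D, f ≤ (t (cfcₙ (cutoff (1 / 4)) (ψ a))).re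

/-- `gTR(A) ≤ 1`, for a simple stably projectionless C⋆-algebra `A`: the hereditary subalgebra
generated by each nonzero positive element of the Pedersen ideal is in `𝒟`. -/
def GTRLeOne (A : Type*) [NonUnitalCStarAlgebra A] : Prop :=
  ∀ a ∈ pedersenPos A, a ≠ 0 → InD (her a)

end ClassD

end GTR

end

/-! The forward direction only needs a nonzero positive element of the Pedersen ideal, which
functional calculus provides (`exists_mem_pedersenPos`). For the converse let `her a` be in 𝒟 and
let `b` be another nonzero element of Ped(A)₊. By simplicity the algebraic ideal spanned by A a A is
dense, so it contains Ped(A), and polarization turns a representation of `b` in it into b ≤ ∑ wᵢ⋆ a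
wᵢ (`exists_le_sum_of_mem_pedersenPos`). The polar decomposition of the column with entries √a wᵢ
then identifies `her b` with a hereditary subalgebra of Mₙ(her a) (`exists_herEmb_matrix`). It
remains to pass tracial approximation to matrix algebras and to hereditary subalgebras.

Matrices (`InD.traciallyApproximated_matrix`): the maps are applied entrywise and Mₙ(D) replaces D.
That Mₙ(D) is again in 𝒞₀' is `InC0'.matrix`. The smallness of the first summand survives because,
without projections, every nonzero positive element dominates n orthogonal nonzero ones
(`exists_orthogonal`), which leaves room for a diagonal matrix with n equal entries.

Hereditary subalgebras (`TraciallyApproximated.inD`): let `b` be strictly positive in B ⊆ A and let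
y = φ(b) + ψ(b) be close to `b`. Cutting the maps down by f_δ(b) would destroy the orthogonality
φ(A)D = 0, and cutting them down by f_δ(y) would lead out of B. An element W in the closure of √b A,
close to f_δ(b) and with W⋆W = f_δ(y)², avoids both defects (`exists_near_cutoff`). Since the
summands of y are orthogonal, f_δ(y) acts on D as u = f_δ(ψ(b)), so d ↦ W d W⋆ induces an embedding
of `her u` into B (`exists_transport`). The new maps are W φ(·) W⋆ and u ψ(·) u.

The algebra `her u` is full in D, hence in 𝒞₀': a proper closed ideal containing it would be
annihilated by a tracial state of D (`InC0'.exists_tracialState`), against the lower bound on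
traces. That bound passes from D to `her u` because tracial states extend from full hereditary
subalgebras to bounded traces (`exists_tracialState_extension`); boundedness comes from the
finite-dimensional fibres, in the form of `TransposeBounded`. Finally, simplicity of A converts a
lower bound on the traces of ψ(s), for one fixed s, into one for f_{1/4}(ψ(b))
(`IsSimpleCStar.exists_trace_bound`). -/

noncomputable section

namespace GTR

/-! ### Approximate polar decomposition and Cuntz comparison. -/

section Approximation

attribute [local instance] CStarAlgebra.spectralOrder CStarAlgebra.spectralOrderedRing

variable {A : Type*} [NonUnitalCStarAlgebra A]

/-- A regularized version of the function `t ↦ 1 / √t`. -/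
def regInvSqrt (n : ℕ) (t : ℝ) : ℝ := √t / (|t| + 1 / (n + 1))

lemma continuous_regInvSqrt (n : ℕ) : Continuous (regInvSqrt n) := by
  unfold regInvSqrt
  -- The absolute value keeps the denominator positive for negative `t` as well, where `√t = 0`.
  refine Real.continuous_sqrt.div (by fun_prop) fun t => ?_
  positivity

lemma regInvSqrt_zero (n : ℕ) : regInvSqrt n 0 = 0 := by simp [regInvSqrt]

lemma regInvSqrt_nonneg (n : ℕ) (t : ℝ) : 0 ≤ regInvSqrt n t := by
  unfold regInvSqrt; positivity

lemma mul_regInvSqrt {n : ℕ} {t : ℝ} (ht : 0 ≤ t) :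
    √t * regInvSqrt n t = t / (t + 1 / (n + 1)) := by
  rw [regInvSqrt, abs_of_nonneg ht, ← mul_div_assoc, Real.mul_self_sqrt ht]

lemma mul_regInvSqrt_mem {n : ℕ} {t : ℝ} (ht : 0 ≤ t) :
    0 ≤ √t * regInvSqrt n t ∧ √t * regInvSqrt n t ≤ 1 := by
  rw [mul_regInvSqrt ht]
  exact ⟨by positivity, div_le_one_of_le₀ (by simp; positivity) (by positivity)⟩

/-- With r = 1/(n+1) the left side is t r / (t + r). -/
lemma mul_one_sub_regInvSqrt_le {n : ℕ} {t : ℝ} (ht : 0 ≤ t) :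
    t * (1 - √t * regInvSqrt n t) ≤ 1 / (n + 1) := by
  rw [mul_regInvSqrt ht]
  have h : (0 : ℝ) < 1 / (n + 1) := by positivity
  set r : ℝ := 1 / (n + 1)
  have h2 : 0 < t + r := by positivity
  rw [one_sub_div h2.ne', ← mul_div_assoc, div_le_iff₀ h2]
  nlinarith

/-- For `0 ≤ q` the elements `q ^ (1/2) g` are an approximate unit for everything below `q`. -/
lemma exists_approx_inv_sqrt {q : A} (hq : 0 ≤ q) :
    ∃ g : ℕ → A, (∀ n, 0 ≤ g n) ∧ (∀ n, Commute (g n) q) ∧ (∀ n, ‖g n * q * g n‖ ≤ 1) ∧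
      (∀ n, IsSelfAdjoint (cfcₙ Real.sqrt q * g n)) ∧
      (∀ n, (cfcₙ Real.sqrt q * g n) * (cfcₙ Real.sqrt q * g n) = g n * q * g n) ∧
      (∀ n, ‖q - cfcₙ Real.sqrt q * g n * q - q * (cfcₙ Real.sqrt q * g n) +
        cfcₙ Real.sqrt q * g n * q * (cfcₙ Real.sqrt q * g n)‖ ≤ 1 / (n + 1)) ∧
      (∀ n, ‖q - g n * q * g n * q - q * (g n * q * g n) +
        g n * q * g n * q * (g n * q * g n)‖ ≤ 4 / (n + 1)) := by
  have hs : ∀ x ∈ quasispectrum ℝ q, 0 ≤ x := quasispectrum_nonneg_of_nonneg q hq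
  have hid : cfcₙ (fun t : ℝ => t) q = q := cfcₙ_id' ℝ q
  have cont := fun n => (continuous_regInvSqrt n).continuousOn (s := quasispectrum ℝ q)
  have csq : ContinuousOn Real.sqrt (quasispectrum ℝ q) := Real.continuous_sqrt.continuousOn
  have hz := regInvSqrt_zero
  have he : ∀ n, cfcₙ Real.sqrt q * cfcₙ (regInvSqrt n) q =
      cfcₙ (fun t => √t * regInvSqrt n t) q := fun n => by
    rw [cfcₙ_mul _ _ q csq (by simp) (cont n) (hz n)]
  have hv : ∀ n, cfcₙ (regInvSqrt n) q * q * cfcₙ (regInvSqrt n) q =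
      cfcₙ (fun t => regInvSqrt n t * t * regInvSqrt n t) q := fun n => by
    have c := cont n
    rw [cfcₙ_mul _ _ q (by fun_prop) (by simp) (by fun_prop) (hz n),
      cfcₙ_mul _ _ q (by fun_prop) (hz n) (by fun_prop) (by simp), hid]
  -- The four-term expression is (1 - f(q)) q (1 - f(q)) multiplied out, since the algebra may have
  -- no unit.
  have key : ∀ f : ℝ → ℝ, Continuous f → f 0 = 0 → q - cfcₙ f q * q - q * cfcₙ f q +
      cfcₙ f q * q * cfcₙ f q = cfcₙ (fun t => t * (1 - f t) ^ 2) q := fun f hf h0 => by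
    have : (fun t : ℝ => t * (1 - f t) ^ 2) = fun t => t - f t * t - t * f t + f t * t * f t := by
      ext t; ring
    rw [this, cfcₙ_add (a := q) (fun t => t - f t * t - t * f t) (fun t => f t * t * f t)
        (by fun_prop) (by simp) (by fun_prop) (by simp),
      cfcₙ_sub (a := q) (fun t => t - f t * t) (fun t => t * f t)
        (by fun_prop) (by simp) (by fun_prop) (by simp),
      cfcₙ_sub (a := q) (fun t => t) (fun t => f t * t)
        (by fun_prop) rfl (by fun_prop) (by simp),
      cfcₙ_mul (a := q) (fun t => f t * t) f (by fun_prop) (by simp) (by fun_prop) h0,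
      cfcₙ_mul (a := q) f (fun t => t) (by fun_prop) h0 (by fun_prop) rfl,
      cfcₙ_mul (a := q) (fun t => t) f (by fun_prop) rfl (by fun_prop) h0, hid]
  have sq : ∀ n t, regInvSqrt n t * t * regInvSqrt n t = if 0 ≤ t then
      (√t * regInvSqrt n t) ^ 2 else 0 := fun n t => by
    split_ifs with h
    · rw [mul_pow, Real.sq_sqrt h]; ring
    · simp [regInvSqrt, Real.sqrt_eq_zero_of_nonpos (not_le.1 h).le]
  refine ⟨fun n => cfcₙ (regInvSqrt n) q, fun n => cfcₙ_nonneg fun x _ => regInvSqrt_nonneg n x,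
    fun n => ?_, fun n => ?_, fun n => ?_, fun n => ?_, fun n => ?_, fun n => ?_⟩
  · nth_rw 2 [← hid]
    exact cfcₙ_commute_cfcₙ _ _ _
  · rw [hv]
    refine norm_cfcₙ_le fun t ht => ?_
    have h := mul_regInvSqrt_mem (n := n) (hs t ht)
    rw [sq, if_pos (hs t ht), Real.norm_of_nonneg (by positivity)]
    exact pow_le_one₀ h.1 h.2
  · rw [he]; exact cfcₙ_predicate _ _
  · have c := cont n
    rw [he, hv, ← cfcₙ_mul _ _ q (by fun_prop) (by simp) (by fun_prop) (by simp)]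
    refine cfcₙ_congr fun t ht => ?_
    simp only [sq, if_pos (hs t ht)]
    ring
  · have := continuous_regInvSqrt n
    rw [he, key _ (by fun_prop) (by simp)]
    refine norm_cfcₙ_le fun t ht => ?_
    have h := mul_regInvSqrt_mem (n := n) (hs t ht)
    have h' := mul_one_sub_regInvSqrt_le (n := n) (hs t ht)
    have h0 := hs t ht
    rw [Real.norm_of_nonneg (by positivity)]
    have h3 : 0 ≤ t * (1 - √t * regInvSqrt n t) := mul_nonneg h0 (by linarith)
    nlinarith
  · have := continuous_regInvSqrt n
    rw [hv, key _ (by fun_prop) (by simp)]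
    refine norm_cfcₙ_le fun t ht => ?_
    have h := mul_regInvSqrt_mem (n := n) (hs t ht)
    have h' := mul_one_sub_regInvSqrt_le (n := n) (hs t ht)
    have h0 := hs t ht
    rw [sq, if_pos h0, Real.norm_of_nonneg (by positivity)]
    set r := √t * regInvSqrt n t
    -- One factor t(1 - r) is small; the remaining factor is at most 4 on [0, 1], whence the
    -- constant 4/(n+1).
    have h1 : t * (1 - r ^ 2) ^ 2 = t * (1 - r) * ((1 - r) * (1 + r) ^ 2) := by ring
    have h2 : (1 - r) * (1 + r) ^ 2 ≤ 4 := by nlinarith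
    have h3 : 0 ≤ t * (1 - r) := mul_nonneg h0 (by linarith)
    rw [h1]
    calc _ ≤ t * (1 - r) * 4 := by gcongr
      _ ≤ 1 / (n + 1) * 4 := by gcongr
      _ = 4 / (n + 1) := by ring

/-- Conjugating x x⋆ ≤ q by 1 - e gives (1 - e) x x⋆ (1 - e) ≤ (1 - e) q (1 - e), and the left side
has norm ‖x - e x‖². Thus an approximate unit for `q` also works for everything below `q`. -/
lemma norm_sub_mul_sq_le {x q e : A} (h : x * star x ≤ q) (he : IsSelfAdjoint e) :
    ‖x - e * x‖ ^ 2 ≤ ‖q - e * q - q * e + e * q * e‖ := by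
  rw [sq, ← CStarRing.norm_self_mul_star]
  have hq : IsSelfAdjoint q := .of_nonneg ((mul_star_self_nonneg x).trans h)
  have hd : 0 ≤ (q - x * star x) - e * (q - x * star x) - (q - x * star x) * e +
      e * (q - x * star x) * e := by
    obtain ⟨y, hy⟩ := CStarAlgebra.nonneg_iff_eq_star_mul_self.1 (sub_nonneg.2 h)
    have : star (y - y * e) * (y - y * e) = (q - x * star x) - e * (q - x * star x) -
        (q - x * star x) * e + e * (q - x * star x) * e := by
      rw [hy]
      simp only [star_sub, star_mul, he.star_eq]
      noncomm_ring
    rw [← this]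
    exact star_mul_self_nonneg _
  refine CStarAlgebra.norm_le_norm_of_nonneg_of_le (mul_star_self_nonneg _) ?_
  rw [← sub_nonneg]
  convert hd using 1
  simp only [star_sub, star_mul, he.star_eq]
  noncomm_ring

/-- Polar decomposition relative to a dominating element. -/
lemma exists_polar {y P : A} (hP : 0 ≤ P) (h : P ≤ star y * y) :
    ∃ (m : ℕ → A) (z : A), (∀ n, ‖m n‖ ≤ 1) ∧ Tendsto (fun n => y * m n) atTop (𝓝 z) ∧
      Tendsto (fun n => cfcₙ Real.sqrt (star y * y) * m n) atTop (𝓝 (cfcₙ Real.sqrt P)) ∧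
      star z * z = P := by
  obtain ⟨g, hg0, hgc, hg1, he, hee, hlim, -⟩ := exists_approx_inv_sqrt (star_mul_self_nonneg y)
  set q := star y * y with hqdef
  have hq : 0 ≤ q := star_mul_self_nonneg y
  set p := cfcₙ Real.sqrt P with hp
  have hpsa : star p = p := (cfcₙ_predicate Real.sqrt P : IsSelfAdjoint _).star_eq
  have hpp : p * p = P := by
    rw [hp, ← CFC.sqrt_eq_real_sqrt P hP, CFC.sqrt_mul_sqrt_self P hP]
  set r := cfcₙ Real.sqrt q with hr
  have hrsa : star r = r := (cfcₙ_predicate Real.sqrt q : IsSelfAdjoint _).star_eq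
  have hrr : r * r = q := by
    rw [hr, ← CFC.sqrt_eq_real_sqrt q hq, CFC.sqrt_mul_sqrt_self q hq]
  have hgsa : ∀ n, star (g n) = g n := fun n => (IsSelfAdjoint.of_nonneg (hg0 n)).star_eq
  have hlim2 : Tendsto (fun n => r * (g n * p)) atTop (𝓝 p) := by
    rw [tendsto_iff_norm_sub_tendsto_zero]
    have h1 : Tendsto (fun n : ℕ => √(1 / ((n : ℝ) + 1))) atTop (𝓝 0) := by
      simpa using! tendsto_one_div_add_atTop_nhds_zero_nat.sqrt
    refine squeeze_zero (fun _ => norm_nonneg _) (fun n => ?_) h1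
    refine Real.le_sqrt_of_sq_le ((?_ : _ ≤ _).trans (hlim n))
    rw [norm_sub_rev, ← mul_assoc]
    exact norm_sub_mul_sq_le (by rw [hpsa, hpp]; exact h) (he n)
  -- Here r = |y|, so the sequence y gₙ p is Cauchy because r gₙ p converges to p; its limit is z.
  have hnorm : ∀ x, ‖y * x‖ = ‖r * x‖ := fun x => by
    rw [← sq_eq_sq₀ (norm_nonneg _) (norm_nonneg _), sq, sq, ← CStarRing.norm_star_mul_self,
      ← CStarRing.norm_star_mul_self, star_mul, star_mul, hrsa]
    congr 1
    rw [mul_assoc, ← mul_assoc (star y), ← hqdef, ← hrr]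
    noncomm_ring
  have hcau : CauchySeq fun n => y * (g n * p) := by
    have := hlim2.cauchySeq
    rw [Metric.cauchySeq_iff] at this ⊢
    simpa only [dist_eq_norm, ← mul_sub, hnorm] using this
  obtain ⟨z, hz⟩ := cauchySeq_tendsto_of_complete hcau
  refine ⟨fun n => g n * p, z, fun n => ?_, hz, hlim2, ?_⟩
  -- The square of the norm is that of g P g, which lies below g q g.
  · rw [← sq_le_one_iff₀ (norm_nonneg _), sq, ← CStarRing.norm_self_mul_star]
    refine le_trans ?_ (hg1 n)
    refine CStarAlgebra.norm_le_norm_of_nonneg_of_le (mul_star_self_nonneg _) ?_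
    rw [star_mul, hpsa, hgsa, mul_assoc, ← mul_assoc p, hpp, ← mul_assoc]
    simpa only [hgsa] using star_left_conjugate_le_conjugate h (g n)
  · have h1 := hz.star.mul hz
    have h2 := hlim2.star.mul hlim2
    rw [hpsa, hpp] at h2
    refine tendsto_nhds_unique h1 (h2.congr fun n => ?_)
    simp only [star_mul, hrsa, hpsa, hgsa]
    have : star y * y = r * r := by rw [hrr]
    calc _ = p * g n * (r * r) * (g n * p) := by noncomm_ring
      _ = p * g n * (star y * y) * (g n * p) := by rw [this]
      _ = _ := by noncomm_ring

lemma CuntzLE.trans {a b c : A} (h : CuntzLE a b) (h' : CuntzLE b c) : CuntzLE a c := by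
  have key : ∀ ε > 0, ∃ x : A, ‖star x * c * x - a‖ < ε := fun ε hε => by
    obtain ⟨x, hx⟩ := h
    obtain ⟨y, hy⟩ := h'
    obtain ⟨n, hn⟩ := ((tendsto_iff_norm_sub_tendsto_zero.1 hx).eventually
      (gt_mem_nhds (half_pos hε))).exists
    have h2 := tendsto_iff_norm_sub_tendsto_zero.1 ((hy.const_mul (star (x n))).mul_const (x n))
    obtain ⟨m, hm⟩ := (h2.eventually (gt_mem_nhds (half_pos hε))).exists
    refine ⟨y m * x n, ?_⟩
    calc _ = ‖(star (x n) * (star (y m) * c * y m) * x n - star (x n) * b * x n) +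
          (star (x n) * b * x n - a)‖ := by
          congr 1; simp only [star_mul]; noncomm_ring
      _ ≤ _ := norm_add_le _ _
      _ < ε := by linarith
  choose! x hx using key
  refine ⟨fun n => x (1 / (n + 1)), ?_⟩
  rw [tendsto_iff_norm_sub_tendsto_zero]
  exact squeeze_zero (fun _ => norm_nonneg _) (fun n => (hx _ (by positivity)).le)
    tendsto_one_div_add_atTop_nhds_zero_nat

lemma CuntzLE.conj (b x : A) : CuntzLE (star x * b * x) b := ⟨fun _ => x, tendsto_const_nhds⟩

/-- The contractions mₙ of `exists_polar` satisfy |y| mₙ → √P; multiply this by its adjoint. -/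
lemma CuntzLE.of_le_star_mul_self {P y : A} (hP : 0 ≤ P) (h : P ≤ star y * y) :
    ∃ m : ℕ → A, Tendsto (fun n => star (m n) * (star y * y) * m n) atTop (𝓝 P) := by
  obtain ⟨m, z, -, hz, -, hzz⟩ := exists_polar hP h
  refine ⟨m, ?_⟩
  have h1 := hz.star.mul hz
  rw [hzz] at h1
  refine h1.congr fun n => ?_
  simp only [star_mul]
  noncomm_ring

lemma CuntzLE.of_le {P Q : A} (hP : 0 ≤ P) (h : P ≤ Q) : CuntzLE P Q := by
  obtain ⟨y, rfl⟩ := CStarAlgebra.nonneg_iff_eq_star_mul_self.1 (hP.trans h)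
  exact CuntzLE.of_le_star_mul_self hP h

lemma CuntzLE.refl {P : A} (hP : 0 ≤ P) : CuntzLE P P := .of_le hP le_rfl

lemma CuntzLE.of_le_smul {P Q : A} (hP : 0 ≤ P) (hQ : 0 ≤ Q) {r : ℝ} (hr : 0 ≤ r)
    (h : P ≤ r • Q) : CuntzLE P Q := by
  refine (CuntzLE.of_le hP h).trans ?_
  obtain ⟨x, hx⟩ := CuntzLE.refl hQ
  refine ⟨fun n => √r • x n, ?_⟩
  refine (hx.const_smul r).congr fun n => ?_
  simp only [star_smul, star_trivial, smul_mul_assoc, mul_smul_comm, smul_smul,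
    Real.mul_self_sqrt hr]

end Approximation

/-! ### Hereditary embeddings, closed ideals and transport along partial isometries. -/

section Hereditary

attribute [local instance] CStarAlgebra.spectralOrder CStarAlgebra.spectralOrderedRing

variable {A B C : Type*} [NonUnitalCStarAlgebra A] [NonUnitalCStarAlgebra B]
  [NonUnitalCStarAlgebra C]

lemma norm_hom_le (φ : A →⋆ₙₐ[ℂ] B) (x : A) : ‖φ x‖ ≤ ‖x‖ := NonUnitalStarAlgHom.norm_apply_le φ x

lemma continuous_hom (φ : A →⋆ₙₐ[ℂ] B) : Continuous φ :=
  AddMonoidHomClass.continuous_of_bound φ 1 fun x => by simpa using norm_hom_le φ x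

lemma map_cfcₙ_real (φ : A →⋆ₙₐ[ℂ] B) {f : ℝ → ℝ} (hf : Continuous f) (h0 : f 0 = 0) {a : A}
    (ha : IsSelfAdjoint a) : φ (cfcₙ f a) = cfcₙ f (φ a) :=
  NonUnitalStarAlgHomClass.map_cfcₙ (S := ℂ) φ f a hf.continuousOn h0 (continuous_hom φ) ha (ha.map φ)

/-- The negative part of `a` is mapped to that of `φ a`, which vanishes; injectivity makes it zero
already in the source. -/
lemma nonneg_of_map_nonneg (φ : A →⋆ₙₐ[ℂ] B) (hφ : Function.Injective φ) {a : A}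
    (h : 0 ≤ φ a) : 0 ≤ a := by
  have ha : IsSelfAdjoint a := hφ (by rw [map_star, (IsSelfAdjoint.of_nonneg h).star_eq])
  have h1 : φ (cfcₙ (fun t : ℝ => min t 0) a) = 0 := by
    rw [map_cfcₙ_real φ (by fun_prop) (by simp) ha, ← cfcₙ_zero ℝ (φ a)]
    exact cfcₙ_congr fun t ht => min_eq_right (quasispectrum_nonneg_of_nonneg _ h t ht)
  have h2 : cfcₙ (fun t : ℝ => min t 0) a = 0 := hφ (by rw [h1, map_zero])
  have h3 : a = cfcₙ (fun t : ℝ => max t 0) a + cfcₙ (fun t : ℝ => min t 0) a := by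
    rw [← cfcₙ_add (a := a) (fun t : ℝ => max t 0) (fun t : ℝ => min t 0)]
    simp only [max_add_min, add_zero]
    exact (cfcₙ_id' ℝ a).symm
  rw [h3, h2, add_zero]
  exact cfcₙ_nonneg fun t _ => le_max_right _ _

lemma map_nonneg_hom (φ : A →⋆ₙₐ[ℂ] B) {a : A} (h : 0 ≤ a) : 0 ≤ φ a := by
  obtain ⟨x, rfl⟩ := CStarAlgebra.nonneg_iff_eq_star_mul_self.1 h
  rw [map_mul, map_star]
  exact star_mul_self_nonneg _

lemma exists_approx_unit (F : Finset A) {ε : ℝ} (hε : 0 < ε) :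
    ∃ e : A, 0 ≤ e ∧ ‖e‖ ≤ 1 ∧ ∀ x ∈ F, ‖x - e * x‖ < ε ∧ ‖x - x * e‖ < ε := by
  have h := CStarAlgebra.increasingApproximateUnit (A := A)
  have h1 : ∀ x ∈ F, ∀ᶠ e in CStarAlgebra.approximateUnit A, ‖x - e * x‖ < ε ∧ ‖x - x * e‖ < ε := by
    intro x _
    have a := tendsto_iff_norm_sub_tendsto_zero.1 (h.tendsto_mul_right x)
    have b := tendsto_iff_norm_sub_tendsto_zero.1 (h.tendsto_mul_left x)
    filter_upwards [a.eventually (gt_mem_nhds hε), b.eventually (gt_mem_nhds hε)] with e h1 h2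
    rw [norm_sub_rev] at h1 h2
    tauto
  have h2 := (Filter.eventually_all_finset F).2 h1
  obtain ⟨e, ⟨h3, h4⟩, h5⟩ := ((h.eventually_nonneg.and h.eventually_norm).and h2).exists
  exact ⟨e, h3, h4, h5⟩

/-- An embedding of `B` onto a hereditary subalgebra of `A`. -/
structure HerEmb (ι : B →⋆ₙₐ[ℂ] A) : Prop where
  inj : Function.Injective ι
  sandwich : ∀ (b b' : B) (a : A), ∃ c, ι c = ι b * a * ι b'

/-- The product ι(κ c) a ι(κ c') is ι b for some b. With e an approximate unit of the smallest
algebra, b is approximated by κ(e) b κ(e), which lies in the closed range of κ. -/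
lemma HerEmb.comp {ι : B →⋆ₙₐ[ℂ] A} {κ : C →⋆ₙₐ[ℂ] B} (hι : HerEmb ι) (hκ : HerEmb κ) :
    HerEmb (ι.comp κ) where
  inj := hι.inj.comp hκ.inj
  sandwich c c' a := by
    classical
    obtain ⟨b, hb⟩ := hι.sandwich (κ c) (κ c') a
    have hcl : IsClosed (Set.range κ) :=
      (NonUnitalStarAlgHom.isometry κ hκ.inj).isClosedEmbedding.isClosed_range
    have : b ∈ closure (Set.range κ) := by
      rw [Metric.mem_closure_iff]
      intro ε hε
      obtain ⟨e, he0, he1, he⟩ := exists_approx_unit ({c, c'} : Finset C) (ε := ε / (2 * (1 + ‖a‖) * (1 + ‖c‖) * (1 + ‖c'‖)))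
        (by positivity)
      obtain ⟨d, hd⟩ := hκ.sandwich e e b
      refine ⟨κ d, ⟨d, rfl⟩, ?_⟩
      have h1 := (he c (by simp)).1.le
      have h2 := (he c' (by simp)).2.le
      set η := ε / (2 * (1 + ‖a‖) * (1 + ‖c‖) * (1 + ‖c'‖)) with hη
      have hη0 : 0 < η := by positivity
      have hκe : ‖ι (κ e)‖ ≤ 1 := (norm_hom_le _ _).trans ((norm_hom_le _ _).trans he1)
      rw [dist_eq_norm, hd, ← NonUnitalStarAlgHom.norm_map ι hι.inj, map_sub, map_mul, map_mul, hb]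
      have e1 : ι (κ c) * a * ι (κ c') - ι (κ e) * (ι (κ c) * a * ι (κ c')) * ι (κ e) =
          ι (κ (c - e * c)) * a * ι (κ c') + ι (κ e) * ι (κ c) * a * ι (κ (c' - c' * e)) := by
        simp only [map_sub, map_mul]; noncomm_ring
      have n1 : ∀ x, ‖ι (κ x)‖ ≤ ‖x‖ := fun x => (norm_hom_le _ _).trans (norm_hom_le _ _)
      rw [e1]
      calc _ ≤ ‖ι (κ (c - e * c)) * a * ι (κ c')‖ + ‖ι (κ e) * ι (κ c) * a * ι (κ (c' - c' * e))‖ :=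
            norm_add_le _ _
        _ ≤ ‖ι (κ (c - e * c))‖ * ‖a‖ * ‖ι (κ c')‖ + ‖ι (κ e)‖ * ‖ι (κ c)‖ * ‖a‖ * ‖ι (κ (c' - c' * e))‖ := by
            gcongr
            · exact norm_mul₃_le
            · exact (norm_mul_le _ _).trans (by gcongr; exact norm_mul₃_le)
        _ ≤ η * ‖a‖ * ‖c'‖ + 1 * ‖c‖ * ‖a‖ * η := by
            gcongr
            · exact (n1 _).trans h1
            · exact n1 _
            · exact n1 _
            · exact (n1 _).trans h2
        _ < η * (2 * (1 + ‖a‖) * (1 + ‖c‖) * (1 + ‖c'‖)) := by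
            have := norm_nonneg a
            have := norm_nonneg c
            have := norm_nonneg c'
            have : 0 ≤ ‖a‖ * ‖c‖ := by positivity
            have : 0 ≤ ‖a‖ * ‖c'‖ := by positivity
            have : 0 ≤ ‖c‖ * ‖c'‖ := by positivity
            have : 0 ≤ ‖a‖ * ‖c‖ * ‖c'‖ := by positivity
            nlinarith
        _ = ε := by rw [hη]; field_simp
    rw [hcl.closure_eq] at this
    obtain ⟨d, rfl⟩ := this
    exact ⟨d, hb⟩

lemma mul_mul_mem_her (a x : A) : a * x * star a ∈ her a :=
  subset_closure (show _ ∈ Set.range fun x : A => a * x * star a from ⟨x, rfl⟩)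

lemma her_le_of_isClosed {a : A} {S : Set A} (hS : IsClosed S) (h : ∀ x, a * x * star a ∈ S) :
    (her a : Set A) ⊆ S := by
  change closure (Set.range fun x : A => a * x * star a) ⊆ S
  exact closure_minimal (by rintro _ ⟨x, rfl⟩; exact h x) hS

lemma her_sandwich {a x y : A} (hx : x ∈ her a) (hy : y ∈ her a) (d : A) : x * d * y ∈ her a := by
  refine map_mem_closure₂ (f := fun x y => x * d * y) (by fun_prop) hx hy ?_
  rintro _ ⟨x', rfl⟩ _ ⟨y', rfl⟩
  exact ⟨x' * star a * d * a * y', by simp only [mul_assoc]⟩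

/-- The inclusion of `her a`. -/
def herIncl (a : A) : her a →⋆ₙₐ[ℂ] A := NonUnitalStarSubalgebraClass.subtype (her a)

@[simp] lemma herIncl_apply {a : A} (x : her a) : herIncl a x = x := rfl

lemma herEmb_herIncl (a : A) : HerEmb (herIncl a) :=
  ⟨Subtype.val_injective, fun b b' x => ⟨⟨_, her_sandwich b.2 b'.2 x⟩, rfl⟩⟩

/-- The approximate inverse square roots of a², whose square root is `a`, make a gₙ an approximate
unit for `a` inside `her a`. -/
lemma exists_her_approx {a : A} (ha : 0 ≤ a) :
    ∃ g : ℕ → A, (∀ n, a * g n ∈ her a) ∧ (∀ n, a * g n = g n * a) ∧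
      Tendsto (fun n => a * g n * a) atTop (𝓝 a) := by
  have hsa : star a = a := (IsSelfAdjoint.of_nonneg ha).star_eq
  have hr : cfcₙ Real.sqrt (star a * a) = a := by
    rw [hsa, ← CFC.sqrt_eq_real_sqrt _ (by simpa [hsa] using star_mul_self_nonneg a),
      CFC.sqrt_mul_self a ha]
  obtain ⟨g, hg0, hgc, hg1, he, hee, hlim, -⟩ := exists_approx_inv_sqrt (star_mul_self_nonneg a)
  rw [hr] at he hlim
  have hcomm : ∀ n, a * g n = g n * a := fun n => by
    have := (he n).star_eq
    rwa [star_mul, hsa, (IsSelfAdjoint.of_nonneg (hg0 n)).star_eq, eq_comm] at this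
  have ht : Tendsto (fun n => a * g n * a) atTop (𝓝 a) := by
    rw [tendsto_iff_norm_sub_tendsto_zero]
    have h1 : Tendsto (fun n : ℕ => √(1 / ((n : ℝ) + 1))) atTop (𝓝 0) := by
      simpa using! tendsto_one_div_add_atTop_nhds_zero_nat.sqrt
    refine squeeze_zero (fun _ => norm_nonneg _) (fun n => ?_) h1
    refine Real.le_sqrt_of_sq_le (le_trans ?_ (hlim n))
    rw [norm_sub_rev]
    exact norm_sub_mul_sq_le (by simp [hsa]) (he n)
  refine ⟨g, fun n => ?_, hcomm, ht⟩
  -- The element a gₙ is the limit over m of a g_m a gₙ = a (g_m gₙ) a.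
  refine mem_closure_of_tendsto (ht.mul_const (g n))
    (Eventually.of_forall fun m => ⟨g m * g n, ?_⟩)
  calc a * (g m * g n) * star a = a * g m * (g n * a) := by rw [hsa]; noncomm_ring
    _ = _ := by rw [← hcomm n]; noncomm_ring

lemma self_mem_her {a : A} (ha : 0 ≤ a) : a ∈ her a := by
  obtain ⟨g, hg, hc, ht⟩ := exists_her_approx ha
  have hsa : star a = a := (IsSelfAdjoint.of_nonneg ha).star_eq
  exact mem_closure_of_tendsto ht (Eventually.of_forall fun n => ⟨g n, by simp [hsa]⟩)

/-- Density has to be shown with factors inside `her a`: a v a is the limit of a x a with x = (a gₙ)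
v (a gₙ) in `her a`. -/
lemma isStrictlyPos_her {a : A} (ha : 0 ≤ a) :
    IsStrictlyPos (⟨a, self_mem_her ha⟩ : her a) := by
  have hsa : star a = a := (IsSelfAdjoint.of_nonneg ha).star_eq
  refine ⟨nonneg_of_map_nonneg (herIncl a) Subtype.val_injective ha, fun w => ?_⟩
  obtain ⟨g, hg, hc, ht⟩ := exists_her_approx ha
  rw [closure_subtype]
  have : (her a : Set A) ⊆ closure (Subtype.val '' (Set.range fun x : her a =>
      (⟨a, self_mem_her ha⟩ : her a) * x * ⟨a, self_mem_her ha⟩)) := by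
    refine her_le_of_isClosed isClosed_closure fun v => ?_
    rw [hsa]
    have h1 := (ht.mul_const v).mul ht
    refine mem_closure_of_tendsto h1 (Eventually.of_forall fun n => ?_)
    refine ⟨_, ⟨⟨_, her_sandwich (hg n) (hg n) v⟩, rfl⟩, ?_⟩
    change a * (a * g n * v * (a * g n)) * a = a * g n * a * v * (a * g n * a)
    have h3 : a * (a * g n) = a * g n * a := by rw [mul_assoc a (g n), ← hc n]
    calc _ = a * (a * g n) * v * (a * g n * a) := by simp only [mul_assoc]
      _ = _ := by rw [h3]
  exact this w.2

/-- The closed ideal generated by a set. -/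
def closedIdeal (S : Set A) : Submodule ℂ A :=
  (Submodule.span ℂ {w | ∃ s ∈ S, ∃ x y : A, w = x * s * y}).topologicalClosure

lemma isIdeal_topologicalClosure {I : Submodule ℂ A} (h : IsIdeal I) :
    IsIdeal I.topologicalClosure := fun x hx a =>
  ⟨map_mem_closure (f := fun x => a * x) (by fun_prop) hx fun y hy => (h y hy a).1,
   map_mem_closure (f := fun x => x * a) (by fun_prop) hx fun y hy => (h y hy a).2⟩

lemma isIdeal_span (S : Set A) :
    IsIdeal (Submodule.span ℂ {w | ∃ s ∈ S, ∃ x y : A, w = x * s * y}) := by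
  intro x hx a
  induction hx using Submodule.span_induction with
  | mem x hx =>
    obtain ⟨s, hs, x, y, rfl⟩ := hx
    exact ⟨Submodule.subset_span ⟨s, hs, a * x, y, by simp only [mul_assoc]⟩,
      Submodule.subset_span ⟨s, hs, x, y * a, by simp only [mul_assoc]⟩⟩
  | zero => simp
  | add x y _ _ hx hy =>
    rw [mul_add, add_mul]
    exact ⟨add_mem hx.1 hy.1, add_mem hx.2 hy.2⟩
  | smul c x _ hx =>
    rw [mul_smul_comm, smul_mul_assoc]
    exact ⟨Submodule.smul_mem _ _ hx.1, Submodule.smul_mem _ _ hx.2⟩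

lemma isIdeal_closedIdeal (S : Set A) : IsIdeal (closedIdeal S) :=
  isIdeal_topologicalClosure (isIdeal_span S)

lemma isClosed_closedIdeal (S : Set A) : IsClosed (closedIdeal S : Set A) :=
  Submodule.isClosed_topologicalClosure _

/-- The spanning set only contains two-sided products, so `s` is reached as a limit of e s e along
an approximate unit. -/
lemma mem_closedIdeal {S : Set A} {s : A} (hs : s ∈ S) : s ∈ closedIdeal S := by
  refine Metric.mem_closure_iff.2 fun ε hε => ?_
  obtain ⟨e, he0, he1, he⟩ := exists_approx_unit {s} (half_pos hε)
  refine ⟨e * s * e, Submodule.subset_span ⟨s, hs, e, e, rfl⟩, ?_⟩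
  obtain ⟨h1, h2⟩ := he s (by simp)
  calc dist s (e * s * e) = ‖(s - s * e) + (s - e * s) * e‖ := by
        rw [dist_eq_norm]; congr 1; noncomm_ring
    _ ≤ ‖s - s * e‖ + ‖s - e * s‖ * ‖e‖ := (norm_add_le _ _).trans (by gcongr; exact norm_mul_le _ _)
    _ ≤ ‖s - s * e‖ + ‖s - e * s‖ * 1 := by gcongr
    _ < ε := by linarith

lemma closedIdeal_le {S : Set A} {I : Submodule ℂ A} (hI : IsIdeal I) (hc : IsClosed (I : Set A))
    (h : S ⊆ I) : closedIdeal S ≤ I := by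
  refine Submodule.topologicalClosure_minimal _ (Submodule.span_le.2 ?_) hc
  rintro _ ⟨s, hs, x, y, rfl⟩
  exact (hI _ (hI _ (h hs) x).1 y).2

lemma exists_sum_of_mem_span {S : Set A} {a : A}
    (ha : a ∈ Submodule.span ℂ {w | ∃ s ∈ S, ∃ x y : A, w = x * s * y}) :
    ∃ (n : ℕ) (x y s : Fin n → A), (∀ i, s i ∈ S) ∧ a = ∑ i, x i * s i * y i := by
  induction ha using Submodule.span_induction with
  | mem w hw =>
    obtain ⟨s, hs, x, y, rfl⟩ := hw
    exact ⟨1, fun _ => x, fun _ => y, fun _ => s, fun _ => hs, by simp⟩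
  | zero => exact ⟨0, Fin.elim0, Fin.elim0, Fin.elim0, fun i => i.elim0, by simp⟩
  | add a b _ _ ha hb =>
    obtain ⟨n, x, y, s, h1, rfl⟩ := ha
    obtain ⟨m, x', y', s', h1', rfl⟩ := hb
    refine ⟨n + m, Fin.append x x', Fin.append y y', Fin.append s s', fun i => ?_, ?_⟩
    · refine Fin.addCases (fun i => ?_) (fun i => ?_) i <;> simp [h1, h1']
    · simp [Fin.sum_univ_add]
  | smul c a _ ha =>
    obtain ⟨n, x, y, s, h1, rfl⟩ := ha
    exact ⟨n, fun i => c • x i, y, s, h1, by simp [Finset.smul_sum, smul_mul_assoc]⟩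

lemma IsSimpleCStar.closedIdeal_eq_top (h : IsSimpleCStar A) {S : Set A} {s : A} (hs : s ∈ S)
    (h0 : s ≠ 0) : closedIdeal S = ⊤ :=
  (h.2 _ (isIdeal_closedIdeal S) (isClosed_closedIdeal S)).resolve_left fun hb =>
    h0 (by simpa [hb] using mem_closedIdeal hs)

lemma IsSimpleCStar.dense_span (h : IsSimpleCStar A) {s : A} (h0 : s ≠ 0) :
    Dense (Submodule.span ℂ {w | ∃ s' ∈ ({s} : Set A), ∃ x y : A, w = x * s' * y} : Set A) := by
  have := h.closedIdeal_eq_top (Set.mem_singleton s) h0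
  exact Submodule.dense_iff_topologicalClosure_eq_top.2 this

lemma IsSimpleCStar.exists_sum_near (h : IsSimpleCStar A) {s : A} (h0 : s ≠ 0) (a : A) {ε : ℝ}
    (hε : 0 < ε) : ∃ (n : ℕ) (x y : Fin n → A), ‖a - ∑ i, x i * s * y i‖ < ε := by
  obtain ⟨w, hw, hd⟩ := Metric.mem_closure_iff.1 (h.dense_span h0 a) ε hε
  obtain ⟨n, x, y, s', h1, rfl⟩ := exists_sum_of_mem_span hw
  simp only [Set.mem_singleton_iff] at h1
  exact ⟨n, x, y, by simpa [h1, dist_eq_norm] using hd⟩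

/-- For nonzero j in an ideal J, sums of x ι(j⋆ j j⋆) y are dense in A. The outer factors j⋆ serve
to return to B: compressing by ι(e), both ι(e) x ι(j⋆) and ι(j⋆) y ι(e) come from B, so the
compressed sum is the image of an element of J. -/
lemma HerEmb.isSimpleCStar {ι : B →⋆ₙₐ[ℂ] A} (hι : HerEmb ι) (h : IsSimpleCStar A)
    [Nontrivial B] : IsSimpleCStar B := by
  refine ⟨‹_›, fun J hJ hc => or_iff_not_imp_left.2 fun hne => ?_⟩
  obtain ⟨j, hj, hj0⟩ := (Submodule.ne_bot_iff _).1 hne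
  have hj1 : star j * j * star j ≠ 0 := by
    intro h0
    have : ‖star j * j * star j * j‖ = ‖j‖ ^ 4 := by
      have : star j * j * star j * j = star (star j * j) * (star j * j) := by
        simp only [star_mul, star_star, mul_assoc]
      rw [this, CStarRing.norm_star_mul_self, CStarRing.norm_star_mul_self]; ring
    rw [h0, zero_mul, norm_zero] at this
    exact hj0 (norm_eq_zero.1 (pow_eq_zero_iff (by norm_num) |>.1 this.symm))
  have hι0 : ι (star j * j * star j) ≠ 0 := fun h0 => hj1 (hι.inj (by rw [h0, map_zero]))
  rw [eq_top_iff]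
  rintro b -
  refine hc.closure_subset (Metric.mem_closure_iff.2 fun ε hε => ?_)
  obtain ⟨e, he0, he1, he⟩ := exists_approx_unit {b} (ε := ε / 3) (by positivity)
  obtain ⟨n, x, y, hxy⟩ := h.exists_sum_near hι0 (ι b) (ε := ε / 3) (by positivity)
  choose p hp using fun i => hι.sandwich e (star j) (x i)
  choose q hq using fun i => hι.sandwich (star j) e (y i)
  refine ⟨∑ i, p i * j * q i, ?_, ?_⟩
  · exact Submodule.sum_mem _ fun i _ => (hJ _ (hJ _ hj _).1 _).2
  have h1 : ι (∑ i, p i * j * q i) = ι e * (∑ i, x i * ι (star j * j * star j) * y i) * ι e := by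
    simp only [map_sum, map_mul, hp, hq, Finset.mul_sum, Finset.sum_mul, mul_assoc]
  obtain ⟨h2, h3⟩ := he b (by simp)
  have hιe : ‖ι e‖ ≤ 1 := (norm_hom_le _ _).trans he1
  set w := ∑ i, x i * ι (star j * j * star j) * y i
  rw [dist_eq_norm, ← NonUnitalStarAlgHom.norm_map ι hι.inj, map_sub, h1]
  have h4 : ι b - ι e * w * ι e = ι (b - b * e) + ι (b - e * b) * ι e + ι e * (ι b - w) * ι e := by
    simp only [map_sub, map_mul]; noncomm_ring
  rw [h4]
  calc _ ≤ ‖ι (b - b * e)‖ + ‖ι (b - e * b)‖ * ‖ι e‖ + ‖ι e‖ * ‖ι b - w‖ * ‖ι e‖ := by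
        refine (norm_add₃_le).trans ?_
        gcongr
        · exact norm_mul_le _ _
        · exact norm_mul₃_le
    _ ≤ ‖b - b * e‖ + ‖b - e * b‖ * 1 + 1 * ‖ι b - w‖ * 1 := by
        gcongr
        · exact norm_hom_le _ _
        · exact norm_hom_le _ _
    _ < ε := by linarith

/-- A ⋆-homomorphism whose values lie in the range of an embedding factors through it. -/
lemma exists_factor (ι : B →⋆ₙₐ[ℂ] A) (hι : Function.Injective ι) (φ : C →⋆ₙₐ[ℂ] A)
    (h : ∀ x, ∃ b, ι b = φ x) : ∃ ψ : C →⋆ₙₐ[ℂ] B, ∀ x, ι (ψ x) = φ x := by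
  choose f hf using h
  refine ⟨{ toFun := f
            map_smul' := fun c x => hι (by simp [hf])
            map_zero' := hι (by simp [hf])
            map_add' := fun x y => hι (by simp [hf])
            map_mul' := fun x y => hι (by simp [hf])
            map_star' := fun x => hι (by simp [hf, map_star]) }, hf⟩

/-- Transport of a hereditary subalgebra along (the partial isometry in the polar decomposition
of) an element `z`. -/
theorem exists_transport (j : B →⋆ₙₐ[ℂ] A) (hj : Function.Injective j) {u : B} (hu : 0 ≤ u) {z : A}
    (hz : ∀ d, star z * z * j d = j (u * u * d)) :
    ∃ α : her u →⋆ₙₐ[ℂ] A, Function.Injective α ∧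
      ∀ d (h : u * d * u ∈ her u), α ⟨u * d * u, h⟩ = z * j d * star z := by
  have hsa : star u = u := (IsSelfAdjoint.of_nonneg hu).star_eq
  have hz' : ∀ d, j d * (star z * z) = j (d * (u * u)) := fun d => by
    have := congrArg star (hz (star d))
    simpa only [star_mul, star_star, ← map_star, hsa, mul_assoc] using this
  -- The homomorphism is built from its graph, the closure of the pairs (u d u, z j(d) z⋆). Both
  -- coordinates have the same norm, so the second is a function of the first.
  let S₀ : NonUnitalStarSubalgebra ℂ (B × A) :=
    { carrier := Set.range fun d : B => ((u * d * u, z * j d * star z) : B × A)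
      add_mem' := by
        rintro _ _ ⟨x, rfl⟩ ⟨y, rfl⟩
        exact ⟨x + y, by simp [mul_add, add_mul]⟩
      zero_mem' := ⟨0, by simp⟩
      mul_mem' := by
        rintro _ _ ⟨x, rfl⟩ ⟨y, rfl⟩
        refine ⟨x * (u * u * y), Prod.ext (by simp [mul_assoc]) ?_⟩
        change z * j (x * (u * u * y)) * star z = z * j x * star z * (z * j y * star z)
        calc _ = z * (j x * j (u * u * y)) * star z := by rw [map_mul]
          _ = _ := by rw [← hz]; noncomm_ring
      smul_mem' := by
        rintro c _ ⟨x, rfl⟩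
        exact ⟨c • x, by simp only [mul_smul_comm, smul_mul_assoc, map_smul, Prod.smul_mk]⟩
      star_mem' := by
        rintro _ ⟨x, rfl⟩
        exact ⟨star x, Prod.ext (by simp [mul_assoc, hsa]) (by simp [mul_assoc, map_star])⟩ }
  let S := S₀.topologicalClosure
  have hScl : IsClosed (S : Set (B × A)) := NonUnitalStarSubalgebra.isClosed_topologicalClosure _
  have hmem : ∀ d, ((u * d * u, z * j d * star z) : B × A) ∈ S := fun d =>
    subset_closure ⟨d, rfl⟩
  -- Since z⋆z acts on the range of j as u², the elements z and u are interchangeable in norms.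
  have hzx : ∀ x y, ‖z * (j x * y)‖ = ‖j (u * x) * y‖ := fun x y => by
    rw [← sq_eq_sq₀ (norm_nonneg _) (norm_nonneg _), sq, sq, ← CStarRing.norm_star_mul_self,
      ← CStarRing.norm_star_mul_self]
    congr 1
    calc _ = star (j x * y) * (star z * z * j x) * y := by simp only [star_mul, mul_assoc]
      _ = _ := by rw [hz]; simp only [star_mul, map_mul, hsa, mul_assoc, ← map_star]
  have hn0 : ∀ d, ‖z * j d * star z‖ = ‖u * d * u‖ := fun d => by
    rw [mul_assoc, hzx, ← norm_star, star_mul, star_star, ← map_star]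
    have h1 : ∀ x, ‖z * j x‖ = ‖u * x‖ := fun x => by
      rw [← NonUnitalStarAlgHom.norm_map j hj, ← sq_eq_sq₀ (norm_nonneg _) (norm_nonneg _), sq, sq,
        ← CStarRing.norm_star_mul_self, ← CStarRing.norm_star_mul_self]
      congr 1
      calc _ = star (j x) * (star z * z * j x) := by simp only [star_mul, mul_assoc]
        _ = _ := by rw [hz]; simp only [star_mul, map_mul, hsa, mul_assoc, ← map_star]
    rw [h1, star_mul, hsa, ← norm_star]
    simp only [star_mul, star_star, hsa, mul_assoc]
  have hn : ∀ s : S, ‖(s : B × A).2‖ = ‖(s : B × A).1‖ := by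
    have : (S : Set (B × A)) ⊆ {s | ‖s.2‖ = ‖s.1‖} :=
      closure_minimal (by rintro _ ⟨d, rfl⟩; exact hn0 d)
        (isClosed_eq (by fun_prop) (by fun_prop))
    exact fun s => this s.2
  have : IsClosed (S : Set (B × A)) := hScl
  let p₁ : S →⋆ₙₐ[ℂ] B := (NonUnitalStarAlgHom.fst ℂ B A).comp (NonUnitalStarSubalgebraClass.subtype S)
  let p₂ : S →⋆ₙₐ[ℂ] A := (NonUnitalStarAlgHom.snd ℂ B A).comp (NonUnitalStarSubalgebraClass.subtype S)
  have hp : ∀ s, ‖p₂ s‖ = ‖p₁ s‖ := hn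
  have hinj : ∀ s, p₁ s = 0 → s = 0 := fun s h => by
    have h2 : p₂ s = 0 := by rw [← norm_eq_zero, hp, h, norm_zero]
    exact Subtype.ext (Prod.ext h h2)
  have hp₁ : Function.Injective p₁ := (injective_iff_map_eq_zero p₁).2 hinj
  -- The first projection is isometric with closed range containing every u d u, so each element of
  -- `her u` lifts to the graph.
  have hcl : IsClosed (Set.range p₁) :=
    (NonUnitalStarAlgHom.isometry p₁ hp₁).isClosedEmbedding.isClosed_range
  have hsub : (her u : Set B) ⊆ Set.range p₁ :=
    her_le_of_isClosed hcl fun d => ⟨⟨_, hmem d⟩, by rw [hsa]; rfl⟩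
  obtain ⟨ψ, hψ⟩ := exists_factor p₁ hp₁ (herIncl u) fun x => hsub x.2
  refine ⟨p₂.comp ψ, (injective_iff_map_eq_zero _).2 fun x hx => ?_, fun d h => ?_⟩
  · have h1 : p₂ (ψ x) = 0 := hx
    have h2 : p₁ (ψ x) = 0 := by rw [← norm_eq_zero, ← hp, h1, norm_zero]
    exact Subtype.ext ((hψ x).symm.trans h2)
  · have : ψ ⟨u * d * u, h⟩ = ⟨_, hmem d⟩ := hp₁ (hψ _)
    change p₂ (ψ ⟨u * d * u, h⟩) = _
    rw [this]
    rfl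

lemma her_induction {u : B} (hu : 0 ≤ u) {p : her u → Prop} (hp : IsClosed {x | p x})
    (h : ∀ d (hd : u * d * u ∈ her u), p ⟨u * d * u, hd⟩) (x : her u) : p x := by
  have hsa : star u = u := (IsSelfAdjoint.of_nonneg hu).star_eq
  have hd : Dense (Set.range fun d : B => (⟨u * d * star u, mul_mul_mem_her u d⟩ : her u)) := by
    intro x
    rw [closure_subtype, ← Set.range_comp]
    exact x.2
  refine hp.closure_subset_iff.2 ?_ (hd x)
  rintro _ ⟨d, rfl⟩
  simp only [hsa, Set.mem_ofPred_eq]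
  exact h d _

/-- The product (z j(d) z⋆) a (z j(d') z⋆) equals z j(c) z⋆, where j(c) = j(d) (z⋆ a z) j(d') exists
because j is hereditary. The range is closed, so this suffices. -/
lemma herEmb_of_transport {j : B →⋆ₙₐ[ℂ] A} (hj : HerEmb j) {u : B} (hu : 0 ≤ u) {z : A}
    {α : her u →⋆ₙₐ[ℂ] A} (hα : Function.Injective α)
    (h : ∀ d (h : u * d * u ∈ her u), α ⟨u * d * u, h⟩ = z * j d * star z) : HerEmb α := by
  have hsa : star u = u := (IsSelfAdjoint.of_nonneg hu).star_eq
  have hcl : IsClosed (Set.range α) :=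
    (NonUnitalStarAlgHom.isometry α hα).isClosedEmbedding.isClosed_range
  refine ⟨hα, fun x y a => ?_⟩
  have hc := continuous_hom α
  refine her_induction hu (p := fun x => α x * a * α y ∈ Set.range α)
    (hcl.preimage (f := fun x => α x * a * α y) (by fun_prop)) (fun d hd => ?_) x
  refine her_induction hu (p := fun y => α ⟨u * d * u, hd⟩ * a * α y ∈ Set.range α)
    (hcl.preimage (f := fun y => α ⟨u * d * u, hd⟩ * a * α y) (by fun_prop)) (fun d' hd' => ?_) y
  obtain ⟨c, hc⟩ := hj.sandwich d d' (star z * a * z)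
  have := mul_mul_mem_her u c
  rw [hsa] at this
  refine ⟨⟨u * c * u, this⟩, ?_⟩
  rw [h, h, h, hc]
  simp only [mul_assoc]

end Hereditary

/-! ### Cutoff functions and domination in the Pedersen ideal. -/

section Pedersen

attribute [local instance] CStarAlgebra.spectralOrder CStarAlgebra.spectralOrderedRing

variable {A : Type*} [NonUnitalCStarAlgebra A]

lemma cutoff_eq {ε : ℝ} (hε : 0 < ε) (t : ℝ) :
    cutoff ε t = min 1 (max 0 ((t - ε / 2) / (ε / 2))) := by
  unfold cutoff
  split_ifs with h1 h2
  · rw [max_eq_left, min_eq_right zero_le_one]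
    exact div_nonpos_of_nonpos_of_nonneg (by linarith) (by linarith)
  · rw [max_eq_right (div_nonneg (by linarith) (by linarith)), min_eq_right]
    rw [div_le_one (by linarith)]; linarith
  · rw [max_eq_right (div_nonneg (by linarith) (by linarith)), min_eq_left]
    rw [one_le_div (by linarith)]; linarith

lemma continuous_cutoff {ε : ℝ} (hε : 0 < ε) : Continuous (cutoff ε) := by
  have : cutoff ε = fun t => min 1 (max 0 ((t - ε / 2) / (ε / 2))) := funext (cutoff_eq hε)
  rw [this]
  fun_prop

lemma cutoff_zero {ε : ℝ} (hε : 0 < ε) : cutoff ε 0 = 0 := by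
  rw [cutoff, if_pos (by linarith)]

lemma cutoff_mem {ε : ℝ} (hε : 0 < ε) (t : ℝ) : 0 ≤ cutoff ε t ∧ cutoff ε t ≤ 1 := by
  rw [cutoff_eq hε]
  exact ⟨le_min zero_le_one (le_max_left _ _), min_le_left _ _⟩

lemma cutoff_of_le {ε t : ℝ} (h : t ≤ ε / 2) : cutoff ε t = 0 := if_pos h

lemma cutoff_of_ge {ε t : ℝ} (hε : 0 < ε) (h : ε ≤ t) : cutoff ε t = 1 := by
  rw [cutoff_eq hε, min_eq_left]
  refine le_max_of_le_right ?_
  rw [one_le_div (by linarith)]; linarith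

lemma exists_mem_quasispectrum_norm {g : A} (hg : 0 ≤ g) {r : ℝ} (hr : r < ‖g‖) :
    ∃ t ∈ quasispectrum ℝ g, r < t := by
  by_contra! h
  have : ‖cfcₙ (fun t : ℝ => t) g‖ ≤ r := norm_cfcₙ_le fun t ht => by
    rw [Real.norm_of_nonneg (quasispectrum_nonneg_of_nonneg g hg t ht)]
    exact h t ht
  rw [cfcₙ_id' ℝ g] at this
  linarith

lemma cfcₙ_ne_zero {g : A} (hg : IsSelfAdjoint g) {f : ℝ → ℝ} (hf : Continuous f) (h0 : f 0 = 0) {t : ℝ}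
    (ht : t ∈ quasispectrum ℝ g) (hft : f t ≠ 0) : cfcₙ f g ≠ 0 := by
  intro h
  have := norm_apply_le_norm_cfcₙ f g ht hf.continuousOn h0 hg
  rw [h, norm_zero] at this
  exact hft (norm_le_zero_iff.1 this)

lemma exists_nonneg_norm_one [Nontrivial A] : ∃ g : A, 0 ≤ g ∧ ‖g‖ = 1 := by
  obtain ⟨a, ha⟩ := exists_ne (0 : A)
  have h0 : ‖star a * a‖ ≠ 0 := by
    rw [CStarRing.norm_star_mul_self]; simpa using ha
  refine ⟨‖star a * a‖⁻¹ • (star a * a), smul_nonneg (by positivity) (star_mul_self_nonneg a), ?_⟩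
  rw [norm_smul, norm_inv, norm_norm, inv_mul_cancel₀ h0]

/-- Elements with a local unit k lie in every dense ideal: for i in the ideal with ‖k - i‖ < 1, the
element 1 - (k - i) of the unitization is invertible and sends x to i x. -/
lemma mem_of_dense_ideal {I : Submodule ℂ A} (hI : IsIdeal I) (hd : Dense (I : Set A)) {k x : A}
    (h : k * x = x) : x ∈ I := by
  obtain ⟨i, hi, hki⟩ := Metric.mem_closure_iff.1 (hd k) 1 one_pos
  rw [dist_eq_norm] at hki
  have hn : ‖((k - i : A) : Unitization ℂ A)‖ < 1 := by rwa [Unitization.norm_inr]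
  have hu := isUnit_one_sub_of_norm_lt_one hn
  obtain ⟨w, hw⟩ := hu.exists_left_inv
  have h1 : (x : Unitization ℂ A) = w * ((i * x : A) : Unitization ℂ A) := by
    have : (1 - ((k - i : A) : Unitization ℂ A)) * (x : Unitization ℂ A) = ((i * x : A) : Unitization ℂ A) := by
      rw [sub_mul, one_mul, ← Unitization.inr_mul, ← Unitization.inr_sub]
      congr 1
      rw [sub_mul, h]; abel
    rw [← this, ← mul_assoc, hw, one_mul]
  have h2 : x = w.fst • (i * x) + w.snd * (i * x) := by
    have := congrArg (fun z : Unitization ℂ A => z.snd) h1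
    simpa using this
  rw [h2]
  have hix := (hI i hi x).2
  exact add_mem (Submodule.smul_mem _ _ hix) (hI _ hix _).1

/-- For a positive g of norm one, f_{1/2}(g) is a local unit for f_1(g), and f_1(g) is nonzero
because g has spectrum above 1/2. -/
lemma exists_mem_pedersenPos [Nontrivial A] : ∃ a ∈ pedersenPos A, a ≠ 0 := by
  obtain ⟨g, hg, hg1⟩ := exists_nonneg_norm_one (A := A)
  have c1 := continuous_cutoff (ε := 1) one_pos
  have c2 := continuous_cutoff (ε := 1 / 2) (by norm_num)
  have z1 := cutoff_zero (ε := 1) one_pos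
  have z2 := cutoff_zero (ε := 1 / 2) (by norm_num)
  refine ⟨cfcₙ (cutoff 1) g, ⟨?_, cfcₙ_nonneg fun t _ => (cutoff_mem one_pos t).1⟩, ?_⟩
  · rw [pedersenIdeal, Submodule.mem_sInf]
    rintro I ⟨hI, hd⟩
    refine mem_of_dense_ideal hI hd (k := cfcₙ (cutoff (1 / 2)) g) ?_
    rw [← cfcₙ_mul _ _ g]
    refine cfcₙ_congr fun t _ => ?_
    by_cases ht : t ≤ 1 / 2
    · simp [cutoff_of_le ht]
    · rw [cutoff_of_ge (ε := 1 / 2) (by norm_num) (not_le.1 ht).le, one_mul]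
  · obtain ⟨t, ht, h⟩ := exists_mem_quasispectrum_norm hg (r := 1 / 2)
      (by rw [hg1]; norm_num)
    refine cfcₙ_ne_zero (.of_nonneg hg) c1 z1 ht ?_
    rw [cutoff_eq one_pos]
    refine (lt_min one_pos (lt_max_of_lt_right ?_)).ne'
    apply div_pos <;> linarith

/-- Positivity of (x⋆ - y)⋆ a (x⋆ - y) bounds x a y + y⋆ a x⋆ by x a x⋆ + y⋆ a y; the sum of the
left sides is b + b⋆ = 2b. -/
lemma le_sum_conj_of_eq_sum {ι : Type*} {s : Finset ι} {a b : A} (ha : 0 ≤ a) (hb : IsSelfAdjoint b)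
    {x y : ι → A} (h : b = ∑ i ∈ s, x i * a * y i) :
    b + b ≤ ∑ i ∈ s, (x i * a * star (x i) + star (y i) * a * y i) := by
  have hsa : star a = a := (IsSelfAdjoint.of_nonneg ha).star_eq
  have h2 : b + b = ∑ i ∈ s, (x i * a * y i + star (y i) * a * star (x i)) := by
    rw [Finset.sum_add_distrib, ← h]
    nth_rw 2 [← hb.star_eq]
    rw [h, star_sum]
    simp only [star_mul, hsa, mul_assoc]
  rw [h2]
  refine Finset.sum_le_sum fun i _ => ?_
  rw [← sub_nonneg]
  have := star_left_conjugate_nonneg ha (star (x i) - y i)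
  convert this using 1
  simp only [star_sub, star_star]
  noncomm_ring

/-- By simplicity the span of A a A is a dense ideal, so it contains the Pedersen ideal without
taking a closure. This is the only place where membership of `b` in that ideal is used. -/
lemma exists_le_sum_of_mem_pedersenPos (h : IsSimpleCStar A) {a b : A} (ha : 0 ≤ a) (ha0 : a ≠ 0)
    (hb : b ∈ pedersenPos A) :
    ∃ (n : ℕ) (w : Fin n → A), b ≤ ∑ i, star (w i) * a * w i := by
  have hmem : b ∈ Submodule.span ℂ {w | ∃ s ∈ ({a} : Set A), ∃ x y : A, w = x * s * y} :=
    (Submodule.mem_sInf.1 hb.1) _ ⟨isIdeal_span _, h.dense_span ha0⟩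
  obtain ⟨n, x, y, s, hs, hsum⟩ := exists_sum_of_mem_span hmem
  simp only [Set.mem_singleton_iff] at hs
  simp only [hs] at hsum
  have h1 := le_sum_conj_of_eq_sum ha (.of_nonneg hb.2) hsum
  refine ⟨n + n, Fin.append (fun i => star (x i)) y, ?_⟩
  rw [Fin.sum_univ_add]
  simp only [Fin.append_left, Fin.append_right, star_star, ← Finset.sum_add_distrib]
  exact (le_add_of_nonneg_left hb.2).trans h1

end Pedersen

/-! ### Extending traces from full hereditary subalgebras. -/

section TraceExtension

attribute [local instance] CStarAlgebra.spectralOrder CStarAlgebra.spectralOrderedRing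

variable {A D G : Type*} [NonUnitalCStarAlgebra A] [NonUnitalCStarAlgebra D]
  [NonUnitalCStarAlgebra G]

/-- The norms of `∑ xᵢ xᵢ⋆` are controlled by those of `∑ xᵢ⋆ xᵢ`. This is a quantitative form of
the boundedness of the dimensions of the irreducible representations. -/
def TransposeBounded (D : Type*) [NonUnitalCStarAlgebra D] (N : ℝ) : Prop :=
  ∀ (n : ℕ) (x : Fin n → D), ‖∑ i, x i * star (x i)‖ ≤ N * ‖∑ i, star (x i) * x i‖

lemma TransposeBounded.of_injective {N : ℝ} (h : TransposeBounded A N) (φ : D →⋆ₙₐ[ℂ] A)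
    (hφ : Function.Injective φ) : TransposeBounded D N := fun n x => by
  rw [← NonUnitalStarAlgHom.norm_map φ hφ, ← NonUnitalStarAlgHom.norm_map φ hφ (∑ i, star (x i) * x i)]
  simpa only [map_sum, map_mul, map_star] using h n fun i => φ (x i)

/-- Elements of the right ideal generated by the image of `ι`. -/
def RightIdeal (ι : G →⋆ₙₐ[ℂ] D) (x : D) : Prop := ∃ g d, x = ι g * d

lemma RightIdeal.mul {ι : G →⋆ₙₐ[ℂ] D} {x : D} (h : RightIdeal ι x) (d : D) :
    RightIdeal ι (x * d) := by
  obtain ⟨g, d', rfl⟩ := h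
  exact ⟨g, d' * d, mul_assoc _ _ _⟩

lemma RightIdeal.sandwich {ι : G →⋆ₙₐ[ℂ] D} (hι : HerEmb ι) {x y : D} (hx : RightIdeal ι x)
    (hy : RightIdeal ι y) (d : D) : ∃ g, ι g = x * d * star y := by
  obtain ⟨g, d1, rfl⟩ := hx
  obtain ⟨g', d2, rfl⟩ := hy
  obtain ⟨c, hc⟩ := hι.sandwich g (star g') (d1 * d * star d2)
  exact ⟨c, by rw [hc]; simp only [star_mul, map_star, mul_assoc]⟩

lemma RightIdeal.mul_star {ι : G →⋆ₙₐ[ℂ] D} (hι : HerEmb ι) {x y : D} (hx : RightIdeal ι x)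
    (hy : RightIdeal ι y) : ∃ g, ι g = x * star y := by
  obtain ⟨g, d1, rfl⟩ := hx
  obtain ⟨g', d2, rfl⟩ := hy
  obtain ⟨c, hc⟩ := hι.sandwich g (star g') (d1 * star d2)
  exact ⟨c, by rw [hc]; simp only [star_mul, map_star, mul_assoc]⟩

/-- For zₖ in the right ideal generated by G, normalize xₖ = zₖ gₙ so that v = ∑ xₖ⋆ xₖ is a
contraction and nearly a unit for the zₖ⋆, and put σ(d) = ∑ T(xₖ d xₖ⋆). The arguments of T lie in
G, so σ is positive; `TransposeBounded` bounds ∑ xₖ xₖ⋆, hence σ, independently of the finite set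
and of n. -/
lemma exists_approx_trace {N : ℝ} (hN0 : 0 ≤ N) (hN : TransposeBounded D N) {ι : G →⋆ₙₐ[ℂ] D} (hι : HerEmb ι)
    (T : D →L[ℂ] ℂ) (hpos : ∀ g : G, 0 ≤ g → 0 ≤ (T (ι g)).re ∧ (T (ι g)).im = 0)
    (htr : ∀ g g' : G, T (ι (g * g')) = T (ι (g' * g))) (Z : Finset {x : D // RightIdeal ι x}) (n : ℕ) :
    ∃ σ : D →ₗ[ℂ] ℂ, (∀ d, ‖σ d‖ ≤ 4 * (‖T‖ * N) * ‖d‖) ∧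
      (∀ d, 0 ≤ d → 0 ≤ (σ d).re ∧ (σ d).im = 0) ∧
      ∀ z ∈ Z, ∀ w, RightIdeal ι w →
        ‖σ (star (z : D) * w) - T (w * star (z : D))‖ ≤ ‖T‖ * ‖w‖ * √(4 / (n + 1)) := by
  obtain ⟨m, ⟨e⟩⟩ : ∃ m, Nonempty (Fin m ≃ Z) := ⟨Z.card, ⟨Z.equivFin.symm⟩⟩
  let z : Fin m → D := fun k => (e k : {x : D // RightIdeal ι x})
  have hz : ∀ k, RightIdeal ι (z k) := fun k => (e k : {x : D // RightIdeal ι x}).2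
  set w0 := ∑ k, star (z k) * z k with hw0
  have hw0n : 0 ≤ w0 := Finset.sum_nonneg fun k _ => star_mul_self_nonneg _
  obtain ⟨g, hg0, hgc, hg1, -, -, -, hlim⟩ := exists_approx_inv_sqrt hw0n
  have hgsa : star (g n) = g n := (IsSelfAdjoint.of_nonneg (hg0 n)).star_eq
  set v := g n * w0 * g n with hv
  have hvsa : IsSelfAdjoint v := by
    rw [IsSelfAdjoint, hv]
    simp only [star_mul, hgsa, (IsSelfAdjoint.of_nonneg hw0n).star_eq, mul_assoc]
  let x : Fin m → D := fun k => z k * g n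
  have hx : ∀ k, RightIdeal ι (x k) := fun k => (hz k).mul _
  have hxv : ∑ k, star (x k) * x k = v := by
    rw [hv, hw0, Finset.mul_sum, Finset.sum_mul]
    refine Finset.sum_congr rfl fun k _ => ?_
    simp only [x, star_mul, hgsa, mul_assoc]
  have hNx : ‖∑ k, x k * star (x k)‖ ≤ N :=
    (hN m x).trans (by rw [hxv]; exact mul_le_of_le_one_right hN0 (hg1 n))
  let σ : D →ₗ[ℂ] ℂ := ∑ k, T.toLinearMap ∘ₗ
    (LinearMap.mulLeft ℂ (x k) ∘ₗ LinearMap.mulRight ℂ (star (x k)))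
  have hσ : ∀ d, σ d = ∑ k, T (x k * d * star (x k)) := fun d => by
    simp [σ, mul_assoc]
  refine ⟨σ, fun d => ?_, fun d hd => ?_, fun y hy w hw => ?_⟩
  -- The bound is proved on positive elements; the factor 4 comes from writing d as a combination of
  -- four of them.
  · have hp : ∀ p : D, 0 ≤ p → ‖σ p‖ ≤ ‖T‖ * N * ‖p‖ := fun p hp => by
      rw [hσ, ← map_sum]
      refine (T.le_opNorm _).trans ?_
      rw [mul_assoc]
      gcongr
      have h1 : ∑ k, x k * p * star (x k) ≤ ‖p‖ • ∑ k, x k * star (x k) := by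
        rw [Finset.smul_sum]
        exact Finset.sum_le_sum fun k _ =>
          CStarAlgebra.star_right_conjugate_le_norm_smul (.of_nonneg hp)
      have h0 : 0 ≤ ∑ k, x k * p * star (x k) :=
        Finset.sum_nonneg fun k _ => star_right_conjugate_nonneg hp _
      refine (CStarAlgebra.norm_le_norm_of_nonneg_of_le h0 h1).trans ?_
      rw [norm_smul, norm_norm, mul_comm]
      gcongr
    obtain ⟨p, hp0, hpn, hsum⟩ := CStarAlgebra.exists_sum_four_nonneg d
    rw [hsum, map_sum]
    refine (norm_sum_le _ _).trans ?_
    calc _ ≤ ∑ i : Fin 4, ‖T‖ * N * ‖d‖ := Finset.sum_le_sum fun i _ => by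
          rw [map_smul, norm_smul, norm_pow, Complex.norm_I, one_pow, one_mul]
          exact (hp _ (hp0 i)).trans (by gcongr; exact hpn i)
      _ = 4 * (‖T‖ * N) * ‖∑ i : Fin 4, Complex.I ^ (i : ℕ) • p i‖ := by
          rw [← hsum]; simp; ring
  · have : ∀ k, 0 ≤ (T (x k * d * star (x k))).re ∧ (T (x k * d * star (x k))).im = 0 := fun k => by
      obtain ⟨c, hc⟩ := (hx k).sandwich hι (hx k) d
      rw [← hc]
      refine hpos c (nonneg_of_map_nonneg ι hι.inj ?_)
      rw [hc]
      exact star_right_conjugate_nonneg hd _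
    rw [hσ, Complex.re_sum, Complex.im_sum]
    exact ⟨Finset.sum_nonneg fun k _ => (this k).1, Finset.sum_eq_zero fun k _ => (this k).2⟩
  -- Traciality on G moves y⋆ past each xₖ; afterwards v is replaced by a unit at the cost of ‖y⋆ -
  -- v y⋆‖.
  · have h1 : σ (star (y : D) * w) = T (w * v * star (y : D)) := by
      rw [hσ, ← hxv, Finset.mul_sum, Finset.sum_mul, map_sum]
      refine Finset.sum_congr rfl fun k _ => ?_
      obtain ⟨a, ha⟩ := (hx k).mul_star hι y.2
      obtain ⟨b, hb⟩ := hw.mul_star hι (hx k)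
      have := htr a b
      rw [map_mul ι, map_mul ι, ha, hb] at this
      simp only [mul_assoc] at this ⊢
      exact this
    obtain ⟨k, hk⟩ : ∃ k, z k = y := ⟨e.symm ⟨y, hy⟩, by simp [z]⟩
    have h2 : star (y : D) * star (star (y : D)) ≤ w0 := by
      rw [star_star, ← hk, hw0]
      exact Finset.single_le_sum (f := fun k => star (z k) * z k)
        (fun k _ => star_mul_self_nonneg _) (Finset.mem_univ k)
    have h3 : ‖star (y : D) - v * star (y : D)‖ ≤ √(4 / (n + 1)) := by
      refine Real.le_sqrt_of_sq_le ((norm_sub_mul_sq_le h2 hvsa).trans ?_)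
      convert hlim n using 2
    rw [h1, ← map_sub, mul_assoc, ← mul_sub]
    calc _ ≤ ‖T‖ * (‖w‖ * ‖v * star (y : D) - star (y : D)‖) :=
          (T.le_opNorm _).trans (by gcongr; exact norm_mul_le _ _)
      _ ≤ ‖T‖ * (‖w‖ * √(4 / (n + 1))) := by rw [norm_sub_rev]; gcongr
      _ = _ := by ring

/-- A limit of the approximate traces satisfies σ(z⋆ w) = T(w z⋆) exactly, for z and w in the right
ideal generated by G. This forces traciality on the ideal generated by G, which is dense by
fullness. -/
lemma exists_trace_extension {N : ℝ} (hN0 : 0 ≤ N) (hN : TransposeBounded D N) {ι : G →⋆ₙₐ[ℂ] D}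
    (hι : HerEmb ι) (hfull : closedIdeal (Set.range ι) = ⊤) (t : G →L[ℂ] ℂ)
    (hpos : ∀ g : G, 0 ≤ g → 0 ≤ (t g).re ∧ (t g).im = 0)
    (htr : ∀ g g' : G, t (g * g') = t (g' * g)) :
    ∃ σ : D →L[ℂ] ℂ, (∀ d, 0 ≤ d → 0 ≤ (σ d).re ∧ (σ d).im = 0) ∧
      (∀ a b, σ (a * b) = σ (b * a)) ∧ ∀ g, σ (ι g) = t g := by
  classical
  -- A Hahn–Banach extension, which need be neither positive nor tracial on D: it is only evaluated
  -- on the range of ι.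
  obtain ⟨T, hT⟩ : ∃ T : D →L[ℂ] ℂ, ∀ g, T (ι g) = t g := by
    let ιl : G →ₗ[ℂ] D := { toFun := ι, map_add' := map_add ι, map_smul' := map_smul ι }
    let e : G ≃ₗ[ℂ] LinearMap.range ιl := LinearEquiv.ofInjective ιl hι.inj
    have he : ∀ g, (e g : D) = ι g := fun g => rfl
    let f : LinearMap.range ιl →L[ℂ] ℂ :=
      LinearMap.mkContinuous (t.toLinearMap ∘ₗ e.symm.toLinearMap) ‖t‖ fun x => by
        refine (t.le_opNorm _).trans_eq ?_
        have : ‖(e (e.symm x) : D)‖ = ‖e.symm x‖ := by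
          rw [he, NonUnitalStarAlgHom.norm_map ι hι.inj]
        change ‖t‖ * ‖e.symm x‖ = _
        rw [← this, e.apply_symm_apply]
        rfl
    obtain ⟨T, hT, -⟩ := exists_extension_norm_eq _ f
    refine ⟨T, fun g => ?_⟩
    have := hT (e g)
    rw [he] at this
    rw [this]
    change t (e.symm (e g)) = _
    rw [e.symm_apply_apply]
  have happ := exists_approx_trace hN0 hN hι T (by simpa only [hT] using hpos)
    (by simpa only [hT] using htr)
  choose s hsb hsp hst using fun i : Finset {x : D // RightIdeal ι x} × ℕ => happ i.1 i.2
  set K := 4 * (‖T‖ * N)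
  -- An ultrafilter finer than `atTop` makes all the bounded nets σᵢ(d) converge at once, so that
  -- linearity passes to the limit.
  let 𝓤 := Ultrafilter.of (atTop : Filter (Finset {x : D // RightIdeal ι x} × ℕ))
  have h𝓤 : (𝓤 : Filter (Finset {x : D // RightIdeal ι x} × ℕ)) ≤ atTop := Ultrafilter.of_le _
  have hlim : ∀ d, ∃ c : ℂ, Tendsto (fun i => s i d) 𝓤 (𝓝 c) := fun d => by
    obtain ⟨c, -, hc⟩ := (isCompact_closedBall (0 : ℂ) (K * ‖d‖)).ultrafilter_le_nhds
      (𝓤.map fun i => s i d) (by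
        rw [Filter.le_principal_iff]
        refine Filter.mem_map.2 (Filter.univ_mem' fun i => ?_)
        simpa using hsb i d)
    exact ⟨c, hc⟩
  choose σ hσ using hlim
  let σl : D →ₗ[ℂ] ℂ :=
    { toFun := σ
      map_add' := fun a b => tendsto_nhds_unique (hσ _) (by
        simpa only [map_add] using (hσ a).add (hσ b))
      map_smul' := fun c a => tendsto_nhds_unique (hσ _) (by
        simpa only [map_smul, RingHom.id_apply] using (hσ a).const_smul c) }
  let σc : D →L[ℂ] ℂ := σl.mkContinuous K fun d =>
    le_of_tendsto (hσ d).norm (Eventually.of_forall fun i => hsb i d)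
  have hσc : ∀ d, Tendsto (fun i => s i d) 𝓤 (𝓝 (σc d)) := hσ
  have hswap : ∀ z w, RightIdeal ι z → RightIdeal ι w → σc (star z * w) = T (w * star z) := by
    intro z w hz hw
    refine tendsto_nhds_unique (hσc _) ?_
    rw [tendsto_iff_norm_sub_tendsto_zero]
    have h1 : Tendsto (fun i : Finset {x : D // RightIdeal ι x} × ℕ =>
        ‖T‖ * ‖w‖ * √(4 / ((i.2 : ℝ) + 1))) 𝓤 (𝓝 0) := by
      have h2 : Tendsto (fun n : ℕ => ‖T‖ * ‖w‖ * √(4 * (1 / ((n : ℝ) + 1)))) atTop (𝓝 0) := by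
        simpa using! ((tendsto_one_div_add_atTop_nhds_zero_nat.const_mul 4).sqrt).const_mul (‖T‖ * ‖w‖)
      refine ((h2.comp (tendsto_snd (f := (atTop : Filter (Finset {x : D // RightIdeal ι x}))))).mono_left
        ?_).congr fun i => by simp [div_eq_mul_inv]
      rw [prod_atTop_atTop_eq]
      exact h𝓤
    refine squeeze_zero' (Eventually.of_forall fun _ => norm_nonneg _) ?_ h1
    have h3 : ∀ᶠ i : Finset {x : D // RightIdeal ι x} × ℕ in atTop, ⟨z, hz⟩ ∈ i.1 := by
      filter_upwards [eventually_ge_atTop ({⟨z, hz⟩}, 0)] with i hi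
      exact hi.1 (Finset.mem_singleton_self _)
    filter_upwards [h𝓤 h3] with i hi
    exact hst i _ hi w hw
  refine ⟨σc, fun d hd => ⟨?_, ?_⟩, fun a b => ?_, fun g => ?_⟩
  · exact ge_of_tendsto ((Complex.continuous_re.tendsto _).comp (hσc d))
      (Eventually.of_forall fun i => (hsp i d hd).1)
  · exact tendsto_nhds_unique ((Complex.continuous_im.tendsto _).comp (hσc d))
      (tendsto_const_nhds.congr fun i => (hsp i d hd).2.symm)
  -- Both sides equal T(w b z⋆): on the left b is absorbed into w, on the right into z.
  · have hbase : ∀ z w, RightIdeal ι z → RightIdeal ι w → σc (star z * w * b) = σc (b * (star z * w)) := by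
      intro z w hz hw
      have h1 := hswap z (w * b) hz (hw.mul b)
      have h2 := hswap (z * star b) w (hz.mul _) hw
      simp only [star_mul, star_star, mul_assoc] at h1 h2 ⊢
      rw [h1, h2]
    have hcl : IsClosed {a : D | σc (a * b) = σc (b * a)} :=
      isClosed_eq (by fun_prop) (by fun_prop)
    let V : Submodule ℂ D := LinearMap.eqLocus (σc.toLinearMap ∘ₗ LinearMap.mulRight ℂ b)
      (σc.toLinearMap ∘ₗ LinearMap.mulLeft ℂ b)
    have hV : closedIdeal (Set.range ι) ≤ V := by
      refine Submodule.topologicalClosure_minimal _ (Submodule.span_le.2 ?_) hcl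
      rintro _ ⟨_, ⟨g, rfl⟩, x, y, rfl⟩
      change x * ι g * y ∈ {a : D | σc (a * b) = σc (b * a)}
      refine hcl.closure_subset (Metric.mem_closure_iff.2 fun ε hε => ?_)
      obtain ⟨e, he0, he1, he⟩ := exists_approx_unit {g} (ε := ε / ((1 + ‖x‖) * (1 + ‖y‖)))
        (by positivity)
      have hesa : star e = e := (IsSelfAdjoint.of_nonneg he0).star_eq
      refine ⟨x * ι (e * g) * y, ?_, ?_⟩
      · have := hbase (ι e * star x) (ι g * y) ⟨e, _, rfl⟩ ⟨g, _, rfl⟩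
        rw [Set.mem_ofPred_eq]
        simpa only [star_mul, star_star, ← map_star, hesa, map_mul, mul_assoc] using this
      · have h1 := (he g (by simp)).1
        rw [lt_div_iff₀ (by positivity)] at h1
        calc dist (x * ι g * y) (x * ι (e * g) * y) = ‖x * ι (g - e * g) * y‖ := by
              rw [dist_eq_norm, map_sub]; congr 1; noncomm_ring
          _ ≤ ‖x‖ * ‖ι (g - e * g)‖ * ‖y‖ := norm_mul₃_le
          _ ≤ (1 + ‖x‖) * ‖g - e * g‖ * (1 + ‖y‖) := by
            gcongr
            · linarith
            · exact norm_hom_le _ _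
            · linarith
          _ < ε := by linarith
    have : a ∈ V := hV (by rw [hfull]; trivial)
    exact this
  -- The swapping identity with z = e² and w = e g gives σ(e³ g) = t(e g e²), and both arguments are
  -- within 3ε of g.
  · have key : ∀ ε > 0, ‖σc (ι g) - t g‖ ≤ (‖σc‖ * 3 + ‖t‖ * 3) * ε := by
      intro ε hε
      obtain ⟨e, he0, he1, he⟩ := exists_approx_unit {g} hε
      obtain ⟨h1, h2⟩ := he g (by simp)
      have hesa : star e = e := (IsSelfAdjoint.of_nonneg he0).star_eq
      have h3 := hswap (ι e * ι e) (ι e * ι g) ⟨e, _, rfl⟩ ⟨e, _, rfl⟩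
      simp only [star_mul, ← map_star, hesa, ← map_mul, hT] at h3
      have b1 : ‖g - e * e * (e * g)‖ ≤ 3 * ε := by
        calc _ = ‖(g - e * g) + e * (g - e * g) + e * e * (g - e * g)‖ := by congr 1; noncomm_ring
          _ ≤ ‖g - e * g‖ + ‖e‖ * ‖g - e * g‖ + ‖e‖ * ‖e‖ * ‖g - e * g‖ := by
            refine norm_add₃_le.trans ?_
            gcongr
            · exact norm_mul_le _ _
            · exact norm_mul₃_le
          _ ≤ ε + 1 * ε + 1 * 1 * ε := by gcongr
          _ = 3 * ε := by ring
      have b2 : ‖e * g * (e * e) - g‖ ≤ 3 * ε := by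
        rw [norm_sub_rev]
        calc _ = ‖(g - e * g) + e * (g - g * e) + e * (g - g * e) * e‖ := by congr 1; noncomm_ring
          _ ≤ ‖g - e * g‖ + ‖e‖ * ‖g - g * e‖ + ‖e‖ * ‖g - g * e‖ * ‖e‖ := by
            refine norm_add₃_le.trans ?_
            gcongr
            · exact norm_mul_le _ _
            · exact norm_mul₃_le
          _ ≤ ε + 1 * ε + 1 * ε * 1 := by gcongr
          _ = 3 * ε := by ring
      have h4 : σc (ι g) - t g = σc (ι (g - e * e * (e * g))) + t (e * g * (e * e) - g) := by
        rw [map_sub ι, map_sub, map_sub, h3]; ring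
      rw [h4]
      calc _ ≤ ‖σc‖ * ‖ι (g - e * e * (e * g))‖ + ‖t‖ * ‖e * g * (e * e) - g‖ :=
            (norm_add_le _ _).trans (add_le_add (σc.le_opNorm _) (t.le_opNorm _))
        _ ≤ ‖σc‖ * (3 * ε) + ‖t‖ * (3 * ε) := by
            gcongr
            exact (norm_hom_le _ _).trans b1
        _ = _ := by ring
    have : ‖σc (ι g) - t g‖ ≤ 0 := by
      refine le_of_forall_pos_le_add fun ε hε => ?_
      have hp : 0 < ‖σc‖ * 3 + ‖t‖ * 3 + 1 := by positivity
      refine (key (ε / (‖σc‖ * 3 + ‖t‖ * 3 + 1)) (by positivity)).trans ?_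
      rw [zero_add, ← mul_div_assoc, div_le_iff₀ hp]
      nlinarith
    exact sub_eq_zero.1 (norm_le_zero_iff.1 this)

lemma mem_tracialStates_of {τ : D →L[ℂ] ℂ} (hpos : ∀ d, 0 ≤ d → 0 ≤ (τ d).re ∧ (τ d).im = 0)
    (htr : ∀ a b, τ (a * b) = τ (b * a)) (h0 : τ ≠ 0) :
    StrongDual.toWeakDual ((‖τ‖⁻¹ : ℝ) • τ) ∈ tracialStates D := by
  have hn : ‖τ‖ ≠ 0 := norm_ne_zero_iff.2 h0
  refine ⟨fun a ha => ?_, ?_, fun a b => ?_⟩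
  · change 0 ≤ ((‖τ‖⁻¹ : ℝ) • τ a).re ∧ ((‖τ‖⁻¹ : ℝ) • τ a).im = 0
    rw [Complex.smul_re, Complex.smul_im, (hpos a ha).2]
    exact ⟨smul_nonneg (by positivity) (hpos a ha).1, smul_zero _⟩
  · change ‖(‖τ‖⁻¹ : ℝ) • τ‖ = 1
    rw [norm_smul, norm_inv, norm_norm, inv_mul_cancel₀ hn]
  · change (‖τ‖⁻¹ : ℝ) • τ (a * b) = (‖τ‖⁻¹ : ℝ) • τ (b * a)
    rw [htr]

/-- The factor r is the norm of the extension, at least 1 because it extends a functional of norm 1.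
With r ≥ 1, lower bounds for the tracial states of D on positive elements of G become lower bounds
for those of G. -/
lemma exists_tracialState_extension {N : ℝ} (hN0 : 0 ≤ N) (hN : TransposeBounded D N)
    {ι : G →⋆ₙₐ[ℂ] D} (hι : HerEmb ι) (hfull : closedIdeal (Set.range ι) = ⊤) {t : WeakDual ℂ G}
    (ht : t ∈ tracialStates G) :
    ∃ s ∈ tracialStates D, ∃ r : ℝ, 1 ≤ r ∧ ∀ g, t g = r • s (ι g) := by
  obtain ⟨σ, h1, h2, h3⟩ := exists_trace_extension hN0 hN hι hfull (WeakDual.toStrongDual t) ht.1 ht.2.2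
  have hn : 1 ≤ ‖σ‖ := by
    rw [← ht.2.1]
    refine ContinuousLinearMap.opNorm_le_bound _ (norm_nonneg _) fun g => ?_
    rw [← h3]
    exact (σ.le_opNorm _).trans (by gcongr; exact norm_hom_le _ _)
  have h0 : σ ≠ 0 := fun h => by rw [h, norm_zero] at hn; linarith
  refine ⟨_, mem_tracialStates_of h1 h2 h0, ‖σ‖, hn, fun g => ?_⟩
  change t g = ‖σ‖ • (‖σ‖⁻¹ : ℝ) • σ (ι g)
  rw [h3, smul_smul, mul_inv_cancel₀ (norm_ne_zero_iff.2 h0), one_smul]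
  rfl

end TraceExtension

/-! ### Traces on finite-dimensional quotients via left multiplication. -/

section LeftTrace

attribute [local instance] CStarAlgebra.spectralOrder CStarAlgebra.spectralOrderedRing

variable {D F : Type*} [NonUnitalCStarAlgebra D] [NonUnitalCStarAlgebra F]

/-- Left multiplication by `d` on the quotient of `D` by a two-sided ideal. -/
def leftQuot {K : Submodule ℂ D} (hK : IsIdeal K) (d : D) : Module.End ℂ (D ⧸ K) :=
  K.mapQ K (LinearMap.mulLeft ℂ d) fun x hx => (hK x hx d).1

lemma leftQuot_mk {K : Submodule ℂ D} (hK : IsIdeal K) (d x : D) :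
    leftQuot hK d (K.mkQ x) = K.mkQ (d * x) := rfl

lemma leftQuot_mul {K : Submodule ℂ D} (hK : IsIdeal K) (d e : D) :
    leftQuot hK (d * e) = leftQuot hK d * leftQuot hK e := by
  refine Submodule.linearMap_qext _ (LinearMap.ext fun x => ?_)
  change K.mkQ (d * e * x) = K.mkQ (d * (e * x))
  rw [mul_assoc]

lemma leftQuot_pow_mk {K : Submodule ℂ D} (hK : IsIdeal K) (d x : D) (n : ℕ) :
    (leftQuot hK d ^ n) (K.mkQ x) = K.mkQ ((fun y => d * y)^[n] x) := by
  induction n with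
  | zero => rfl
  | succ n ih =>
    rw [pow_succ', Module.End.mul_apply, ih, Function.iterate_succ_apply', leftQuot_mk]

/-- The trace of left multiplication on a quotient. -/
def leftTrace {K : Submodule ℂ D} (hK : IsIdeal K) : D →ₗ[ℂ] ℂ where
  toFun d := LinearMap.trace ℂ _ (leftQuot hK d)
  map_add' d e := by
    rw [← map_add]
    congr 1
    refine Submodule.linearMap_qext _ (LinearMap.ext fun x => ?_)
    change K.mkQ ((d + e) * x) = K.mkQ (d * x) + K.mkQ (e * x)
    rw [add_mul, map_add]
  map_smul' c d := by
    rw [RingHom.id_apply, ← map_smul]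
    congr 1
    refine Submodule.linearMap_qext _ (LinearMap.ext fun x => ?_)
    change K.mkQ ((c • d) * x) = c • K.mkQ (d * x)
    rw [smul_mul_assoc, map_smul]

lemma leftTrace_mul_comm {K : Submodule ℂ D} (hK : IsIdeal K) (d e : D) :
    leftTrace hK (d * e) = leftTrace hK (e * d) := by
  change LinearMap.trace ℂ _ (leftQuot hK _) = LinearMap.trace ℂ _ (leftQuot hK _)
  rw [leftQuot_mul, leftQuot_mul, LinearMap.trace_mul_comm]

lemma leftTrace_eq_zero {K : Submodule ℂ D} (hK : IsIdeal K) {d : D} (hd : d ∈ K) :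
    leftTrace hK d = 0 := by
  have : leftQuot hK d = 0 := by
    refine Submodule.linearMap_qext _ (LinearMap.ext fun x => ?_)
    change K.mkQ (d * x) = 0
    simpa using (hK d hd x).2
  change LinearMap.trace ℂ _ (leftQuot hK _) = 0
  rw [this, map_zero]

/-- If v represents an eigenvector for c ≠ 0, then d v - c v is in K. A quasi-inverse of -c⁻¹ d
would express v through this element and put v into K. -/
lemma mem_quasispectrum_of_isRoot {K : Submodule ℂ D} (hK : IsIdeal K) [FiniteDimensional ℂ (D ⧸ K)]
    {d : D} {c : ℂ} (hc : (leftQuot hK d).charpoly.IsRoot c) : c ∈ quasispectrum ℂ d := by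
  rcases eq_or_ne c 0 with rfl | h0
  · exact quasispectrum.zero_mem ℂ d
  obtain ⟨v, hv⟩ := ((Module.End.hasEigenvalue_iff_isRoot_charpoly _ _).2 hc).exists_hasEigenvector
  obtain ⟨v, rfl⟩ := K.mkQ_surjective v
  have hk : d * v - c • v ∈ K := by
    have := hv.apply_eq_smul
    rw [leftQuot_mk, ← map_smul, ← sub_eq_zero] at this
    rwa [← map_sub, Submodule.mkQ_apply, Submodule.Quotient.mk_eq_zero] at this
  have hvK : v ∉ K := fun h => hv.2 (by simpa using h)
  have h1 : ¬ IsQuasiregular (-((Units.mk0 c h0)⁻¹ • d)) := fun h => by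
    obtain ⟨y, -, hy⟩ := isQuasiregular_iff.1 h
    refine hvK ?_
    have e : (Units.mk0 c h0)⁻¹ • d = c⁻¹ • d := rfl
    rw [e] at hy
    have hk' := K.smul_mem c⁻¹ hk
    rw [smul_sub, smul_smul, inv_mul_cancel₀ h0, one_smul] at hk'
    have h2 : (-(c⁻¹ • d) + y + y * -(c⁻¹ • d)) * v = 0 := by rw [hy, zero_mul]
    have h3 : v = -(c⁻¹ • (d * v) - v) - y * (c⁻¹ • (d * v) - v) := by
      have : v = v + (-(c⁻¹ • d) + y + y * -(c⁻¹ • d)) * v := by rw [h2, add_zero]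
      conv_lhs => rw [this]
      rw [← smul_mul_assoc]
      noncomm_ring
    rw [h3]
    exact K.sub_mem (K.neg_mem hk') (hK _ hk' y).1
  exact quasispectrum.mem_of_not_quasiregular d h1

lemma leftTrace_eq_sum {K : Submodule ℂ D} (hK : IsIdeal K) [FiniteDimensional ℂ (D ⧸ K)] (d : D) :
    leftTrace hK d = (leftQuot hK d).charpoly.roots.sum :=
  Module.End.trace_eq_sum_roots_charpoly_of_splits (IsAlgClosed.splits _)

lemma nonneg_of_mem_quasispectrum_complex {d : D} (hd : 0 ≤ d) {c : ℂ}
    (hc : c ∈ quasispectrum ℂ d) : ∃ t : ℝ, 0 ≤ t ∧ t ∈ quasispectrum ℝ d ∧ c = t := by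
  have h := (IsSelfAdjoint.of_nonneg hd).quasispectrumRestricts
  rw [← QuasispectrumRestricts.algebraMap_image h] at hc
  obtain ⟨t, ht, rfl⟩ := hc
  exact ⟨t, quasispectrum_nonneg_of_nonneg d hd t ht, ht, rfl⟩

lemma norm_le_of_mem_quasispectrum {d : D} {c : ℂ} (hc : c ∈ quasispectrum ℂ d) : ‖c‖ ≤ ‖d‖ := by
  rw [Unitization.quasispectrum_eq_spectrum_inr] at hc
  rw [← Unitization.norm_inr (𝕜 := ℂ) d]
  exact spectrum.norm_le_norm_of_mem hc

lemma Multiset.norm_sum_le_card_nsmul (s : Multiset ℂ) {r : ℝ} (h : ∀ c ∈ s, ‖c‖ ≤ r) :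
    ‖s.sum‖ ≤ s.card • r := by
  induction s using Multiset.induction_on with
  | empty => simp
  | cons a s ih =>
    rw [Multiset.sum_cons, Multiset.card_cons, succ_nsmul, add_comm]
    exact (norm_add_le _ _).trans (add_le_add (ih fun c hc => h c (Multiset.mem_cons_of_mem hc))
      (h a (Multiset.mem_cons_self a s))) |>.trans_eq' (by rw [add_comm])

lemma norm_leftTrace_le {K : Submodule ℂ D} (hK : IsIdeal K) [FiniteDimensional ℂ (D ⧸ K)] (d : D) :
    ‖leftTrace hK d‖ ≤ Module.finrank ℂ (D ⧸ K) * ‖d‖ := by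
  rw [leftTrace_eq_sum]
  refine (Multiset.norm_sum_le_card_nsmul _ (r := ‖d‖) fun c hc => ?_).trans ?_
  · exact norm_le_of_mem_quasispectrum (mem_quasispectrum_of_isRoot hK (Polynomial.isRoot_of_mem_roots hc))
  · rw [nsmul_eq_mul]
    gcongr
    rw [← LinearMap.charpoly_natDegree (leftQuot hK d)]
    exact Polynomial.card_roots' _

lemma Multiset.le_sum_of_nonneg (s : Multiset ℂ) (h : ∀ c ∈ s, 0 ≤ c.re ∧ c.im = 0) :
    (0 ≤ s.sum.re ∧ s.sum.im = 0) ∧ ∀ c ∈ s, c.re ≤ s.sum.re := by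
  induction s using Multiset.induction_on with
  | empty => simp
  | cons a s ih =>
    obtain ⟨⟨h1, h2⟩, h3⟩ := ih fun c hc => h c (Multiset.mem_cons_of_mem hc)
    obtain ⟨h4, h5⟩ := h a (Multiset.mem_cons_self a s)
    rw [Multiset.sum_cons, Complex.add_re, Complex.add_im]
    refine ⟨⟨by linarith, by linarith⟩, fun c hc => ?_⟩
    rcases Multiset.mem_cons.1 hc with rfl | hc
    · linarith
    · linarith [h3 c hc]

lemma leftQuot_roots_nonneg {K : Submodule ℂ D} (hK : IsIdeal K) [FiniteDimensional ℂ (D ⧸ K)] {d : D}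
    (hd : 0 ≤ d) : ∀ c ∈ (leftQuot hK d).charpoly.roots, 0 ≤ c.re ∧ c.im = 0 := fun c hc => by
  obtain ⟨t, ht, -, rfl⟩ := nonneg_of_mem_quasispectrum_complex hd
    (mem_quasispectrum_of_isRoot hK (Polynomial.isRoot_of_mem_roots hc))
  exact ⟨ht, rfl⟩

lemma leftTrace_nonneg {K : Submodule ℂ D} (hK : IsIdeal K) [FiniteDimensional ℂ (D ⧸ K)] {d : D}
    (hd : 0 ≤ d) : 0 ≤ (leftTrace hK d).re ∧ (leftTrace hK d).im = 0 := by
  rw [leftTrace_eq_sum]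
  exact (Multiset.le_sum_of_nonneg _ (leftQuot_roots_nonneg hK hd)).1

/-- The eigenvalues are nonnegative with sum zero, so left multiplication is nilpotent by
Cayley–Hamilton. Iterating it n times on d itself gives the power n + 1 of d. -/
lemma pow_mem_of_leftTrace_eq_zero {K : Submodule ℂ D} (hK : IsIdeal K) [FiniteDimensional ℂ (D ⧸ K)]
    {d : D} (hd : 0 ≤ d) (h : leftTrace hK d = 0) :
    (fun y => d * y)^[Module.finrank ℂ (D ⧸ K)] d ∈ K := by
  have h1 : ∀ c ∈ (leftQuot hK d).charpoly.roots, c = 0 := fun c hc => by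
    have h2 := leftQuot_roots_nonneg hK hd
    have h3 := (Multiset.le_sum_of_nonneg _ h2).2 c hc
    rw [← leftTrace_eq_sum, h] at h3
    exact Complex.ext (le_antisymm h3 (h2 c hc).1) (h2 c hc).2
  have h2 : (leftQuot hK d).charpoly = Polynomial.X ^ Module.finrank ℂ (D ⧸ K) := by
    have h4 := (IsAlgClosed.splits (leftQuot hK d).charpoly).eq_prod_roots
    rw [(LinearMap.charpoly_monic _).leadingCoeff, map_one, one_mul,
      Multiset.eq_replicate_card.2 h1] at h4
    rw [Multiset.map_replicate, Multiset.prod_replicate, map_zero, sub_zero] at h4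
    have h5 := congrArg Polynomial.natDegree h4
    rw [LinearMap.charpoly_natDegree, Polynomial.natDegree_X_pow] at h5
    rw [h4, ← h5]
  have h3 : leftQuot hK d ^ Module.finrank ℂ (D ⧸ K) = 0 := by
    have := (leftQuot hK d).aeval_self_charpoly
    rwa [h2, map_pow, Polynomial.aeval_X] at this
  have h4 := leftQuot_pow_mk hK d d (Module.finrank ℂ (D ⧸ K))
  rw [h3, LinearMap.zero_apply] at h4
  simpa using h4.symm

lemma isIdeal_bot (F : Type*) [NonUnitalCStarAlgebra F] : IsIdeal (⊥ : Submodule ℂ F) :=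
  fun x hx a => by simp_all

/-- On a finite-dimensional algebra the norm of a positive element is at most the trace of left
multiplication. -/
lemma norm_le_leftTrace [FiniteDimensional ℂ F] {d : F} (hd : 0 ≤ d) :
    ‖d‖ ≤ (leftTrace (isIdeal_bot F) d).re := by
  have hK := isIdeal_bot F
  refine le_of_forall_lt fun r hr => ?_
  rcases lt_or_ge r 0 with hr0 | hr0
  · exact hr0.trans_le (leftTrace_nonneg hK hd).1
  obtain ⟨t, ht, hrt⟩ := exists_mem_quasispectrum_norm hd hr
  refine hrt.trans_le ?_
  have ht0 : t ≠ 0 := by linarith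
  have hroot : (leftQuot hK d).charpoly.IsRoot t := by
    rw [← Module.End.hasEigenvalue_iff_isRoot_charpoly]
    by_contra hne
    -- If t were no eigenvalue, left multiplication by d minus t would be injective, hence
    -- surjective. A solution x of d x - t x = d gives the one-sided quasi-inverse -x of -t⁻¹ d.
    have hinj : Function.Injective (LinearMap.mulLeft ℂ d - (t : ℂ) • LinearMap.id : F →ₗ[ℂ] F) := by
      rw [← LinearMap.ker_eq_bot, LinearMap.ker_eq_bot']
      intro v hv
      by_contra hv0
      refine hne (Module.End.hasEigenvalue_of_hasEigenvector (x := (⊥ : Submodule ℂ F).mkQ v)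
        ⟨Module.End.mem_eigenspace_iff.2 ?_, fun h => hv0 (by simpa using h)⟩)
      rw [leftQuot_mk, ← map_smul]
      exact congrArg _ (sub_eq_zero.1 hv)
    obtain ⟨x, hx⟩ := LinearMap.surjective_of_injective hinj d
    have hx : d * x - (t : ℂ) • x = d := hx
    refine (show (t : ℝ) ∈ quasispectrum ℝ d from ht) (IsUnit.mk0 t ht0) ?_
    have e : -((IsUnit.mk0 t ht0).unit⁻¹ • d) = -(t⁻¹ • d) := by
      congr 1
      simp [Units.smul_def]
    rw [e]
    set w := -(t⁻¹ • d) with hw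
    have hwsa : star w = w := by
      rw [hw, star_neg, star_smul, star_trivial, (IsSelfAdjoint.of_nonneg hd).star_eq]
    have h1 : -x + w + w * -x = 0 := by
      have hx' : d * x - t • x = d := hx
      have h3 : x = t⁻¹ • (d * x) - t⁻¹ • d := by
        conv_rhs => rw [← smul_sub]
        rw [show d * x - d = t • x from by
          rw [sub_eq_iff_eq_add] at hx' ⊢; rw [hx', add_comm], smul_smul, inv_mul_cancel₀ ht0, one_smul]
      rw [hw]
      simp only [neg_mul, mul_neg, neg_neg, smul_mul_assoc]
      nth_rw 1 [h3]
      abel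
    -- The adjoint identity is a quasi-inverse on the other side; a left and a right quasi-inverse
    -- coincide.
    have h2 : star (-x) + w + star (-x) * w = 0 := by
      have := congrArg star h1
      simpa only [star_add, star_mul, hwsa, star_zero] using this
    have h3 : star (-x) = -x := by
      have e1 : star (-x) + (-x + w + w * -x) + star (-x) * (-x + w + w * -x) =
          -x + (star (-x) + w + star (-x) * w) + (star (-x) + w + star (-x) * w) * -x := by
        noncomm_ring
      rw [h1, h2] at e1
      simpa using e1
    rw [h3] at h2
    exact isQuasiregular_iff.2 ⟨-x, h1, by rw [add_comm w]; exact h2⟩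
  rw [leftTrace_eq_sum]
  have := (Multiset.le_sum_of_nonneg _ (leftQuot_roots_nonneg hK hd)).2 t
    ((Polynomial.mem_roots (LinearMap.charpoly_monic _).ne_zero).2 hroot)
  simpa using this

/-- Compare with the trace: ‖∑ x x⋆‖ ≤ tr(∑ x x⋆) = tr(∑ x⋆ x) ≤ dim(F) ‖∑ x⋆ x‖. -/
lemma transposeBounded_of_finiteDimensional (F : Type*) [NonUnitalCStarAlgebra F]
    [FiniteDimensional ℂ F] : TransposeBounded F (Module.finrank ℂ (F ⧸ (⊥ : Submodule ℂ F))) := by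
  intro n x
  have hK := isIdeal_bot F
  refine (norm_le_leftTrace (Finset.sum_nonneg fun i _ => mul_star_self_nonneg _)).trans ?_
  refine (Complex.re_le_norm _).trans ?_
  have : leftTrace hK (∑ i, x i * star (x i)) = leftTrace hK (∑ i, star (x i) * x i) := by
    rw [map_sum, map_sum]
    exact Finset.sum_congr rfl fun i _ => leftTrace_mul_comm _ _ _
  rw [this]
  exact norm_leftTrace_le hK _

lemma TransposeBounded.mono {N N' : ℝ} (h : TransposeBounded D N) (hN : N ≤ N') :
    TransposeBounded D N' := fun n x => (h n x).trans (by gcongr)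

/-- A positive trace vanishing on a proper ideal of finite codimension. -/
lemma exists_tracialState_of_finiteDimensional {K : Submodule ℂ D} (hK : IsIdeal K) (hne : K ≠ ⊤)
    [FiniteDimensional ℂ (D ⧸ K)] : ∃ σ ∈ tracialStates D, ∀ x ∈ K, σ x = 0 := by
  let τ : D →L[ℂ] ℂ := (leftTrace hK).mkContinuous _ (norm_leftTrace_le hK)
  have hτ : ∀ d, τ d = leftTrace hK d := fun d => rfl
  have h0 : τ ≠ 0 := by
    intro h
    refine hne (Submodule.eq_top_iff'.2 fun d => ?_)
    -- If the trace vanished, nilpotency applied to the root of d of order n + 1 would put d itself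
    -- into K, for every positive d.
    have key : ∀ d : D, 0 ≤ d → d ∈ K := by
      intro d hd
      set n := Module.finrank ℂ (D ⧸ K)
      have h1 := pow_mem_of_leftTrace_eq_zero (d := cfcₙ (fun t : ℝ => |t| ^ ((n + 1 : ℝ)⁻¹)) d) hK
        (cfcₙ_nonneg fun t _ => by positivity)
        (by rw [← hτ, h]; rfl)
      have hpos : (0 : ℝ) < (n + 1 : ℝ)⁻¹ := by positivity
      have hcont : Continuous fun t : ℝ => |t| ^ ((n + 1 : ℝ)⁻¹) :=
        Continuous.rpow_const (by fun_prop) fun _ => Or.inr hpos.le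
      have h2 : ∀ m : ℕ, (fun y => cfcₙ (fun t : ℝ => |t| ^ ((n + 1 : ℝ)⁻¹)) d * y)^[m]
          (cfcₙ (fun t : ℝ => |t| ^ ((n + 1 : ℝ)⁻¹)) d) =
          cfcₙ (fun t : ℝ => (|t| ^ ((n + 1 : ℝ)⁻¹)) ^ (m + 1)) d := by
        intro m
        induction m with
        | zero => simp
        | succ m ih =>
          rw [Function.iterate_succ_apply', ih, ← cfcₙ_mul (fun t : ℝ => |t| ^ ((n + 1 : ℝ)⁻¹))
            (fun t : ℝ => (|t| ^ ((n + 1 : ℝ)⁻¹)) ^ (m + 1)) d hcont.continuousOn (by simp [hpos.ne'])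
            (hcont.pow (m + 1)).continuousOn (by simp [hpos.ne'])]
          exact cfcₙ_congr fun t _ => (pow_succ' _ _).symm
      rw [h2] at h1
      convert h1 using 1
      conv_lhs => rw [← cfcₙ_id' ℝ d]
      refine cfcₙ_congr fun t ht => ?_
      have ht0 := quasispectrum_nonneg_of_nonneg d hd t ht
      change t = (|t| ^ ((n + 1 : ℝ)⁻¹)) ^ (n + 1)
      rw [abs_of_nonneg ht0, ← Real.rpow_natCast, ← Real.rpow_mul ht0]
      push_cast
      rw [inv_mul_cancel₀ (by positivity), Real.rpow_one]
    obtain ⟨p, hp0, -, hsum⟩ := CStarAlgebra.exists_sum_four_nonneg d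
    rw [hsum]
    exact K.sum_mem fun i _ => K.smul_mem _ (key _ (hp0 i))
  refine ⟨_, mem_tracialStates_of (fun d hd => leftTrace_nonneg hK hd)
    (fun a b => leftTrace_mul_comm hK a b) h0, fun x hx => ?_⟩
  change (‖τ‖⁻¹ : ℝ) • τ x = 0
  rw [hτ, leftTrace_eq_zero hK hx, smul_zero]

end LeftTrace

/-! ### Hereditary subalgebras as embeddings; stability of 𝒞₀'. -/

section HereditaryEmbedding

attribute [local instance] CStarAlgebra.spectralOrder CStarAlgebra.spectralOrderedRing

variable {A B C D G : Type*} [NonUnitalCStarAlgebra A] [NonUnitalCStarAlgebra B]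
  [NonUnitalCStarAlgebra C] [NonUnitalCStarAlgebra D] [NonUnitalCStarAlgebra G]

lemma mul_mul_star_polarization (x y a : A) :
    (4 : ℂ) • (y * a * star x) = ∑ k : Fin 4, Complex.I ^ (k : ℕ) •
      ((y + Complex.I ^ (k : ℕ) • x) * a * star (y + Complex.I ^ (k : ℕ) • x)) := by
  simp only [Fin.sum_univ_four, star_add, star_smul, mul_add, add_mul, smul_mul_assoc,
    mul_smul_comm, smul_add, smul_smul, RCLike.star_def, map_pow, Complex.conj_I, Fin.val_zero,
    Fin.val_one, Fin.val_two]
  have h3 : ((3 : Fin 4) : ℕ) = 3 := rfl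
  rw [h3]
  have i2 : Complex.I * Complex.I = -1 := Complex.I_mul_I
  simp only [pow_succ, pow_zero, one_mul, i2, neg_mul, mul_neg, neg_neg, neg_smul,
    one_smul, mul_one]
  module

/-- By decomposition and polarization only products y p y⋆ with y in B and p ≥ 0 matter, and these
are dominated by ‖p‖ y y⋆, which is in B. -/
lemma IsHereditary.sandwich {B : NonUnitalStarSubalgebra ℂ A} (hB : IsHereditary B) {b b' : A}
    (hb : b ∈ B) (hb' : b' ∈ B) (a : A) : b * a * b' ∈ B := by
  obtain ⟨p, hp, -, rfl⟩ := CStarAlgebra.exists_sum_four_nonneg a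
  rw [Finset.mul_sum, Finset.sum_mul]
  refine sum_mem fun i _ => ?_
  rw [mul_smul_comm, smul_mul_assoc]
  refine B.smul_mem _ ?_
  have h4 : b * p i * b' = (4 : ℂ)⁻¹ • (4 : ℂ) • (b * p i * star (star b')) := by
    rw [smul_smul, inv_mul_cancel₀ (by norm_num), one_smul, star_star]
  rw [h4, mul_mul_star_polarization]
  refine B.smul_mem _ (sum_mem fun k _ => B.smul_mem _ ?_)
  have hm : b + Complex.I ^ (k : ℕ) • star b' ∈ B :=
    B.add_mem hb (B.smul_mem _ (B.star_mem' hb'))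
  refine hB.2 _ (‖p i‖ • ((b + Complex.I ^ (k : ℕ) • star b') * star (b + Complex.I ^ (k : ℕ) • star b')))
    (star_right_conjugate_nonneg (hp i) _)
    (CStarAlgebra.star_right_conjugate_le_norm_smul (.of_nonneg (hp i))) ?_
  exact B.smul_mem (‖p i‖ : ℂ) (B.mul_mem hm (B.star_mem' hm))

lemma HerEmb.isClosed_range {ι : B →⋆ₙₐ[ℂ] A} (hι : HerEmb ι) : IsClosed (Set.range ι) :=
  (NonUnitalStarAlgHom.isometry ι hι.inj).isClosedEmbedding.isClosed_range

/-- With r = √x, domination by ι(b) makes r - ι(e) r small for an approximate unit e. Hence x = r²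
is close to ι(e) x ι(e), which is in the closed range. -/
lemma HerEmb.mem_range_of_le {ι : B →⋆ₙₐ[ℂ] A} (hι : HerEmb ι) {x : A} {b : B} (hx : 0 ≤ x)
    (h : x ≤ ι b) : x ∈ Set.range ι := by
  have hr : star (cfcₙ Real.sqrt x) = cfcₙ Real.sqrt x :=
    (cfcₙ_predicate Real.sqrt x : IsSelfAdjoint _).star_eq
  have hrr : cfcₙ Real.sqrt x * cfcₙ Real.sqrt x = x := by
    rw [← CFC.sqrt_eq_real_sqrt _ hx, CFC.sqrt_mul_sqrt_self x hx]
  set r := cfcₙ Real.sqrt x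
  refine hι.isClosed_range.closure_subset (Metric.mem_closure_iff.2 fun ε hε => ?_)
  obtain ⟨δ, hδ, hδε⟩ : ∃ δ : ℝ, 0 < δ ∧ ‖r‖ * δ + δ * ‖r‖ < ε := by
    refine ⟨ε / (4 * (‖r‖ + 1)), by positivity, ?_⟩
    rw [← mul_div_assoc, div_mul_eq_mul_div, ← add_div, div_lt_iff₀ (by positivity)]
    nlinarith [norm_nonneg r]
  obtain ⟨e, he0, he1, he⟩ := exists_approx_unit {b} (ε := δ ^ 2 / 2) (by positivity)
  obtain ⟨h1, h2⟩ := he b (by simp)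
  have hesa : star (ι e) = ι e := by rw [← map_star, (IsSelfAdjoint.of_nonneg he0).star_eq]
  have h3 : ‖r - ι e * r‖ ≤ δ := by
    have := norm_sub_mul_sq_le (x := r) (q := ι b) (e := ι e) (by rw [hr, hrr]; exact h) hesa
    have h4 : ‖ι b - ι e * ι b - ι b * ι e + ι e * ι b * ι e‖ ≤ δ ^ 2 := by
      simp only [← map_mul, ← map_sub, ← map_add]
      refine (norm_hom_le _ _).trans ?_
      calc _ = ‖(b - e * b) - (b - e * b) * e‖ := by congr 1; noncomm_ring
        _ ≤ ‖b - e * b‖ + ‖b - e * b‖ * ‖e‖ := (norm_sub_le _ _).trans (by gcongr; exact norm_mul_le _ _)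
        _ ≤ δ ^ 2 / 2 + δ ^ 2 / 2 * 1 := by gcongr
        _ = δ ^ 2 := by ring
    exact le_of_sq_le_sq (this.trans h4) hδ.le
  have h3' : ‖r - r * ι e‖ ≤ δ := by
    rw [← norm_star, star_sub, star_mul, hr, hesa]; exact h3
  have hie : ‖ι e‖ ≤ 1 := (norm_hom_le _ _).trans he1
  obtain ⟨c, hc⟩ := hι.sandwich e e x
  refine ⟨ι c, ⟨c, rfl⟩, ?_⟩
  rw [hc, dist_eq_norm, ← hrr]
  calc _ = ‖(r - ι e * r) * r + ι e * r * (r - r * ι e)‖ := by congr 1; noncomm_ring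
    _ ≤ ‖r - ι e * r‖ * ‖r‖ + ‖ι e‖ * ‖r‖ * ‖r - r * ι e‖ :=
      (norm_add_le _ _).trans (add_le_add (norm_mul_le _ _) norm_mul₃_le)
    _ ≤ δ * ‖r‖ + 1 * ‖r‖ * δ := by gcongr
    _ < ε := by linarith

lemma HerEmb.isHereditary_range {ι : B →⋆ₙₐ[ℂ] A} (hι : HerEmb ι) :
    IsHereditary (NonUnitalStarAlgHom.range ι) := by
  refine ⟨?_, fun x y hx hxy hy => ?_⟩
  · rw [NonUnitalStarAlgHom.coe_range]; exact hι.isClosed_range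
  · obtain ⟨b, rfl⟩ := (NonUnitalStarAlgHom.mem_range ι).1 hy
    obtain ⟨c, hc⟩ := hι.mem_range_of_le hx hxy
    exact (NonUnitalStarAlgHom.mem_range ι).2 ⟨c, hc⟩

/-- The preimage of an ideal under a homomorphism. -/
def comapIdeal (ι : B →⋆ₙₐ[ℂ] A) (I : Submodule ℂ A) : Submodule ℂ B :=
  I.comap (LinearMapClass.linearMap ι : B →ₗ[ℂ] A)

lemma mem_comapIdeal {ι : B →⋆ₙₐ[ℂ] A} {I : Submodule ℂ A} {b : B} : b ∈ comapIdeal ι I ↔ ι b ∈ I :=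
  Iff.rfl

lemma isIdeal_comapIdeal (ι : B →⋆ₙₐ[ℂ] A) {I : Submodule ℂ A} (hI : IsIdeal I) :
    IsIdeal (comapIdeal ι I) := fun x hx b => by
  simp only [mem_comapIdeal, map_mul]
  exact hI _ hx _

lemma isClosed_comapIdeal (ι : B →⋆ₙₐ[ℂ] A) {I : Submodule ℂ A} (hI : IsClosed (I : Set A)) :
    IsClosed (comapIdeal ι I : Set B) := hI.preimage (continuous_hom ι)

lemma closedIdeal_range_comp {ι : B →⋆ₙₐ[ℂ] A} {κ : C →⋆ₙₐ[ℂ] B}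
    (hι : closedIdeal (Set.range ι) = ⊤) (hκ : closedIdeal (Set.range κ) = ⊤) :
    closedIdeal (Set.range (ι.comp κ)) = ⊤ := by
  have hJ := isIdeal_closedIdeal (Set.range (ι.comp κ))
  have hJc := isClosed_closedIdeal (Set.range (ι.comp κ))
  have h1 : closedIdeal (Set.range κ) ≤ comapIdeal ι (closedIdeal (Set.range (ι.comp κ))) :=
    closedIdeal_le (isIdeal_comapIdeal ι hJ) (isClosed_comapIdeal ι hJc) (by
      rintro _ ⟨c, rfl⟩
      exact mem_closedIdeal ⟨c, rfl⟩)
  rw [hκ] at h1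
  rw [eq_top_iff, ← hι]
  exact closedIdeal_le hJ hJc (by rintro _ ⟨b, rfl⟩; exact h1 (Submodule.mem_top (x := b)))

/-- Embeddings, unlike subalgebras of subalgebras, compose directly; this form is used throughout
below. -/
lemma inC0'_iff : InC0' D ↔ ∃ (F₁ F₂ : Type) (_ : NonUnitalCStarAlgebra F₁)
    (_ : NonUnitalCStarAlgebra F₂) (φ₀ φ₁ : F₁ →⋆ₙₐ[ℂ] F₂) (ι : D →⋆ₙₐ[ℂ] mappingTorus φ₀ φ₁),
    FiniteDimensional ℂ F₁ ∧ FiniteDimensional ℂ F₂ ∧ SatisfiesC0 (mappingTorus φ₀ φ₁) ∧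
      HerEmb ι ∧ closedIdeal (Set.range ι) = ⊤ := by
  constructor
  · rintro ⟨F₁, F₂, i₁, i₂, φ₀, φ₁, B, h1, h2, h3, hB, hfull, ⟨e⟩⟩
    let ι : D →⋆ₙₐ[ℂ] mappingTorus φ₀ φ₁ :=
      (NonUnitalStarSubalgebraClass.subtype B).comp (e : D →⋆ₙₐ[ℂ] B)
    have hι : ∀ d, ι d = (e d : mappingTorus φ₀ φ₁) := fun d => rfl
    refine ⟨F₁, F₂, i₁, i₂, φ₀, φ₁, ι, h1, h2, h3,
      ⟨fun x y h => e.injective (Subtype.val_injective h), fun b b' a => ?_⟩, ?_⟩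
    · obtain ⟨c, hc⟩ := e.surjective ⟨_, hB.sandwich (e b).2 (e b').2 a⟩
      exact ⟨c, congrArg Subtype.val hc⟩
    · refine hfull _ (isIdeal_closedIdeal _) (isClosed_closedIdeal _) fun b hb => ?_
      obtain ⟨c, hc⟩ := e.surjective ⟨b, hb⟩
      exact mem_closedIdeal ⟨c, congrArg Subtype.val hc⟩
  · rintro ⟨F₁, F₂, i₁, i₂, φ₀, φ₁, ι, h1, h2, h3, hι, hfull⟩
    refine ⟨F₁, F₂, i₁, i₂, φ₀, φ₁, NonUnitalStarAlgHom.range ι, h1, h2, h3, hι.isHereditary_range,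
      fun I hI hc h => ?_, ⟨?_⟩⟩
    · rw [eq_top_iff, ← hfull]
      exact closedIdeal_le hI hc (by rwa [NonUnitalStarAlgHom.coe_range] at h)
    · exact StarAlgEquiv.ofBijective (NonUnitalStarAlgHom.rangeRestrict ι)
        ⟨fun x y h => hι.inj (congrArg Subtype.val h), fun ⟨y, hy⟩ => by
          obtain ⟨x, hx⟩ := (NonUnitalStarAlgHom.mem_range ι).1 hy
          exact ⟨x, Subtype.ext hx⟩⟩

lemma InC0'.of_herEmb (hD : InC0' D) {κ : G →⋆ₙₐ[ℂ] D} (hκ : HerEmb κ)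
    (hfull : closedIdeal (Set.range κ) = ⊤) : InC0' G := by
  obtain ⟨F₁, F₂, i₁, i₂, φ₀, φ₁, ι, h1, h2, h3, hι, h4⟩ := inC0'_iff.1 hD
  exact inC0'_iff.2 ⟨F₁, F₂, i₁, i₂, φ₀, φ₁, ι.comp κ, h1, h2, h3, hι.comp hκ,
    closedIdeal_range_comp h4 hfull⟩

end HereditaryEmbedding

/-! ### Ideals and tracial states of algebras in 𝒞₀'. -/

section MappingTorus

attribute [local instance] CStarAlgebra.spectralOrder CStarAlgebra.spectralOrderedRing

variable {F₁ F₂ D : Type*} [NonUnitalCStarAlgebra F₁] [NonUnitalCStarAlgebra F₂]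
  [NonUnitalCStarAlgebra D] {φ₀ φ₁ : F₁ →⋆ₙₐ[ℂ] F₂}

/-- Evaluation of an element of the mapping torus at a point of the interval. -/
def evalAt (φ₀ φ₁ : F₁ →⋆ₙₐ[ℂ] F₂) (t : unitInterval) : mappingTorus φ₀ φ₁ →⋆ₙₐ[ℂ] F₂ where
  toFun x := x.1.1 t
  map_smul' _ _ := rfl
  map_zero' := rfl
  map_add' _ _ := rfl
  map_mul' _ _ := rfl
  map_star' _ := rfl

/-- The fibre of an element of the mapping torus at infinity. -/
def evalInf (φ₀ φ₁ : F₁ →⋆ₙₐ[ℂ] F₂) : mappingTorus φ₀ φ₁ →⋆ₙₐ[ℂ] F₁ where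
  toFun x := x.1.2
  map_smul' _ _ := rfl
  map_zero' := rfl
  map_add' _ _ := rfl
  map_mul' _ _ := rfl
  map_star' _ := rfl

lemma mappingTorus_norm_le {x : mappingTorus φ₀ φ₁} {r : ℝ} (hr : 0 ≤ r)
    (h : ∀ t, ‖evalAt φ₀ φ₁ t x‖ ≤ r) (h' : ‖evalInf φ₀ φ₁ x‖ ≤ r) : ‖x‖ ≤ r :=
  (Prod.norm_def x.1).trans_le (max_le ((ContinuousMap.norm_le _ hr).2 h) h')

lemma exists_transposeBounded_mappingTorus [FiniteDimensional ℂ F₁] [FiniteDimensional ℂ F₂]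
    (φ₀ φ₁ : F₁ →⋆ₙₐ[ℂ] F₂) : ∃ N : ℝ, 0 ≤ N ∧ TransposeBounded (mappingTorus φ₀ φ₁) N := by
  have h1 := transposeBounded_of_finiteDimensional F₁
  have h2 := transposeBounded_of_finiteDimensional F₂
  set N₁ : ℝ := (Module.finrank ℂ (F₁ ⧸ (⊥ : Submodule ℂ F₁)) : ℝ)
  set N₂ : ℝ := (Module.finrank ℂ (F₂ ⧸ (⊥ : Submodule ℂ F₂)) : ℝ)
  have hN₁ : 0 ≤ N₁ := Nat.cast_nonneg _
  have hN₂ : 0 ≤ N₂ := Nat.cast_nonneg _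
  refine ⟨N₁ + N₂, by positivity, fun n x => mappingTorus_norm_le (by positivity) (fun t => ?_) ?_⟩
  · have := (h2.mono (le_add_of_nonneg_left hN₁)) n fun i => evalAt φ₀ φ₁ t (x i)
    simp only [← map_star, ← map_mul, ← map_sum] at this
    exact this.trans (by gcongr; exact norm_hom_le _ _)
  · have := (h1.mono (le_add_of_nonneg_right hN₂)) n fun i => evalInf φ₀ φ₁ (x i)
    simp only [← map_star, ← map_mul, ← map_sum] at this
    exact this.trans (by gcongr; exact norm_hom_le _ _)

lemma InC0'.exists_transposeBounded (hD : InC0' D) : ∃ N : ℝ, 0 ≤ N ∧ TransposeBounded D N := by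
  obtain ⟨F₁, F₂, i₁, i₂, φ₀, φ₁, ι, h1, h2, h3, hι, h4⟩ := inC0'_iff.1 hD
  obtain ⟨N, hN, h⟩ := exists_transposeBounded_mappingTorus φ₀ φ₁
  exact ⟨N, hN, h.of_injective ι hι.inj⟩

/-- Multiplication of an element of the mapping torus by a function vanishing at the endpoints. -/
def bump (h : C(unitInterval, ℝ)) (h0 : h 0 = 0) (h1 : h 1 = 0) (x : mappingTorus φ₀ φ₁) :
    mappingTorus φ₀ φ₁ :=
  ⟨(⟨fun t => h t • x.1.1 t, by fun_prop⟩, 0), by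
    constructor
    · change h 0 • x.1.1 0 = φ₀ 0
      rw [h0, zero_smul, map_zero]
    · change h 1 • x.1.1 1 = φ₁ 0
      rw [h1, zero_smul, map_zero]⟩

lemma evalAt_bump {h : C(unitInterval, ℝ)} {h0 : h 0 = 0} {h1 : h 1 = 0} (x : mappingTorus φ₀ φ₁)
    (t : unitInterval) : evalAt φ₀ φ₁ t (bump h h0 h1 x) = h t • evalAt φ₀ φ₁ t x := rfl

lemma evalInf_bump {h : C(unitInterval, ℝ)} {h0 : h 0 = 0} {h1 : h 1 = 0} (x : mappingTorus φ₀ φ₁) :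
    evalInf φ₀ φ₁ (bump h h0 h1 x) = 0 := rfl

lemma mappingTorus_ext {x y : mappingTorus φ₀ φ₁} (h : ∀ t, evalAt φ₀ φ₁ t x = evalAt φ₀ φ₁ t y)
    (h' : evalInf φ₀ φ₁ x = evalInf φ₀ φ₁ y) : x = y :=
  Subtype.ext (Prod.ext (ContinuousMap.ext h) h')

lemma mul_bump {h : C(unitInterval, ℝ)} {h0 : h 0 = 0} {h1 : h 1 = 0} (x y : mappingTorus φ₀ φ₁) :
    x * bump h h0 h1 y = bump h h0 h1 (x * y) :=
  mappingTorus_ext (fun t => by simp only [map_mul, evalAt_bump, mul_smul_comm])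
    (by simp only [map_mul, evalInf_bump, mul_zero])

lemma bump_mul {h : C(unitInterval, ℝ)} {h0 : h 0 = 0} {h1 : h 1 = 0} (x y : mappingTorus φ₀ φ₁) :
    bump h h0 h1 x * y = bump h h0 h1 (x * y) :=
  mappingTorus_ext (fun t => by simp only [map_mul, evalAt_bump, smul_mul_assoc])
    (by simp only [map_mul, evalInf_bump, zero_mul])

lemma bump_sub {h : C(unitInterval, ℝ)} {h0 : h 0 = 0} {h1 : h 1 = 0} (x y : mappingTorus φ₀ φ₁) :
    bump h h0 h1 x - bump h h0 h1 y = bump h h0 h1 (x - y) :=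
  mappingTorus_ext (fun t => by simp only [map_sub, evalAt_bump, smul_sub])
    (by simp only [map_sub, evalInf_bump, sub_zero])

lemma norm_bump_le {h : C(unitInterval, ℝ)} {h0 : h 0 = 0} {h1 : h 1 = 0} (x : mappingTorus φ₀ φ₁) :
    ‖bump h h0 h1 x‖ ≤ ‖h‖ * ‖x‖ := by
  refine mappingTorus_norm_le (by positivity) (fun t => ?_) ?_
  · rw [evalAt_bump, norm_smul]
    gcongr
    · exact h.norm_coe_le_norm t
    · exact norm_hom_le _ _
  · rw [evalInf_bump, norm_zero]; positivity

/-- Closed ideals of D are stable under multiplication by scalar functions h. The element h ι(e)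
need not come from D, but ι(e) (h ι(e)) ι(e) does; multiply it with i and let e run through an
approximate unit. -/
lemma exists_map_eq_bump {ι : D →⋆ₙₐ[ℂ] mappingTorus φ₀ φ₁} (hι : HerEmb ι) {I : Submodule ℂ D}
    (hI : IsIdeal I) (hc : IsClosed (I : Set D)) (h : C(unitInterval, ℝ)) (h0 : h 0 = 0)
    (h1 : h 1 = 0) {i : D} (hi : i ∈ I) : ∃ x ∈ I, ι x = bump h h0 h1 (ι i) := by
  have hcl : IsClosed (ι '' I) :=
    (NonUnitalStarAlgHom.isometry ι hι.inj).isClosedEmbedding.isClosedMap _ hc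
  change bump h h0 h1 (ι i) ∈ ι '' I
  refine hcl.closure_subset (Metric.mem_closure_iff.2 fun ε hε => ?_)
  obtain ⟨e, he0, he1, he⟩ := exists_approx_unit {i} (ε := ε / (4 * (‖h‖ + 1))) (by positivity)
  obtain ⟨h2, -⟩ := he i (by simp)
  obtain ⟨w, hw⟩ := hι.sandwich e e (bump h h0 h1 (ι i))
  obtain ⟨v, hv⟩ := hι.sandwich e e (bump h h0 h1 (ι e))
  refine ⟨ι (v * i), ⟨_, (hI i hi v).1, rfl⟩, ?_⟩
  have h3 : ι (v * i) = bump h h0 h1 (ι (e * (e * (e * i)))) := by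
    rw [map_mul, hv, mul_bump, bump_mul, bump_mul]
    simp only [map_mul, mul_assoc]
  rw [h3, dist_eq_norm, bump_sub, ← map_sub]
  have h4 : ‖i - e * (e * (e * i))‖ ≤ 3 * ‖i - e * i‖ := by
    calc _ = ‖(i - e * i) + e * (i - e * i) + e * e * (i - e * i)‖ := by congr 1; noncomm_ring
      _ ≤ ‖i - e * i‖ + ‖e‖ * ‖i - e * i‖ + ‖e‖ * ‖e‖ * ‖i - e * i‖ := by
        refine norm_add₃_le.trans ?_
        gcongr
        · exact norm_mul_le _ _
        · exact norm_mul₃_le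
      _ ≤ ‖i - e * i‖ + 1 * ‖i - e * i‖ + 1 * 1 * ‖i - e * i‖ := by gcongr
      _ = _ := by ring
  rw [lt_div_iff₀ (by positivity)] at h2
  calc _ ≤ ‖h‖ * ‖ι (i - e * (e * (e * i)))‖ := norm_bump_le _
    _ ≤ ‖h‖ * (3 * ‖i - e * i‖) := by gcongr; exact (norm_hom_le _ _).trans h4
    _ < ε := by nlinarith [norm_nonneg h, norm_nonneg (i - e * i)]

/-- A closed ideal that fills every fibre of D is all of D: local approximations over the interval
are glued by a partition of unity, which acts on I by `exists_map_eq_bump`. -/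
lemma exists_eval_ne {ι : D →⋆ₙₐ[ℂ] mappingTorus φ₀ φ₁} (hι : HerEmb ι) {I : Submodule ℂ D}
    (hI : IsIdeal I) (hc : IsClosed (I : Set D)) (hne : I ≠ ⊤) :
    (∃ t, ∃ d, ∀ i ∈ I, evalAt φ₀ φ₁ t (ι i) ≠ evalAt φ₀ φ₁ t (ι d)) ∨
      ∃ d, ∀ i ∈ I, evalInf φ₀ φ₁ (ι i) ≠ evalInf φ₀ φ₁ (ι d) := by
  by_contra! h
  obtain ⟨h1, h2⟩ := h
  refine hne (Submodule.eq_top_iff'.2 fun d => ?_)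
  obtain ⟨k, hk, hkd⟩ := h2 d
  -- Subtracting an element of I with the same value at infinity makes the difference vanish at both
  -- endpoints.
  rw [← sub_add_cancel d k]
  refine I.add_mem ?_ hk
  set d' := d - k
  have hd' : evalInf φ₀ φ₁ (ι d') = 0 := by rw [map_sub, map_sub, hkd, sub_self]
  have hd0 : evalAt φ₀ φ₁ 0 (ι d') = 0 := (ι d').2.1.trans (by
    change φ₀ (evalInf φ₀ φ₁ (ι d')) = 0
    rw [hd', map_zero])
  have hd1 : evalAt φ₀ φ₁ 1 (ι d') = 0 := (ι d').2.2.trans (by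
    change φ₁ (evalInf φ₀ φ₁ (ι d')) = 0
    rw [hd', map_zero])
  have hev : ∀ x : mappingTorus φ₀ φ₁, Continuous fun t => evalAt φ₀ φ₁ t x := fun x =>
    x.1.1.continuous
  refine hc.closure_subset (Metric.mem_closure_iff.2 fun ε hε => ?_)
  -- Functions of the partition that are nonzero at an endpoint are not allowed as multipliers. Near
  -- the endpoints j = 0 is good enough; elsewhere the neighbourhoods avoid 0 and 1.
  have h3 : ∀ t : unitInterval, ∃ j ∈ I, ∃ U : Set unitInterval, IsOpen U ∧ t ∈ U ∧
      (∀ s ∈ U, ‖evalAt φ₀ φ₁ s (ι (d' - j))‖ < ε / 2) ∧ (j = 0 ∨ (0 ∉ U ∧ 1 ∉ U)) := fun t => by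
    by_cases ht : t = 0 ∨ t = 1
    · refine ⟨0, I.zero_mem, {s | ‖evalAt φ₀ φ₁ s (ι (d' - 0))‖ < ε / 2},
        isOpen_lt (hev _).norm continuous_const, ?_, fun s hs => hs, Or.inl rfl⟩
      rw [Set.mem_ofPred_eq, sub_zero]
      rcases ht with rfl | rfl
      · rw [hd0, norm_zero]; positivity
      · rw [hd1, norm_zero]; positivity
    · push Not at ht
      obtain ⟨j, hj, hjd⟩ := h1 t d'
      refine ⟨j, hj, {s | ‖evalAt φ₀ φ₁ s (ι (d' - j))‖ < ε / 2} ∩ ({0}ᶜ ∩ {1}ᶜ),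
        (isOpen_lt (hev _).norm continuous_const).inter (isOpen_compl_singleton.inter
          isOpen_compl_singleton), ⟨?_, by simpa using ht⟩, fun s hs => hs.1, Or.inr ⟨by simp, by simp⟩⟩
      rw [Set.mem_ofPred_eq, map_sub, map_sub, hjd, sub_self, norm_zero]; positivity
  choose j hj U hUo htU hU hjU using h3
  obtain ⟨T, hT⟩ := isCompact_univ.elim_nhds_subcover U fun t _ => (hUo t).mem_nhds (htU t)
  obtain ⟨f, hf⟩ := PartitionOfUnity.exists_isSubordinate isClosed_univ (fun t : T => U t)
    (fun t => hUo t) (fun s hs => by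
      obtain ⟨t, ht, hst⟩ := Set.mem_iUnion₂.1 (hT.2 hs)
      exact Set.mem_iUnion.2 ⟨⟨t, ht⟩, hst⟩)
  have hout : ∀ (t : T) s, s ∉ U t → f t s = 0 := fun t s hs => by
    by_contra h0
    exact hs (hf t (subset_tsupport _ h0))
  have hterm : ∀ t : T, ∃ x ∈ I, (∀ s, evalAt φ₀ φ₁ s (ι x) = f t s • evalAt φ₀ φ₁ s (ι (j t))) ∧
      evalInf φ₀ φ₁ (ι x) = 0 := fun t => by
    rcases hjU t with h0 | ⟨h0, h1'⟩
    · exact ⟨0, I.zero_mem, fun s => by rw [h0, map_zero, map_zero, smul_zero], by rw [map_zero, map_zero]⟩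
    · obtain ⟨x, hx, he⟩ := exists_map_eq_bump hι hI hc (f t) (hout t 0 h0) (hout t 1 h1') (hj t)
      exact ⟨x, hx, fun s => by rw [he, evalAt_bump], by rw [he, evalInf_bump]⟩
  choose x hx hxs hxi using hterm
  refine ⟨∑ t, x t, I.sum_mem fun t _ => hx t, ?_⟩
  rw [dist_eq_norm, ← NonUnitalStarAlgHom.norm_map ι hι.inj]
  refine (mappingTorus_norm_le (r := ε / 2) (by positivity) (fun s => ?_) ?_).trans_lt (half_lt_self hε)
  · have hsum : ∑ t : T, f t s = 1 := by
      rw [← finsum_eq_sum_of_fintype]; exact f.sum_eq_one (Set.mem_univ s)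
    have e1 : evalAt φ₀ φ₁ s (ι (d' - ∑ t, x t)) = ∑ t : T, f t s • evalAt φ₀ φ₁ s (ι (d' - j t)) := by
      simp only [map_sub, map_sum, hxs, smul_sub, Finset.sum_sub_distrib]
      rw [← Finset.sum_smul, hsum, one_smul]
    rw [e1]
    calc _ ≤ ∑ t : T, f t s * (ε / 2) := by
          refine (norm_sum_le _ _).trans (Finset.sum_le_sum fun t _ => ?_)
          rw [norm_smul, Real.norm_of_nonneg (f.nonneg t s)]
          by_cases hs : s ∈ U t
          · exact mul_le_mul_of_nonneg_left (hU t s hs).le (f.nonneg t s)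
          · rw [hout t s hs]; simp
      _ = ε / 2 := by rw [← Finset.sum_mul, hsum, one_mul]
  · rw [map_sub, map_sub, map_sum, map_sum, Finset.sum_eq_zero fun t _ => hxi t, hd', sub_zero, norm_zero]
    positivity

/-- The ideal I + ker π is proper, since π(d) is not in π(I), and has finite codimension, so
`exists_tracialState_of_finiteDimensional` applies. -/
lemma exists_tracialState_of_eval {F : Type*} [NonUnitalCStarAlgebra F] [FiniteDimensional ℂ F]
    (π : D →⋆ₙₐ[ℂ] F) {I : Submodule ℂ D} (hI : IsIdeal I) {d : D} (hd : ∀ i ∈ I, π i ≠ π d) :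
    ∃ σ ∈ tracialStates D, ∀ x ∈ I, σ x = 0 := by
  let πl : D →ₗ[ℂ] F := LinearMapClass.linearMap π
  have hK : IsIdeal (I ⊔ LinearMap.ker πl) := fun x hx a => by
    obtain ⟨i, hi, k, hk, rfl⟩ := Submodule.mem_sup.1 hx
    have hk : π k = 0 := hk
    rw [mul_add, add_mul]
    refine ⟨Submodule.add_mem_sup (hI i hi a).1 ?_, Submodule.add_mem_sup (hI i hi a).2 ?_⟩
    · change π (a * k) = 0; rw [map_mul, hk, mul_zero]
    · change π (k * a) = 0; rw [map_mul, hk, zero_mul]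
  have hne : I ⊔ LinearMap.ker πl ≠ ⊤ := fun h => by
    obtain ⟨i, hi, k, hk, hik⟩ := Submodule.mem_sup.1 (h ▸ Submodule.mem_top (x := d))
    have hk : π k = 0 := hk
    exact hd i hi (by rw [← hik, map_add, hk, add_zero])
  have : FiniteDimensional ℂ (D ⧸ LinearMap.ker πl) :=
    Module.Finite.equiv πl.quotKerEquivRange.symm
  have : FiniteDimensional ℂ (D ⧸ (I ⊔ LinearMap.ker πl)) :=
    Module.Finite.of_surjective (Submodule.factor (le_sup_right : LinearMap.ker πl ≤ I ⊔ LinearMap.ker πl))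
      (Submodule.factor_surjective _)
  obtain ⟨σ, hσ, h0⟩ := exists_tracialState_of_finiteDimensional hK hne
  exact ⟨σ, hσ, fun x hx => h0 x (Submodule.mem_sup_left hx)⟩

/-- Every proper closed ideal of an algebra in `𝒞₀'` is annihilated by a tracial state. -/
lemma InC0'.exists_tracialState (hD : InC0' D) {I : Submodule ℂ D} (hI : IsIdeal I)
    (hc : IsClosed (I : Set D)) (hne : I ≠ ⊤) : ∃ σ ∈ tracialStates D, ∀ x ∈ I, σ x = 0 := by
  obtain ⟨F₁, F₂, i₁, i₂, φ₀, φ₁, ι, h1, h2, h3, hι, h4⟩ := inC0'_iff.1 hD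
  rcases exists_eval_ne hι hI hc hne with ⟨t, d, h⟩ | ⟨d, h⟩
  · exact exists_tracialState_of_eval ((evalAt φ₀ φ₁ t).comp ι) hI h
  · exact exists_tracialState_of_eval ((evalInf φ₀ φ₁).comp ι) hI h

end MappingTorus

/-! ### Matrix algebras: matrix units, hereditary embeddings and fullness. -/

section MatrixAlgebra

set_option linter.unusedSectionVars false

attribute [local instance] CStarAlgebra.spectralOrder CStarAlgebra.spectralOrderedRing

variable {A B C : Type*} [NonUnitalCStarAlgebra A] [NonUnitalCStarAlgebra B]
  [NonUnitalCStarAlgebra C] {n : Type*} [Fintype n]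

lemma tendsto_approximateUnit_conj (x : A) :
    Tendsto (fun e => e * x * e) (CStarAlgebra.approximateUnit A) (𝓝 x) := by
  have h := CStarAlgebra.increasingApproximateUnit (A := A)
  have h1 := tendsto_iff_norm_sub_tendsto_zero.1 (h.tendsto_mul_left x)
  have h2 := tendsto_iff_norm_sub_tendsto_zero.1 (h.tendsto_mul_right x)
  refine tendsto_iff_norm_sub_tendsto_zero.2 (squeeze_zero' (Eventually.of_forall fun _ =>
    norm_nonneg _) ?_ (by simpa using! h1.add h2))
  filter_upwards [h.eventually_norm] with e he
  calc _ = ‖e * (x * e - x) + (e * x - x)‖ := by congr 1; noncomm_ring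
    _ ≤ ‖e‖ * ‖x * e - x‖ + ‖e * x - x‖ := (norm_add_le _ _).trans (by gcongr; exact norm_mul_le _ _)
    _ ≤ 1 * ‖x * e - x‖ + ‖e * x - x‖ := by gcongr
    _ = _ := by rw [one_mul]

lemma CStarMatrix.mul_apply_apply (M N : CStarMatrix n n A) (i j : n) :
    (M * N) i j = ∑ k, M i k * N k j := CStarMatrix.mul_apply

lemma CStarMatrix.sum_apply {κ : Type*} (s : Finset κ) (f : κ → CStarMatrix n n A) (i j : n) :
    (∑ k ∈ s, f k) i j = ∑ k ∈ s, f k i j := by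
  classical
  induction s using Finset.induction_on with
  | empty => simp
  | insert k s hk ih => rw [Finset.sum_insert hk, Finset.sum_insert hk, CStarMatrix.add_apply, ih]

lemma CStarMatrix.tendsto_iff {κ : Type*} {l : Filter κ} {f : κ → CStarMatrix n n A}
    {M : CStarMatrix n n A} :
    Tendsto f l (𝓝 M) ↔ ∀ i j, Tendsto (fun k => f k i j) l (𝓝 (M i j)) := by
  refine ⟨fun h i j => ?_, fun h => ?_⟩
  · exact ((continuous_apply_apply i j : Continuous fun M : n → n → A => M i j).tendsto M).comp h
  · exact tendsto_pi_nhds.2 fun i => tendsto_pi_nhds.2 fun j => h i j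

variable [DecidableEq n]

/-- The matrix with the single entry `a` in position `(i, j)`. -/
def matUnit (i j : n) (a : A) : CStarMatrix n n A := CStarMatrix.ofMatrix (Matrix.single i j a)

lemma matUnit_apply (i j : n) (a : A) (k l : n) :
    matUnit i j a k l = if i = k ∧ j = l then a else 0 := Matrix.single_apply ..

lemma matUnit_mul_matUnit (i j k l : n) (a b : A) :
    matUnit i j a * matUnit k l b = if j = k then matUnit i l (a * b) else 0 := by
  ext p q
  rw [CStarMatrix.mul_apply_apply]
  split_ifs with h
  · subst h
    rw [Finset.sum_eq_single j]
    · simp only [matUnit_apply]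
      by_cases h1 : i = p <;> by_cases h2 : l = q <;> simp [h1, h2]
    · intro m _ hm
      simp [matUnit_apply, Ne.symm hm]
    · simp
  · refine Finset.sum_eq_zero fun m _ => ?_
    simp only [matUnit_apply]
    by_cases h1 : j = m
    · subst h1; simp [Ne.symm h]
    · simp [h1]

lemma star_matUnit (i j : n) (a : A) : star (matUnit i j a) = matUnit j i (star a) := by
  ext p q
  rw [CStarMatrix.star_apply, matUnit_apply, matUnit_apply]
  by_cases h1 : i = q <;> by_cases h2 : j = p <;> simp [h1, h2]

lemma matUnit_add (i j : n) (a b : A) : matUnit i j (a + b) = matUnit i j a + matUnit i j b := by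
  ext p q
  rw [CStarMatrix.add_apply, matUnit_apply, matUnit_apply, matUnit_apply]
  split_ifs <;> simp

lemma matUnit_smul (i j : n) (c : ℂ) (a : A) : matUnit i j (c • a) = c • matUnit i j a := by
  ext p q
  rw [CStarMatrix.smul_apply, matUnit_apply, matUnit_apply]
  split_ifs <;> simp

@[simp] lemma matUnit_zero (i j : n) : matUnit i j (0 : A) = 0 := by
  ext p q; simp [matUnit_apply]

lemma sum_matUnit (M : CStarMatrix n n A) : M = ∑ i, ∑ j, matUnit i j (M i j) := by
  ext p q
  rw [CStarMatrix.sum_apply, Finset.sum_eq_single p, CStarMatrix.sum_apply, Finset.sum_eq_single q]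
  · simp [matUnit_apply]
  · intro j _ hj; simp [matUnit_apply, hj]
  · simp
  · intro i _ hi
    rw [CStarMatrix.sum_apply]
    exact Finset.sum_eq_zero fun j _ => by simp [matUnit_apply, hi]
  · simp

/-- The corner embedding of `A` into matrices over `A`. -/
def cornerHom (A : Type*) [NonUnitalCStarAlgebra A] (i : n) : A →⋆ₙₐ[ℂ] CStarMatrix n n A where
  toFun := matUnit i i
  map_smul' := matUnit_smul i i
  map_zero' := matUnit_zero i i
  map_add' := matUnit_add i i
  map_mul' a b := by rw [matUnit_mul_matUnit, if_pos rfl]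
  map_star' a := (star_matUnit i i a).symm

lemma cornerHom_apply (i : n) (a : A) : cornerHom A i a = matUnit i i a := rfl

/-- The diagonal embedding of `A` into matrices over `A`. -/
def diagHom (A : Type*) [NonUnitalCStarAlgebra A] (n : Type*) [Fintype n] [DecidableEq n] :
    A →⋆ₙₐ[ℂ] CStarMatrix n n A where
  toFun a := CStarMatrix.ofMatrix (Matrix.diagonal fun _ => a)
  map_smul' c a := by
    ext p q
    change Matrix.diagonal (fun _ => c • a) p q = c • Matrix.diagonal (fun _ => a) p q
    rw [Matrix.diagonal_apply, Matrix.diagonal_apply]; split_ifs <;> simp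
  map_zero' := by ext p q; change Matrix.diagonal (fun _ => (0 : A)) p q = 0; simp
  map_add' a b := by
    ext p q
    change Matrix.diagonal (fun _ => a + b) p q =
      Matrix.diagonal (fun _ => a) p q + Matrix.diagonal (fun _ => b) p q
    simp only [Matrix.diagonal_apply]; split_ifs <;> simp
  map_mul' a b := (Matrix.diagonal_mul_diagonal (fun _ : n => a) fun _ => b).symm
  map_star' a := (Matrix.diagonal_conjTranspose (fun _ : n => a)).symm

lemma diagHom_apply_apply (a : A) (i j : n) : diagHom A n a i j = if i = j then a else 0 :=
  Matrix.diagonal_apply ..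

lemma diagHom_mul_apply (a : A) (M : CStarMatrix n n A) (i j : n) :
    (diagHom A n a * M) i j = a * M i j := Matrix.diagonal_mul ..

lemma mul_diagHom_apply (a : A) (M : CStarMatrix n n A) (i j : n) :
    (M * diagHom A n a) i j = M i j * a := Matrix.mul_diagonal ..

lemma matUnit_injective (i j : n) : Function.Injective (matUnit i j : A → CStarMatrix n n A) :=
  fun a b h => by simpa [matUnit_apply] using congrFun (congrFun h i) j

lemma continuous_matUnit (i j : n) : Continuous (matUnit i j : A → CStarMatrix n n A) :=
  continuous_pi fun k => continuous_pi fun l => by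
    have : (fun a : A => matUnit i j a k l) = fun a => if i = k ∧ j = l then a else 0 :=
      funext fun a => matUnit_apply i j a k l
    rw [this]
    split_ifs <;> fun_prop

lemma matUnit_mul_mul_matUnit (i j k l : n) (a b : A) (M : CStarMatrix n n A) :
    matUnit i j a * M * matUnit k l b = matUnit i l (a * M j k * b) := by
  conv_lhs => rw [sum_matUnit M]
  simp only [Finset.mul_sum, Finset.sum_mul, matUnit_mul_matUnit]
  rw [Finset.sum_eq_single j, Finset.sum_eq_single k]
  · simp [matUnit_mul_matUnit]
  · intro q _ hq
    simp [matUnit_mul_matUnit, hq]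
  · simp
  · intro p _ hp
    exact Finset.sum_eq_zero fun q _ => by rw [if_neg (Ne.symm hp), zero_mul]
  · simp

lemma herEmb_cornerHom (i : n) : HerEmb (cornerHom A i) where
  inj := matUnit_injective i i
  sandwich b b' M := ⟨b * M i i * b', (matUnit_mul_mul_matUnit i i i i b b' M).symm⟩

lemma map_matUnit (φ : A →⋆ₙₐ[ℂ] B) (i j : n) (a : A) :
    CStarMatrix.mapₙₐ φ (matUnit i j a) = matUnit i j (φ a) := by
  ext p q
  change φ (matUnit i j a p q) = _
  rw [matUnit_apply, matUnit_apply]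
  split_ifs <;> simp

lemma mapₙₐ_injective {φ : A →⋆ₙₐ[ℂ] B} (hφ : Function.Injective φ) :
    Function.Injective (CStarMatrix.mapₙₐ φ : CStarMatrix n n A →⋆ₙₐ[ℂ] CStarMatrix n n B) :=
  CStarMatrix.map_injective hφ

lemma HerEmb.mapₙₐ {ι : B →⋆ₙₐ[ℂ] A} (hι : HerEmb ι) :
    HerEmb (CStarMatrix.mapₙₐ ι : CStarMatrix n n B →⋆ₙₐ[ℂ] CStarMatrix n n A) where
  inj := mapₙₐ_injective hι.inj
  sandwich b b' M := by
    choose c hc using hι.sandwich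
    refine ⟨CStarMatrix.ofMatrix (Matrix.of fun i j =>
      ∑ l, ∑ k, c (b i k) (b' l j) (M k l)), ?_⟩
    ext i j
    rw [CStarMatrix.mul_apply_apply]
    change ι (∑ l, ∑ k, _) = _
    simp only [map_sum, hc, CStarMatrix.mul_apply_apply, Finset.sum_mul]
    rfl

/-- The elements of A whose (i, i) corner lies in the ideal form a closed ideal containing S, hence
everything. Other positions are reached by multiplying with matrix units, and an approximate unit
replaces the missing identity entries. -/
lemma closedIdeal_matrix {S : Set A} (hS : closedIdeal S = ⊤) {T : Set (CStarMatrix n n A)} (i : n)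
    (h : ∀ s ∈ S, matUnit i i s ∈ T) : closedIdeal T = ⊤ := by
  have h1 : closedIdeal S ≤ comapIdeal (cornerHom A i) (closedIdeal T) :=
    closedIdeal_le (isIdeal_comapIdeal _ (isIdeal_closedIdeal T))
      (isClosed_comapIdeal _ (isClosed_closedIdeal T)) fun s hs => mem_closedIdeal (h s hs)
  rw [hS] at h1
  refine Submodule.eq_top_iff'.2 fun M => ?_
  have h2 : ∀ p q (a b c : A), matUnit p q (a * b * c) ∈ closedIdeal T := fun p q a b c => by
    have h3 : matUnit i i b ∈ closedIdeal T := h1 (Submodule.mem_top (x := b))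
    have h4 := (isIdeal_closedIdeal T _ (isIdeal_closedIdeal T _ h3 (matUnit p i a)).1
      (matUnit i q c)).2
    rwa [matUnit_mul_matUnit, if_pos rfl, matUnit_mul_matUnit, if_pos rfl] at h4
  rw [sum_matUnit M]
  refine Submodule.sum_mem _ fun p _ => Submodule.sum_mem _ fun q _ => ?_
  refine (isClosed_closedIdeal T).closure_subset (mem_closure_of_tendsto
    (f := fun e : A => matUnit p q (e * M p q * e)) (b := CStarAlgebra.approximateUnit A)
    ((continuous_matUnit p q).continuousAt.tendsto.comp (tendsto_approximateUnit_conj _))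
    (Eventually.of_forall fun e => h2 p q _ _ _))

lemma closedIdeal_range_mapₙₐ [Nonempty n] {ι : B →⋆ₙₐ[ℂ] A} (h : closedIdeal (Set.range ι) = ⊤) :
    closedIdeal (Set.range (CStarMatrix.mapₙₐ ι : CStarMatrix n n B →⋆ₙₐ[ℂ] CStarMatrix n n A)) = ⊤ := by
  refine closedIdeal_matrix h (Classical.arbitrary n) ?_
  rintro _ ⟨b, rfl⟩
  exact ⟨matUnit _ _ b, map_matUnit ι _ _ b⟩

end MatrixAlgebra

/-! ### Completely positive contractions, their compressions and amplifications. -/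

section CompletelyPositive

set_option linter.unusedSectionVars false

attribute [local instance] CStarAlgebra.spectralOrder CStarAlgebra.spectralOrderedRing

variable {A B C : Type*} [NonUnitalCStarAlgebra A] [NonUnitalCStarAlgebra B]
  [NonUnitalCStarAlgebra C]

lemma exists_eq_star_mul_self {a : A} (ha : 0 ≤ a) : ∃ x, a = star x * x :=
  CStarAlgebra.nonneg_iff_eq_star_mul_self.1 ha

/-- Complete positivity of a linear map. -/
def IsCP (φ : A →ₗ[ℂ] B) : Prop :=
  ∀ (k : ℕ) (M : CStarMatrix (Fin k) (Fin k) A), 0 ≤ M → 0 ≤ M.map φ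

lemma isCPC_iff {φ : A →ₗ[ℂ] B} : IsCPC φ ↔ IsCP φ ∧ ∀ x, ‖φ x‖ ≤ ‖x‖ := by
  refine and_congr_left fun _ => ⟨?_, fun h => ⟨⟨φ, h⟩, rfl⟩⟩
  rintro ⟨Φ, rfl⟩
  exact Φ.map_cstarMatrix_nonneg'

lemma IsCP.map_nonneg {n : Type*} [Fintype n] {φ : A →ₗ[ℂ] B} (h : IsCP φ) {M : CStarMatrix n n A}
    (hM : 0 ≤ M) : 0 ≤ M.map φ :=
  CompletelyPositiveMap.map_cstarMatrix_nonneg ⟨φ, h⟩ M hM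

lemma IsCP.nonneg {φ : A →ₗ[ℂ] B} (h : IsCP φ) {a : A} (ha : 0 ≤ a) : 0 ≤ φ a := by
  have h1 := h.map_nonneg (map_nonneg_hom (cornerHom A (0 : Fin 1)) ha)
  refine nonneg_of_map_nonneg (cornerHom B (0 : Fin 1)) (matUnit_injective 0 0) ?_
  convert h1 using 1
  ext i j
  simp [cornerHom_apply, matUnit_apply, Subsingleton.elim i 0, Subsingleton.elim j 0]

lemma IsCP.comp {ψ : B →ₗ[ℂ] C} {φ : A →ₗ[ℂ] B} (hψ : IsCP ψ) (hφ : IsCP φ) : IsCP (ψ ∘ₗ φ) :=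
  fun k M hM => hψ k _ (hφ k M hM)

lemma IsCPC.comp {ψ : B →ₗ[ℂ] C} {φ : A →ₗ[ℂ] B} (hψ : IsCPC ψ) (hφ : IsCPC φ) : IsCPC (ψ ∘ₗ φ) :=
  isCPC_iff.2 ⟨(isCPC_iff.1 hψ).1.comp (isCPC_iff.1 hφ).1, fun x => (hψ.2 _).trans (hφ.2 x)⟩

/-- A ⋆-homomorphism as a linear map. -/
def homLin (φ : A →⋆ₙₐ[ℂ] B) : A →ₗ[ℂ] B := LinearMapClass.linearMap φ

@[simp] lemma homLin_apply (φ : A →⋆ₙₐ[ℂ] B) (a : A) : homLin φ a = φ a := rfl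

lemma isCPC_homLin (φ : A →⋆ₙₐ[ℂ] B) : IsCPC (homLin φ) :=
  isCPC_iff.2 ⟨fun _ _ hM => map_nonneg_hom (CStarMatrix.mapₙₐ φ) hM, norm_hom_le φ⟩

/-- The map `x ↦ w * x * star w`. -/
def conjLin (w : A) : A →ₗ[ℂ] A := LinearMap.mulLeft ℂ w ∘ₗ LinearMap.mulRight ℂ (star w)

@[simp] lemma conjLin_apply (w a : A) : conjLin w a = w * a * star w := (mul_assoc w a (star w)).symm

lemma isCPC_conjLin {w : A} (hw : ‖w‖ ≤ 1) : IsCPC (conjLin w) := by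
  refine isCPC_iff.2 ⟨fun k M hM => ?_, fun x => ?_⟩
  · have : M.map (conjLin w) = diagHom A (Fin k) w * M * star (diagHom A (Fin k) w) := by
      ext i j
      rw [← map_star, mul_diagHom_apply, diagHom_mul_apply]
      exact conjLin_apply w _
    rw [this]
    exact star_right_conjugate_nonneg hM _
  · rw [conjLin_apply]
    calc _ ≤ ‖w‖ * ‖x‖ * ‖star w‖ := norm_mul₃_le
      _ ≤ 1 * ‖x‖ * 1 := by rw [norm_star]; gcongr
      _ = ‖x‖ := by ring

lemma exists_linear_factor {j : B →⋆ₙₐ[ℂ] C} (hj : Function.Injective j) (φ : A →ₗ[ℂ] C)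
    (h : ∀ x, φ x ∈ Set.range j) : ∃ ψ : A →ₗ[ℂ] B, ∀ x, j (ψ x) = φ x := by
  choose f hf using h
  exact ⟨{ toFun := f
           map_add' := fun x y => hj (by simp [hf])
           map_smul' := fun c x => hj (by simp [hf]) }, hf⟩

lemma IsCPC.of_comp {j : B →⋆ₙₐ[ℂ] C} (hj : Function.Injective j) {ψ : A →ₗ[ℂ] B} {φ : A →ₗ[ℂ] C}
    (h : IsCPC φ) (hψ : ∀ x, j (ψ x) = φ x) : IsCPC ψ := by
  refine isCPC_iff.2 ⟨fun k M hM => ?_, fun x => ?_⟩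
  · refine nonneg_of_map_nonneg (CStarMatrix.mapₙₐ j) (mapₙₐ_injective hj) ?_
    convert (isCPC_iff.1 h).1 k M hM using 1
    ext p q
    exact hψ _
  · rw [← NonUnitalStarAlgHom.norm_map j hj, hψ]
    exact h.2 x

/-- Writing M = T⋆T, the entries of M are the products Sᵢ⋆ Sⱼ of the columns of T, so this is
submultiplicativity of the norm. -/
lemma norm_sq_offDiag_le {M : CStarMatrix (Fin 2) (Fin 2) A} (hM : 0 ≤ M) :
    ‖M 0 1‖ ^ 2 ≤ ‖M 0 0‖ * ‖M 1 1‖ := by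
  obtain ⟨T, rfl⟩ := exists_eq_star_mul_self hM
  let S : Fin 2 → CStarMatrix (Fin 2) (Fin 2) A := fun j => matUnit 0 0 (T 0 j) + matUnit 1 0 (T 1 j)
  have hS : ∀ i j, star (S i) * S j = matUnit 0 0 ((star T * T) i j) := fun i j => by
    rw [CStarMatrix.mul_apply_apply, Fin.sum_univ_two, CStarMatrix.star_apply, CStarMatrix.star_apply,
      matUnit_add]
    simp [S, star_add, star_matUnit, add_mul, mul_add, matUnit_mul_matUnit]
  have hn : ∀ a : A, ‖(matUnit 0 0 a : CStarMatrix (Fin 2) (Fin 2) A)‖ = ‖a‖ := fun a =>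
    NonUnitalStarAlgHom.norm_map (cornerHom A (0 : Fin 2)) (matUnit_injective 0 0) a
  have h1 : ∀ i, ‖S i‖ * ‖S i‖ = ‖(star T * T) i i‖ := fun i => by
    rw [← CStarRing.norm_star_mul_self, hS, hn]
  have h2 : ‖(star T * T) 0 1‖ ≤ ‖S 0‖ * ‖S 1‖ := by
    rw [← hn, ← hS]
    exact (norm_mul_le _ _).trans_eq (by rw [norm_star])
  calc _ ≤ (‖S 0‖ * ‖S 1‖) ^ 2 := by gcongr
    _ = (‖S 0‖ * ‖S 0‖) * (‖S 1‖ * ‖S 1‖) := by ring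
    _ = _ := by rw [h1, h1]

/-- The Cauchy–Schwarz inequality for completely positive maps, read off from the positive matrix
T⋆T of the row T = (x, y). -/
lemma IsCP.norm_sq_le {φ : A →ₗ[ℂ] B} (h : IsCP φ) (x y : A) :
    ‖φ (star x * y)‖ ^ 2 ≤ ‖φ (star x * x)‖ * ‖φ (star y * y)‖ := by
  let T : CStarMatrix (Fin 2) (Fin 2) A := matUnit 0 0 x + matUnit 0 1 y
  have hT := norm_sq_offDiag_le (h.map_nonneg (star_mul_self_nonneg T))
  have e : star T * T = matUnit 0 0 (star x * x) + matUnit 1 0 (star y * x) +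
      (matUnit 0 1 (star x * y) + matUnit 1 1 (star y * y)) := by
    simp [T, star_add, star_matUnit, add_mul, mul_add, matUnit_mul_matUnit]
  simpa [CStarMatrix.map_apply, e, CStarMatrix.add_apply, matUnit_apply] using hT

/-- Cauchy–Schwarz for e and x e, together with e x⋆x e ≤ ‖x‖² e². It replaces the bound by the
value at the unit in the nonunital setting. -/
lemma IsCP.norm_conj_le {φ : A →ₗ[ℂ] B} (h : IsCP φ) {e : A} (he : IsSelfAdjoint e) (x : A)
    (he1 : ‖φ (e * e)‖ ≤ 1) : ‖φ (e * x * e)‖ ≤ ‖x‖ := by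
  have h1 := h.norm_sq_le e (x * e)
  rw [he.star_eq, ← mul_assoc] at h1
  have h2 : ‖φ (star (x * e) * (x * e))‖ ≤ ‖x‖ ^ 2 := by
    have h3 : star (x * e) * (x * e) ≤ ‖x‖ ^ 2 • (e * e) := by
      have := CStarAlgebra.star_left_conjugate_le_norm_smul (a := e) (b := star x * x)
        (IsSelfAdjoint.star_mul_self x)
      rw [CStarRing.norm_star_mul_self, ← sq, he.star_eq] at this
      rw [star_mul, he.star_eq]
      simpa only [mul_assoc] using this
    have h4 : φ (star (x * e) * (x * e)) ≤ φ (‖x‖ ^ 2 • (e * e)) := by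
      rw [← sub_nonneg, ← map_sub]
      exact h.nonneg (sub_nonneg.2 h3)
    have h5 : φ (‖x‖ ^ 2 • (e * e)) = ‖x‖ ^ 2 • φ (e * e) := by
      rw [← Complex.coe_smul, map_smul, Complex.coe_smul]
    refine (CStarAlgebra.norm_le_norm_of_nonneg_of_le (h.nonneg (star_mul_self_nonneg _)) h4).trans ?_
    rw [h5, norm_smul, Real.norm_of_nonneg (by positivity)]
    exact mul_le_of_le_one_right (by positivity) he1
  refine le_of_sq_le_sq (h1.trans ?_) (norm_nonneg _)
  calc _ ≤ 1 * ‖x‖ ^ 2 := by gcongr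
    _ = _ := one_mul _

variable {n : ℕ}

/-- Entrywise application of a linear map. -/
def mapLin (n : ℕ) (φ : A →ₗ[ℂ] B) :
    CStarMatrix (Fin n) (Fin n) A →ₗ[ℂ] CStarMatrix (Fin n) (Fin n) B := CStarMatrix.mapₗ φ

lemma mapLin_apply_apply (φ : A →ₗ[ℂ] B) (M : CStarMatrix (Fin n) (Fin n) A) (i j : Fin n) :
    mapLin n φ M i j = φ (M i j) := rfl

/-- Flattening a matrix of matrices. -/
def flattenHom (A : Type*) [NonUnitalCStarAlgebra A] (k n : ℕ) :
    CStarMatrix (Fin k) (Fin k) (CStarMatrix (Fin n) (Fin n) A) →⋆ₙₐ[ℂ]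
      CStarMatrix (Fin k × Fin n) (Fin k × Fin n) A where
  toFun M := CStarMatrix.ofMatrix (Matrix.of fun p q => M p.1 q.1 p.2 q.2)
  map_smul' _ _ := rfl
  map_zero' := rfl
  map_add' _ _ := rfl
  map_mul' M N := by
    ext p q
    rw [CStarMatrix.mul_apply_apply]
    change (M * N) p.1 q.1 p.2 q.2 = ∑ r : Fin k × Fin n, M p.1 r.1 p.2 r.2 * N r.1 q.1 r.2 q.2
    rw [CStarMatrix.mul_apply_apply, CStarMatrix.sum_apply, Fintype.sum_prod_type]
    exact Finset.sum_congr rfl fun i _ => CStarMatrix.mul_apply_apply _ _ _ _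
  map_star' M := by
    ext p q
    change star M p.1 q.1 p.2 q.2 = star (M q.1 p.1 q.2 p.2)
    rw [CStarMatrix.star_apply, CStarMatrix.star_apply]

lemma flattenHom_injective (A : Type*) [NonUnitalCStarAlgebra A] (k n : ℕ) :
    Function.Injective (flattenHom A k n) := fun M N h => by
  ext i j p q
  exact congrFun (congrFun h (i, p)) (j, q)

lemma IsCP.mapLin {φ : A →ₗ[ℂ] B} (h : IsCP φ) (n : ℕ) : IsCP (mapLin n φ) := fun k M hM => by
  refine nonneg_of_map_nonneg (flattenHom B k n) (flattenHom_injective B k n) ?_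
  convert h.map_nonneg (map_nonneg_hom (flattenHom A k n) hM) using 1
  rfl

lemma continuous_of_norm_le {φ : A →ₗ[ℂ] B} (h : ∀ x, ‖φ x‖ ≤ ‖x‖) : Continuous φ :=
  AddMonoidHomClass.continuous_of_bound φ 1 fun x => by simpa using h x

/-- For contractivity compress by diag(e) with e an approximate unit: the amplified map sends
diag(e²) to diag(φ(e²)), of norm at most 1, so `IsCP.norm_conj_le` applies before passing to the
limit. -/
lemma IsCPC.mapLin {φ : A →ₗ[ℂ] B} (h : IsCPC φ) (n : ℕ) : IsCPC (mapLin n φ) := by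
  obtain ⟨hcp, hn⟩ := isCPC_iff.1 h
  refine isCPC_iff.2 ⟨hcp.mapLin n, fun M => ?_⟩
  have hu := CStarAlgebra.increasingApproximateUnit (A := A)
  have hlim : Tendsto (fun e => GTR.mapLin n φ (diagHom A (Fin n) e * M * diagHom A (Fin n) e))
      (CStarAlgebra.approximateUnit A) (𝓝 (GTR.mapLin n φ M)) := by
    refine CStarMatrix.tendsto_iff.2 fun i j => ?_
    simp only [mapLin_apply_apply, mul_diagHom_apply, diagHom_mul_apply]
    exact ((continuous_of_norm_le hn).tendsto _).comp (tendsto_approximateUnit_conj (M i j))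
  refine le_of_tendsto hlim.norm ?_
  filter_upwards [hu.eventually_norm, hu.eventually_nonneg] with e he he0
  refine (hcp.mapLin n).norm_conj_le ?_ M ?_
  · rw [IsSelfAdjoint, ← map_star, (IsSelfAdjoint.of_nonneg he0).star_eq]
  · have : GTR.mapLin n φ (diagHom A (Fin n) e * diagHom A (Fin n) e) =
        diagHom B (Fin n) (φ (e * e)) := by
      ext i j
      rw [← map_mul, mapLin_apply_apply, diagHom_apply_apply, diagHom_apply_apply]
      split_ifs <;> simp
    rw [this]
    calc _ ≤ ‖φ (e * e)‖ := norm_hom_le _ _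
      _ ≤ ‖e‖ * ‖e‖ := (hn _).trans (norm_mul_le _ _)
      _ ≤ 1 * 1 := by gcongr
      _ = 1 := one_mul 1

end CompletelyPositive

/-! ### Vanishing of K₁ expressed through matrices over the algebra itself. -/

section KOne

variable {A B : Type*} [NonUnitalCStarAlgebra A] [NonUnitalCStarAlgebra B]

/-- The matrices `X` over `A` for which `1 + X` is unitary. -/
def quasiUnitary (A : Type*) [NonUnitalCStarAlgebra A] (N : ℕ) : Set (Matrix (Fin N) (Fin N) A) :=
  {X | Xᴴ * X + X + Xᴴ = 0 ∧ X * Xᴴ + X + Xᴴ = 0}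

/-- The matrix `diag(X, 0)` of size `k`. -/
def pad {R : Type*} [Zero R] {n : ℕ} (k : ℕ) (X : Matrix (Fin n) (Fin n) R) :
    Matrix (Fin k) (Fin k) R :=
  fun i j => if h : (i : ℕ) < n ∧ (j : ℕ) < n then X ⟨i, h.1⟩ ⟨j, h.2⟩ else 0

lemma pad_pad {R : Type*} [Zero R] {n k l : ℕ} (h : n ≤ k) (X : Matrix (Fin n) (Fin n) R) :
    pad l (pad k X) = pad l X := by
  ext i j
  simp only [pad]
  grind

lemma continuous_pad {R : Type*} [Zero R] [TopologicalSpace R] {n k : ℕ} :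
    Continuous (pad k : Matrix (Fin n) (Fin n) R → Matrix (Fin k) (Fin k) R) := by
  refine continuous_matrix fun i j => ?_
  unfold pad
  split_ifs
  · exact continuous_id.matrix_elem _ _
  · exact continuous_const

/-- Matrices over `A` as matrices over the unitization. -/
def inrMat {N : ℕ} (X : Matrix (Fin N) (Fin N) A) : Matrix (Fin N) (Fin N) (Unitization ℂ A) :=
  X.map (Unitization.inrNonUnitalStarAlgHom ℂ A)

/-- Scalar matrices as matrices over the unitization. -/
def inlMat (A : Type*) [NonUnitalCStarAlgebra A] {N : ℕ} (s : Matrix (Fin N) (Fin N) ℂ) :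
    Matrix (Fin N) (Fin N) (Unitization ℂ A) := s.map (algebraMap ℂ (Unitization ℂ A))

/-- The scalar part of a matrix over the unitization. -/
def fstMat {N : ℕ} (W : Matrix (Fin N) (Fin N) (Unitization ℂ A)) : Matrix (Fin N) (Fin N) ℂ :=
  W.map (augmentation A)

/-- The non-scalar part of a matrix over the unitization. -/
def sndMat {N : ℕ} (W : Matrix (Fin N) (Fin N) (Unitization ℂ A)) : Matrix (Fin N) (Fin N) A :=
  W.map fun x => x.snd

variable {N : ℕ}

lemma inrMat_add (X Y : Matrix (Fin N) (Fin N) A) : inrMat (X + Y) = inrMat X + inrMat Y :=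
  Matrix.map_add _ (map_add _) X Y

lemma inrMat_mul (X Y : Matrix (Fin N) (Fin N) A) : inrMat (X * Y) = inrMat X * inrMat Y :=
  Matrix.map_mul

lemma inrMat_conjTranspose (X : Matrix (Fin N) (Fin N) A) : inrMat Xᴴ = (inrMat X)ᴴ :=
  conjTranspose_map _ (map_star _)

lemma inrMat_injective : Function.Injective (inrMat : Matrix (Fin N) (Fin N) A → _) :=
  Matrix.map_injective Unitization.inr_injective

@[simp] lemma inrMat_zero : inrMat (0 : Matrix (Fin N) (Fin N) A) = 0 :=
  Matrix.map_zero _ (map_zero _)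

lemma inlMat_mul (s t : Matrix (Fin N) (Fin N) ℂ) : inlMat A (s * t) = inlMat A s * inlMat A t :=
  Matrix.map_mul

lemma inlMat_conjTranspose (s : Matrix (Fin N) (Fin N) ℂ) : inlMat A sᴴ = (inlMat A s)ᴴ :=
  conjTranspose_map _ fun z => algebraMap_star_comm z

@[simp] lemma inlMat_one : inlMat A (1 : Matrix (Fin N) (Fin N) ℂ) = 1 :=
  Matrix.map_one _ (map_zero _) (map_one _)

lemma fstMat_mul (V W : Matrix (Fin N) (Fin N) (Unitization ℂ A)) :
    fstMat (V * W) = fstMat V * fstMat W := Matrix.map_mul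

lemma fstMat_conjTranspose (W : Matrix (Fin N) (Fin N) (Unitization ℂ A)) :
    fstMat Wᴴ = (fstMat W)ᴴ := conjTranspose_map _ fun z => augmentation_star A z

@[simp] lemma fstMat_one : fstMat (1 : Matrix (Fin N) (Fin N) (Unitization ℂ A)) = 1 :=
  Matrix.map_one _ (map_zero _) (map_one _)

lemma fstMat_inlMat (s : Matrix (Fin N) (Fin N) ℂ) : fstMat (inlMat A s) = s := by
  ext i j; rfl

lemma fstMat_one_add_inrMat (X : Matrix (Fin N) (Fin N) A) : fstMat (1 + inrMat X) = 1 := by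
  rw [fstMat, Matrix.map_add _ (map_add _)]
  change fstMat 1 + _ = 1
  rw [fstMat_one, add_eq_left]
  ext i j; rfl

lemma one_add_inrMat_sndMat {W : Matrix (Fin N) (Fin N) (Unitization ℂ A)} (h : fstMat W = 1) :
    1 + inrMat (sndMat W) = W := by
  ext1 i j
  have h1 : (W i j).fst = (1 : Matrix (Fin N) (Fin N) ℂ) i j := congrFun (congrFun h i) j
  change (1 : Matrix (Fin N) (Fin N) (Unitization ℂ A)) i j + Unitization.inr (W i j).snd = W i j
  rw [Matrix.one_apply] at h1 ⊢
  refine Unitization.ext ?_ ?_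
  · rw [h1, Unitization.fst_add, Unitization.fst_inr]
    split_ifs <;> simp
  · rw [Unitization.snd_add, Unitization.snd_inr]
    split_ifs <;> simp

lemma sndMat_one_add_inrMat (X : Matrix (Fin N) (Fin N) A) : sndMat (1 + inrMat X) = X := by
  ext1 i j
  change ((1 : Matrix (Fin N) (Fin N) (Unitization ℂ A)) i j + Unitization.inr (X i j)).snd = X i j
  rw [Matrix.one_apply, Unitization.snd_add, Unitization.snd_inr]
  split_ifs <;> simp

lemma mem_quasiUnitary_iff {X : Matrix (Fin N) (Fin N) A} :
    X ∈ quasiUnitary A N ↔ 1 + inrMat X ∈ unitary (Matrix (Fin N) (Fin N) (Unitization ℂ A)) := by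
  rw [Unitary.mem_iff, star_eq_conjTranspose, conjTranspose_add, conjTranspose_one]
  have h1 : (1 + (inrMat X)ᴴ) * (1 + inrMat X) = 1 + inrMat (Xᴴ * X + X + Xᴴ) := by
    rw [inrMat_add, inrMat_add, inrMat_mul, inrMat_conjTranspose]
    noncomm_ring
  have h2 : (1 + inrMat X) * (1 + (inrMat X)ᴴ) = 1 + inrMat (X * Xᴴ + X + Xᴴ) := by
    rw [inrMat_add, inrMat_add, inrMat_mul, inrMat_conjTranspose]
    noncomm_ring
  rw [h1, h2, add_eq_left, add_eq_left]
  refine and_congr ?_ ?_ <;>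
  · rw [← inrMat_zero]; exact inrMat_injective.eq_iff.symm

lemma stab_one_add_inrMat {k : ℕ} (X : Matrix (Fin N) (Fin N) A) :
    stab k (1 + inrMat X) = 1 + inrMat (pad k X) := by
  ext1 i j
  simp only [stab, pad, inrMat, Matrix.add_apply, Matrix.map_apply, Matrix.one_apply, Fin.ext_iff]
  split_ifs <;> simp_all

lemma stab_inlMat {k : ℕ} (s : Matrix (Fin N) (Fin N) ℂ) :
    stab k (inlMat A s) = inlMat A (stab k s) := by
  ext1 i j
  simp only [stab, inlMat, Matrix.map_apply]
  split_ifs <;> simp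

lemma stab_mul {R : Type*} [Ring R] {k : ℕ} (h : N ≤ k) (u v : Matrix (Fin N) (Fin N) R) :
    stab k (u * v) = stab k u * stab k v := by
  obtain ⟨r, rfl⟩ := Nat.exists_eq_add_of_le h
  rw [stab_eq_diagSum, stab_eq_diagSum, stab_eq_diagSum, diagSum_mul, one_mul]

lemma mem_unitary_map {R S : Type*} [Ring R] [StarRing R] [Ring S] [StarRing S]
    {f : Matrix (Fin N) (Fin N) R → Matrix (Fin N) (Fin N) S} (hm : ∀ u v, f (u * v) = f u * f v)
    (hs : ∀ u, f uᴴ = (f u)ᴴ) (h1 : f 1 = 1) {u : Matrix (Fin N) (Fin N) R}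
    (hu : u ∈ unitary (Matrix (Fin N) (Fin N) R)) : f u ∈ unitary (Matrix (Fin N) (Fin N) S) := by
  rw [Unitary.mem_iff, star_eq_conjTranspose] at hu ⊢
  rw [← hs, ← hm, ← hm, hu.1, hu.2, h1]
  exact ⟨rfl, rfl⟩

lemma joinedIn_of_subsingleton_K1 (h : Subsingleton (K1 A))
    {u : Matrix (Fin N) (Fin N) (Unitization ℂ A)}
    (hu : u ∈ unitary (Matrix (Fin N) (Fin N) (Unitization ℂ A))) :
    ∃ k, N ≤ k ∧ JoinedIn (unitary (Matrix (Fin k) (Fin k) (Unitization ℂ A)) :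
      Set (Matrix (Fin k) (Fin k) (Unitization ℂ A))) (stab k u) 1 := by
  have := Quotient.exact (s := MatUnitary.setoid (R := Unitization ℂ A))
    (@Subsingleton.elim (K1 A) h (Quotient.mk _ ⟨N, u, hu⟩)
    (Quotient.mk _ ⟨0, 1, one_mem _⟩))
  obtain ⟨k, hk, -, hj⟩ := this
  refine ⟨k, hk, ?_⟩
  -- The base point is the empty unitary, which `stab k` turns into the identity of size k.
  convert hj using 1
  ext1 i j
  simp [stab, Matrix.one_apply]

/-- Each unitary W on the path is multiplied by the adjoint of its own scalar part. The result has
scalar part 1, so the path stays of the form 1 + Y with Y over A, and the endpoints do not change.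
-/
lemma joinedIn_quasiUnitary_of_subsingleton_K1 (h : Subsingleton (K1 A))
    {X : Matrix (Fin N) (Fin N) A} (hX : X ∈ quasiUnitary A N) :
    ∃ k, N ≤ k ∧ JoinedIn (quasiUnitary A k) (pad k X) 0 := by
  obtain ⟨k, hk, hj⟩ := joinedIn_of_subsingleton_K1 h (mem_quasiUnitary_iff.1 hX)
  refine ⟨k, hk, ?_⟩
  let f : Matrix (Fin k) (Fin k) (Unitization ℂ A) → Matrix (Fin k) (Fin k) A := fun W =>
    sndMat (W * (inlMat A (fstMat W))ᴴ)
  have hf : Continuous f := by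
    have h1 : Continuous fun W : Matrix (Fin k) (Fin k) (Unitization ℂ A) => inlMat A (fstMat W) :=
      continuous_matrix fun i j =>
        ((continuous_algebraMap ℂ (Unitization ℂ A)).comp Unitization.continuous_fst).comp
          (continuous_id.matrix_elem i j)
    have h2 : Continuous fun W : Matrix (Fin k) (Fin k) (Unitization ℂ A) =>
      W * (inlMat A (fstMat W))ᴴ := continuous_id.matrix_mul h1.matrix_conjTranspose
    exact continuous_matrix fun i j => Unitization.continuous_snd.comp (h2.matrix_elem i j)
  have h3 := (hj.map_continuousOn hf.continuousOn).mono (V := quasiUnitary A k) (by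
    rintro _ ⟨W, hW, rfl⟩
    have h4 : inlMat A (fstMat W) ∈ unitary (Matrix (Fin k) (Fin k) (Unitization ℂ A)) :=
      mem_unitary_map inlMat_mul inlMat_conjTranspose inlMat_one
        (mem_unitary_map fstMat_mul fstMat_conjTranspose fstMat_one hW)
    have h5 : fstMat (W * (inlMat A (fstMat W))ᴴ) = 1 := by
      rw [fstMat_mul, fstMat_conjTranspose, fstMat_inlMat]
      exact (Unitary.mem_iff.1 (mem_unitary_map fstMat_mul fstMat_conjTranspose fstMat_one hW)).2
    rw [mem_quasiUnitary_iff, one_add_inrMat_sndMat h5]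
    exact mul_mem hW (Unitary.star_mem h4))
  have e1 : f (stab k (1 + inrMat X)) = pad k X := by
    simp only [f]
    rw [stab_one_add_inrMat, fstMat_one_add_inrMat, inlMat_one, conjTranspose_one, mul_one,
      sndMat_one_add_inrMat]
  have e2 : f 1 = 0 := by
    simp only [f]
    rw [fstMat_one, inlMat_one, conjTranspose_one, mul_one, ← add_zero 1, ← inrMat_zero,
      sndMat_one_add_inrMat]
  rwa [e1, e2] at h3

/-- The augmentation maps a path over the unitization to a path of scalar unitaries. This supplies
the scalar hypothesis of `subsingleton_K1_of_joinedIn` without any appeal to connectedness of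
unitary groups. -/
lemma joinedIn_scalar_of_subsingleton_K1 (h : Subsingleton (K1 A))
    {s : Matrix (Fin N) (Fin N) ℂ} (hs : s ∈ unitary (Matrix (Fin N) (Fin N) ℂ)) :
    ∃ k, N ≤ k ∧ JoinedIn (unitary (Matrix (Fin k) (Fin k) ℂ) : Set (Matrix (Fin k) (Fin k) ℂ))
      (stab k s) 1 := by
  obtain ⟨k, hk, hj⟩ := joinedIn_of_subsingleton_K1 h
    (mem_unitary_map (inlMat_mul (A := A)) inlMat_conjTranspose inlMat_one hs)
  refine ⟨k, hk, ?_⟩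
  have hf : Continuous (fstMat : Matrix (Fin k) (Fin k) (Unitization ℂ A) → _) :=
    continuous_matrix fun i j => Unitization.continuous_fst.comp (continuous_id.matrix_elem i j)
  have h3 := (hj.map_continuousOn hf.continuousOn).mono
    (V := (unitary (Matrix (Fin k) (Fin k) ℂ) : Set (Matrix (Fin k) (Fin k) ℂ))) (by
      rintro _ ⟨W, hW, rfl⟩
      exact mem_unitary_map fstMat_mul fstMat_conjTranspose fstMat_one hW)
  rwa [stab_inlMat, fstMat_inlMat, fstMat_one] at h3

/-- A unitary over the unitization factors as (1 + X) s with s its scalar part; the two factors are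
contracted one after the other. -/
lemma subsingleton_K1_of_joinedIn
    (h1 : ∀ (N : ℕ) (X : Matrix (Fin N) (Fin N) A), X ∈ quasiUnitary A N →
      ∃ k, N ≤ k ∧ JoinedIn (quasiUnitary A k) (pad k X) 0)
    (h2 : ∀ (N : ℕ) (s : Matrix (Fin N) (Fin N) ℂ), s ∈ unitary (Matrix (Fin N) (Fin N) ℂ) →
      ∃ k, N ≤ k ∧ JoinedIn (unitary (Matrix (Fin k) (Fin k) ℂ) : Set (Matrix (Fin k) (Fin k) ℂ))
        (stab k s) 1) : Subsingleton (K1 A) := by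
  have key : ∀ u : MatUnitary (Unitization ℂ A),
      (Quotient.mk (MatUnitary.setoid (R := Unitization ℂ A)) u) = Quotient.mk _ ⟨0, 1, one_mem _⟩ := by
    rintro ⟨N, u, hu⟩
    have hs : fstMat u ∈ unitary (Matrix (Fin N) (Fin N) ℂ) :=
      mem_unitary_map fstMat_mul fstMat_conjTranspose fstMat_one hu
    have his : inlMat A (fstMat u) ∈ unitary (Matrix (Fin N) (Fin N) (Unitization ℂ A)) :=
      mem_unitary_map inlMat_mul inlMat_conjTranspose inlMat_one hs
    have hv : fstMat (u * (inlMat A (fstMat u))ᴴ) = 1 := by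
      rw [fstMat_mul, fstMat_conjTranspose, fstMat_inlMat]
      exact (Unitary.mem_iff.1 hs).2
    have hX : sndMat (u * (inlMat A (fstMat u))ᴴ) ∈ quasiUnitary A N := by
      rw [mem_quasiUnitary_iff, one_add_inrMat_sndMat hv]
      exact mul_mem hu (Unitary.star_mem his)
    have hu' : (1 + inrMat (sndMat (u * (inlMat A (fstMat u))ᴴ))) * inlMat A (fstMat u) = u := by
      rw [one_add_inrMat_sndMat hv, Matrix.mul_assoc, ← star_eq_conjTranspose,
        (Unitary.mem_iff.1 his).1, mul_one]
    set X := sndMat (u * (inlMat A (fstMat u))ᴴ)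
    obtain ⟨k, hk, hj⟩ := h1 N X hX
    obtain ⟨l, hl, hj'⟩ := h2 N _ hs
    refine (Quotient.sound (s := MatUnitary.setoid (R := Unitization ℂ A))
      (b := ⟨N, inlMat A (fstMat u), his⟩) ⟨k, hk, hk, ?_⟩).trans
      (Quotient.sound (s := MatUnitary.setoid (R := Unitization ℂ A)) ⟨l, hl, Nat.zero_le l, ?_⟩)
    · have hf : Continuous fun Y : Matrix (Fin k) (Fin k) A =>
          (1 + inrMat Y) * stab k (inlMat A (fstMat u)) := by
        have : Continuous fun Y : Matrix (Fin k) (Fin k) A => inrMat Y := continuous_matrix fun i j =>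
          Unitization.continuous_inr.comp (continuous_id.matrix_elem i j)
        exact (continuous_const.add this).matrix_mul continuous_const
      have h3 := (hj.map_continuousOn hf.continuousOn).mono
        (V := (unitary (Matrix (Fin k) (Fin k) (Unitization ℂ A)) :
          Set (Matrix (Fin k) (Fin k) (Unitization ℂ A)))) (by
        rintro _ ⟨Y, hY, rfl⟩
        exact mul_mem (mem_quasiUnitary_iff.1 hY) (stab_mem_unitary hk his))
      rw [inrMat_zero, add_zero, one_mul, ← stab_one_add_inrMat, ← stab_mul hk, hu'] at h3
      exact h3
    · have hf : Continuous (inlMat A : Matrix (Fin l) (Fin l) ℂ → _) :=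
        continuous_matrix fun i j => (continuous_algebraMap ℂ (Unitization ℂ A)).comp
          (continuous_id.matrix_elem i j)
      have h3 := (hj'.map_continuousOn hf.continuousOn).mono
        (V := (unitary (Matrix (Fin l) (Fin l) (Unitization ℂ A)) :
          Set (Matrix (Fin l) (Fin l) (Unitization ℂ A)))) (by
        rintro _ ⟨Y, hY, rfl⟩
        exact mem_unitary_map inlMat_mul inlMat_conjTranspose inlMat_one hY)
      rw [← stab_inlMat, inlMat_one] at h3
      convert h3 using 1
      ext1 i j
      simp [stab, Matrix.one_apply]
  refine ⟨fun x y => ?_⟩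
  obtain ⟨u, rfl⟩ := Quotient.exists_rep x
  obtain ⟨v, rfl⟩ := Quotient.exists_rep y
  exact (key u).trans (key v).symm

end KOne

/-! ### Triviality of the positive cone of K₀ and projections. -/

section KZero

attribute [local instance] CStarAlgebra.spectralOrder CStarAlgebra.spectralOrderedRing

lemma sum_trace_conjTranspose_mul {R : Type*} [Ring R] [StarRing R] {τ : R →+ ℂ}
    (hτ : ∀ a b, τ (a * b) = τ (b * a)) {m n : ℕ} (v : Matrix (Fin n) (Fin m) R) :
    ∑ i, τ ((vᴴ * v) i i) = ∑ i, τ ((v * vᴴ) i i) := by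
  simp only [Matrix.mul_apply, map_sum, conjTranspose_apply]
  rw [Finset.sum_comm]
  exact Finset.sum_congr rfl fun i _ => Finset.sum_congr rfl fun j _ => hτ _ _

/-- The sum of the values of a trace at the diagonal entries, as a function on the Murray–von
Neumann semigroup. -/
def VMonoid.trace {R : Type*} [Ring R] [StarRing R] (τ : R →+ ℂ) (hτ : ∀ a b, τ (a * b) = τ (b * a)) :
    VMonoid R →+ ℂ where
  toFun := Quotient.lift (fun p => ∑ i, τ (p.mat i i)) (by
    rintro p q ⟨v, h1, h2⟩
    have := sum_trace_conjTranspose_mul hτ v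
    rwa [h1, h2] at this)
  map_zero' := by
    change ∑ i : Fin 0, _ = (0 : ℂ)
    simp
  map_add' := by
    rintro ⟨⟨m, p, hp⟩⟩ ⟨⟨n, q, hq⟩⟩
    change ∑ i : Fin (m + n), τ (diagSum p q i i) = ∑ i, τ (p i i) + ∑ i, τ (q i i)
    rw [Fin.sum_univ_add]
    simp [diagSum]

variable {A : Type*} [NonUnitalCStarAlgebra A]

lemma sum_trace_eq_zero_of_cls_eq_zero {R : Type*} [Ring R] [StarRing R] (τ : R →+ ℂ)
    (hτ : ∀ a b, τ (a * b) = τ (b * a)) {p : MatProj R} (hp : K00.cls p = 0) :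
    ∑ i, τ (p.mat i i) = 0 := by
  have h1 := congrArg (Algebra.GrothendieckAddGroup.lift (VMonoid.trace τ hτ)) hp
  rw [map_zero] at h1
  have h2 := DFunLike.congr_fun (Algebra.GrothendieckAddGroup.lift.symm_apply_apply
    (VMonoid.trace τ hτ)) (VMonoid.mk p)
  exact h2.symm.trans h1

instance finiteDimensional_unitization {F : Type*} [NonUnitalCStarAlgebra F] [FiniteDimensional ℂ F] :
    FiniteDimensional ℂ (Unitization ℂ F) :=
  Module.Finite.of_surjective
    (LinearMap.coprod (Algebra.linearMap ℂ (Unitization ℂ F)) (Unitization.inrHom ℂ ℂ F)) fun x =>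
      ⟨(x.fst, x.snd), Unitization.inl_fst_add_inr_snd_eq x⟩

/-- The trace of left multiplication on the unitization of F, pulled back along π, is additive on
K₀₀. If the class of p vanishes, so does the sum of the traces of π(p k i)⋆ π(p k i), and this trace
is faithful by `norm_le_leftTrace`. -/
lemma eq_zero_of_cls_eq_zero {F : Type*} [NonUnitalCStarAlgebra F] [FiniteDimensional ℂ F]
    (π : A →⋆ₙₐ[ℂ] F) {n : ℕ} {p : Matrix (Fin n) (Fin n) A} (hp : IsStarProjection p)
    (h0 : K00.cls (MatProj.ofNonUnital p hp) = 0) (i j : Fin n) : π (p i j) = 0 := by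
  set hK := isIdeal_bot (Unitization ℂ F)
  let ρ := Unitization.starMap (R := ℂ) π
  let τ : Unitization ℂ A →+ ℂ := (leftTrace hK).toAddMonoidHom.comp (ρ : Unitization ℂ A →+ Unitization ℂ F)
  have hτ : ∀ a, τ a = leftTrace hK (ρ a) := fun a => rfl
  have h1 := sum_trace_eq_zero_of_cls_eq_zero τ (fun a b => by
    rw [hτ, hτ, map_mul ρ, map_mul ρ, leftTrace_mul_comm]) h0
  have hpp : ∀ i, p i i = ∑ k, star (p k i) * p k i := fun i => by
    have h2 : pᴴ * p = p := by
      have h3 : pᴴ = p := hp.isSelfAdjoint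
      rw [h3]; exact hp.isIdempotentElem
    conv_lhs => rw [← h2]
    rfl
  let y : Fin n → Fin n → Unitization ℂ F := fun k i => Unitization.inr (π (p k i))
  have h1' : ∑ i : Fin n, leftTrace hK (ρ (Unitization.inr (p i i))) = 0 := h1
  have h2 : ∀ i : Fin n, leftTrace hK (ρ (Unitization.inr (p i i))) =
      ∑ k, leftTrace hK (star (y k i) * y k i) := by
    intro i
    have h3 : ρ (Unitization.inr (p i i)) = ∑ k, star (y k i) * y k i := by
      rw [Unitization.starMap_inr, hpp, map_sum]
      refine (map_sum (Unitization.inrHom ℂ ℂ F) _ _).trans (Finset.sum_congr rfl fun k _ => ?_)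
      change Unitization.inr (π (star (p k i) * p k i)) = _
      rw [map_mul, map_star, Unitization.inr_mul, Unitization.inr_star]
    rw [h3, map_sum]
  have h3 : ∀ k i, ‖star (y k i) * y k i‖ ≤ (leftTrace hK (star (y k i) * y k i)).re := fun k i =>
    norm_le_leftTrace (star_mul_self_nonneg _)
  have h4 : ∑ i, ∑ k, (leftTrace hK (star (y k i) * y k i)).re = 0 := by
    have := congrArg Complex.re h1'
    rw [Complex.zero_re] at this
    rw [← this, Complex.re_sum]
    exact Finset.sum_congr rfl fun i _ => by rw [h2, Complex.re_sum]
  have h5 : ∀ i k, 0 ≤ (leftTrace hK (star (y k i) * y k i)).re := fun i k =>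
    (norm_nonneg _).trans (h3 k i)
  have h6 := (Finset.sum_eq_zero_iff_of_nonneg fun i _ => Finset.sum_nonneg fun k _ => h5 i k).1 h4 j
    (Finset.mem_univ j)
  have h7 := (Finset.sum_eq_zero_iff_of_nonneg fun k _ => h5 j k).1 h6 i (Finset.mem_univ i)
  have h8 : ‖star (y i j) * y i j‖ ≤ 0 := h7 ▸ h3 i j
  rw [CStarRing.norm_star_mul_self] at h8
  have h9 : ‖y i j‖ = 0 := by nlinarith [norm_nonneg (y i j)]
  exact Unitization.inr_injective (norm_eq_zero.1 h9)

/-- A projection with trivial class is zero in every fibre by `eq_zero_of_cls_eq_zero`. Being stably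
projectionless passes to matrix algebras at once, which is why the condition on K₀ is traded for it.
-/
lemma isStablyProjectionless_of_K0Pos {F₁ F₂ : Type*} [NonUnitalCStarAlgebra F₁]
    [NonUnitalCStarAlgebra F₂] [FiniteDimensional ℂ F₁] [FiniteDimensional ℂ F₂]
    {φ₀ φ₁ : F₁ →⋆ₙₐ[ℂ] F₂} (h : K0Pos (mappingTorus φ₀ φ₁) = {0}) :
    IsStablyProjectionless (mappingTorus φ₀ φ₁) := by
  intro n p hp
  have h0 : K00.cls (MatProj.ofNonUnital p hp) = 0 := by
    have hmem : K00.cls (MatProj.ofNonUnital p hp) ∈ K0 (mappingTorus φ₀ φ₁) := by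
      change K00.map _ _ _ = 0
      have e : K00.map (augmentation (mappingTorus φ₀ φ₁)) (augmentation_star _)
          (K00.cls (MatProj.ofNonUnital p hp)) = K00.cls ((MatProj.ofNonUnital p hp).map
            (augmentation (mappingTorus φ₀ φ₁)) (augmentation_star _)) :=
        DFunLike.congr_fun (Algebra.GrothendieckAddGroup.lift.symm_apply_apply
          (Algebra.GrothendieckAddGroup.of.comp (VMonoid.map (augmentation (mappingTorus φ₀ φ₁))
            (augmentation_star _)))) (VMonoid.mk (MatProj.ofNonUnital p hp))
      rw [e]
      have e2 : VMonoid.mk ((MatProj.ofNonUnital p hp).map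
          (augmentation (mappingTorus φ₀ φ₁)) (augmentation_star _)) = 0 := by
        -- The augmentation kills all entries of p, and a zero matrix is equivalent to the empty
        -- projection through v = 0.
        refine VMonoid.mk_eq_mk.2 ⟨0, ?_, ?_⟩
        · rw [conjTranspose_zero, Matrix.zero_mul]
          ext i j; rfl
        · ext1 i; exact i.elim0
      rw [K00.cls, e2, map_zero]
    have : (⟨_, hmem⟩ : K0 (mappingTorus φ₀ φ₁)) ∈ K0Pos (mappingTorus φ₀ φ₁) := ⟨n, p, hp, rfl⟩
    rw [h] at this
    exact congrArg Subtype.val (Set.mem_singleton_iff.1 this)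
  ext1 i j
  refine mappingTorus_ext (fun t => ?_) ?_
  · rw [eq_zero_of_cls_eq_zero (evalAt φ₀ φ₁ t) hp h0, Matrix.zero_apply, map_zero]
  · rw [eq_zero_of_cls_eq_zero (evalInf φ₀ φ₁) hp h0, Matrix.zero_apply, map_zero]

lemma K0Pos_eq_of_isStablyProjectionless (h : IsStablyProjectionless A) : K0Pos A = {0} := by
  have key : ∀ (n : ℕ) (p : Matrix (Fin n) (Fin n) A) (hp : IsStarProjection p),
      K00.cls (MatProj.ofNonUnital p hp) = 0 := by
    intro n p hp
    have : VMonoid.mk (MatProj.ofNonUnital p hp) = 0 := by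
      refine VMonoid.mk_eq_mk.2 ⟨0, ?_, ?_⟩
      · rw [conjTranspose_zero, Matrix.zero_mul]
        ext1 i j
        change (0 : Unitization ℂ A) = Unitization.inr (p i j)
        rw [congrFun (congrFun (h n p hp) i) j]
        exact (Unitization.inr_zero ℂ).symm
      · ext1 i; exact i.elim0
    rw [K00.cls, this, map_zero]
  ext x
  refine ⟨?_, ?_⟩
  · rintro ⟨n, p, hp, hx⟩
    rw [key] at hx
    exact Subtype.ext hx
  · rintro rfl
    exact ⟨0, 0, .zero _, (key 0 0 _).symm⟩

end KZero

/-! ### Matrices over Mₙ(A) as matrices over A: K₁ and projections. -/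

section Flatten

attribute [local instance] CStarAlgebra.spectralOrder CStarAlgebra.spectralOrderedRing

variable {A B : Type*} [NonUnitalCStarAlgebra A] [NonUnitalCStarAlgebra B] {n : ℕ}
  (e : CStarMatrix (Fin n) (Fin n) A ≃⋆ₐ[ℂ] B)

/-- Matrices over `Mₙ(A)` as larger matrices over `A`. -/
def flat {k : ℕ} (M : Matrix (Fin k) (Fin k) B) : Matrix (Fin (k * n)) (Fin (k * n)) A :=
  fun i j => e.symm (M i.divNat j.divNat) i.modNat j.modNat

/-- The inverse of `flat`. -/
def unflat {k : ℕ} (X : Matrix (Fin (k * n)) (Fin (k * n)) A) : Matrix (Fin k) (Fin k) B :=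
  fun i j => e (CStarMatrix.ofMatrix (Matrix.of fun p q =>
    X (finProdFinEquiv (i, p)) (finProdFinEquiv (j, q))))

lemma finProdFinEquiv_divNat_modNat {k : ℕ} (i : Fin (k * n)) :
    finProdFinEquiv (i.divNat, i.modNat) = i := finProdFinEquiv.apply_symm_apply i

lemma divNat_finProdFinEquiv {k : ℕ} (i : Fin k) (p : Fin n) :
    (finProdFinEquiv (i, p)).divNat = i := congrArg Prod.fst (finProdFinEquiv.symm_apply_apply (i, p))

lemma modNat_finProdFinEquiv {k : ℕ} (i : Fin k) (p : Fin n) :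
    (finProdFinEquiv (i, p)).modNat = p := congrArg Prod.snd (finProdFinEquiv.symm_apply_apply (i, p))

lemma unflat_flat {k : ℕ} (M : Matrix (Fin k) (Fin k) B) : unflat e (flat e M) = M := by
  ext1 i j
  simp only [unflat, flat, divNat_finProdFinEquiv, modNat_finProdFinEquiv]
  exact e.apply_symm_apply (M i j)

lemma flat_unflat {k : ℕ} (X : Matrix (Fin (k * n)) (Fin (k * n)) A) : flat e (unflat e X) = X := by
  ext1 i j
  simp only [unflat, flat]
  rw [e.symm_apply_apply]
  change X (finProdFinEquiv (i.divNat, i.modNat)) (finProdFinEquiv (j.divNat, j.modNat)) = _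
  rw [finProdFinEquiv_divNat_modNat, finProdFinEquiv_divNat_modNat]

lemma flat_add {k : ℕ} (M N : Matrix (Fin k) (Fin k) B) : flat e (M + N) = flat e M + flat e N := by
  ext1 i j
  simp only [flat, Matrix.add_apply, map_add, CStarMatrix.add_apply]

lemma flat_zero {k : ℕ} : flat e (0 : Matrix (Fin k) (Fin k) B) = 0 := by
  ext1 i j
  simp only [flat, Matrix.zero_apply, map_zero, CStarMatrix.zero_apply]

lemma flat_mul {k : ℕ} (M N : Matrix (Fin k) (Fin k) B) : flat e (M * N) = flat e M * flat e N := by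
  ext1 i j
  rw [Matrix.mul_apply, ← finProdFinEquiv.sum_comp, Fintype.sum_prod_type]
  simp only [flat, Matrix.mul_apply, map_sum, map_mul, divNat_finProdFinEquiv, modNat_finProdFinEquiv]
  rw [CStarMatrix.sum_apply]
  exact Finset.sum_congr rfl fun l _ => CStarMatrix.mul_apply_apply _ _ _ _

lemma flat_conjTranspose {k : ℕ} (M : Matrix (Fin k) (Fin k) B) : flat e Mᴴ = (flat e M)ᴴ := by
  ext1 i j
  simp only [flat, conjTranspose_apply, map_star, CStarMatrix.star_apply]

lemma flat_injective {k : ℕ} : Function.Injective (flat e (k := k)) :=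
  Function.LeftInverse.injective (unflat_flat e)

lemma flat_pad {k l : ℕ} (M : Matrix (Fin k) (Fin k) B) :
    flat e (pad l M) = pad (l * n) (flat e M) := by
  ext1 i j
  have hn : 0 < n := Nat.pos_of_ne_zero fun h => by
    have := i.2; simp [h] at this
  simp only [flat, pad]
  have h1 : ∀ i : Fin (l * n), ((i.divNat : ℕ) < k ↔ (i : ℕ) < k * n) := fun i => by
    rw [Fin.coe_divNat, Nat.div_lt_iff_lt_mul hn]
  by_cases h : (i : ℕ) < k * n ∧ (j : ℕ) < k * n
  · rw [dif_pos ⟨(h1 i).2 h.1, (h1 j).2 h.2⟩, dif_pos h]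
    rfl
  · rw [dif_neg fun h' => h ⟨(h1 i).1 h'.1, (h1 j).1 h'.2⟩, dif_neg h, map_zero]
    rfl

lemma continuous_unflat {k : ℕ} : Continuous (unflat e (k := k)) := by
  refine continuous_matrix fun i j => (continuous_hom (e : CStarMatrix (Fin n) (Fin n) A →⋆ₙₐ[ℂ] B)).comp ?_
  exact continuous_pi fun p => continuous_pi fun q => continuous_id.matrix_elem _ _

lemma flat_mem_quasiUnitary_iff {k : ℕ} {M : Matrix (Fin k) (Fin k) B} :
    flat e M ∈ quasiUnitary A (k * n) ↔ M ∈ quasiUnitary B k := by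
  simp only [quasiUnitary, Set.mem_ofPred_eq, ← flat_conjTranspose, ← flat_mul, ← flat_add]
  rw [← flat_zero e, (flat_injective e).eq_iff, (flat_injective e).eq_iff]

lemma pad_mem_quasiUnitary {N k : ℕ} (h : N ≤ k) {X : Matrix (Fin N) (Fin N) A}
    (hX : X ∈ quasiUnitary A N) : pad k X ∈ quasiUnitary A k := by
  rw [mem_quasiUnitary_iff, ← stab_one_add_inrMat]
  exact stab_mem_unitary h (mem_quasiUnitary_iff.1 hX)

/-- A quasi-unitary over Mₙ(A) is contracted after flattening; the path is then brought back to
Mₙ(A) by `unflat`. -/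
lemma subsingleton_K1_matrix (e : CStarMatrix (Fin n) (Fin n) A ≃⋆ₐ[ℂ] B)
    (hn : 0 < n) (h : Subsingleton (K1 A)) : Subsingleton (K1 B) := by
  refine subsingleton_K1_of_joinedIn (fun N X hX => ?_)
    (fun N s hs => joinedIn_scalar_of_subsingleton_K1 h hs)
  obtain ⟨k, hk, hj⟩ := joinedIn_quasiUnitary_of_subsingleton_K1 h ((flat_mem_quasiUnitary_iff e).2 hX)
  -- The size k of the null homotopy need not be a multiple of n, so the path is padded to size k n
  -- before unflattening.
  have hkn : k ≤ k * n := Nat.le_mul_of_pos_right k hn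
  refine ⟨k, (Nat.le_mul_of_pos_right N hn).trans hk, ?_⟩
  have h3 := (hj.map_continuousOn (f := fun Y => unflat e (pad (k * n) Y))
    ((continuous_unflat e).comp continuous_pad).continuousOn).mono (V := quasiUnitary B k) (by
      rintro _ ⟨Y, hY, rfl⟩
      rw [← flat_mem_quasiUnitary_iff e, flat_unflat]
      exact pad_mem_quasiUnitary hkn hY)
  rw [pad_pad hk, ← flat_pad, unflat_flat] at h3
  have e0 : pad (k * n) (0 : Matrix (Fin k) (Fin k) A) = flat e (0 : Matrix (Fin k) (Fin k) B) := by
    rw [flat_zero]; ext1 i j; simp [pad]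
  rwa [e0, unflat_flat] at h3

lemma isStablyProjectionless_matrix (e : CStarMatrix (Fin n) (Fin n) A ≃⋆ₐ[ℂ] B)
    (h : IsStablyProjectionless A) : IsStablyProjectionless B := by
  intro k p hp
  refine flat_injective e ?_
  rw [flat_zero]
  refine h _ _ ⟨?_, ?_⟩
  · rw [IsIdempotentElem, ← flat_mul, hp.isIdempotentElem.eq]
  · have h3 : pᴴ = p := hp.isSelfAdjoint
    rw [IsSelfAdjoint, star_eq_conjTranspose, ← flat_conjTranspose, h3]

end Flatten

/-! ### Tracial states of matrix algebras and their corners. -/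

section MatrixTraces

attribute [local instance] CStarAlgebra.spectralOrder CStarAlgebra.spectralOrderedRing

variable {A B : Type*} [NonUnitalCStarAlgebra A] [NonUnitalCStarAlgebra B] {n : ℕ}

/-- For a product a b, the matrix unit with entry a b factors through any index l, and traciality
swaps the factors. A general x is the limit of the products e x e. -/
lemma map_matUnit_of_trace {τ : CStarMatrix (Fin n) (Fin n) A →L[ℂ] ℂ}
    (hτ : ∀ a b, τ (a * b) = τ (b * a)) (k i j : Fin n) (x : A) :
    τ (matUnit i j x) = if i = j then τ (matUnit k k x) else 0 := by
  have hx := tendsto_approximateUnit_conj x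
  have h1 : ∀ i j : Fin n, Tendsto (fun e : A => τ (matUnit i j (e * x * e)))
      (CStarAlgebra.approximateUnit A) (𝓝 (τ (matUnit i j x))) := fun i j =>
    ((τ.continuous.comp (continuous_matUnit i j)).tendsto x).comp hx
  have h2 : ∀ (i j l : Fin n) (a b : A), τ (matUnit i j (a * b)) =
      if j = i then τ (matUnit l l (b * a)) else 0 := fun i j l a b => by
    have h3 : matUnit i j (a * b) = matUnit i l a * matUnit l j b := by
      rw [matUnit_mul_matUnit, if_pos rfl]
    rw [h3, hτ, matUnit_mul_matUnit]
    split_ifs <;> simp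
  refine tendsto_nhds_unique (h1 i j) ?_
  have h4 : ∀ e : A, τ (matUnit i j (e * x * e)) =
      if i = j then τ (matUnit k k (e * x * e)) else 0 := fun e => by
    rw [h2 i j k (e * x) e]
    by_cases h : i = j
    · rw [if_pos h, if_pos h.symm, h2 k k k e (e * x), if_pos rfl]
    · rw [if_neg h, if_neg (Ne.symm h)]
  simp only [h4]
  split_ifs
  · exact h1 k k
  · exact tendsto_const_nhds

lemma trace_eq_sum_diag {τ : CStarMatrix (Fin n) (Fin n) A →L[ℂ] ℂ}
    (hτ : ∀ a b, τ (a * b) = τ (b * a)) (k : Fin n) (M : CStarMatrix (Fin n) (Fin n) A) :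
    τ M = ∑ i, τ (matUnit k k (M i i)) := by
  conv_lhs => rw [sum_matUnit M, map_sum]
  refine Finset.sum_congr rfl fun i _ => ?_
  rw [map_sum, Finset.sum_eq_single i]
  · rw [map_matUnit_of_trace hτ k, if_pos rfl]
  · intro j _ hj
    rw [map_matUnit_of_trace hτ k, if_neg (Ne.symm hj)]
  · simp

/-- The restriction of a functional on a matrix algebra to a diagonal corner. -/
def cornerFunctional (e : CStarMatrix (Fin n) (Fin n) A ≃⋆ₐ[ℂ] B) (k : Fin n) (τ : WeakDual ℂ B) :
    A →L[ℂ] ℂ :=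
  let J : A →⋆ₙₐ[ℂ] B := (e : CStarMatrix (Fin n) (Fin n) A →⋆ₙₐ[ℂ] B).comp (cornerHom A k)
  (WeakDual.toStrongDual τ).comp ⟨LinearMapClass.linearMap J, continuous_hom J⟩

lemma cornerFunctional_apply (e : CStarMatrix (Fin n) (Fin n) A ≃⋆ₐ[ℂ] B) (k : Fin n)
    (τ : WeakDual ℂ B) (a : A) : cornerFunctional e k τ a = τ (e (matUnit k k a)) := rfl

lemma trace_eq_sum_cornerFunctional (e : CStarMatrix (Fin n) (Fin n) A ≃⋆ₐ[ℂ] B) (k : Fin n)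
    {τ : WeakDual ℂ B} (hτ : τ ∈ tracialStates B) (M : CStarMatrix (Fin n) (Fin n) A) :
    τ (e M) = ∑ i, cornerFunctional e k τ (M i i) := by
  let eh : CStarMatrix (Fin n) (Fin n) A →⋆ₙₐ[ℂ] B := e
  let E : CStarMatrix (Fin n) (Fin n) A →L[ℂ] B :=
    ⟨LinearMapClass.linearMap eh, continuous_hom eh⟩
  exact trace_eq_sum_diag (τ := (WeakDual.toStrongDual τ).comp E) (fun a b => by
    change τ (e (a * b)) = τ (e (b * a))
    rw [map_mul e, map_mul e]
    exact hτ.2.2 _ _) k M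

/-- The trace is the sum of n copies of its corner functional, evaluated at the diagonal entries.
The bound allows the corner functional to be normalized with a factor of at most n. -/
lemma one_le_mul_norm_cornerFunctional (e : CStarMatrix (Fin n) (Fin n) A ≃⋆ₐ[ℂ] B) (k : Fin n)
    {τ : WeakDual ℂ B} (hτ : τ ∈ tracialStates B) : (1 : ℝ) ≤ n * ‖cornerFunctional e k τ‖ := by
  let eh : CStarMatrix (Fin n) (Fin n) A →⋆ₙₐ[ℂ] B := e
  rw [← hτ.2.1]
  refine ContinuousLinearMap.opNorm_le_bound _ (by positivity) fun b => ?_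
  obtain ⟨M, rfl⟩ := EquivLike.surjective e b
  have h3 : ‖e M‖ = ‖M‖ := NonUnitalStarAlgHom.norm_map eh (EquivLike.injective e) M
  rw [h3]
  change ‖τ (e M)‖ ≤ _
  rw [trace_eq_sum_cornerFunctional e k hτ]
  calc _ ≤ ∑ i : Fin n, ‖cornerFunctional e k τ‖ * ‖M‖ :=
        (norm_sum_le _ _).trans (Finset.sum_le_sum fun i _ =>
          ((cornerFunctional e k τ).le_opNorm _).trans
            (by gcongr; exact CStarMatrix.norm_entry_le_norm))
    _ = n * ‖cornerFunctional e k τ‖ * ‖M‖ := by simp; ring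

lemma cornerFunctional_mem (e : CStarMatrix (Fin n) (Fin n) A ≃⋆ₐ[ℂ] B) (k : Fin n)
    {τ : WeakDual ℂ B} (hτ : τ ∈ tracialStates B) :
    StrongDual.toWeakDual ((‖cornerFunctional e k τ‖⁻¹ : ℝ) • cornerFunctional e k τ) ∈
      tracialStates A := by
  let eh : CStarMatrix (Fin n) (Fin n) A →⋆ₙₐ[ℂ] B := e
  refine mem_tracialStates_of (fun a ha => ?_) (fun a b => ?_) fun h => ?_
  · exact hτ.1 _ (map_nonneg_hom (eh.comp (cornerHom A k)) ha)
  · rw [cornerFunctional_apply, cornerFunctional_apply]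
    have h2 : ∀ x y : A, e (matUnit k k (x * y)) = e (matUnit k k x) * e (matUnit k k y) :=
      fun x y => map_mul (eh.comp (cornerHom A k)) x y
    rw [h2, h2]
    exact hτ.2.2 _ _
  · have h1 := one_le_mul_norm_cornerFunctional e k hτ
    rw [h, norm_zero, mul_zero] at h1
    linarith

/-- If tracial states of B tended weak-⋆ to 0, so would their corner functionals, and normalizing
these multiplies by at most n. -/
lemma zero_notMem_closure_tracialStates_matrix (e : CStarMatrix (Fin n) (Fin n) A ≃⋆ₐ[ℂ] B)
    (hn : 0 < n) (h : 0 ∉ closure (tracialStates A)) : 0 ∉ closure (tracialStates B) := by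
  intro h0
  refine h ?_
  obtain ⟨u, hu, hu0⟩ := mem_closure_iff_ultrafilter.1 h0
  let k : Fin n := ⟨0, hn⟩
  refine mem_closure_of_tendsto (b := (u : Filter (WeakDual ℂ B)))
    (f := fun τ => StrongDual.toWeakDual
      ((‖cornerFunctional e k τ‖⁻¹ : ℝ) • cornerFunctional e k τ)) ?_
    (by filter_upwards [hu] with τ hτ using cornerFunctional_mem e k hτ)
  refine tendsto_iff_forall_eval_tendsto_topDualPairing.2 fun a => ?_
  change Tendsto (fun τ => (‖cornerFunctional e k τ‖⁻¹ : ℝ) • τ (e (matUnit k k a))) u (𝓝 0)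
  have h4 : Tendsto (fun τ : WeakDual ℂ B => n * ‖τ (e (matUnit k k a))‖) u (𝓝 0) := by
    have := ((WeakDual.eval_continuous (𝕜 := ℂ) (e (matUnit k k a))).tendsto
      (0 : WeakDual ℂ B)).mono_left hu0
    have h5 : (n : ℝ) * ‖(0 : WeakDual ℂ B) (e (matUnit k k a))‖ = 0 := by
      change (n : ℝ) * ‖(0 : ℂ)‖ = 0
      simp
    have h6 := this.norm.const_mul (n : ℝ)
    rwa [h5] at h6
  refine squeeze_zero_norm' ?_ h4
  filter_upwards [hu] with τ hτ
  have h5 := one_le_mul_norm_cornerFunctional e k hτ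
  have h6 : 0 < ‖cornerFunctional e k τ‖ := by
    by_contra h7
    have : ‖cornerFunctional e k τ‖ = 0 := le_antisymm (not_lt.1 h7) (norm_nonneg _)
    rw [this, mul_zero] at h5
    linarith
  rw [norm_smul, Real.norm_of_nonneg (by positivity)]
  gcongr
  rwa [inv_le_iff_one_le_mul₀ h6]

end MatrixTraces

/-! ### 𝒞₀' is closed under matrix algebras. -/

section MatrixTorus

attribute [local instance] CStarAlgebra.spectralOrder CStarAlgebra.spectralOrderedRing

variable {F₁ F₂ D : Type*} [NonUnitalCStarAlgebra F₁] [NonUnitalCStarAlgebra F₂]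
  [NonUnitalCStarAlgebra D] (φ₀ φ₁ : F₁ →⋆ₙₐ[ℂ] F₂) (n : ℕ)

/-- Matrices over a mapping torus as elements of the mapping torus of the matrix algebras. -/
def torusHom : CStarMatrix (Fin n) (Fin n) (mappingTorus φ₀ φ₁) →⋆ₙₐ[ℂ]
    mappingTorus (CStarMatrix.mapₙₐ φ₀ : CStarMatrix (Fin n) (Fin n) F₁ →⋆ₙₐ[ℂ] CStarMatrix (Fin n) (Fin n) F₂)
      (CStarMatrix.mapₙₐ φ₁) where
  toFun M := ⟨(⟨fun t => CStarMatrix.mapₙₐ (evalAt φ₀ φ₁ t) M,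
      continuous_pi fun i => continuous_pi fun j => (M i j).1.1.continuous⟩,
      CStarMatrix.mapₙₐ (evalInf φ₀ φ₁) M), by
    constructor
    · ext i j; exact (M i j).2.1
    · ext i j; exact (M i j).2.2⟩
  map_smul' c M := mappingTorus_ext (fun t => map_smul (CStarMatrix.mapₙₐ (evalAt φ₀ φ₁ t)) c M)
    (map_smul (CStarMatrix.mapₙₐ (evalInf φ₀ φ₁)) c M)
  map_zero' := mappingTorus_ext (fun t => map_zero (CStarMatrix.mapₙₐ (evalAt φ₀ φ₁ t)))
    (map_zero (CStarMatrix.mapₙₐ (evalInf φ₀ φ₁)))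
  map_add' M N := mappingTorus_ext (fun t => map_add (CStarMatrix.mapₙₐ (evalAt φ₀ φ₁ t)) M N)
    (map_add (CStarMatrix.mapₙₐ (evalInf φ₀ φ₁)) M N)
  map_mul' M N := mappingTorus_ext (fun t => map_mul (CStarMatrix.mapₙₐ (evalAt φ₀ φ₁ t)) M N)
    (map_mul (CStarMatrix.mapₙₐ (evalInf φ₀ φ₁)) M N)
  map_star' M := mappingTorus_ext (fun t => map_star (CStarMatrix.mapₙₐ (evalAt φ₀ φ₁ t)) M)
    (map_star (CStarMatrix.mapₙₐ (evalInf φ₀ φ₁)) M)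

lemma torusHom_evalAt (t : unitInterval) (M : CStarMatrix (Fin n) (Fin n) (mappingTorus φ₀ φ₁))
    (i j : Fin n) : (torusHom φ₀ φ₁ n M).1.1 t i j = (M i j).1.1 t := rfl

lemma torusHom_evalInf (M : CStarMatrix (Fin n) (Fin n) (mappingTorus φ₀ φ₁))
    (i j : Fin n) : (torusHom φ₀ φ₁ n M).1.2 i j = (M i j).1.2 := rfl

lemma torusHom_injective : Function.Injective (torusHom φ₀ φ₁ n) := by
  intro M N h
  refine CStarMatrix.ext fun i j => mappingTorus_ext (fun t => ?_) ?_
  · change (M i j).1.1 t = (N i j).1.1 t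
    rw [← torusHom_evalAt, h, torusHom_evalAt]
  · change (M i j).1.2 = (N i j).1.2
    rw [← torusHom_evalInf, h, torusHom_evalInf]

lemma torusHom_surjective : Function.Surjective (torusHom φ₀ φ₁ n) := by
  intro x
  let M : CStarMatrix (Fin n) (Fin n) (mappingTorus φ₀ φ₁) := CStarMatrix.ofMatrix
    (Matrix.of fun i j => ⟨(⟨fun t => x.1.1 t i j, (continuous_apply_apply i j).comp
      x.1.1.continuous⟩, x.1.2 i j),
      ⟨congrFun (congrFun x.2.1 i) j, congrFun (congrFun x.2.2 i) j⟩⟩)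
  refine ⟨M, Subtype.ext (Prod.ext (ContinuousMap.ext fun t => CStarMatrix.ext fun i j => ?_)
    (CStarMatrix.ext fun i j => ?_))⟩
  · rw [torusHom_evalAt]; rfl
  · rw [torusHom_evalInf]; rfl

variable {φ₀ φ₁ n}

lemma SatisfiesC0.of_matrix {C B : Type*} [NonUnitalCStarAlgebra C] [NonUnitalCStarAlgebra B]
    (hn : 0 < n) (e : CStarMatrix (Fin n) (Fin n) C ≃⋆ₐ[ℂ] B) (h : SatisfiesC0 C)
    (hp : IsStablyProjectionless C) : SatisfiesC0 B :=
  ⟨subsingleton_K1_matrix e hn h.1, K0Pos_eq_of_isStablyProjectionless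
    (isStablyProjectionless_matrix e hp),
    zero_notMem_closure_tracialStates_matrix e hn h.2.2⟩

lemma HerEmb.matrix_equiv {C B : Type*} [NonUnitalCStarAlgebra C] [NonUnitalCStarAlgebra B]
    (hn : 0 < n) (e : CStarMatrix (Fin n) (Fin n) C ≃⋆ₐ[ℂ] B) {ι : D →⋆ₙₐ[ℂ] C} (hι : HerEmb ι)
    (h : closedIdeal (Set.range ι) = ⊤) :
    ∃ κ : CStarMatrix (Fin n) (Fin n) D →⋆ₙₐ[ℂ] B, HerEmb κ ∧ closedIdeal (Set.range κ) = ⊤ := by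
  have : Nonempty (Fin n) := ⟨⟨0, hn⟩⟩
  let E : CStarMatrix (Fin n) (Fin n) C →⋆ₙₐ[ℂ] B := e
  have hE : Function.Surjective E := EquivLike.surjective e
  refine ⟨E.comp (CStarMatrix.mapₙₐ ι), HerEmb.comp ⟨EquivLike.injective e, fun b b' a => hE _⟩
    hι.mapₙₐ, closedIdeal_range_comp ?_ (closedIdeal_range_mapₙₐ h)⟩
  exact Submodule.eq_top_iff'.2 fun x => mem_closedIdeal (hE x)

/-- Matrices over a mapping torus form the mapping torus of the matrix algebras and amplified
homomorphisms, and full hereditary embeddings amplify to such. -/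
lemma InC0'.matrix (hn : 0 < n) (hD : InC0' D) : InC0' (CStarMatrix (Fin n) (Fin n) D) := by
  obtain ⟨F₁, F₂, i₁, i₂, φ₀, φ₁, ι, h1, h2, h3, hι, h4⟩ := inC0'_iff.1 hD
  let e := StarAlgEquiv.ofBijective (torusHom φ₀ φ₁ n)
    ⟨torusHom_injective φ₀ φ₁ n, torusHom_surjective φ₀ φ₁ n⟩
  obtain ⟨κ, hκ, hf⟩ := HerEmb.matrix_equiv hn e hι h4
  exact inC0'_iff.2 ⟨CStarMatrix (Fin n) (Fin n) F₁, CStarMatrix (Fin n) (Fin n) F₂, inferInstance,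
    inferInstance, CStarMatrix.mapₙₐ φ₀, CStarMatrix.mapₙₐ φ₁, κ,
    inferInstanceAs (Module.Finite ℂ (Matrix (Fin n) (Fin n) F₁)),
    inferInstanceAs (Module.Finite ℂ (Matrix (Fin n) (Fin n) F₂)), h3.of_matrix hn e
      (isStablyProjectionless_of_K0Pos h3.2.1), hκ, hf⟩

end MatrixTorus

/-! ### Tracial approximation by embedded algebras. -/

section External

attribute [local instance] CStarAlgebra.spectralOrder CStarAlgebra.spectralOrderedRing

universe u

variable {A B G D : Type u} [NonUnitalCStarAlgebra A] [NonUnitalCStarAlgebra B]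
  [NonUnitalCStarAlgebra G] [NonUnitalCStarAlgebra D]

lemma exists_tracialState_comp (e : G ≃⋆ₐ[ℂ] D) {t : WeakDual ℂ D} (ht : t ∈ tracialStates D) :
    ∃ s ∈ tracialStates G, ∀ g, s g = t (e g) := by
  let eh : G →⋆ₙₐ[ℂ] D := e
  let E : G →L[ℂ] D := ⟨LinearMapClass.linearMap eh, continuous_hom eh⟩
  let s : G →L[ℂ] ℂ := (WeakDual.toStrongDual t).comp E
  have hs : ∀ g, s g = t (e g) := fun g => rfl
  have hn : ∀ g, ‖e g‖ = ‖g‖ := fun g =>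
    NonUnitalStarAlgHom.norm_map eh (EquivLike.injective e) g
  refine ⟨StrongDual.toWeakDual s, ⟨fun a ha => ht.1 _ (map_nonneg_hom eh ha), le_antisymm ?_ ?_,
    fun a b => ?_⟩, hs⟩
  · refine ContinuousLinearMap.opNorm_le_bound _ zero_le_one fun g => ?_
    rw [← hn g, ← ht.2.1]
    exact (WeakDual.toStrongDual t).le_opNorm (e g)
  · rw [← ht.2.1]
    refine ContinuousLinearMap.opNorm_le_bound _ (norm_nonneg _) fun d => ?_
    obtain ⟨g, rfl⟩ := EquivLike.surjective e d
    rw [hn g]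
    exact s.le_opNorm g
  · change t (e (a * b)) = t (e (b * a))
    rw [map_mul e, map_mul e]
    exact ht.2.2 _ _

lemma InC0'.of_equiv (h : InC0' G) (e : G ≃⋆ₐ[ℂ] D) : InC0' D := by
  obtain ⟨F₁, F₂, i₁, i₂, φ₀, φ₁, B, h1, h2, h3, h4, h5, ⟨f⟩⟩ := h
  exact ⟨F₁, F₂, i₁, i₂, φ₀, φ₁, B, h1, h2, h3, h4, h5, ⟨e.symm.trans f⟩⟩

/-- Membership in `𝒟` can be tested with algebras in `𝒞₀'` that are embedded in `A` by an injective
⋆-homomorphism. -/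
theorem InD.of_embeddings (hA : IsSimpleCStar A) {a : A} (ha : IsStrictlyPos a) (ha1 : ‖a‖ = 1)
    {f : ℝ} (hf0 : 0 < f) (hf1 : f < 1)
    (h : ∀ (ε : ℝ) (F : Finset A) (b : A), 0 < ε → 0 ≤ b → b ≠ 0 →
      ∃ (D : Type u) (_ : NonUnitalCStarAlgebra D) (γ : D →⋆ₙₐ[ℂ] A) (φ : A →ₗ[ℂ] A)
        (ψ : A →ₗ[ℂ] D), Nontrivial D ∧ Function.Injective γ ∧ IsCPC φ ∧ IsCPC ψ ∧
        IsAlmostMul F ε φ ∧ IsAlmostMul F ε ψ ∧ (∀ x d, φ x * γ d = 0) ∧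
        (∀ x ∈ F, ‖x - (φ x + γ (ψ x))‖ < ε) ∧ ‖a - (φ a + γ (ψ a))‖ < ε ∧ InC0' D ∧
        CuntzLE (φ a) b ∧ ∀ t ∈ tracialStates D, f ≤ (t (cfcₙ (cutoff (1 / 4)) (ψ a))).re) :
    InD A := by
  refine ⟨hA, a, ha, ha1, f, hf0, hf1, fun ε F b hε hb hb0 => ?_⟩
  obtain ⟨D, _, γ, φ, ψ, hnt, hγ, hφ, hψ, hφm, hψm, h0, hF, haF, hD, hc, ht⟩ := h ε F b hε hb hb0
  have hn : ∀ d, ‖γ d‖ = ‖d‖ := NonUnitalStarAlgHom.norm_map γ hγ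
  have hcl : IsClosed (NonUnitalStarAlgHom.range γ : Set A) := by
    rw [NonUnitalStarAlgHom.coe_range]
    exact (AddMonoidHomClass.isometry_of_norm γ hn).isClosedEmbedding.isClosed_range
  let e : D ≃⋆ₐ[ℂ] NonUnitalStarAlgHom.range γ := StarAlgEquiv.ofInjective' γ hγ
  have he : ∀ d, (e d : A) = γ d := fun d => rfl
  let eh : D →⋆ₙₐ[ℂ] NonUnitalStarAlgHom.range γ := e
  have hen : ∀ d, ‖eh d‖ = ‖d‖ := fun d => hn d
  refine ⟨NonUnitalStarAlgHom.range γ, hcl, φ, homLin eh ∘ₗ ψ, fun hbot => ?_, hφ,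
    (isCPC_homLin eh).comp hψ, hφm, fun x hx y hy => ?_, fun x d => ?_, hF, haF, hD.of_equiv e, hc,
    fun t ht' => ?_⟩
  · obtain ⟨x, hx⟩ := exists_ne (0 : D)
    have h1 : γ x ∈ NonUnitalStarAlgHom.range γ := (NonUnitalStarAlgHom.mem_range γ).2 ⟨x, rfl⟩
    rw [hbot, NonUnitalStarAlgebra.mem_bot] at h1
    exact hx (hγ (h1.trans (map_zero γ).symm))
  · have h1 : homLin eh (ψ (x * y)) - homLin eh (ψ x) * homLin eh (ψ y) =
        eh (ψ (x * y) - ψ x * ψ y) := by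
      rw [map_sub eh, map_mul eh]; rfl
    simp only [LinearMap.comp_apply]
    rw [h1, hen]
    exact hψm x hx y hy
  · obtain ⟨d', hd'⟩ := (NonUnitalStarAlgHom.mem_range γ).1 d.2
    rw [← hd']
    exact h0 x d'
  · obtain ⟨s, hs, hst⟩ := exists_tracialState_comp e ht'
    have h1 := ht s hs
    rw [hst] at h1
    have h2 : eh (cfcₙ (cutoff (1 / 4)) (ψ a)) = cfcₙ (cutoff (1 / 4)) (eh (ψ a)) :=
      map_cfcₙ_real eh (continuous_cutoff (by norm_num)) (cutoff_zero (by norm_num))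
        (IsSelfAdjoint.of_nonneg ((isCPC_iff.1 hψ).1.nonneg ha.1))
    have h3 : e (cfcₙ (cutoff (1 / 4)) (ψ a)) = cfcₙ (cutoff (1 / 4)) (eh (ψ a)) := h2
    rw [h3] at h1
    exact h1

lemma InD.exists_embeddings (h : InD A) :
    ∃ a : A, IsStrictlyPos a ∧ ‖a‖ = 1 ∧ ∃ f : ℝ, 0 < f ∧ f < 1 ∧
      ∀ (ε : ℝ) (F : Finset A) (b : A), 0 < ε → 0 ≤ b → b ≠ 0 →
      ∃ (D : Type u) (_ : NonUnitalCStarAlgebra D) (γ : D →⋆ₙₐ[ℂ] A) (φ : A →ₗ[ℂ] A)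
        (ψ : A →ₗ[ℂ] D), Nontrivial D ∧ Function.Injective γ ∧ IsCPC φ ∧ IsCPC ψ ∧
        IsAlmostMul F ε φ ∧ IsAlmostMul F ε ψ ∧ (∀ x d, φ x * γ d = 0) ∧
        (∀ x ∈ F, ‖x - (φ x + γ (ψ x))‖ < ε) ∧ InC0' D ∧
        CuntzLE (φ a) b ∧ ∀ t ∈ tracialStates D, f ≤ (t (cfcₙ (cutoff (1 / 4)) (ψ a))).re := by
  obtain ⟨-, a, ha, ha1, f, hf0, hf1, h⟩ := h
  refine ⟨a, ha, ha1, f, hf0, hf1, fun ε F b hε hb hb0 => ?_⟩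
  obtain ⟨D, hcl, φ, ψ, hbot, hφ, hψ, hφm, hψm, h0, hF, -, hD, hc, ht⟩ := h ε F b hε hb hb0
  refine ⟨D, inferInstance, NonUnitalStarSubalgebraClass.subtype D, φ, ψ, ?_, Subtype.val_injective,
    hφ, hψ, hφm, hψm, h0, hF, hD, hc, ht⟩
  by_contra hn
  have := not_nontrivial_iff_subsingleton.1 hn
  refine hbot (eq_bot_iff.2 fun x hx => ?_)
  have h1 : (⟨x, hx⟩ : D) = 0 := Subsingleton.elim _ _
  rw [NonUnitalStarAlgebra.mem_bot]
  exact congrArg Subtype.val h1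

/-- A variant of the tracial approximation property, with the approximating algebras given by
embeddings, and a lower bound for the traces of a fixed element of the algebra. -/
def TraciallyApproximated (s : A) (f : ℝ) : Prop :=
  ∀ (ε : ℝ) (F : Finset A) (b : A), 0 < ε → 0 ≤ b → b ≠ 0 →
    ∃ (D : Type u) (_ : NonUnitalCStarAlgebra D) (γ : D →⋆ₙₐ[ℂ] A) (φ : A →ₗ[ℂ] A)
      (ψ : A →ₗ[ℂ] D), Nontrivial D ∧ Function.Injective γ ∧ IsCPC φ ∧ IsCPC ψ ∧
      IsAlmostMul F ε φ ∧ IsAlmostMul F ε ψ ∧ (∀ x d, φ x * γ d = 0) ∧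
      (∀ x ∈ F, ‖x - (φ x + γ (ψ x))‖ < ε) ∧ InC0' D ∧
      CuntzLE (φ s) b ∧ ∀ t ∈ tracialStates D, f ≤ (t (ψ s)).re

end External

/-! ### Cuntz comparison in simple algebras. -/

section Cuntz

attribute [local instance] CStarAlgebra.spectralOrder CStarAlgebra.spectralOrderedRing

variable {A B : Type*} [NonUnitalCStarAlgebra A] [NonUnitalCStarAlgebra B]

lemma CuntzLE.map {a b : A} (h : CuntzLE a b) (φ : A →⋆ₙₐ[ℂ] B) : CuntzLE (φ a) (φ b) := by
  obtain ⟨x, hx⟩ := h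
  refine ⟨fun n => φ (x n), ?_⟩
  have := ((continuous_hom φ).tendsto a).comp hx
  simpa only [Function.comp_def, map_mul, map_star] using this

lemma CuntzLE.of_forall_exists {a b : A} (h : ∀ ε > 0, ∃ x : A, ‖star x * b * x - a‖ < ε) :
    CuntzLE a b := by
  choose x hx using fun n : ℕ => h (1 / (n + 1)) Nat.one_div_pos_of_nat
  refine ⟨x, tendsto_iff_norm_sub_tendsto_zero.2 ?_⟩
  exact squeeze_zero (fun _ => norm_nonneg _) (fun n => (hx n).le)
    tendsto_one_div_add_atTop_nhds_zero_nat

/-- Cuntz subequivalence in an algebra restricts to hereditary subalgebras. -/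
lemma CuntzLE.of_map {ι : B →⋆ₙₐ[ℂ] A} (hι : HerEmb ι) {p q : B} (h : CuntzLE (ι p) (ι q)) :
    CuntzLE p q := by
  classical
  refine CuntzLE.of_forall_exists fun ε hε => ?_
  obtain ⟨x, hx⟩ := h
  obtain ⟨n, hn⟩ := ((tendsto_iff_norm_sub_tendsto_zero.1 hx).eventually_lt_const
    (by positivity : 0 < ε / 4)).exists
  generalize x n = x at hn
  have hε' : 0 < ε / (4 * (‖x‖ ^ 2 + 1)) := by positivity
  set ε' := ε / (4 * (‖x‖ ^ 2 + 1)) with hε'd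
  have hε'' : (2 * ε') * (‖x‖ ^ 2 + 1) = ε / 2 := by rw [hε'd]; field_simp; norm_num
  obtain ⟨e, he0, he1, he⟩ := exists_approx_unit {p, q} hε'
  -- Compressing x by an approximate unit e for p and q brings it into B; e is chosen after x, so
  -- its tolerance may depend on ‖x‖.
  obtain ⟨y, hy⟩ := hι.sandwich e e x
  refine ⟨y, ?_⟩
  have hse : star e = e := (IsSelfAdjoint.of_nonneg he0).star_eq
  have hiso : ∀ b, ‖ι b‖ = ‖b‖ := NonUnitalStarAlgHom.norm_map ι hι.inj
  have h2 : ∀ r ∈ ({p, q} : Finset B), ‖e * r * e - r‖ ≤ 2 * ε' := fun r hr => by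
    have h3 : e * r * e - r = -((r - e * r) + e * (r - r * e)) := by noncomm_ring
    rw [h3, norm_neg, two_mul]
    refine (norm_add_le _ _).trans (add_le_add (he r hr).1.le ((norm_mul_le _ _).trans ?_))
    exact (mul_le_of_le_one_left (norm_nonneg _) he1).trans (he r hr).2.le
  have hse' : star (ι e) = ι e := by rw [← map_star, hse]
  have hιe : ‖ι e‖ ≤ 1 := by rwa [hiso]
  have h4 : ∀ w : A, ‖ι e * w * ι e‖ ≤ ‖w‖ := fun w => by
    refine (norm_mul_le _ _).trans ((mul_le_of_le_one_right (norm_nonneg _) hιe).trans ?_)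
    exact (norm_mul_le _ _).trans (mul_le_of_le_one_left (norm_nonneg _) hιe)
  rw [← hiso, map_sub, map_mul, map_mul, map_star, hy]
  have h5 : star (ι e * x * ι e) * ι q * (ι e * x * ι e) - ι p =
      ι e * (star x * ι (e * q * e - q) * x) * ι e + ι e * (star x * ι q * x - ι p) * ι e +
        ι (e * p * e - p) := by
    simp only [star_mul, hse', map_sub, map_mul]
    noncomm_ring
  rw [h5]
  have h6 : ‖ι e * (star x * ι (e * q * e - q) * x) * ι e‖ ≤ ‖x‖ ^ 2 * (2 * ε') := by
    refine (h4 _).trans ((norm_mul_le _ _).trans ?_)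
    have := norm_mul_le (star x) (ι (e * q * e - q))
    rw [norm_star, hiso] at this
    nlinarith [norm_nonneg x, mul_le_mul_of_nonneg_left (h2 q (by simp)) (norm_nonneg x),
      mul_le_mul_of_nonneg_right (this.trans (mul_le_mul_of_nonneg_left (h2 q (by simp))
        (norm_nonneg x))) (norm_nonneg x)]
  have h7 := h4 (star x * ι q * x - ι p)
  have h8 : ‖ι (e * p * e - p)‖ ≤ 2 * ε' := (hiso _).trans_le (h2 p (by simp))
  calc _ ≤ _ := norm_add₃_le
    _ < ε := by nlinarith

/-- If p A e = 0, then p p⋆ = p (p⋆ - w) for every w in the span of A e A. Taking w close to p⋆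
contradicts ‖p p⋆‖ = ‖p‖². -/
lemma IsSimpleCStar.exists_mul_mul_ne_zero (h : IsSimpleCStar A) {p e : A} (hp : p ≠ 0)
    (he : e ≠ 0) : ∃ x, p * x * e ≠ 0 := by
  by_contra! hx
  obtain ⟨n, u, v, huv⟩ := h.exists_sum_near he (star p) (ε := ‖p‖) (norm_pos_iff.2 hp)
  have h1 : p * (star p - ∑ i, u i * e * v i) = p * star p := by
    rw [mul_sub, Finset.mul_sum, Finset.sum_eq_zero, sub_zero]
    intro i _
    rw [← mul_assoc, ← mul_assoc, hx, zero_mul]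
  have h2 := norm_mul_le p (star p - ∑ i, u i * e * v i)
  rw [h1, CStarRing.norm_self_mul_star] at h2
  have h3 : 0 < ‖p‖ := norm_pos_iff.2 hp
  nlinarith

lemma exists_sqrt {p : A} (hp : 0 ≤ p) : ∃ r : A, star r = r ∧ r * r = p :=
  ⟨CFC.sqrt p, (IsSelfAdjoint.of_nonneg (CFC.sqrt_nonneg p)).star_eq, CFC.sqrt_mul_sqrt_self p hp⟩

/-- For y = √p x √q ≠ 0 the element y⋆y is a conjugate of p and lies below a multiple of q. -/
lemma IsSimpleCStar.exists_cuntzLE_cuntzLE (h : IsSimpleCStar A) {p q : A} (hp : 0 ≤ p)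
    (hq : 0 ≤ q) (hp0 : p ≠ 0) (hq0 : q ≠ 0) :
    ∃ e, 0 ≤ e ∧ e ≠ 0 ∧ CuntzLE e p ∧ CuntzLE e q := by
  obtain ⟨r, hr, rfl⟩ := exists_sqrt hq
  obtain ⟨s, hs, rfl⟩ := exists_sqrt hp
  obtain ⟨x, hx⟩ := h.exists_mul_mul_ne_zero (p := s) (e := r) (by rintro rfl; simp at hp0)
    (by rintro rfl; simp at hq0)
  have h1 : star (x * r) * (s * s) * (x * r) = star (s * x * r) * (s * x * r) := by
    simp only [star_mul, hs, mul_assoc]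
  refine ⟨star (s * x * r) * (s * x * r), star_mul_self_nonneg _, ?_, ?_, ?_⟩
  · rwa [Ne, CStarRing.star_mul_self_eq_zero_iff]
  · rw [← h1]
    exact CuntzLE.conj _ _
  · have h2 : star (s * x * r) * (s * x * r) = star r * (star (s * x) * (s * x)) * r := by
      simp only [star_mul, mul_assoc]
    refine CuntzLE.of_le_smul (star_mul_self_nonneg _) hq (norm_nonneg (star (s * x) * (s * x))) ?_
    rw [h2]
    refine (CStarAlgebra.star_left_conjugate_le_norm_smul (.star_mul_self _)).trans_eq ?_
    rw [hr]

lemma IsSimpleCStar.exists_cuntzLE_all (h : IsSimpleCStar A) (n : ℕ) (p : ℕ → A)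
    (hp : ∀ i, 0 ≤ p i) (hp0 : ∀ i < n, p i ≠ 0) :
    ∃ e, 0 ≤ e ∧ e ≠ 0 ∧ ∀ i < n, CuntzLE e (p i) := by
  induction n with
  | zero =>
    have := h.1
    obtain ⟨e, he, he1⟩ := exists_nonneg_norm_one (A := A)
    exact ⟨e, he, norm_ne_zero_iff.1 (by rw [he1]; norm_num), by simp⟩
  | succ n ih =>
    obtain ⟨e, he, he0, hep⟩ := ih fun i hi => hp0 i (by omega)
    obtain ⟨e', he', he0', h1, h2⟩ := h.exists_cuntzLE_cuntzLE he (hp n) he0 (hp0 n (by omega))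
    refine ⟨e', he', he0', fun i hi => ?_⟩
    obtain hi | rfl := Nat.lt_succ_iff_lt_or_eq.1 hi
    · exact h1.trans (hep i hi)
    · exact h2

end Cuntz

/-! ### Simplicity, norms and strictly positive elements of matrix algebras. -/

section MatrixSimple

attribute [local instance] CStarAlgebra.spectralOrder CStarAlgebra.spectralOrderedRing

variable {A : Type*} [NonUnitalCStarAlgebra A] {n : ℕ}

lemma CStarMatrix.exists_entry_ne_zero {M : CStarMatrix (Fin n) (Fin n) A} (h : M ≠ 0) :
    ∃ i j, M i j ≠ 0 := by
  by_contra! h0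
  exact h (CStarMatrix.ext h0)

lemma star_mul_mul_star_ne_zero {m : A} (h : m ≠ 0) : star m * m * star m ≠ 0 := by
  intro h0
  have h1 : star (star m * m) * (star m * m) = 0 := by
    rw [star_mul, star_star, ← mul_assoc, h0, zero_mul]
  rw [CStarRing.star_mul_self_eq_zero_iff, CStarRing.star_mul_self_eq_zero_iff] at h1
  exact h h1

lemma IsSimpleCStar.matrix (h : IsSimpleCStar A) (hn : 0 < n) :
    IsSimpleCStar (CStarMatrix (Fin n) (Fin n) A) := by
  let k : Fin n := ⟨0, hn⟩
  have := h.1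
  obtain ⟨a, ha⟩ := exists_ne (0 : A)
  refine ⟨⟨matUnit k k a, 0, fun h0 => ha (matUnit_injective k k (h0.trans (map_zero
    (cornerHom A k)).symm))⟩, fun I hI hc => ?_⟩
  by_cases hb : I = ⊥
  · exact Or.inl hb
  · obtain ⟨M, hM, hM0⟩ := Submodule.exists_mem_ne_zero_of_ne_bot hb
    obtain ⟨i, j, hij⟩ := CStarMatrix.exists_entry_ne_zero hM0
    have h1 : matUnit k k (star (M i j) * M i j * star (M i j)) ∈ I := by
      rw [← matUnit_mul_mul_matUnit k i j k]
      exact (hI _ (hI _ hM _).1 _).2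
    have h2 := closedIdeal_matrix (T := (I : Set (CStarMatrix (Fin n) (Fin n) A)))
      (h.closedIdeal_eq_top (Set.mem_singleton _) (star_mul_mul_star_ne_zero hij)) k
      (by rintro s rfl; exact h1)
    exact Or.inr (top_le_iff.1 (h2.symm.trans_le (closedIdeal_le hI hc le_rfl)))

lemma norm_matUnit_le (i j : Fin n) (a : A) : ‖matUnit i j a‖ ≤ ‖a‖ := by
  have h1 : ‖matUnit i j a‖ * ‖matUnit i j a‖ ≤ ‖a‖ * ‖a‖ := by
    rw [← CStarRing.norm_star_mul_self, ← CStarRing.norm_star_mul_self, star_matUnit,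
      matUnit_mul_matUnit, if_pos rfl]
    exact norm_hom_le (cornerHom A j) _
  nlinarith [norm_nonneg a, norm_nonneg (matUnit i j a)]

lemma CStarMatrix.norm_le_of_entries {M : CStarMatrix (Fin n) (Fin n) A} {r : ℝ}
    (h : ∀ i j, ‖M i j‖ ≤ r) : ‖M‖ ≤ n * (n * r) := by
  conv_lhs => rw [sum_matUnit M]
  calc _ ≤ ∑ _i : Fin n, ∑ _j : Fin n, r := (norm_sum_le _ _).trans (Finset.sum_le_sum fun i _ =>
        (norm_sum_le _ _).trans (Finset.sum_le_sum fun j _ => (norm_matUnit_le i j _).trans (h i j)))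
    _ = n * (n * r) := by simp

lemma dense_diagHom {a : A} (ha : IsStrictlyPos a) :
    Dense (Set.range fun M => diagHom A (Fin n) a * M * diagHom A (Fin n) a) := by
  intro M
  have h1 : ∀ i j, ∃ x : ℕ → A, Tendsto (fun m => a * x m * a) atTop (𝓝 (M i j)) := fun i j => by
    obtain ⟨y, hy, hyt⟩ := mem_closure_iff_seq_limit.1 (ha.2 (M i j))
    choose x hx using hy
    exact ⟨x, by simpa only [hx] using hyt⟩
  choose x hx using h1
  refine mem_closure_of_tendsto (f := fun m => diagHom A (Fin n) a *
    CStarMatrix.ofMatrix (Matrix.of fun i j => x i j m) * diagHom A (Fin n) a) (b := atTop)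
    (CStarMatrix.tendsto_iff.2 fun i j => ?_) (Eventually.of_forall fun m => ⟨_, rfl⟩)
  simp only [mul_diagHom_apply, diagHom_mul_apply]
  exact hx i j

end MatrixSimple

/-! ### Orthogonal elements in algebras without projections. -/

section Bumps

attribute [local instance] CStarAlgebra.spectralOrder CStarAlgebra.spectralOrderedRing

variable {A : Type*} [NonUnitalCStarAlgebra A]

/-- On a finite spectrum the indicator of the nonzero points is continuous, so it yields a
projection p with c p = c; as p = 0, this forces c = 0. -/
lemma quasispectrum_infinite (hA : ∀ p : A, IsStarProjection p → p = 0) {c : A} (hc : 0 ≤ c)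
    (hc0 : c ≠ 0) : (quasispectrum ℝ c).Infinite := by
  intro hfin
  obtain ⟨t, ht, ht0⟩ := exists_mem_quasispectrum_norm hc (norm_pos_iff.2 hc0)
  have hsa : IsSelfAdjoint c := .of_nonneg hc
  let f : ℝ → ℝ := fun s => if s = 0 then 0 else 1
  have hf0 : f 0 = 0 := if_pos rfl
  have hf : ContinuousOn f (quasispectrum ℝ c) := hfin.continuousOn f
  have hff : (fun s => f s * f s) = f := by
    funext s; simp only [f]; split_ifs <;> simp
  have hp : IsStarProjection (cfcₙ f c) :=
    ⟨by rw [IsIdempotentElem, ← cfcₙ_mul f f c hf hf0 hf hf0, hff], cfcₙ_predicate f c⟩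
  have h1 : ∀ s ∈ quasispectrum ℝ c, s * f s = s := fun s _ => by
    simp only [f]; split_ifs with h <;> simp [h]
  have h2 : c * cfcₙ f c = c := by
    conv_lhs => enter [1]; rw [← cfcₙ_id' ℝ c]
    rw [← cfcₙ_mul (fun s => s) f c continuousOn_id rfl hf hf0, cfcₙ_congr h1, cfcₙ_id' ℝ c]
  rw [hA _ hp, mul_zero] at h2
  exact hc0 h2.symm

lemma exists_separation {S : Finset ℝ} (hS : ∀ t ∈ S, 0 < t) :
    ∃ r > 0, (∀ t ∈ S, 2 * r ≤ t) ∧ ∀ t ∈ S, ∀ s ∈ S, t ≠ s → 2 * r ≤ |t - s| := by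
  have key : ∀ {ι : Type} (T : Finset ι) (f : ι → ℝ), (∀ i ∈ T, 0 < f i) →
      ∃ r > 0, ∀ i ∈ T, 2 * r ≤ f i := fun T f hf => by
    obtain rfl | hT := T.eq_empty_or_nonempty
    · exact ⟨1, one_pos, by simp⟩
    · obtain ⟨i, hi, him⟩ := T.exists_min_image f hT
      exact ⟨f i / 2, half_pos (hf i hi), fun j hj => by linarith [him j hj]⟩
  obtain ⟨r, hr, h1⟩ := key S id hS
  obtain ⟨r', hr', h2⟩ := key S.offDiag (fun p => |p.1 - p.2|) fun p hp =>
    abs_pos.2 (sub_ne_zero.2 (Finset.mem_offDiag.1 hp).2.2)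
  refine ⟨min r r', lt_min hr hr', fun t ht => ?_, fun t ht s hs hts => ?_⟩
  · exact (by linarith [min_le_left r r'] : 2 * min r r' ≤ 2 * r).trans (h1 t ht)
  · exact (by linarith [min_le_right r r'] : 2 * min r r' ≤ 2 * r').trans
      (h2 (t, s) (Finset.mem_offDiag.2 ⟨ht, hs, hts⟩))

/-- In an algebra without projections, every nonzero positive element dominates any given number of
pairwise orthogonal nonzero positive elements. -/
lemma exists_orthogonal (hA : ∀ p : A, IsStarProjection p → p = 0) {c : A} (hc : 0 ≤ c)
    (hc0 : c ≠ 0) (n : ℕ) : ∃ g : Fin n → A, (∀ i, 0 ≤ g i) ∧ (∀ i, g i ≠ 0) ∧ (∀ i, g i ≤ c) ∧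
      ∀ i j, i ≠ j → g i * g j = 0 := by
  have hinf := (quasispectrum_infinite hA hc hc0).sdiff (Set.finite_singleton (0 : ℝ))
  obtain ⟨S, hS, hSn⟩ := hinf.exists_subset_card_eq n
  have hpos : ∀ t ∈ S, 0 < t := fun t ht =>
    lt_of_le_of_ne (quasispectrum_nonneg_of_nonneg c hc t (hS ht).1) (Ne.symm (hS ht).2)
  obtain ⟨r, hr, h1, h2⟩ := exists_separation hpos
  let e : Fin n ≃ S := (Fin.castOrderIso hSn.symm).toEquiv.trans S.equivFin.symm
  -- Tents of height r at n spectral points that are 2r-separated from each other and from 0: they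
  -- are nonzero at c, have pairwise zero product, and lie below the identity function.
  let f : Fin n → ℝ → ℝ := fun i t => max 0 (r - |t - e i|)
  have hf : ∀ i, Continuous (f i) := fun i => by fun_prop
  have hf0 : ∀ i, f i 0 = 0 := fun i => max_eq_left (by
    rw [zero_sub, abs_neg, abs_of_pos (hpos _ (e i).2)]
    linarith [h1 _ (e i).2])
  have hsa : IsSelfAdjoint c := .of_nonneg hc
  refine ⟨fun i => cfcₙ (f i) c, fun i => cfcₙ_nonneg fun t _ => le_max_left _ _, fun i => ?_,
    fun i => ?_, fun i j hij => ?_⟩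
  · refine cfcₙ_ne_zero hsa (hf i) (hf0 i) (hS (e i).2).1 ?_
    simp only [f, sub_self, abs_zero, sub_zero, max_eq_right hr.le]
    exact hr.ne'
  · refine (cfcₙ_mono (f := f i) (g := id) (fun t ht => ?_) (hf i).continuousOn continuousOn_id
      (hf0 i) rfl).trans_eq (cfcₙ_id ℝ c)
    refine max_le (quasispectrum_nonneg_of_nonneg c hc t ht) ?_
    have h3 := h1 _ (e i).2
    have h4 := neg_abs_le (t - e i)
    have h5 := abs_nonneg (t - e i)
    simp only [id]
    linarith
  · rw [← cfcₙ_mul (f i) (f j) c (hf i).continuousOn (hf0 i) (hf j).continuousOn (hf0 j)]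
    have h3 : (fun t => f i t * f j t) = fun _ => 0 := by
      funext t
      have h4 := h2 _ (e i).2 _ (e j).2 fun h => hij (e.injective (Subtype.ext h))
      by_cases h5 : r ≤ |t - e i|
      · simp only [f]; rw [max_eq_left (sub_nonpos.2 h5), zero_mul]
      · have h6 := abs_sub_le (e i : ℝ) t (e j)
        rw [abs_sub_comm (e i : ℝ) t] at h6
        simp only [f]
        rw [max_eq_left (b := r - |t - e j|) (by linarith), mul_zero]
    rw [h3]
    exact cfcₙ_zero ℝ c

end Bumps

/-! ### Tracial approximation of matrix algebras. -/

section MatrixApproximation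

attribute [local instance] CStarAlgebra.spectralOrder CStarAlgebra.spectralOrderedRing

universe u

variable {A : Type u} [NonUnitalCStarAlgebra A] {n : ℕ}

/-- A nonzero b = y⋆y has a nonzero diagonal entry w; conjugating b by the corner element with entry
w leaves only w³ in that corner. -/
lemma exists_matUnit_cuntzLE {b : CStarMatrix (Fin n) (Fin n) A} (hb : 0 ≤ b) (hb0 : b ≠ 0) :
    ∃ (k : Fin n) (c : A), 0 ≤ c ∧ c ≠ 0 ∧ CuntzLE (matUnit k k c) b := by
  obtain ⟨y, rfl⟩ := exists_eq_star_mul_self hb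
  have hy : y ≠ 0 := by rintro rfl; simp at hb0
  obtain ⟨i, l, hil⟩ := CStarMatrix.exists_entry_ne_zero hy
  set w := (star y * y) l l with hw
  have h1 : w = ∑ k, star (y k l) * y k l := CStarMatrix.mul_apply_apply _ _ _ _
  have h2 : star (y i l) * y i l ≤ w := by
    rw [h1]
    exact Finset.single_le_sum (f := fun k => star (y k l) * y k l)
      (fun k _ => star_mul_self_nonneg _) (Finset.mem_univ i)
  have h3 : 0 ≤ w := (star_mul_self_nonneg _).trans h2
  have h4 : w ≠ 0 := fun h => by
    rw [h] at h2
    have := le_antisymm h2 (star_mul_self_nonneg _)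
    rw [CStarRing.star_mul_self_eq_zero_iff] at this
    exact hil this
  refine ⟨l, star w * w * w, star_left_conjugate_nonneg h3 w, ?_, ?_⟩
  · have := star_mul_mul_star_ne_zero h4
    rwa [(IsSelfAdjoint.of_nonneg h3).star_eq] at this ⊢
  · have h5 : matUnit l l (star w * w * w) = star (matUnit l l w) * (star y * y) * matUnit l l w := by
      rw [star_matUnit, matUnit_mul_mul_matUnit]
    rw [h5]
    exact CuntzLE.conj _ _

/-- Room for n copies of e: below c there are n orthogonal elements gᵢ, and simplicity gives one
nonzero e ≲ gᵢ³ for all i. Conjugating the corner entry ∑ gᵢ by the row with entries gᵢ xᵢ kills all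
cross terms and leaves a diagonal converging to diag(e, …, e). -/
lemma exists_diagHom_cuntzLE (hs : IsSimpleCStar A) (hA : ∀ p : A, IsStarProjection p → p = 0)
    {b : CStarMatrix (Fin n) (Fin n) A} (hb : 0 ≤ b) (hb0 : b ≠ 0) :
    ∃ e : A, 0 ≤ e ∧ e ≠ 0 ∧ CuntzLE (diagHom A (Fin n) e) b := by
  obtain ⟨k, c, hc, hc0, hcb⟩ := exists_matUnit_cuntzLE hb hb0
  obtain ⟨g, hg, hg0, hgc, horth⟩ := exists_orthogonal hA hc hc0 n
  have hgs : ∀ i, star (g i) = g i := fun i => (IsSelfAdjoint.of_nonneg (hg i)).star_eq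
  let p : ℕ → A := fun i => if h : i < n then star (g ⟨i, h⟩) * g ⟨i, h⟩ * g ⟨i, h⟩ else 0
  have hpi : ∀ i : Fin n, p i = g i * g i * g i := fun i => by
    simp only [p]; rw [dif_pos i.2, hgs]
  obtain ⟨e, he, he0, hep⟩ := hs.exists_cuntzLE_all n p (fun i => by
      simp only [p]; split_ifs
      · exact star_left_conjugate_nonneg (hg _) _
      · exact le_rfl)
    (fun i hi => by
      simp only [p]; rw [dif_pos hi]
      have := star_mul_mul_star_ne_zero (hg0 ⟨i, hi⟩)
      rwa [hgs] at this ⊢)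
  refine ⟨e, he, he0, CuntzLE.trans ?_ hcb⟩
  choose x hx using fun i : Fin n => hep i i.2
  have h1 : CuntzLE (matUnit k k (∑ i, g i)) (matUnit k k c) := by
    refine CuntzLE.map (φ := cornerHom A k) (CuntzLE.of_le_smul (r := n)
      (Finset.sum_nonneg fun i _ => hg i) hc (Nat.cast_nonneg n) ?_)
    refine (Finset.sum_le_sum fun i _ => hgc i).trans_eq ?_
    rw [Finset.sum_const, Finset.card_univ, Fintype.card_fin, Nat.cast_smul_eq_nsmul]
  refine CuntzLE.trans ⟨fun m => ∑ i, matUnit k i (g i * x i m), ?_⟩ h1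
  have h2 : ∀ m, star (∑ i, matUnit k i (g i * x i m)) * matUnit k k (∑ i, g i) *
      ∑ i, matUnit k i (g i * x i m) = ∑ i, matUnit i i (star (x i m) * p i * x i m) := fun m => by
    simp only [star_sum, star_matUnit, Finset.sum_mul, Finset.mul_sum, matUnit_mul_matUnit, if_true]
    rw [Finset.sum_comm]
    refine Finset.sum_congr rfl fun i _ => ?_
    rw [Finset.sum_eq_single i]
    · congr 1
      rw [hpi, star_mul, hgs, Finset.sum_eq_single i]
      · simp only [mul_assoc]
      · intro l _ hl
        rw [mul_assoc (star (x i m)), horth i l (Ne.symm hl), mul_zero, zero_mul]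
      · simp
    · intro j _ hj
      rw [star_mul, hgs, Finset.sum_eq_zero]
      · exact CStarMatrix.ext fun _ _ => by rw [matUnit_apply, ite_self]; rfl
      · intro l _
        by_cases h : i = l
        · rw [← h, mul_assoc, ← mul_assoc (g i) (g j), horth i j (Ne.symm hj), zero_mul, mul_zero]
        · rw [mul_assoc (star (x i m)), horth i l h, mul_zero, zero_mul]
    · simp
  simp only [h2]
  refine CStarMatrix.tendsto_iff.2 fun i j => ?_
  simp only [CStarMatrix.sum_apply, matUnit_apply, diagHom_apply_apply]
  by_cases hij : i = j
  · subst hij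
    simp only [and_self, Finset.sum_ite_eq', Finset.mem_univ, if_true]
    exact hx i
  · rw [if_neg hij]
    refine tendsto_const_nhds.congr fun m => (Finset.sum_eq_zero fun l _ => ?_).symm
    exact if_neg fun h => hij (h.1.symm.trans h.2)

lemma cutoff_le_four_mul {t : ℝ} (ht : 0 ≤ t) : cutoff (1 / 4) t ≤ 4 * t := by
  unfold cutoff
  split_ifs <;> linarith

lemma trace_cutoff_le {D : Type*} [NonUnitalCStarAlgebra D] {t : WeakDual ℂ D}
    (ht : t ∈ tracialStates D) {c : D} (hc : 0 ≤ c) :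
    (t (cfcₙ (cutoff (1 / 4)) c)).re ≤ 4 * (t c).re := by
  have h1 : cfcₙ (cutoff (1 / 4)) c ≤ (4 : ℝ) • c := by
    have h2 : (4 : ℝ) • c = cfcₙ (fun s : ℝ => 4 * s) c := by
      rw [cfcₙ_const_mul_id (4 : ℝ) c]
    rw [h2]
    exact cfcₙ_mono (fun s hs => cutoff_le_four_mul (quasispectrum_nonneg_of_nonneg c hc s hs))
      (continuous_cutoff (by norm_num)).continuousOn (by fun_prop) (cutoff_zero (by norm_num))
      (by simp)
  have h3 := (ht.1 _ (sub_nonneg.2 h1)).1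
  have h4 : t ((4 : ℝ) • c) = 4 * t c := by
    have : (4 : ℝ) • c = (4 : ℂ) • c := by norm_cast
    rw [this, map_smul, smul_eq_mul]
  rw [map_sub, h4, Complex.sub_re] at h3
  simp at h3
  linarith

lemma mapLin_diagHom {B : Type*} [NonUnitalCStarAlgebra B] (φ : A →ₗ[ℂ] B) (a : A) :
    mapLin n φ (diagHom A (Fin n) a) = diagHom B (Fin n) (φ a) := by
  refine CStarMatrix.ext fun i j => ?_
  rw [mapLin_apply_apply, diagHom_apply_apply, diagHom_apply_apply]
  split_ifs <;> simp

/-- The trace of the diagonal matrix is n ρ(c) for the corner functional ρ. The normalization of ρ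
is at least f/4 at c, since the cutoff is at most 4t, and n ‖ρ‖ ≥ 1. -/
lemma le_trace_diagHom {D : Type*} [NonUnitalCStarAlgebra D] (hn : 0 < n) {c : D} (hc : 0 ≤ c)
    {f : ℝ} (hf : 0 ≤ f)
    (h : ∀ t ∈ tracialStates D, f ≤ (t (cfcₙ (cutoff (1 / 4)) c)).re)
    {τ : WeakDual ℂ (CStarMatrix (Fin n) (Fin n) D)}
    (hτ : τ ∈ tracialStates (CStarMatrix (Fin n) (Fin n) D)) :
    f / 4 ≤ (τ (diagHom D (Fin n) c)).re := by
  let k : Fin n := ⟨0, hn⟩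
  let e := StarAlgEquiv.refl (R := ℂ) (A := CStarMatrix (Fin n) (Fin n) D)
  set ρ := cornerFunctional e k τ with hρ
  have h1 : τ (diagHom D (Fin n) c) = n * ρ c := by
    have := trace_eq_sum_cornerFunctional e k hτ (diagHom D (Fin n) c)
    simp only [diagHom_apply_apply, if_true, ← hρ, Finset.sum_const, Finset.card_univ,
      Fintype.card_fin, nsmul_eq_mul] at this
    exact this
  have h2 : 1 ≤ n * ‖ρ‖ := one_le_mul_norm_cornerFunctional e k hτ
  have hm := cornerFunctional_mem e k hτ
  have h3 := (h _ hm).trans (trace_cutoff_le hm hc)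
  have h4 : ((StrongDual.toWeakDual ((‖ρ‖⁻¹ : ℝ) • ρ)) c).re = ‖ρ‖⁻¹ * (ρ c).re := by
    change ((‖ρ‖⁻¹ : ℝ) • ρ c).re = _
    simp
  rw [← hρ, h4] at h3
  have h5 : 0 < ‖ρ‖ := by
    by_contra h7
    have : ‖ρ‖ = 0 := le_antisymm (not_lt.1 h7) (norm_nonneg _)
    rw [this, mul_zero] at h2
    linarith
  have h6 : f / 4 * ‖ρ‖ ≤ (ρ c).re := by
    have h8 : (ρ c).re = ‖ρ‖ * (‖ρ‖⁻¹ * (ρ c).re) := by field_simp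
    nlinarith
  rw [h1]
  simp only [Complex.mul_re, Complex.natCast_re, Complex.natCast_im, zero_mul, sub_zero]
  calc f / 4 ≤ n * ‖ρ‖ * (f / 4) := le_mul_of_one_le_left (by positivity) h2
    _ = n * (f / 4 * ‖ρ‖) := by ring
    _ ≤ _ := by gcongr

/-- Entrywise application of an almost multiplicative map is almost multiplicative. -/
lemma norm_mapLin_mul_sub_lt {B : Type*} [NonUnitalCStarAlgebra B] {φ : A →ₗ[ℂ] B} {ε : ℝ}
    {M N : CStarMatrix (Fin n) (Fin n) A}
    (h : ∀ i j k l, ‖φ (M i j * N k l) - φ (M i j) * φ (N k l)‖ < ε) :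
    ‖mapLin n φ (M * N) - mapLin n φ M * mapLin n φ N‖ ≤ n * (n * (n * ε)) := by
  refine CStarMatrix.norm_le_of_entries fun i j => ?_
  have h1 : (mapLin n φ (M * N) - mapLin n φ M * mapLin n φ N) i j =
      ∑ k, (φ (M i k * N k j) - φ (M i k) * φ (N k j)) := by
    rw [CStarMatrix.sub_apply, mapLin_apply_apply, CStarMatrix.mul_apply_apply,
      CStarMatrix.mul_apply_apply, map_sum, ← Finset.sum_sub_distrib]
    rfl
  rw [h1]
  refine (norm_sum_le _ _).trans ((Finset.sum_le_sum fun k _ => (h i k k j).le).trans_eq ?_)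
  simp

/-- Tracial approximation passes to matrix algebras. -/
theorem InD.traciallyApproximated_matrix (h : InD A) (hA : ∀ p : A, IsStarProjection p → p = 0)
    (hn : 0 < n) : ∃ s : CStarMatrix (Fin n) (Fin n) A, 0 ≤ s ∧
      Dense (Set.range fun M => s * M * s) ∧ ∃ f : ℝ, 0 < f ∧ TraciallyApproximated s f := by
  classical
  obtain ⟨a, ha, -, f, hf0, -, hd⟩ := h.exists_embeddings
  refine ⟨diagHom A (Fin n) a, map_nonneg_hom _ ha.1, dense_diagHom ha, f / 4, by positivity,
    fun ε F b hε hb hb0 => ?_⟩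
  obtain ⟨e, he, he0, heb⟩ := exists_diagHom_cuntzLE h.1 hA hb hb0
  have hn' : (0 : ℝ) < n := Nat.cast_pos.2 hn
  have hn1 : (1 : ℝ) ≤ n := Nat.one_le_cast.2 hn
  -- A factor n² comes from bounding a matrix norm by its entries, one more n from the sums in a
  -- matrix product; the 2 makes the estimate strict.
  let ε' := ε / (2 * (n * n * n))
  have hε' : 0 < ε' := by positivity
  have hεn : n * (n * (n * ε')) < ε := by
    have : n * (n * (n * ε')) = ε / 2 := by simp only [ε']; field_simp
    linarith
  let F' : Finset A := F.biUnion fun M => Finset.univ.image fun p : Fin n × Fin n => M p.1 p.2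
  have hF' : ∀ M ∈ F, ∀ i j, M i j ∈ F' := fun M hM i j =>
    Finset.mem_biUnion.2 ⟨M, hM, Finset.mem_image.2 ⟨(i, j), Finset.mem_univ _, rfl⟩⟩
  obtain ⟨D, _, γ, φ, ψ, hnt, hγ, hφ, hψ, hφm, hψm, h0, hF, hD, hc, ht⟩ := hd ε' F' e hε' he he0
  let k : Fin n := ⟨0, hn⟩
  have hnt' : Nontrivial (CStarMatrix (Fin n) (Fin n) D) := by
    obtain ⟨x, hx⟩ := exists_ne (0 : D)
    exact ⟨matUnit k k x, 0, fun h0 => hx (matUnit_injective k k (h0.trans (map_zero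
      (cornerHom D k)).symm))⟩
  refine ⟨CStarMatrix (Fin n) (Fin n) D, inferInstance, CStarMatrix.mapₙₐ γ, mapLin n φ,
    mapLin n ψ, hnt', mapₙₐ_injective hγ, hφ.mapLin n, hψ.mapLin n, fun M hM N hN => ?_,
    fun M hM N hN => ?_, fun M d => ?_, fun M hM => ?_, hD.matrix hn, ?_, fun τ hτ => ?_⟩
  · exact (norm_mapLin_mul_sub_lt fun i j k l =>
      hφm _ (hF' M hM i j) _ (hF' N hN k l)).trans_lt hεn
  · exact (norm_mapLin_mul_sub_lt fun i j k l =>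
      hψm _ (hF' M hM i j) _ (hF' N hN k l)).trans_lt hεn
  · refine CStarMatrix.ext fun i j => ?_
    rw [CStarMatrix.mul_apply_apply]
    exact Finset.sum_eq_zero fun k _ => h0 (M i k) (d k j)
  · refine (CStarMatrix.norm_le_of_entries (r := n * ε') fun i j => ?_).trans_lt hεn
    exact (hF _ (hF' M hM i j)).le.trans (le_mul_of_one_le_left hε'.le hn1)
  · rw [mapLin_diagHom]
    exact (hc.map (diagHom A (Fin n))).trans heb
  · rw [mapLin_diagHom]
    exact le_trace_diagHom hn ((isCPC_iff.1 hψ).1.nonneg ha.1) hf0.le ht hτ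

end MatrixApproximation

/-! ### Cutoffs of nearby elements and of orthogonal sums. -/

section PerturbedCutoff

attribute [local instance] CStarAlgebra.spectralOrder CStarAlgebra.spectralOrderedRing

variable {A D : Type*} [NonUnitalCStarAlgebra A] [NonUnitalCStarAlgebra D]

lemma tendsto_cfcₙ_selfAdjoint {f : ℝ → ℝ} (hf : Continuous f) (h0 : f 0 = 0) {b : A}
    (hb : IsSelfAdjoint b) :
    Tendsto (fun y : A => cfcₙ f y) (𝓝[{y | IsSelfAdjoint y}] b) (𝓝 (cfcₙ f b)) :=
  (ContinuousOn.cfcₙ_of_mem_nhdsSet (s := Set.univ) f univ_mem continuousOn_id (fun _ h => h)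
    hf.continuousOn h0) b hb

lemma cfcₙ_sqrt_mul_self {p : A} (hp : 0 ≤ p) : cfcₙ Real.sqrt (p * p) = p := by
  have h : 0 ≤ p * p := by
    have := star_mul_self_nonneg p
    rwa [(IsSelfAdjoint.of_nonneg hp).star_eq] at this
  rw [← CFC.sqrt_eq_real_sqrt _ h, CFC.sqrt_mul_self p hp]

lemma cutoff_nonneg_cfcₙ {δ : ℝ} (hδ : 0 < δ) (y : A) : 0 ≤ cfcₙ (cutoff δ) y :=
  cfcₙ_nonneg fun t _ => (cutoff_mem hδ t).1

lemma star_cfcₙ_cutoff {δ : ℝ} (hδ : 0 < δ) (y : A) :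
    star (cfcₙ (cutoff δ) y) = cfcₙ (cutoff δ) y :=
  (IsSelfAdjoint.of_nonneg (cutoff_nonneg_cfcₙ hδ y)).star_eq

lemma norm_cfcₙ_cutoff_le {δ : ℝ} (hδ : 0 < δ) (y : A) : ‖cfcₙ (cutoff δ) y‖ ≤ 1 :=
  norm_cfcₙ_le fun t _ => by
    rw [Real.norm_of_nonneg (cutoff_mem hδ t).1]; exact (cutoff_mem hδ t).2

/-- If `‖y - q‖ ≤ δ / 4` and `k = f_δ(y)`, then `k y k ≤ 2 k q k` and `k ^ 2 ≤ (4 / δ) k q k`. -/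
lemma cutoff_conj_le {δ : ℝ} (hδ : 0 < δ) {y q : A} (hy : 0 ≤ y) (hq : IsSelfAdjoint q)
    (h : ‖y - q‖ ≤ δ / 4) :
    cfcₙ (cutoff δ) y * y * cfcₙ (cutoff δ) y ≤
        (2 : ℝ) • (cfcₙ (cutoff δ) y * q * cfcₙ (cutoff δ) y) ∧
      cfcₙ (cutoff δ) y * cfcₙ (cutoff δ) y ≤
        (4 / δ) • (cfcₙ (cutoff δ) y * q * cfcₙ (cutoff δ) y) := by
  have hc := continuous_cutoff hδ
  have h0 := cutoff_zero hδ
  have hsa : IsSelfAdjoint y := .of_nonneg hy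
  set k := cfcₙ (cutoff δ) y with hk
  have hks : star k = k := star_cfcₙ_cutoff hδ y
  have h1 : k * y * k - k * q * k ≤ (δ / 4) • (k * k) := by
    have h2 := CStarAlgebra.star_left_conjugate_le_norm_smul (a := k) (b := y - q) (hsa.sub hq)
    rw [hks] at h2
    have h3 : ‖y - q‖ • (k * k) ≤ (δ / 4) • (k * k) := by
      refine smul_le_smul_of_nonneg_right h ?_
      have := star_mul_self_nonneg k
      rwa [hks] at this
    calc _ = k * (y - q) * k := by noncomm_ring
      _ ≤ _ := h2.trans h3
  have h4 : k * k = cfcₙ (fun t => cutoff δ t * cutoff δ t) y := by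
    rw [hk, ← cfcₙ_mul _ _ y]
  have h5 : k * y * k = cfcₙ (fun t => cutoff δ t * t * cutoff δ t) y := by
    conv_lhs => rw [hk, ← cfcₙ_id' ℝ y]
    rw [cfcₙ_id' ℝ y, cfcₙ_mul (fun t => cutoff δ t * t) _ y, cfcₙ_mul _ (fun t => t) y,
      cfcₙ_id' ℝ y]
  -- The cutoff vanishes below δ/2. Hence the error (δ/4) k² is at most half of k y k, and k q k
  -- keeps the other half.
  have h6 : (δ / 2) • (k * k) ≤ k * y * k := by
    rw [h4, h5, ← cfcₙ_smul (δ / 2) _ y (by fun_prop) (by simp [h0])]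
    refine cfcₙ_mono (fun t _ => ?_) (by fun_prop) (by fun_prop) (by simp [h0]) (by simp [h0])
    by_cases ht : t ≤ δ / 2
    · simp [cutoff_of_le ht]
    · have := (cutoff_mem hδ t).1
      simp only [smul_eq_mul]
      nlinarith [mul_nonneg this this, not_le.1 ht]
  have h7 : (δ / 4) • (k * k) ≤ (1 / 2 : ℝ) • (k * y * k) := by
    have := smul_le_smul_of_nonneg_left h6 (by norm_num : (0 : ℝ) ≤ 1 / 2)
    rwa [smul_smul, show (1 / 2 : ℝ) * (δ / 2) = δ / 4 by ring] at this
  constructor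
  · have h8 : (1 / 2 : ℝ) • (k * y * k) ≤ k * q * k := by
      have h9 := sub_le_iff_le_add'.1 (h1.trans h7)
      have h10 : k * y * k = (1 / 2 : ℝ) • (k * y * k) + (1 / 2 : ℝ) • (k * y * k) := by
        rw [← add_smul]; norm_num
      nth_rw 1 [h10] at h9
      exact le_of_add_le_add_right h9
    have := smul_le_smul_of_nonneg_left h8 (by norm_num : (0 : ℝ) ≤ 2)
    rwa [smul_smul, show (2 : ℝ) * (1 / 2) = 1 by norm_num, one_smul] at this
  · have h8 : (δ / 4) • (k * k) ≤ k * q * k := by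
      have h9 := h6.trans (sub_le_iff_le_add'.1 h1)
      have h10 : (δ / 2) • (k * k) = (δ / 4) • (k * k) + (δ / 4) • (k * k) := by
        rw [← add_smul]; congr 1; ring
      rw [h10] at h9
      exact le_of_add_le_add_right h9
    have := smul_le_smul_of_nonneg_left h8 (by positivity : (0 : ℝ) ≤ 4 / δ)
    rwa [smul_smul, show 4 / δ * (δ / 4) = 1 by field_simp, one_smul] at this

/-- For `y` close to `b`, the element `f_δ(y)` is of the form `|W|` for some `W` in `√b A` that is
close to `f_δ(b)`. -/
lemma exists_near_cutoff {b : A} (hb : 0 ≤ b) {δ η : ℝ} (hδ : 0 < δ) (hη : 0 < η) :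
    ∃ ε > 0, ∀ y : A, 0 ≤ y → ‖y - b‖ < ε → ∃ (W : A) (w : ℕ → A),
      Tendsto (fun n => cfcₙ Real.sqrt b * w n) atTop (𝓝 W) ∧
      star W * W = cfcₙ (cutoff δ) y * cfcₙ (cutoff δ) y ∧ ‖W - cfcₙ (cutoff δ) b‖ < η := by
  have hsa : IsSelfAdjoint b := .of_nonneg hb
  have hc := continuous_cutoff hδ
  have h0 := cutoff_zero hδ
  set r := cfcₙ Real.sqrt b with hr
  have hr0 : 0 ≤ r := cfcₙ_nonneg fun t _ => Real.sqrt_nonneg t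
  have hrs : star r = r := (IsSelfAdjoint.of_nonneg hr0).star_eq
  have hrr : r * r = b := by
    rw [hr, ← CFC.sqrt_eq_real_sqrt _ hb, CFC.sqrt_mul_sqrt_self b hb]
  set c : ℝ := √(4 / δ) with hcd
  have hcc : c * c = 4 / δ := Real.mul_self_sqrt (by positivity)
  -- For y near b, Y⋆Y = (4/δ) k b k dominates k² with k = f_δ(y), so `exists_polar` yields W in the
  -- closure of √b A with |W| = k. At y = b the element Y is positive, hence Y is close to |Y|
  -- nearby, and W is close to k.
  let Y : A → A := fun y => c • (r * cfcₙ (cutoff δ) y)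
  have hYY : ∀ y, star (Y y) * Y y = (4 / δ) • (cfcₙ (cutoff δ) y * b * cfcₙ (cutoff δ) y) :=
    fun y => by
      simp only [Y, star_smul, star_mul, star_cfcₙ_cutoff hδ, hrs, star_trivial, smul_mul_assoc,
        mul_smul_comm, smul_smul, hcc, ← hrr]
      congr 1
      noncomm_ring
  have hYb : 0 ≤ Y b := by
    refine smul_nonneg (Real.sqrt_nonneg _) ?_
    rw [hr, ← cfcₙ_mul _ _ b]
    exact cfcₙ_nonneg fun t _ => mul_nonneg (Real.sqrt_nonneg t) (cutoff_mem hδ t).1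
  have t1 := tendsto_cfcₙ_selfAdjoint hc h0 hsa
  have t2 : Tendsto Y (𝓝[{y | IsSelfAdjoint y}] b) (𝓝 (Y b)) := (t1.const_mul r).const_smul c
  have t3 : Tendsto (fun y => cfcₙ Real.sqrt (star (Y y) * Y y)) (𝓝[{y | IsSelfAdjoint y}] b)
      (𝓝 (Y b)) := by
    have h1 : cfcₙ Real.sqrt (star (Y b) * Y b) = Y b := by
      rw [(IsSelfAdjoint.of_nonneg hYb).star_eq, cfcₙ_sqrt_mul_self hYb]
    have h2 := (tendsto_cfcₙ_selfAdjoint Real.continuous_sqrt Real.sqrt_zero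
      (IsSelfAdjoint.star_mul_self (Y b)))
    rw [h1] at h2
    refine h2.comp (tendsto_nhdsWithin_iff.2 ⟨t2.star.mul t2, Eventually.of_forall fun y => ?_⟩)
    exact IsSelfAdjoint.star_mul_self (Y y)
  have e1 : ∀ᶠ y in 𝓝[{y : A | IsSelfAdjoint y}] b,
      ‖Y y - cfcₙ Real.sqrt (star (Y y) * Y y)‖ < η / 2 := by
    have := (t2.sub t3).norm
    rw [sub_self, norm_zero] at this
    exact this.eventually_lt_const (half_pos hη)
  have e2 : ∀ᶠ y in 𝓝[{y : A | IsSelfAdjoint y}] b,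
      ‖cfcₙ (cutoff δ) y - cfcₙ (cutoff δ) b‖ < η / 2 :=
    (tendsto_iff_norm_sub_tendsto_zero.1 t1).eventually_lt_const (half_pos hη)
  obtain ⟨ε, hε, hball⟩ := Metric.mem_nhdsWithin_iff.1 (e1.and e2)
  refine ⟨min ε (δ / 4), lt_min hε (by positivity), fun y hy hyb => ?_⟩
  have hysa : IsSelfAdjoint y := .of_nonneg hy
  obtain ⟨h1, h2⟩ := hball ⟨mem_ball_iff_norm.2 (hyb.trans_le (min_le_left _ _)), hysa⟩
  have h3 := (cutoff_conj_le hδ hy hsa (hyb.le.trans (min_le_right _ _))).2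
  rw [← hYY] at h3
  have hk0 := cutoff_nonneg_cfcₙ hδ y
  have hkk : 0 ≤ cfcₙ (cutoff δ) y * cfcₙ (cutoff δ) y := by
    have := star_mul_self_nonneg (cfcₙ (cutoff δ) y)
    rwa [star_cfcₙ_cutoff hδ] at this
  obtain ⟨m, W, hm, hW1, hW2, hW3⟩ := exists_polar hkk h3
  rw [cfcₙ_sqrt_mul_self hk0] at hW2
  refine ⟨W, fun n => c • (cfcₙ (cutoff δ) y * m n), ?_, hW3, ?_⟩
  · refine hW1.congr fun n => ?_
    simp only [Y, smul_mul_assoc, mul_smul_comm, mul_assoc]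
  -- W and k are the limits of Y mₙ and |Y| mₙ for the same contractions mₙ.
  · have h5 : ‖W - cfcₙ (cutoff δ) y‖ ≤ ‖Y y - cfcₙ Real.sqrt (star (Y y) * Y y)‖ := by
      refine le_of_tendsto (hW1.sub hW2).norm (Eventually.of_forall fun n => ?_)
      rw [← sub_mul]
      exact (norm_mul_le _ _).trans (mul_le_of_le_one_right (norm_nonneg _) (hm n))
    calc _ = ‖(W - cfcₙ (cutoff δ) y) + (cfcₙ (cutoff δ) y - cfcₙ (cutoff δ) b)‖ := by
          rw [sub_add_sub_cancel]
      _ ≤ _ := norm_add_le _ _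
      _ < η := by linarith

/-- Functional calculus of an orthogonal sum `c₀ + γ(c)`. -/
lemma cfcₙ_add_hom (γ : D →⋆ₙₐ[ℂ] A) {c₀ : A} {c : D} (hc₀ : IsSelfAdjoint c₀)
    (hc : IsSelfAdjoint c) (h : ∀ d, c₀ * γ d = 0) {f : ℝ → ℝ} (hf : Continuous f) (h0 : f 0 = 0) :
    cfcₙ f (c₀ + γ c) = cfcₙ f c₀ + γ (cfcₙ f c) ∧ ∀ d, cfcₙ f c₀ * γ d = 0 := by
  have hγ := continuous_hom γ
  -- Triples (sum, first summand, second summand) with orthogonal summands form a C⋆-algebra, in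
  -- which functional calculus is computed coordinatewise.
  let S : NonUnitalStarSubalgebra ℂ (A × A × D) :=
    { carrier := {x | x.1 = x.2.1 + γ x.2.2 ∧ (∀ d, x.2.1 * γ d = 0) ∧ ∀ d, γ d * x.2.1 = 0}
      add_mem' := by
        rintro x y ⟨h1, h2, h3⟩ ⟨h4, h5, h6⟩
        refine ⟨?_, fun d => ?_, fun d => ?_⟩
        · simp only [Prod.fst_add, Prod.snd_add, map_add, h1, h4]; abel
        · simp [add_mul, h2, h5]
        · simp [mul_add, h3, h6]
      zero_mem' := by simp
      mul_mem' := by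
        rintro x y ⟨h1, h2, h3⟩ ⟨h4, h5, h6⟩
        refine ⟨?_, fun d => ?_, fun d => ?_⟩
        · simp only [Prod.fst_mul, Prod.snd_mul, map_mul, h1, h4, mul_add, add_mul, h2, h6, add_zero,
            zero_add]
        · simp [mul_assoc, h5]
        · simp [← mul_assoc, h3]
      smul_mem' := by
        rintro a x ⟨h1, h2, h3⟩
        refine ⟨by simp [h1], fun d => ?_, fun d => ?_⟩
        · simp [smul_mul_assoc, h2]
        · simp [mul_smul_comm, h3]
      star_mem' := by
        rintro x ⟨h1, h2, h3⟩
        refine ⟨by simp [h1, map_star], fun d => ?_, fun d => ?_⟩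
        · have := congrArg star (h3 (star d))
          simpa [map_star] using this
        · have := congrArg star (h2 (star d))
          simpa [map_star] using this }
  have hcl : IsClosed (S : Set (A × A × D)) := by
    have i2 : IsClosed {x : A × A × D | ∀ d, x.2.1 * γ d = 0} := by
      simp only [Set.ofPred_forall]
      exact isClosed_iInter fun d => isClosed_eq (by fun_prop) continuous_const
    have i3 : IsClosed {x : A × A × D | ∀ d, γ d * x.2.1 = 0} := by
      simp only [Set.ofPred_forall]
      exact isClosed_iInter fun d => isClosed_eq (by fun_prop) continuous_const
    exact (isClosed_eq (f := fun x : A × A × D => x.1) (g := fun x => x.2.1 + γ x.2.2)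
      (by fun_prop) (by fun_prop)).inter (i2.inter i3)
  have h' : ∀ d, γ d * c₀ = 0 := fun d => by
    have := congrArg star (h (star d))
    simpa [map_star, hc₀.star_eq] using this
  let j := NonUnitalStarSubalgebraClass.subtype S
  let e : S := ⟨(c₀ + γ c, c₀, c), rfl, h, h'⟩
  have he : IsSelfAdjoint e := Subtype.ext (Prod.ext (hc₀.add (hc.map γ)) (Prod.ext hc₀ hc))
  let p₂ := (NonUnitalStarAlgHom.snd ℂ A (A × D)).comp j
  have q1 := map_cfcₙ_real ((NonUnitalStarAlgHom.fst ℂ A (A × D)).comp j) hf h0 he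
  have q2 := map_cfcₙ_real ((NonUnitalStarAlgHom.fst ℂ A D).comp p₂) hf h0 he
  have q3 := map_cfcₙ_real ((NonUnitalStarAlgHom.snd ℂ A D).comp p₂) hf h0 he
  change ((cfcₙ f e : S) : A × A × D).1 = cfcₙ f (c₀ + γ c) at q1
  change ((cfcₙ f e : S) : A × A × D).2.1 = cfcₙ f c₀ at q2
  change ((cfcₙ f e : S) : A × A × D).2.2 = cfcₙ f c at q3
  obtain ⟨s1, s2, -⟩ := (cfcₙ f e).2
  rw [q1, q2, q3] at s1
  exact ⟨s1, fun d => by rw [← q2]; exact s2 d⟩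

/-- By strict positivity x is close to some b m b, and ‖f_δ(b) b - b‖ ≤ δ. -/
lemma tendsto_cutoff_mul {b : A} (hb : IsStrictlyPos b) (x : A) {η : ℝ} (hη : 0 < η) :
    ∀ᶠ δ in 𝓝[>] (0 : ℝ), ‖cfcₙ (cutoff δ) b * x - x‖ < η ∧ ‖x * cfcₙ (cutoff δ) b - x‖ < η := by
  have key : ∀ x : A, ∀ᶠ δ in 𝓝[>] (0 : ℝ), ‖cfcₙ (cutoff δ) b * x - x‖ < η := fun x => by
    obtain ⟨_, ⟨m, rfl⟩, hm⟩ := Metric.mem_closure_iff.1 (hb.2 x) (η / 3) (by positivity)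
    rw [dist_eq_norm] at hm
    have h1 : ∀ᶠ δ in 𝓝[>] (0 : ℝ), δ * ‖m * b‖ < η / 3 := by
      have : Tendsto (fun δ : ℝ => δ * ‖m * b‖) (𝓝[>] 0) (𝓝 (0 * ‖m * b‖)) :=
        (tendsto_id.mono_left nhdsWithin_le_nhds).mul_const _
      rw [zero_mul] at this
      exact this.eventually_lt_const (by positivity)
    filter_upwards [h1, self_mem_nhdsWithin] with δ h1 hδ
    have hδ : 0 < δ := hδ
    have hc := continuous_cutoff hδ
    have h0 := cutoff_zero hδ
    have hsa : IsSelfAdjoint b := .of_nonneg hb.1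
    have h2 : ‖cfcₙ (cutoff δ) b * b - b‖ ≤ δ := by
      have h3 : cfcₙ (cutoff δ) b * b - b = cfcₙ (fun t => cutoff δ t * t - t) b := by
        rw [cfcₙ_sub (fun t => cutoff δ t * t) (fun t => t) b, cfcₙ_mul _ (fun t => t) b,
          cfcₙ_id' ℝ b]
      rw [h3]
      refine norm_cfcₙ_le fun t ht => ?_
      have ht0 := quasispectrum_nonneg_of_nonneg b hb.1 t ht
      obtain ⟨h4, h5⟩ := cutoff_mem hδ t
      rw [Real.norm_eq_abs, abs_le]
      by_cases h : δ ≤ t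
      · rw [cutoff_of_ge hδ h]; constructor <;> linarith
      · constructor <;> nlinarith
    have hn := norm_cfcₙ_cutoff_le hδ b
    set k := cfcₙ (cutoff δ) b
    have h4 : k * x - x = k * (x - b * m * b) - (x - b * m * b) + (k * b - b) * (m * b) := by
      noncomm_ring
    rw [h4]
    have h5 : ‖k * (x - b * m * b)‖ ≤ ‖x - b * m * b‖ :=
      (norm_mul_le _ _).trans (mul_le_of_le_one_left (norm_nonneg _) hn)
    have h6 : ‖(k * b - b) * (m * b)‖ ≤ δ * ‖m * b‖ :=
      (norm_mul_le _ _).trans (by gcongr)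
    calc _ ≤ _ := norm_add_le _ _
      _ ≤ ‖k * (x - b * m * b)‖ + ‖x - b * m * b‖ + ‖(k * b - b) * (m * b)‖ := by
        gcongr; exact norm_sub_le _ _
      _ < η := by linarith
  filter_upwards [key x, key (star x), self_mem_nhdsWithin] with δ h1 h2 hδ
  refine ⟨h1, ?_⟩
  rwa [← norm_star, star_sub, star_mul, star_cfcₙ_cutoff hδ]

/-- With k = f_δ(c), `cutoff_conj_le` gives k c k ≤ 2 k p m p k ≤ 2 ‖m‖ k p² k, and k p² k ≲ p² ≲ p.
-/
lemma cuntzLE_cutoff {δ : ℝ} (hδ : 0 < δ) {c p m : A} (hc : 0 ≤ c) (hp : 0 ≤ p)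
    (hm : IsSelfAdjoint m) (h : ‖c - p * m * p‖ ≤ δ / 4) :
    CuntzLE (cfcₙ (cutoff δ) c * c * cfcₙ (cutoff δ) c) p := by
  have hps : star p = p := (IsSelfAdjoint.of_nonneg hp).star_eq
  have hks := star_cfcₙ_cutoff hδ c
  have hq : IsSelfAdjoint (p * m * p) := by
    have := hm.conjugate p
    rwa [hps] at this
  have h1 := (cutoff_conj_le hδ hc hq h).1
  set k := cfcₙ (cutoff δ) c
  have h2 : k * (p * m * p) * k ≤ ‖m‖ • (star (p * k) * (p * k)) := by
    have := CStarAlgebra.star_left_conjugate_le_norm_smul (a := p * k) (b := m) hm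
    refine le_trans (le_of_eq ?_) this
    simp only [star_mul, hps, hks, mul_assoc]
  have h3 : k * c * k ≤ (2 * ‖m‖) • (star (p * k) * (p * k)) := by
    rw [mul_smul]
    exact h1.trans (smul_le_smul_of_nonneg_left h2 (by norm_num))
  have h4 : 0 ≤ k * c * k := by
    have := star_left_conjugate_nonneg hc k
    rwa [hks] at this
  refine (CuntzLE.of_le_smul h4 (star_mul_self_nonneg _) (by positivity) h3).trans ?_
  have h5 : star (p * k) * (p * k) = star k * (p * p) * k := by
    simp only [star_mul, hps, mul_assoc]
  rw [h5]
  refine (CuntzLE.conj _ _).trans ?_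
  obtain ⟨r, hr, rfl⟩ := exists_sqrt hp
  have h6 : 0 ≤ r * r * (r * r) := by
    have := star_mul_self_nonneg (r * r)
    rwa [hps] at this
  refine CuntzLE.of_le_smul h6 hp (norm_nonneg (r * r)) ?_
  have := CStarAlgebra.star_left_conjugate_le_norm_smul (a := r) (b := r * r) (.of_nonneg hp)
  rw [hr] at this
  refine le_trans (le_of_eq ?_) this
  simp only [mul_assoc]

end PerturbedCutoff

/-! ### Lower bounds for traces of cut-down elements. -/

section TraceEstimate

attribute [local instance] CStarAlgebra.spectralOrder CStarAlgebra.spectralOrderedRing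

variable {A D : Type*} [NonUnitalCStarAlgebra A] [NonUnitalCStarAlgebra D]

lemma tracialState_mono {σ : WeakDual ℂ D} (hσ : σ ∈ tracialStates D) {x y : D} (h : x ≤ y) :
    (σ x).re ≤ (σ y).re := by
  have := (hσ.1 _ (sub_nonneg.2 h)).1
  rw [map_sub, Complex.sub_re] at this
  linarith

lemma tracialState_real_smul (σ : WeakDual ℂ D) (r : ℝ) (x : D) :
    (σ (r • x)).re = r * (σ x).re := by
  have : r • x = (r : ℂ) • x := by norm_cast
  rw [this, map_smul, smul_eq_mul, Complex.re_ofReal_mul]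

lemma norm_tracialState_le {σ : WeakDual ℂ D} (hσ : σ ∈ tracialStates D) (x : D) :
    ‖σ x‖ ≤ ‖x‖ := by
  have := (WeakDual.toStrongDual σ).le_opNorm x
  rwa [hσ.2.1, one_mul] at this

/-- Traciality rewrites σ(w p) as σ(√p w √p), which is monotone in w; the 4 counts the positive
parts of w. -/
lemma norm_tracialState_mul_le {σ : WeakDual ℂ D} (hσ : σ ∈ tracialStates D) (w : D) {p : D}
    (hp : 0 ≤ p) : ‖σ (w * p)‖ ≤ 4 * ‖w‖ * (σ p).re := by
  obtain ⟨r, hr, rfl⟩ := exists_sqrt hp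
  have h1 : σ (w * (r * r)) = σ (r * w * r) := by rw [← mul_assoc, hσ.2.2, ← mul_assoc]
  have h2 : ∀ q : D, 0 ≤ q → ‖σ (r * q * r)‖ ≤ ‖q‖ * (σ (r * r)).re := fun q hq => by
    have h3 : 0 ≤ r * q * r := by
      have := star_left_conjugate_nonneg hq r
      rwa [hr] at this
    have h4 := CStarAlgebra.star_left_conjugate_le_norm_smul (a := r) (b := q) (.of_nonneg hq)
    rw [hr] at h4
    have h5 := tracialState_mono hσ h4
    rw [tracialState_real_smul] at h5
    obtain ⟨h6, h7⟩ := hσ.1 _ h3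
    rw [← Complex.re_add_im (σ (r * q * r)), h7]
    simpa [abs_of_nonneg h6] using h5
  obtain ⟨q, hq, hqn, hw⟩ := CStarAlgebra.exists_sum_four_nonneg w
  have h0 := (hσ.1 _ hp).1
  rw [h1]
  have h8 : r * w * r = ∑ i : Fin 4, Complex.I ^ (i : ℕ) • (r * q i * r) := by
    conv_lhs => rw [hw]
    simp only [Finset.mul_sum, Finset.sum_mul, mul_smul_comm, smul_mul_assoc]
  rw [h8, map_sum]
  calc _ ≤ ∑ i : Fin 4, ‖w‖ * (σ (r * r)).re := (norm_sum_le _ _).trans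
        (Finset.sum_le_sum fun i _ => by
          rw [map_smul, norm_smul, norm_pow, Complex.norm_I, one_pow, one_mul]
          exact (h2 _ (hq i)).trans (mul_le_mul_of_nonneg_right (hqn i) h0))
    _ = _ := by simp; ring

/-- Each further factor of b adds one multiplicativity defect and does not enlarge the previous
error, as ‖ψ b‖ ≤ 1. The exponent is shifted because the calculus is nonunital. -/
lemma norm_map_pow_sub_le {b : A} (hb : IsSelfAdjoint b) {ψ : A →ₗ[ℂ] D} (hψ : ∀ x, ‖ψ x‖ ≤ ‖x‖)
    (hc : IsSelfAdjoint (ψ b)) (hb1 : ‖b‖ ≤ 1) {ε : ℝ} {j : ℕ}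
    (h : ∀ i < j, ‖ψ (cfcₙ (fun t : ℝ => t ^ (i + 1)) b * b) -
      ψ (cfcₙ (fun t : ℝ => t ^ (i + 1)) b) * ψ b‖ ≤ ε) :
    ‖ψ (cfcₙ (fun t : ℝ => t ^ (j + 1)) b) - cfcₙ (fun t : ℝ => t ^ (j + 1)) (ψ b)‖ ≤ j * ε := by
  induction j with
  | zero => simp [cfcₙ_id' ℝ b, cfcₙ_id' ℝ (ψ b)]
  | succ j ih =>
    have h1 : cfcₙ (fun t : ℝ => t ^ (j + 1 + 1)) b = cfcₙ (fun t : ℝ => t ^ (j + 1)) b * b := by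
      conv_rhs => enter [2]; rw [← cfcₙ_id' ℝ b]
      rw [← cfcₙ_mul (fun t : ℝ => t ^ (j + 1)) (fun t => t) b (by fun_prop) (by simp)]
      simp only [pow_succ]
    have h2 : cfcₙ (fun t : ℝ => t ^ (j + 1 + 1)) (ψ b) =
        cfcₙ (fun t : ℝ => t ^ (j + 1)) (ψ b) * ψ b := by
      conv_rhs => enter [2]; rw [← cfcₙ_id' ℝ (ψ b)]
      rw [← cfcₙ_mul (fun t : ℝ => t ^ (j + 1)) (fun t => t) (ψ b) (by fun_prop) (by simp)]
      simp only [pow_succ]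
    have h3 := ih fun i hi => h i (by omega)
    have h4 := h j (by omega)
    have h5 : ‖ψ b‖ ≤ 1 := (hψ b).trans hb1
    rw [h1, h2]
    set p := cfcₙ (fun t : ℝ => t ^ (j + 1)) b
    set q := cfcₙ (fun t : ℝ => t ^ (j + 1)) (ψ b)
    calc _ = ‖(ψ (p * b) - ψ p * ψ b) + (ψ p - q) * ψ b‖ := by congr 1; noncomm_ring
      _ ≤ ε + ‖ψ p - q‖ * ‖ψ b‖ := (norm_add_le _ _).trans (add_le_add h4 (norm_mul_le _ _))
      _ ≤ ε + ‖ψ p - q‖ * 1 := by gcongr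
      _ ≤ _ := by push_cast; linarith

lemma quasispectrum_mem_Icc {c : D} (hc : 0 ≤ c) (hc1 : ‖c‖ ≤ 1) {t : ℝ}
    (ht : t ∈ quasispectrum ℝ c) : 0 ≤ t ∧ t ≤ 1 := by
  have h0 := quasispectrum_nonneg_of_nonneg c hc t ht
  have := norm_apply_le_norm_cfcₙ (fun t : ℝ => t) c ht continuousOn_id rfl (.of_nonneg hc)
  rw [cfcₙ_id' ℝ c, Real.norm_of_nonneg h0] at this
  exact ⟨h0, this.trans hc1⟩

/-- The cutoff vanishes for t ≤ 1/2, and (2t)^(j+1) ≥ 1 beyond. -/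
lemma cutoff_one_le_pow {b : A} (hb : 0 ≤ b) (j : ℕ) :
    cfcₙ (cutoff 1) b ≤ (2 ^ (j + 1) : ℝ) • cfcₙ (fun t : ℝ => t ^ (j + 1)) b := by
  have c1 := continuous_cutoff (ε := 1) one_pos
  have z1 := cutoff_zero (ε := 1) one_pos
  rw [← cfcₙ_smul (2 ^ (j + 1) : ℝ) (fun t : ℝ => t ^ (j + 1)) b (by fun_prop) (by simp)]
  refine cfcₙ_mono (fun t ht => ?_) c1.continuousOn (by fun_prop) z1 (by simp)
  have ht0 := quasispectrum_nonneg_of_nonneg b hb t ht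
  simp only [smul_eq_mul, ← mul_pow]
  by_cases h : t ≤ 1 / 2
  · rw [cutoff_of_le h]; positivity
  · exact (cutoff_mem one_pos t).2.trans (one_le_pow₀ (by linarith))

/-- For t ≤ 1/4 use t^(j+1) ≤ 4^(-j) t; for larger t in the spectrum the cutoff is 1. -/
lemma pow_le_cutoff_add {c : A} (hc : 0 ≤ c) (hc1 : ‖c‖ ≤ 1) (j : ℕ) :
    cfcₙ (fun t : ℝ => t ^ (j + 1)) c ≤ cfcₙ (cutoff (1 / 4)) c + ((1 / 4) ^ j : ℝ) • c := by
  have c4 := continuous_cutoff (ε := 1 / 4) (by norm_num)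
  have z4 := cutoff_zero (ε := 1 / 4) (by norm_num)
  have hsa : IsSelfAdjoint c := .of_nonneg hc
  set q : ℝ := (1 / 4) ^ j with hq
  have e1 : q • c = cfcₙ (fun t : ℝ => q * t) c := (cfcₙ_const_mul_id q c).symm
  rw [e1, ← cfcₙ_add (a := c) (cutoff (1 / 4)) (fun t : ℝ => q * t) c4.continuousOn z4
    (by fun_prop) (by simp)]
  refine cfcₙ_mono (fun t ht => ?_) (by fun_prop)
    (c4.add (continuous_const.mul continuous_id)).continuousOn (by simp) (by simp only [z4, mul_zero, add_zero])
  obtain ⟨ht0, ht1⟩ := quasispectrum_mem_Icc hc hc1 ht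
  have hq0 : 0 ≤ q := by positivity
  by_cases h : t ≤ 1 / 4
  · have h1 := (cutoff_mem (ε := 1 / 4) (by norm_num) t).1
    have h2 := mul_le_mul_of_nonneg_right (pow_le_pow_left₀ ht0 h j) ht0
    rw [← hq] at h2
    rw [pow_succ]
    linarith
  · rw [cutoff_of_ge (by norm_num) (not_le.1 h).le]
    have h1 := pow_le_one₀ ht0 ht1 (n := j + 1)
    have h2 := mul_nonneg hq0 ht0
    linarith

lemma map_real_smul (ψ : A →ₗ[ℂ] D) (r : ℝ) (z : A) : ψ (r • z) = r • ψ z := by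
  have e1 : r • z = (r : ℂ) • z := by norm_cast
  have e2 : r • ψ z = (r : ℂ) • ψ z := by norm_cast
  rw [e1, e2, map_smul]

/-- Lower bounds for the traces of the image of a fixed element give lower bounds for the traces of
the cut-downs of the image of any positive element of norm one. -/
lemma IsSimpleCStar.exists_trace_bound (hA : IsSimpleCStar A) {b : A} (hb : 0 ≤ b) (hb1 : ‖b‖ = 1)
    (s : A) {f : ℝ} (hf : 0 < f) : ∃ (f' ε : ℝ) (F : Finset A), 0 < f' ∧ f' < 1 ∧ 0 < ε ∧
      ∀ {D : Type*} [NonUnitalCStarAlgebra D] (ψ : A →ₗ[ℂ] D), IsCPC ψ → IsAlmostMul F ε ψ →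
        ∀ σ ∈ tracialStates D, f ≤ (σ (ψ s)).re → f' ≤ (σ (cfcₙ (cutoff (1 / 4)) (ψ b))).re := by
  classical
  have hsa : IsSelfAdjoint b := .of_nonneg hb
  have c1 := continuous_cutoff (ε := 1) one_pos
  have z1 := cutoff_zero (ε := 1) one_pos
  set g := cfcₙ (cutoff 1) b with hg
  have hg0 : 0 ≤ g := cutoff_nonneg_cfcₙ one_pos b
  have hg1 : ‖g‖ ≤ 1 := norm_cfcₙ_cutoff_le one_pos b
  have hgne : g ≠ 0 := by
    obtain ⟨t, ht, h⟩ := exists_mem_quasispectrum_norm hb (r := 1 / 2) (by rw [hb1]; norm_num)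
    refine cfcₙ_ne_zero hsa c1 z1 ht ?_
    rw [cutoff_eq one_pos]
    refine (lt_min one_pos (lt_max_of_lt_right ?_)).ne'
    apply div_pos <;> linarith
  -- By simplicity s is close to ∑ xᵢ g yᵢ with g = f_1(b), so the trace of ψ(s) is controlled by
  -- that of ψ(g).
  obtain ⟨n, x, y, hxy⟩ := hA.exists_sum_near hgne s (ε := f / 4) (by positivity)
  set K : ℝ := 1 + ∑ i, 4 * (‖x i‖ * ‖y i‖) with hK
  have hK1 : 1 ≤ K := le_add_of_nonneg_right (Finset.sum_nonneg fun i _ => by positivity)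
  set C : ℝ := ∑ i, (1 + ‖y i‖) with hC
  have hC0 : 0 ≤ C := Finset.sum_nonneg fun i _ => by positivity
  -- Passing from g to powers of b costs 2^(j+1), while the tail of the powers is 4^(-j). Their
  -- product 2 · 2^(-j), times K, has to be below f/4.
  obtain ⟨j, hj⟩ := exists_pow_lt_of_lt_one (show 0 < f / (8 * K) by positivity)
    (by norm_num : (1 / 2 : ℝ) < 1)
  set L : ℝ := K * 2 ^ (j + 1) with hL
  have hL0 : 0 < L := by positivity
  set ε : ℝ := f / (4 * (C + L * j + 1)) with hε
  have hε0 : 0 < ε := by positivity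
  let bp : ℕ → A := fun i => cfcₙ (fun t : ℝ => t ^ (i + 1)) b
  let F : Finset A := {g, b} ∪ Finset.univ.image x ∪ Finset.univ.image y ∪
    (Finset.univ.image fun i => x i * g) ∪ (Finset.range (j + 1)).image bp
  have hFg : g ∈ F := by simp [F]
  have hFb : b ∈ F := by simp [F]
  have hFx : ∀ i, x i ∈ F := fun i => by simp [F]
  have hFy : ∀ i, y i ∈ F := fun i => by simp [F]
  have hFxg : ∀ i, x i * g ∈ F := fun i => by
    simp only [F, Finset.mem_union, Finset.mem_image]
    exact Or.inl (Or.inr ⟨i, Finset.mem_univ _, rfl⟩)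
  have hFbp : ∀ i < j, bp i ∈ F := fun i hi => by
    simp only [F, Finset.mem_union, Finset.mem_image]
    exact Or.inr ⟨i, Finset.mem_range.2 (by omega), rfl⟩
  refine ⟨min (1 / 2) (f / (4 * L)), ε, F, by positivity, (min_le_left _ _).trans_lt (by norm_num),
    hε0, fun {D} _ ψ hψ hm σ hσ hs => (min_le_right _ _).trans ?_⟩
  obtain ⟨hcp, hcn⟩ := isCPC_iff.1 hψ
  set c := ψ b with hc
  have hc0 : 0 ≤ c := hcp.nonneg hb
  have hc1 : ‖c‖ ≤ 1 := (hcn b).trans hb1.le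
  set T := (σ (cfcₙ (cutoff (1 / 4)) c)).re with hT
  have h1 : ∀ i, ‖σ (ψ (x i * g * y i))‖ ≤ ε * (1 + ‖y i‖) + 4 * (‖x i‖ * ‖y i‖) * (σ (ψ g)).re := by
    intro i
    have a1 := (hm _ (hFxg i) _ (hFy i)).le
    have a2 := (hm _ (hFx i) _ hFg).le
    have a3 : σ (ψ (x i * g * y i)) = σ (ψ (x i * g * y i) - ψ (x i * g) * ψ (y i)) +
        σ ((ψ (x i * g) - ψ (x i) * ψ g) * ψ (y i)) + σ (ψ (y i) * ψ (x i) * ψ g) := by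
      have : σ (ψ (y i) * ψ (x i) * ψ g) = σ (ψ (x i) * ψ g * ψ (y i)) := by
        rw [mul_assoc, hσ.2.2]
      rw [this, ← map_add, ← map_add]
      congr 1
      noncomm_ring
    rw [a3]
    have hg0' := hcp.nonneg hg0
    have hgr := (hσ.1 _ hg0').1
    calc _ ≤ _ := norm_add₃_le
      _ ≤ ε + ε * ‖y i‖ + 4 * (‖y i‖ * ‖x i‖) * (σ (ψ g)).re := by
        gcongr
        · exact (norm_tracialState_le hσ _).trans a1
        · exact (norm_tracialState_le hσ _).trans ((norm_mul_le _ _).trans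
            (mul_le_mul a2 (hcn _) (norm_nonneg _) hε0.le))
        · refine (norm_tracialState_mul_le hσ _ hg0').trans ?_
          gcongr
          exact (norm_mul_le _ _).trans (mul_le_mul (hcn _) (hcn _) (norm_nonneg _) (norm_nonneg _))
      _ = _ := by ring
  have h2 : (σ (ψ s)).re ≤ f / 4 + (ε * C + K * (σ (ψ g)).re) := by
    have hgr := (hσ.1 _ (hcp.nonneg hg0)).1
    have a1 : ψ s = ψ (s - ∑ i, x i * g * y i) + ∑ i, ψ (x i * g * y i) := by
      rw [← map_sum, ← map_add, sub_add_cancel]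
    rw [a1, map_add, map_sum, Complex.add_re]
    refine add_le_add ?_ ?_
    · exact (Complex.re_le_norm _).trans ((norm_tracialState_le hσ _).trans ((hcn _).trans hxy.le))
    · refine (Complex.re_le_norm _).trans ((norm_sum_le _ _).trans
        ((Finset.sum_le_sum fun i _ => h1 i).trans ?_))
      rw [Finset.sum_add_distrib, ← Finset.mul_sum, ← Finset.sum_mul, hK, add_mul, one_mul]
      linarith
  have h3 : (σ (ψ g)).re ≤ 2 ^ (j + 1) * (σ (ψ (bp j))).re := by
    rw [← tracialState_real_smul]
    refine tracialState_mono hσ ?_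
    have a1 : g ≤ (2 ^ (j + 1) : ℝ) • bp j := cutoff_one_le_pow hb j
    have a2 := hcp.nonneg (sub_nonneg.2 a1)
    rw [map_sub, map_real_smul] at a2
    exact sub_nonneg.1 a2
  have h4 : (σ (ψ (bp j))).re ≤ j * ε + (T + (1 / 4) ^ j) := by
    have a1 : ‖ψ (bp j) - cfcₙ (fun t : ℝ => t ^ (j + 1)) c‖ ≤ j * ε :=
      norm_map_pow_sub_le hsa hcn (.of_nonneg hc0) hb1.le fun i hi =>
        (hm _ (hFbp i hi) _ hFb).le
    have a2 := pow_le_cutoff_add hc0 hc1 j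
    have a3 := tracialState_mono hσ a2
    rw [map_add, Complex.add_re, tracialState_real_smul] at a3
    have a4 : (σ c).re ≤ 1 :=
      (Complex.re_le_norm _).trans ((norm_tracialState_le hσ _).trans hc1)
    have a5 : (1 / 4 : ℝ) ^ j * (σ c).re ≤ (1 / 4) ^ j :=
      mul_le_of_le_one_right (by positivity) a4
    have a6 := (Complex.re_le_norm _).trans ((norm_tracialState_le hσ _).trans a1)
    rw [map_sub, Complex.sub_re] at a6
    linarith
  have h5 : K * (σ (ψ g)).re ≤ L * (j * ε + (T + (1 / 4) ^ j)) := by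
    rw [hL, mul_assoc]
    gcongr
    exact h3.trans (by gcongr)
  have h6 : L * (1 / 4) ^ j ≤ f / 4 := by
    have e1 : L * (1 / 4 : ℝ) ^ j = 2 * K * (1 / 2) ^ j := by
      have : (1 / 4 : ℝ) ^ j = (1 / 2) ^ j * (1 / 2) ^ j := by rw [← mul_pow]; norm_num
      have e2 : (2 : ℝ) ^ j * (1 / 2) ^ j = 1 := by rw [← mul_pow]; norm_num
      rw [hL, this, pow_succ]
      linear_combination (2 * K * (1 / 2) ^ j) * e2
    have e3 : 2 * K * (f / (8 * K)) = f / 4 := by field_simp; norm_num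
    rw [e1, ← e3]
    gcongr
  have h7 : ε * (C + L * j) ≤ f / 4 := by
    have : ε * (C + L * j + 1) = f / 4 := by rw [hε]; field_simp
    linarith
  -- Three errors of f/4 each, from approximating s, from multiplicativity and from the tail 4^(-j),
  -- leave f/4 ≤ L T.
  rw [div_le_iff₀ (by positivity)]
  nlinarith

end TraceEstimate

/-! ### Cutting down almost multiplicative maps and algebras in 𝒞₀'. -/

section Hereditary

attribute [local instance] CStarAlgebra.spectralOrder CStarAlgebra.spectralOrderedRing

/-- Cutting down an almost multiplicative map by an element `W` with `|W| ^ 2` close to an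
approximate unit `κ` on the relevant elements. -/
lemma norm_conj_mul_sub_le {A C : Type*} [NonUnitalCStarAlgebra A] [NonUnitalCStarAlgebra C]
    {θ : C →ₗ[ℂ] A} (hθ : ∀ x, ‖θ x‖ ≤ ‖x‖) {W κ' : A} {κ x y : C} {R η : ℝ} (hR : 1 ≤ R)
    (hη : 0 ≤ η) (hW : ‖W‖ ≤ 1) (hWκ : ‖κ' - star W * W‖ ≤ 2 * η) (hx : ‖x‖ ≤ R) (hy : ‖y‖ ≤ R)
    (h1 : ‖θ x * (κ' - θ κ)‖ ≤ R * η) (h2 : ‖θ (x * κ) - θ x * θ κ‖ ≤ η) (h3 : ‖x - x * κ‖ ≤ 2 * η)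
    (h4 : ‖θ (x * y) - θ x * θ y‖ ≤ η) :
    ‖W * θ (x * y) * star W - W * θ x * star W * (W * θ y * star W)‖ ≤ 7 * R ^ 2 * η := by
  have hW' : ‖star W‖ ≤ 1 := by rwa [norm_star]
  have hconj : ∀ z : A, ‖W * z * star W‖ ≤ ‖z‖ := fun z =>
    (norm_mul_le _ _).trans ((mul_le_of_le_one_right (norm_nonneg _) hW').trans
      ((norm_mul_le _ _).trans (mul_le_of_le_one_left (norm_nonneg _) hW)))
  -- W⋆W acts almost as a right unit on θ(x): it is close to κ', which θ(x) sees as θ(κ), and x κ is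
  -- close to x.
  have h5 : ‖θ x - θ x * (star W * W)‖ ≤ 6 * R * η := by
    have e1 : θ x - θ x * (star W * W) = θ (x - x * κ) + (θ (x * κ) - θ x * θ κ) +
        (θ x * (κ' - star W * W) - θ x * (κ' - θ κ)) := by
      rw [map_sub]; noncomm_ring
    have e2 : ‖θ x * (κ' - star W * W)‖ ≤ R * (2 * η) :=
      (norm_mul_le _ _).trans (mul_le_mul ((hθ x).trans hx) hWκ (norm_nonneg _) (by linarith))
    rw [e1]
    calc _ ≤ _ := norm_add₃_le
      _ ≤ 2 * η + η + (R * (2 * η) + R * η) := by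
        gcongr
        · exact (hθ _).trans h3
        · exact (norm_sub_le _ _).trans (add_le_add e2 h1)
      _ ≤ _ := by nlinarith
  have e3 : W * θ (x * y) * star W - W * θ x * star W * (W * θ y * star W) =
      W * ((θ (x * y) - θ x * θ y) + (θ x - θ x * (star W * W)) * θ y) * star W := by
    noncomm_ring
  rw [e3]
  have e4 : ‖(θ x - θ x * (star W * W)) * θ y‖ ≤ 6 * R * η * R :=
    (norm_mul_le _ _).trans (mul_le_mul h5 ((hθ y).trans hy) (norm_nonneg _) (by positivity))
  calc _ ≤ _ := (hconj _).trans (norm_add_le _ _)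
    _ ≤ η + 6 * R * η * R := add_le_add h4 e4
    _ ≤ _ := by nlinarith [mul_nonneg hη (by nlinarith : (0 : ℝ) ≤ R ^ 2 - 1)]

/-- W is close to κ, which is nearly a two-sided unit for x, and conjugation by the contraction W
does not enlarge x - x'. -/
lemma norm_sub_conj_le {A : Type*} [NonUnitalCStarAlgebra A] {W κ x x' : A} {R η : ℝ}
    (hη : 0 ≤ η) (hW : ‖W‖ ≤ 1) (hκ : ‖κ‖ ≤ 1) (hWκ : ‖W - κ‖ ≤ η) (hκs : star κ = κ) (hx : ‖x‖ ≤ R)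
    (h1 : ‖κ * x - x‖ ≤ η) (h2 : ‖x * κ - x‖ ≤ η) (h3 : ‖x - x'‖ ≤ η) :
    ‖x - W * x' * star W‖ ≤ (3 + 2 * R) * η := by
  have hW' : ‖star W‖ ≤ 1 := by rwa [norm_star]
  have hconj : ∀ z : A, ‖W * z * star W‖ ≤ ‖z‖ := fun z =>
    (norm_mul_le _ _).trans ((mul_le_of_le_one_right (norm_nonneg _) hW').trans
      ((norm_mul_le _ _).trans (mul_le_of_le_one_left (norm_nonneg _) hW)))
  have hWκ' : ‖star W - κ‖ ≤ η := by rwa [← hκs, ← star_sub, norm_star]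
  have e1 : x - W * x' * star W = -(x * κ - x) - (κ * x - x) * κ -
      ((W - κ) * x * κ + W * x * (star W - κ)) + W * (x - x') * star W := by noncomm_ring
  rw [e1]
  have f1 : ‖(κ * x - x) * κ‖ ≤ η :=
    (norm_mul_le _ _).trans ((mul_le_of_le_one_right (norm_nonneg _) hκ).trans h1)
  have f2 : ‖(W - κ) * x * κ‖ ≤ η * R :=
    (norm_mul_le _ _).trans ((mul_le_of_le_one_right (norm_nonneg _) hκ).trans
      ((norm_mul_le _ _).trans (mul_le_mul hWκ hx (norm_nonneg _) hη)))
  have f3 : ‖W * x * (star W - κ)‖ ≤ R * η := by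
    have : ‖W * x‖ ≤ R :=
      (norm_mul_le _ _).trans ((mul_le_of_le_one_left (norm_nonneg _) hW).trans hx)
    exact (norm_mul_le _ _).trans (mul_le_mul this hWκ' (norm_nonneg _)
      ((norm_nonneg _).trans hx))
  calc _ ≤ ‖-(x * κ - x)‖ + ‖(κ * x - x) * κ‖ + (‖(W - κ) * x * κ‖ + ‖W * x * (star W - κ)‖) +
        ‖W * (x - x') * star W‖ := by
        refine (norm_add_le _ _).trans (add_le_add ((norm_sub_le _ _).trans
          (add_le_add (norm_sub_le _ _) (norm_add_le _ _))) le_rfl)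
    _ ≤ η + η + (η * R + R * η) + η := by
        rw [norm_neg]
        gcongr
        exact (hconj _).trans h3
    _ = _ := by ring

/-- Since δ ≤ 1/8, the cutoff f_δ is 1 wherever f_{1/4} is nonzero. Values t < δ are only decreased
by the conjugation, so f_{1/4} vanishes before and after. -/
lemma cutoff_conj_cutoff {D : Type*} [NonUnitalCStarAlgebra D] {c : D} (hc : 0 ≤ c) {δ : ℝ}
    (hδ : 0 < δ) (hδ1 : δ ≤ 1 / 8) :
    cfcₙ (cutoff (1 / 4)) (cfcₙ (cutoff δ) c * c * cfcₙ (cutoff δ) c) = cfcₙ (cutoff (1 / 4)) c ∧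
      cfcₙ (cutoff δ) c * cfcₙ (cutoff (1 / 4)) c * cfcₙ (cutoff δ) c =
        cfcₙ (cutoff (1 / 4)) c := by
  have hcδ := continuous_cutoff hδ
  have zδ := cutoff_zero hδ
  have c4 := continuous_cutoff (ε := 1 / 4) (by norm_num)
  have z4 := cutoff_zero (ε := 1 / 4) (by norm_num)
  have hsa : IsSelfAdjoint c := .of_nonneg hc
  constructor
  · have h1 : cfcₙ (cutoff δ) c * c * cfcₙ (cutoff δ) c =
        cfcₙ (fun t => cutoff δ t * t * cutoff δ t) c := by
      rw [cfcₙ_mul (fun t => cutoff δ t * t) _ c, cfcₙ_mul _ (fun t => t) c, cfcₙ_id' ℝ c]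
    rw [h1, ← cfcₙ_comp' (cutoff (1 / 4)) (fun t => cutoff δ t * t * cutoff δ t) c
      c4.continuousOn z4 (by fun_prop) (by simp)]
    refine cfcₙ_congr fun t ht => ?_
    have ht0 := quasispectrum_nonneg_of_nonneg c hc t ht
    by_cases h : δ ≤ t
    · simp only [cutoff_of_ge hδ h, one_mul, mul_one]
    · obtain ⟨h2, h3⟩ := cutoff_mem hδ t
      have h4 : cutoff δ t * t * cutoff δ t ≤ 1 * t * 1 := by gcongr
      rw [cutoff_of_le (ε := 1 / 4) (t := t) (by linarith), cutoff_of_le (by linarith)]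
  · rw [← cfcₙ_mul (cutoff δ) (cutoff (1 / 4)) c hcδ.continuousOn zδ c4.continuousOn z4,
      ← cfcₙ_mul (fun t => cutoff δ t * cutoff (1 / 4) t) (cutoff δ) c (by fun_prop) (by simp [zδ])
        hcδ.continuousOn zδ]
    refine cfcₙ_congr fun t ht => ?_
    by_cases h : δ ≤ t
    · simp only [cutoff_of_ge hδ h, one_mul, mul_one]
    · rw [cutoff_of_le (ε := 1 / 4) (t := t) (by linarith)]; simp

/-- The cut-down of an algebra in `𝒞₀'` by an element that is large in all traces. -/
lemma InC0'.her_cutoff {D : Type*} [NonUnitalCStarAlgebra D] [Nontrivial D] (hD : InC0' D) {c : D}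
    (hc : 0 ≤ c) {δ : ℝ} (hδ : 0 < δ) (hδ1 : δ ≤ 1 / 8) {f : ℝ} (hf : 0 < f)
    (h : ∀ σ ∈ tracialStates D, f ≤ (σ (cfcₙ (cutoff (1 / 4)) c)).re) :
    InC0' (her (cfcₙ (cutoff δ) c)) ∧ Nontrivial (her (cfcₙ (cutoff δ) c)) ∧
      ∀ g : her (cfcₙ (cutoff δ) c), (g : D) = cfcₙ (cutoff δ) c * c * cfcₙ (cutoff δ) c →
        ∀ t ∈ tracialStates (her (cfcₙ (cutoff δ) c)), f ≤ (t (cfcₙ (cutoff (1 / 4)) g)).re := by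
  obtain ⟨h1, h2⟩ := cutoff_conj_cutoff hc hδ hδ1
  set k := cfcₙ (cutoff δ) c with hk
  have hks : star k = k := star_cfcₙ_cutoff hδ c
  have c4 := continuous_cutoff (ε := 1 / 4) (by norm_num)
  have z4 := cutoff_zero (ε := 1 / 4) (by norm_num)
  set F := cfcₙ (cutoff (1 / 4)) c with hF
  have hmem : F ∈ her k := by
    have := mul_mul_mem_her k F
    rwa [hks, h2] at this
  have hF0 : F ≠ 0 := by
    obtain ⟨σ, hσ, -⟩ := hD.exists_tracialState (I := ⊥) (fun x hx a => by simp_all)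
      isClosed_singleton bot_ne_top
    have := h σ hσ
    intro h0
    rw [h0, map_zero, Complex.zero_re] at this
    linarith
  -- If `her k` were not full, some tracial state would vanish on it, in particular on f_{1/4}(c),
  -- against the lower bound.
  have hfull : closedIdeal (Set.range (herIncl k)) = ⊤ := by
    by_contra hne
    obtain ⟨σ, hσ, hσ0⟩ := hD.exists_tracialState (isIdeal_closedIdeal _)
      (isClosed_closedIdeal _) hne
    have h3 := h σ hσ
    rw [hσ0 F (mem_closedIdeal ⟨⟨F, hmem⟩, rfl⟩), Complex.zero_re] at h3
    linarith
  refine ⟨hD.of_herEmb (herEmb_herIncl k) hfull,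
    ⟨⟨F, hmem⟩, 0, fun h0 => hF0 (congrArg Subtype.val h0)⟩, fun g hg t ht => ?_⟩
  obtain ⟨N, hN0, hN⟩ := hD.exists_transposeBounded
  obtain ⟨σ, hσ, r, hr, hrt⟩ := exists_tracialState_extension hN0 hN (herEmb_herIncl k) hfull ht
  have hgsa : IsSelfAdjoint g := by
    refine Subtype.ext ?_
    change star (g : D) = g
    rw [hg]
    simp only [star_mul, hks, (IsSelfAdjoint.of_nonneg hc).star_eq, mul_assoc]
  have h3 : herIncl k (cfcₙ (cutoff (1 / 4)) g) = F := by
    rw [map_cfcₙ_real _ c4 z4 hgsa]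
    change cfcₙ (cutoff (1 / 4)) (g : D) = F
    rw [hg, h1]
  -- The given trace is r times a tracial state σ of D with r ≥ 1, so the bound for σ suffices.
  rw [hrt, h3, Complex.smul_re, smul_eq_mul]
  have h4 := h σ hσ
  nlinarith

end Hereditary

/-! ### Tracial approximation passes to hereditary subalgebras. -/

section Hereditary

attribute [local instance] CStarAlgebra.spectralOrder CStarAlgebra.spectralOrderedRing

/-- With v = f_{δ/2}(c₀ + γ c) one has W = W v, and by orthogonality v c₀ v = v₀ c₀ v₀ for v₀ =
f_{δ/2}(c₀). So W c₀ W⋆ ≲ v₀ c₀ v₀, and `cuntzLE_cutoff` compares the latter with p. -/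
lemma cuntzLE_conj_of_orthogonal {A D : Type*} [NonUnitalCStarAlgebra A] [NonUnitalCStarAlgebra D]
    (γ : D →⋆ₙₐ[ℂ] A) {c₀ W p m : A} {c : D} (hc₀ : 0 ≤ c₀) (hc : 0 ≤ c)
    (horth : ∀ d, c₀ * γ d = 0) {δ : ℝ} (hδ : 0 < δ)
    (hW : star W * W = cfcₙ (cutoff δ) (c₀ + γ c) * cfcₙ (cutoff δ) (c₀ + γ c))
    (hp : 0 ≤ p) (hm : IsSelfAdjoint m) (h : ‖c₀ - p * m * p‖ ≤ δ / 8) :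
    CuntzLE (W * c₀ * star W) p := by
  have hδ2 : 0 < δ / 2 := half_pos hδ
  have c1 := continuous_cutoff hδ
  have z1 := cutoff_zero hδ
  have c2 := continuous_cutoff hδ2
  have z2 := cutoff_zero hδ2
  have hsa₀ : IsSelfAdjoint c₀ := .of_nonneg hc₀
  have hy : IsSelfAdjoint (c₀ + γ c) := hsa₀.add ((IsSelfAdjoint.of_nonneg hc).map γ)
  have hv := (cfcₙ_add_hom γ hsa₀ (.of_nonneg hc) horth c2 z2).1
  have horth' : ∀ d, γ d * c₀ = 0 := fun d => by
    have := congrArg star (horth (star d))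
    simpa [map_star, hsa₀.star_eq] using this
  have hkv : cfcₙ (cutoff δ) (c₀ + γ c) * cfcₙ (cutoff (δ / 2)) (c₀ + γ c) =
      cfcₙ (cutoff δ) (c₀ + γ c) := by
    rw [← cfcₙ_mul (cutoff δ) (cutoff (δ / 2)) _ c1.continuousOn z1 c2.continuousOn z2]
    refine cfcₙ_congr fun t _ => ?_
    by_cases ht : t ≤ δ / 2
    · simp only [cutoff_of_le ht, zero_mul]
    · simp only [cutoff_of_ge hδ2 (not_le.1 ht).le, mul_one]
  have hks := star_cfcₙ_cutoff hδ (c₀ + γ c)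
  have hvs := star_cfcₙ_cutoff hδ2 (c₀ + γ c)
  set k := cfcₙ (cutoff δ) (c₀ + γ c)
  set v := cfcₙ (cutoff (δ / 2)) (c₀ + γ c)
  set v₀ := cfcₙ (cutoff (δ / 2)) c₀ with hv₀
  have hvk : v * k = k := by
    have := congrArg star hkv
    rwa [star_mul, hks, hvs] at this
  have hWv : W = W * v := by
    rw [← sub_eq_zero, ← CStarRing.star_mul_self_eq_zero_iff]
    have e1 : star (W - W * v) * (W - W * v) = star W * W - star W * W * v - v * (star W * W) +
        v * (star W * W) * v := by
      rw [star_sub, star_mul, hvs]; noncomm_ring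
    have e2 : k * k * v = k * k := by rw [mul_assoc, hkv]
    have e3 : v * (k * k) = k * k := by rw [← mul_assoc, hvk]
    rw [e1, hW, e3, e2]
    abel
  have e1 : v * c₀ = v₀ * c₀ := by rw [hv, add_mul, horth', add_zero]
  have e2 : c₀ * v = c₀ * v₀ := by rw [hv, mul_add, horth, add_zero]
  have e3 : W * c₀ * star W = star (star W) * (v₀ * c₀ * v₀) * star W := by
    conv_lhs => rw [hWv]
    rw [star_mul, hvs, star_star]
    calc _ = W * (v * c₀ * v) * star W := by noncomm_ring
      _ = W * (v₀ * (c₀ * v)) * star W := by rw [e1, mul_assoc v₀]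
      _ = _ := by rw [e2, mul_assoc v₀]
  rw [e3]
  exact (CuntzLE.conj _ _).trans (cuntzLE_cutoff hδ2 hc₀ hp hm (by linarith))

lemma IsCP.isSelfAdjoint {A B : Type*} [NonUnitalCStarAlgebra A] [NonUnitalCStarAlgebra B]
    {φ : A →ₗ[ℂ] B} (h : IsCP φ) {a : A} (ha : IsSelfAdjoint a) : IsSelfAdjoint (φ a) := by
  have e1 : φ a = φ a⁺ - φ a⁻ := by rw [← map_sub, CFC.posPart_sub_negPart a]
  rw [e1]
  exact (IsSelfAdjoint.of_nonneg (h.nonneg (CFC.posPart_nonneg a))).sub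
    (.of_nonneg (h.nonneg (CFC.negPart_nonneg a)))

universe u

/-- The tracial approximation property passes to hereditary subalgebras with a strictly positive
element. -/
theorem TraciallyApproximated.inD {A B : Type u} [NonUnitalCStarAlgebra A] [NonUnitalCStarAlgebra B]
    [Nontrivial B] (hA : IsSimpleCStar A) {s : A} (hs : 0 ≤ s)
    (hsd : Dense (Set.range fun x => s * x * s)) {f : ℝ} (hf : 0 < f)
    (h : TraciallyApproximated s f) {ι : B →⋆ₙₐ[ℂ] A} (hι : HerEmb ι) {b : B}
    (hb : IsStrictlyPos b) (hb1 : ‖b‖ = 1) : InD B := by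
  classical
  have hnι : ∀ x, ‖ι x‖ = ‖x‖ := NonUnitalStarAlgHom.norm_map ι hι.inj
  have hbsa : IsSelfAdjoint b := .of_nonneg hb.1
  have hιb : 0 ≤ ι b := map_nonneg_hom ι hb.1
  obtain ⟨f', ε₁, F₁, hf'0, hf'1, hε₁, htr⟩ := hA.exists_trace_bound hιb (by rw [hnι, hb1]) s hf
  refine InD.of_embeddings (hι.isSimpleCStar hA) hb hb1 hf'0 hf'1 fun ε F b₀ hε hb₀ hb₀0 => ?_
  obtain ⟨R, hR1, hR⟩ : ∃ R : ℝ, 1 ≤ R ∧ ∀ x ∈ insert b F, ‖x‖ ≤ R :=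
    ⟨1 + ∑ x ∈ insert b F, ‖x‖, le_add_of_nonneg_right (Finset.sum_nonneg fun _ _ => norm_nonneg _),
      fun x hx => (Finset.single_le_sum (f := fun x => ‖x‖) (fun _ _ => norm_nonneg _) hx).trans
        (by linarith)⟩
  -- Chosen to beat both the multiplicativity error 7 R² η and the approximation error (3 + 2R) η.
  set η : ℝ := ε / (8 * R ^ 2) with hηd
  have hη : 0 < η := by positivity
  have hη8 : 8 * R ^ 2 * η = ε := by rw [hηd]; field_simp
  have hη7 : 7 * R ^ 2 * η < ε := by nlinarith [mul_pos (pow_pos (one_pos.trans_le hR1) 2) hη]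
  have hη5 : (3 + 2 * R) * η < ε := by
    rw [← hη8]; gcongr; nlinarith
  have hev : ∀ᶠ δ in 𝓝[>] (0 : ℝ), ∀ x ∈ insert b F,
      ‖cfcₙ (cutoff δ) b * x - x‖ < η ∧ ‖x * cfcₙ (cutoff δ) b - x‖ < η :=
    (Filter.eventually_all_finset _).2 fun x _ => tendsto_cutoff_mul hb x hη
  have hev8 : ∀ᶠ δ in 𝓝[>] (0 : ℝ), δ ≤ 1 / 8 := by
    filter_upwards [Ioo_mem_nhdsGT (show (0 : ℝ) < 1 / 8 by norm_num)] with δ hδ using hδ.2.le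
  obtain ⟨δ, ⟨hδF, hδ8⟩, hδ⟩ := ((hev.and hev8).and self_mem_nhdsWithin).exists
  have hδ : 0 < δ := hδ
  have cδ := continuous_cutoff hδ
  have zδ := cutoff_zero hδ
  set κ := cfcₙ (cutoff δ) b with hκ
  have hκs : star κ = κ := star_cfcₙ_cutoff hδ b
  have hκ1 : ‖κ‖ ≤ 1 := norm_cfcₙ_cutoff_le hδ b
  have hικ : ι κ = cfcₙ (cutoff δ) (ι b) := map_cfcₙ_real ι cδ zδ hbsa
  obtain ⟨ε₀, hε₀, hW⟩ := exists_near_cutoff hιb hδ hη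
  -- Density of s A s links b to s: φ(ι b) will be close to φ(s) φ(m) φ(s), so that the smallness of
  -- φ(s) controls it. Averaging with the adjoint makes m selfadjoint.
  obtain ⟨m, hm, hmb⟩ : ∃ m : A, IsSelfAdjoint m ∧ ‖ι b - s * m * s‖ < δ / 16 := by
    obtain ⟨_, ⟨m, rfl⟩, hm⟩ := Metric.mem_closure_iff.1 (hsd (ι b)) (δ / 16) (by positivity)
    rw [dist_eq_norm] at hm
    have hss : star s = s := (IsSelfAdjoint.of_nonneg hs).star_eq
    refine ⟨(1 / 2 : ℝ) • (m + star m), (IsSelfAdjoint.all (1 / 2 : ℝ)).smul (.add_star_self m), ?_⟩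
    have e1 : ι b - s * ((1 / 2 : ℝ) • (m + star m)) * s =
        (1 / 2 : ℝ) • ((ι b - s * m * s) + star (ι b - s * m * s)) := by
      have e2 : star (ι b) = ι b := (hbsa.map ι).star_eq
      have e3 : ι b = (1 / 2 : ℝ) • (ι b + ι b) := by
        rw [← two_smul ℝ, smul_smul]; norm_num
      conv_lhs => rw [e3]
      simp only [star_sub, star_mul, e2, hss, mul_smul_comm, smul_mul_assoc, ← smul_sub, mul_add,
        add_mul, mul_assoc]
      congr 1
      abel
    rw [e1, norm_smul, Real.norm_of_nonneg (by norm_num)]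
    have := norm_add_le (ι b - s * m * s) (star (ι b - s * m * s))
    rw [norm_star] at this
    linarith
  have hns : 0 < 1 + ‖s‖ := by positivity
  set ε₂ : ℝ := δ / (16 * (1 + ‖s‖)) with hε₂
  have hε₂0 : 0 < ε₂ := by positivity
  have hε₂1 : ε₂ * (1 + ‖s‖) = δ / 16 := by rw [hε₂]; field_simp
  let G : Finset B := insert b F ∪ {κ * κ}
  have hG : ∀ x ∈ insert b F, x ∈ G := fun x hx => by
    simp only [G, Finset.mem_union]; exact Or.inl hx
  have hGκ : κ * κ ∈ G := by simp [G]
  let F' : Finset A := F₁ ∪ G.image ι ∪ {s, m, s * m}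
  have hF'G : ∀ x ∈ G, ι x ∈ F' := fun x hx => by
    simp only [F', Finset.mem_union]
    exact Or.inl (Or.inr (Finset.mem_image_of_mem ι hx))
  have hF's : s ∈ F' := by simp [F']
  have hF'm : m ∈ F' := by simp [F']
  have hF'sm : s * m ∈ F' := by simp [F']
  have hb₀' : ι b₀ ≠ 0 := fun h0 => hb₀0 (hι.inj (h0.trans (map_zero ι).symm))
  set ε' : ℝ := min (min ε₁ η) (min ε₀ ε₂) with hε'
  have hε'0 : 0 < ε' := lt_min (lt_min hε₁ hη) (lt_min hε₀ hε₂0)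
  have hε'1 : ε' ≤ ε₁ := (min_le_left _ _).trans (min_le_left _ _)
  have hε'η : ε' ≤ η := (min_le_left _ _).trans (min_le_right _ _)
  have hε'ε₀ : ε' ≤ ε₀ := (min_le_right _ _).trans (min_le_left _ _)
  have hε'ε₂ : ε' ≤ ε₂ := (min_le_right _ _).trans (min_le_right _ _)
  obtain ⟨D, _, γ, φ, ψ, hnt, hγ, hφ, hψ, hφm, hψm, h0, hF, hD, hcu, ht⟩ :=
    h ε' F' (ι b₀) hε'0 (map_nonneg_hom ι hb₀) hb₀'
  obtain ⟨hφp, hφn⟩ := isCPC_iff.1 hφ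
  obtain ⟨hψp, hψn⟩ := isCPC_iff.1 hψ
  set c₀ := φ (ι b) with hc₀
  set c := ψ (ι b) with hc
  have hc₀0 : 0 ≤ c₀ := hφp.nonneg hιb
  have hc0 : 0 ≤ c := hψp.nonneg hιb
  have hbF' : ι b ∈ F' := hF'G b (hG b (Finset.mem_insert_self b F))
  obtain ⟨W, w, hwW, hWW, hWκ⟩ := hW (c₀ + γ c) (add_nonneg hc₀0 (map_nonneg_hom γ hc0)) (by
    rw [norm_sub_rev]; exact (hF _ hbF').trans_le hε'ε₀)
  have hkeq := cfcₙ_add_hom γ (.of_nonneg hc₀0) (.of_nonneg hc0) (h0 (ι b)) cδ zδ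
  set u := cfcₙ (cutoff δ) c with hu
  have hu0 : 0 ≤ u := cutoff_nonneg_cfcₙ hδ c
  have hus : star u = u := star_cfcₙ_cutoff hδ c
  have hu1 : ‖u‖ ≤ 1 := norm_cfcₙ_cutoff_le hδ c
  -- By orthogonality W⋆W = f_δ(c₀ + γ c)² acts on D as u². This is the hypothesis of
  -- `exists_transport`, and it also keeps the two new maps orthogonal.
  have hz : ∀ d, star W * W * γ d = γ (u * u * d) := fun d => by
    have e1 : ∀ d, (cfcₙ (cutoff δ) c₀ + γ u) * γ d = γ (u * d) := fun d => by
      rw [add_mul, hkeq.2, zero_add, map_mul]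
    rw [hWW, hkeq.1, mul_assoc, e1, e1, mul_assoc]
  have hW1 : ‖W‖ ≤ 1 := by
    have e1 : ‖W‖ * ‖W‖ ≤ 1 * 1 := by
      rw [← CStarRing.norm_star_mul_self, hWW]
      exact (norm_mul_le _ _).trans (mul_le_mul (norm_cfcₙ_cutoff_le hδ _)
        (norm_cfcₙ_cutoff_le hδ _) (norm_nonneg _) zero_le_one)
    nlinarith [norm_nonneg W]
  rw [← hικ] at hWκ
  have hικ1 : ‖ι κ‖ ≤ 1 := by rwa [hnι]
  have hικs : star (ι κ) = ι κ := by rw [← map_star, hκs]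
  have hWWκ : ‖ι (κ * κ) - star W * W‖ ≤ 2 * η := by
    have e1 : ι (κ * κ) - star W * W = -(star (W - ι κ) * ι κ + star W * (W - ι κ)) := by
      rw [star_sub, hικs, map_mul]; noncomm_ring
    rw [e1, norm_neg, two_mul]
    refine (norm_add_le _ _).trans (add_le_add ?_ ?_)
    · refine (norm_mul_le _ _).trans ((mul_le_of_le_one_right (norm_nonneg _) hικ1).trans ?_)
      rw [norm_star]; exact hWκ.le
    · refine (norm_mul_le _ _).trans ((mul_le_of_le_one_left (norm_nonneg _) ?_).trans hWκ.le)
      rwa [norm_star]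
  -- W is a limit of elements √b w, so W a W⋆ is a limit of elements of the hereditary subalgebra B.
  have hWr : ∀ a, W * a * star W ∈ Set.range ι := fun a => by
    have e1 : cfcₙ Real.sqrt (ι b) = ι (cfcₙ Real.sqrt b) :=
      (map_cfcₙ_real ι Real.continuous_sqrt Real.sqrt_zero hbsa).symm
    have e2 : star (ι (cfcₙ Real.sqrt b)) = ι (cfcₙ Real.sqrt b) := by
      rw [← map_star, (cfcₙ_predicate Real.sqrt b : IsSelfAdjoint _).star_eq]
    rw [e1] at hwW
    refine hι.isClosed_range.mem_of_tendsto ((hwW.mul_const a).mul hwW.star)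
      (Eventually.of_forall fun n => ?_)
    obtain ⟨x, hx⟩ := hι.sandwich (cfcₙ Real.sqrt b) (cfcₙ Real.sqrt b) (w n * a * star (w n))
    refine ⟨x, hx.trans ?_⟩
    rw [star_mul, e2]
    simp only [mul_assoc]
  obtain ⟨α, hα, hαd⟩ := exists_transport γ hγ hu0 hz
  obtain ⟨β, hβ⟩ := exists_factor ι hι.inj α (her_induction hu0
    (hι.isClosed_range.preimage (continuous_hom α)) fun d hd => by
      change α _ ∈ Set.range ι
      rw [hαd]; exact hWr _)
  -- The new maps are W φ(·) W⋆ into B and u ψ(·) u into `her u`; the transported embedding β turns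
  -- the latter into W γ(ψ(·)) W⋆.
  have hcW : ∀ x, (conjLin W ∘ₗ φ ∘ₗ homLin ι) x = W * φ (ι x) * star W := fun x =>
    conjLin_apply W (φ (ι x))
  have hcu' : ∀ x, (conjLin u ∘ₗ ψ ∘ₗ homLin ι) x = u * ψ (ι x) * star u := fun x =>
    conjLin_apply u (ψ (ι x))
  obtain ⟨φ', hφ'⟩ := exists_linear_factor hι.inj (conjLin W ∘ₗ φ ∘ₗ homLin ι)
    fun x => by rw [hcW]; exact hWr _
  obtain ⟨ψ', hψ'⟩ := exists_linear_factor (j := herIncl u) Subtype.val_injective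
    (conjLin u ∘ₗ ψ ∘ₗ homLin ι) fun x => by
      rw [hcu']; exact ⟨⟨_, mul_mul_mem_her u _⟩, rfl⟩
  have hφ'c : IsCPC φ' :=
    .of_comp hι.inj ((isCPC_conjLin hW1).comp (hφ.comp (isCPC_homLin ι))) hφ'
  have hψ'c : IsCPC ψ' := .of_comp (j := herIncl u) Subtype.val_injective
    ((isCPC_conjLin hu1).comp (hψ.comp (isCPC_homLin ι))) hψ'
  have hφ' : ∀ x, ι (φ' x) = W * φ (ι x) * star W := fun x => (hφ' x).trans (hcW x)
  have hψ' : ∀ x, (ψ' x : D) = u * ψ (ι x) * u := fun x => by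
    have e1 : (ψ' x : D) = u * ψ (ι x) * star u := (hψ' x).trans (hcu' x)
    rw [e1, hus]
  have hβψ : ∀ x, ι (β (ψ' x)) = W * γ (ψ (ι x)) * star W := fun x => by
    have e1 : ψ' x = ⟨u * ψ (ι x) * u, (hψ' x) ▸ (ψ' x).2⟩ := Subtype.ext (hψ' x)
    rw [hβ, e1, hαd]
  have hβi : Function.Injective β := fun x y hxy => hα (by rw [← hβ, ← hβ, hxy])
  have hψm' : IsAlmostMul F₁ ε₁ ψ := fun x hx y hy =>
    (hψm x (by simp only [F', Finset.mem_union]; exact Or.inl (Or.inl hx)) y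
      (by simp only [F', Finset.mem_union]; exact Or.inl (Or.inl hy))).trans_le hε'1
  obtain ⟨hD', hnt', htD'⟩ := hD.her_cutoff hc0 hδ hδ8 hf'0 fun σ hσ =>
    htr ψ hψ hψm' σ hσ (ht σ hσ)
  have hκ3 : ∀ x ∈ insert b F, ‖ι x - ι x * ι (κ * κ)‖ ≤ 2 * η := fun x hx => by
    have e1 : x - x * (κ * κ) = -((x * κ - x) + (x * κ - x) * κ) := by noncomm_ring
    rw [← map_mul, ← map_sub, hnι, e1, norm_neg, two_mul]
    have e2 := (hδF x hx).2.le
    exact (norm_add_le _ _).trans (add_le_add e2 ((norm_mul_le _ _).trans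
      ((mul_le_of_le_one_right (norm_nonneg _) hκ1).trans e2)))
  have hκF := (hF _ (hF'G _ hGκ)).le.trans hε'η
  have horth' : ∀ d, γ d * φ (ι (κ * κ)) = 0 := fun d => by
    have e1 : IsSelfAdjoint (φ (ι (κ * κ))) := by
      refine .of_nonneg (hφp.nonneg (map_nonneg_hom ι ?_))
      have := star_mul_self_nonneg κ
      rwa [hκs] at this
    have e2 := congrArg star (h0 (ι (κ * κ)) (star d))
    rwa [star_mul, e1.star_eq, ← map_star, star_star, star_zero] at e2
  have hsub : ∀ x ∈ F, x ∈ insert b F := fun x hx => Finset.mem_insert_of_mem hx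
  have hRι : ∀ x ∈ F, ‖ι x‖ ≤ R := fun x hx => (hnι x).trans_le (hR x (hsub x hx))
  have happrox : ∀ x ∈ insert b F, ‖x - (φ' x + β (ψ' x))‖ < ε := fun x hx => by
    rw [← hnι, map_sub, map_add, hφ', hβψ]
    have e1 : W * φ (ι x) * star W + W * γ (ψ (ι x)) * star W =
        W * (φ (ι x) + γ (ψ (ι x))) * star W := by noncomm_ring
    rw [e1]
    refine (norm_sub_conj_le hη.le hW1 hικ1 hWκ.le hικs ((hnι x).trans_le (hR x hx)) ?_ ?_
      ((hF _ (hF'G x (hG x hx))).le.trans hε'η)).trans_lt hη5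
    · rw [← map_mul, ← map_sub, hnι]; exact (hδF x hx).1.le
    · rw [← map_mul, ← map_sub, hnι]; exact (hδF x hx).2.le
  refine ⟨her u, inferInstance, β, φ', ψ', hnt', hβi, hφ'c, hψ'c, fun x hx y hy => ?_,
    fun x hx y hy => ?_, fun x d => ?_, fun x hx => happrox x (hsub x hx),
    happrox b (Finset.mem_insert_self b F), hD', ?_, htD' _ (hψ' b)⟩
  · have hxm := hF'G x (hG x (hsub x hx))
    have hym := hF'G y (hG y (hsub y hy))
    have hκm := hF'G _ hGκ
    rw [← hnι, map_sub ι, map_mul ι (φ' x), hφ', hφ', hφ', map_mul ι x]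
    refine (norm_conj_mul_sub_le hφn hR1 hη.le hW1 hWWκ (hRι x hx) (hRι y hy) ?_
      ((hφm _ hxm _ hκm).le.trans hε'η) (hκ3 x (hsub x hx))
      ((hφm _ hxm _ hym).le.trans hε'η)).trans_lt hη7
    -- As φ(ι x) annihilates D, the ψ part may be inserted for free, and the approximation of ι(κ²)
    -- by φ + ψ becomes available.
    have e1 : φ (ι x) * (ι (κ * κ) - φ (ι (κ * κ))) =
        φ (ι x) * (ι (κ * κ) - (φ (ι (κ * κ)) + γ (ψ (ι (κ * κ))))) := by
      rw [mul_sub, mul_sub, mul_add, h0, add_zero]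
    rw [e1]
    exact (norm_mul_le _ _).trans (mul_le_mul ((hφn _).trans (hRι x hx)) hκF (norm_nonneg _)
      (by linarith))
  · have hxm := hF'G x (hG x (hsub x hx))
    have hym := hF'G y (hG y (hsub y hy))
    have hκm := hF'G _ hGκ
    have hnβ : ∀ z, ‖ι (β z)‖ = ‖z‖ :=
      NonUnitalStarAlgHom.norm_map (ι.comp β) (hι.inj.comp hβi)
    have hnγ : ∀ z, ‖γ z‖ = ‖z‖ := NonUnitalStarAlgHom.norm_map γ hγ
    have hθn : ∀ z, ‖(homLin γ ∘ₗ ψ) z‖ ≤ ‖z‖ := fun z => (hnγ _).trans_le (hψn z)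
    have hθm : ∀ x ∈ F', ∀ y ∈ F', ‖(homLin γ ∘ₗ ψ) (x * y) -
        (homLin γ ∘ₗ ψ) x * (homLin γ ∘ₗ ψ) y‖ ≤ η := fun x hx y hy => by
      change ‖γ (ψ (x * y)) - γ (ψ x) * γ (ψ y)‖ ≤ η
      rw [← map_mul, ← map_sub, hnγ]
      exact (hψm x hx y hy).le.trans hε'η
    rw [← hnβ, map_sub β, map_sub ι, map_mul β, map_mul ι (β _), hβψ, hβψ, hβψ, map_mul ι x]
    refine (norm_conj_mul_sub_le hθn hR1 hη.le hW1 hWWκ (hRι x hx) (hRι y hy) ?_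
      (hθm _ hxm _ hκm) (hκ3 x (hsub x hx)) (hθm _ hxm _ hym)).trans_lt hη7
    change ‖γ (ψ (ι x)) * (ι (κ * κ) - γ (ψ (ι (κ * κ))))‖ ≤ R * η
    have e1 : γ (ψ (ι x)) * (ι (κ * κ) - γ (ψ (ι (κ * κ)))) =
        γ (ψ (ι x)) * (ι (κ * κ) - (φ (ι (κ * κ)) + γ (ψ (ι (κ * κ))))) := by
      rw [mul_sub, mul_sub, mul_add, horth', zero_add]
    rw [e1]
    exact (norm_mul_le _ _).trans (mul_le_mul ((hθn _).trans (hRι x hx)) hκF (norm_nonneg _)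
      (by linarith))
  · refine hι.inj ?_
    rw [map_mul, map_zero]
    refine her_induction hu0 (p := fun d => ι (φ' x) * ι (β d) = 0)
      (isClosed_eq (continuous_const.mul ((continuous_hom ι).comp (continuous_hom β)))
        continuous_const) (fun d hd => ?_) d
    rw [hφ', hβ, hαd]
    calc _ = W * (φ (ι x) * (star W * W * γ d)) * star W := by noncomm_ring
      _ = 0 := by rw [hz, h0, mul_zero, zero_mul]
  · refine CuntzLE.of_map hι ?_
    rw [hφ']
    refine (cuntzLE_conj_of_orthogonal γ hc₀0 hc0 (h0 (ι b)) hδ hWW (hφp.nonneg hs)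
      (hφp.isSelfAdjoint hm) ?_).trans hcu
    -- One approximation error and two multiplicativity errors, which δ/16 and ε₂ (1 + ‖s‖) = δ/16
    -- keep within δ/8.
    have e1 : c₀ - φ s * φ m * φ s = φ (ι b - s * m * s) + (φ (s * m * s) - φ (s * m) * φ s) +
        (φ (s * m) - φ s * φ m) * φ s := by
      rw [map_sub]; noncomm_ring
    rw [e1]
    have e2 : ‖(φ (s * m) - φ s * φ m) * φ s‖ ≤ ε₂ * ‖s‖ :=
      (norm_mul_le _ _).trans (mul_le_mul ((hφm s hF's m hF'm).le.trans hε'ε₂) (hφn s)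
        (norm_nonneg _) hε₂0.le)
    calc _ ≤ _ := norm_add₃_le
      _ ≤ δ / 16 + ε₂ + ε₂ * ‖s‖ := by
        gcongr
        · exact (hφn _).trans hmb.le
        · exact (hφm _ hF'sm s hF's).le.trans hε'ε₂
      _ = δ / 8 := by linarith

end Hereditary

/-! ### Embedding into matrix algebras and the conclusion. -/

section Pedersen

attribute [local instance] CStarAlgebra.spectralOrder CStarAlgebra.spectralOrderedRing

universe u

variable {A B C E : Type u} [NonUnitalCStarAlgebra A] [NonUnitalCStarAlgebra B]
  [NonUnitalCStarAlgebra C] [NonUnitalCStarAlgebra E]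

lemma HerEmb.of_comp {ι : B →⋆ₙₐ[ℂ] A} {κ : C →⋆ₙₐ[ℂ] B} {θ : C →⋆ₙₐ[ℂ] A} (hθ : HerEmb θ)
    (hι : Function.Injective ι) (h : ∀ c, ι (κ c) = θ c) : HerEmb κ := by
  refine ⟨fun x y hxy => hθ.inj (by rw [← h, ← h, hxy]), fun x y b => ?_⟩
  obtain ⟨c, hc⟩ := hθ.sandwich x y (ι b)
  exact ⟨c, hι (by rw [h, hc, map_mul, map_mul, h, h])⟩

/-- If `b ^ 2 ≤ ∑ wᵢ⋆ r ^ 2 wᵢ`, then the hereditary subalgebra generated by `b` is isomorphic to a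
hereditary subalgebra of matrices over any hereditary subalgebra that contains `r`. -/
theorem exists_herEmb_matrix {ι : E →⋆ₙₐ[ℂ] A} (hι : HerEmb ι) {r : E} (hr : star r = r) {b : A}
    (hb : 0 ≤ b) {n : ℕ} (hn : 0 < n) {w : Fin n → A}
    (h : b * b ≤ ∑ i, star (w i) * ι (r * r) * w i) :
    ∃ κ : her b →⋆ₙₐ[ℂ] CStarMatrix (Fin n) (Fin n) E, HerEmb κ := by
  let k : Fin n := ⟨0, hn⟩
  have hbs : star b = b := (IsSelfAdjoint.of_nonneg hb).star_eq
  -- Y is the column with entries r wᵢ, so Y⋆Y sits in one corner and dominates b² there. Its polar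
  -- decomposition relative to b² gives z in the closure of diag(r) Mₙ(A) with z⋆z = b² in that
  -- corner.
  let V : CStarMatrix (Fin n) (Fin n) A := ∑ i, matUnit i k (w i)
  let Y : CStarMatrix (Fin n) (Fin n) A := diagHom A (Fin n) (ι r) * V
  have hrι : star (ι r) = ι r := by rw [← map_star, hr]
  have hVa : ∀ i j, V i j = if j = k then w i else 0 := fun i j => by
    simp only [V, CStarMatrix.sum_apply, matUnit_apply]
    rw [Finset.sum_eq_single i]
    · simp only [true_and, eq_comm]
    · intro l _ hl
      exact if_neg fun h => hl h.1
    · simp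
  have hYY : star Y * Y = matUnit k k (∑ i, star (w i) * ι (r * r) * w i) := by
    refine CStarMatrix.ext fun i j => ?_
    have e1 : ∀ i j, Y i j = ι r * V i j := fun i j => diagHom_mul_apply _ _ _ _
    have e2 : (star Y * Y) i j = ∑ l, star (Y l i) * Y l j := CStarMatrix.mul_apply_apply _ _ _ _
    rw [e2, matUnit_apply]
    simp only [e1, hVa]
    by_cases hi : i = k
    · by_cases hj : j = k
      · rw [if_pos ⟨hi.symm, hj.symm⟩]
        simp only [hi, hj, if_true, star_mul, hrι, map_mul, mul_assoc]
      · rw [if_neg fun h => hj h.2.symm]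
        simp [hj]
    · rw [if_neg fun h => hi h.1.symm]
      simp [hi]
  have hP : matUnit k k (b * b) ≤ star Y * Y := by
    rw [hYY, ← sub_nonneg]
    have := map_nonneg_hom (cornerHom A k) (sub_nonneg.2 h)
    rwa [map_sub] at this
  have hbb : 0 ≤ b * b := by
    have := star_mul_self_nonneg b
    rwa [hbs] at this
  obtain ⟨m, z, -, hz, -, hzz⟩ := exists_polar (map_nonneg_hom (cornerHom A k) hbb) hP
  -- The corner copy of `her b` is carried to elements of z Mₙ(A) z⋆; these lie in Mₙ(E), because r
  -- is in E and E is hereditary.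
  obtain ⟨α, hα, hαd⟩ := exists_transport (cornerHom A k) (herEmb_cornerHom k).inj hb (z := z)
    fun d => by rw [hzz, ← map_mul]
  have hαe := herEmb_of_transport (herEmb_cornerHom k) hb hα hαd
  have hm := hι.mapₙₐ (n := Fin n)
  have hdiag : (CStarMatrix.mapₙₐ ι : CStarMatrix (Fin n) (Fin n) E →⋆ₙₐ[ℂ] _)
      (diagHom E (Fin n) r) = diagHom A (Fin n) (ι r) := by
    refine CStarMatrix.ext fun i j => ?_
    change ι (diagHom E (Fin n) r i j) = _
    rw [diagHom_apply_apply, diagHom_apply_apply]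
    split_ifs <;> simp
  have hds : star (diagHom A (Fin n) (ι r)) = diagHom A (Fin n) (ι r) := by rw [← map_star, hrι]
  have hrange : ∀ x, α x ∈ Set.range
      (CStarMatrix.mapₙₐ ι : CStarMatrix (Fin n) (Fin n) E →⋆ₙₐ[ℂ] _) :=
    her_induction hb (p := fun x => α x ∈ Set.range
        (CStarMatrix.mapₙₐ ι : CStarMatrix (Fin n) (Fin n) E →⋆ₙₐ[ℂ] _))
      (hm.isClosed_range.preimage (continuous_hom α)) fun d hd => by
      rw [hαd]
      refine hm.isClosed_range.mem_of_tendsto ((hz.mul_const _).mul hz.star)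
        (Eventually.of_forall fun l => ?_)
      obtain ⟨x, hx⟩ := hm.sandwich (diagHom E (Fin n) r) (diagHom E (Fin n) r)
        (V * m l * cornerHom A k d * star (m l) * star V)
      refine ⟨x, hx.trans ?_⟩
      rw [hdiag]
      simp only [Y, star_mul, hds, mul_assoc]
  obtain ⟨κ, hκ⟩ := exists_factor
    (CStarMatrix.mapₙₐ ι : CStarMatrix (Fin n) (Fin n) E →⋆ₙₐ[ℂ] CStarMatrix (Fin n) (Fin n) A)
    hm.inj α hrange
  exact ⟨κ, hαe.of_comp hm.inj hκ⟩

lemma IsStrictlyPos.smul {b : B} (hb : IsStrictlyPos b) {r : ℝ} (hr : 0 < r) :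
    IsStrictlyPos (r • b) := by
  refine ⟨smul_nonneg hr.le hb.1, hb.2.mono ?_⟩
  rintro _ ⟨x, rfl⟩
  refine ⟨(r⁻¹ * r⁻¹) • x, ?_⟩
  simp only [smul_mul_assoc, mul_smul_comm, smul_smul]
  rw [show r * (r⁻¹ * r⁻¹ * r) = 1 by field_simp, one_smul]

lemma IsStablyProjectionless.eq_zero (h : IsStablyProjectionless A) {p : A}
    (hp : IsStarProjection p) : p = 0 := by
  have h1 : IsStarProjection (Matrix.of fun _ _ => p : Matrix (Fin 1) (Fin 1) A) := by
    refine ⟨?_, ?_⟩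
    · ext i j
      simpa [Matrix.mul_apply] using hp.isIdempotentElem.eq
    · ext i j
      simpa [Matrix.star_apply] using hp.isSelfAdjoint.star_eq
  exact congrFun (congrFun (h 1 _ h1) 0) 0

/-- Membership of one hereditary subalgebra in `𝒟` passes to the hereditary subalgebra generated by
any positive element that is dominated by conjugates of an element of the former. -/
theorem InD.her_of_le_sum (hE : InD E) (hA : ∀ p : E, IsStarProjection p → p = 0)
    {ι : E →⋆ₙₐ[ℂ] A} (hι : HerEmb ι) {a : E} (ha : 0 ≤ a) {b : A} (hb : 0 ≤ b) (hb0 : b ≠ 0) {n : ℕ}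
    {w : Fin n → A} (h : b ≤ ∑ i, star (w i) * ι a * w i) : InD (her b) := by
  obtain ⟨r, hr, rfl⟩ := exists_sqrt ha
  have hn : 0 < n := by
    rcases Nat.eq_zero_or_pos n with rfl | hn
    · simp only [Finset.univ_eq_empty, Finset.sum_empty] at h
      exact absurd (le_antisymm h hb) hb0
    · exact hn
  -- The embedding needs a bound for b², obtained from b² ≤ ‖b‖ b by rescaling the wᵢ.
  have hbb : b * b ≤ ∑ i, star (√‖b‖ • w i) * ι (r * r) * (√‖b‖ • w i) := by
    have e1 : b * b ≤ ‖b‖ • b := by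
      obtain ⟨q, hq, rfl⟩ := exists_sqrt hb
      have := CStarAlgebra.star_left_conjugate_le_norm_smul (a := q) (b := q * q) (.of_nonneg hb)
      rw [hq] at this
      refine le_trans (le_of_eq ?_) this
      simp only [mul_assoc]
    have e2 : ∑ i, star (√‖b‖ • w i) * ι (r * r) * (√‖b‖ • w i) =
        ‖b‖ • ∑ i, star (w i) * ι (r * r) * w i := by
      rw [Finset.smul_sum]
      refine Finset.sum_congr rfl fun i _ => ?_
      simp only [star_smul, star_trivial, smul_mul_assoc, mul_smul_comm, smul_smul,
        Real.mul_self_sqrt (norm_nonneg b)]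
    rw [e2]
    exact e1.trans (smul_le_smul_of_nonneg_left h (norm_nonneg b))
  obtain ⟨κ, hκ⟩ := exists_herEmb_matrix hι hr hb hn hbb
  obtain ⟨s, hs, hsd, f, hf, hT⟩ := hE.traciallyApproximated_matrix hA hn
  set b' : her b := ⟨b, self_mem_her hb⟩
  have hb'0 : b' ≠ 0 := fun h0 => hb0 (congrArg Subtype.val h0)
  have : Nontrivial (her b) := ⟨b', 0, hb'0⟩
  have hnb : 0 < ‖b'‖ := norm_pos_iff.2 hb'0
  -- The strictly positive element of norm one in `her b` is b divided by its norm.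
  refine hT.inD (hE.1.matrix hn) hs hsd hf hκ ((isStrictlyPos_her hb).smul (inv_pos.2 hnb)) ?_
  rw [norm_smul, norm_inv, norm_norm, inv_mul_cancel₀ hnb.ne']

/-- A simple, stably projectionless C⋆-algebra has generalized tracial rank at most one as soon as
a single hereditary subalgebra generated by an element of the Pedersen ideal is in `𝒟`. -/
theorem IsSimpleCStar.gtrLeOne_iff (hA : IsSimpleCStar A) (hproj : IsStablyProjectionless A) :
    GTRLeOne A ↔ ∃ a ∈ pedersenPos A, a ≠ 0 ∧ InD (her a) := by
  refine ⟨fun h => ?_, fun ⟨a, ha, ha0, hE⟩ b hb hb0 => ?_⟩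
  · have := hA.1
    obtain ⟨a, ha, ha0⟩ := exists_mem_pedersenPos (A := A)
    exact ⟨a, ha, ha0, h a ha ha0⟩
  · obtain ⟨n, w, hw⟩ := exists_le_sum_of_mem_pedersenPos hA ha.2 ha0 hb
    exact hE.her_of_le_sum
      (fun p hp => Subtype.ext (hproj.eq_zero (p := (p : A))
        ⟨congrArg Subtype.val hp.isIdempotentElem, congrArg Subtype.val hp.isSelfAdjoint⟩))
      (herEmb_herIncl a) (a := ⟨a, self_mem_her ha.2⟩)
      (nonneg_of_map_nonneg (herIncl a) Subtype.val_injective ha.2) hb.2 hb0 hw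

end Pedersen

end GTR

end

theorem mainTheorem12 (A : Type*) [NonUnitalCStarAlgebra A] [TopologicalSpace.SeparableSpace A]
    (hsimple : GTR.IsSimpleCStar A) (hproj : GTR.IsStablyProjectionless A) :
    GTR.GTRLeOne A ↔ ∃ a ∈ GTR.pedersenPos A, a ≠ 0 ∧ GTR.InD (GTR.her a) :=
  hsimple.gtrLeOne_iff hproj
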